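/- **Setting.** Fix an infinite set $\Omega$. A *ribbon graph* is a finite connected (non-empty) graph whose half-edges are elements of $\Omega$, all of whose vertices have valence $\ge 3$, with a cyclic ordering of the half-edges at each vertex. A *morphism* $\Gamma\to\Gamma'$ is an isomorphism of ribbon graphs $\Gamma/F\cong\Gamma'$ for some spanning forest $F$ of $\Gamma$, where $\Gamma/F$ is obtained by collapsing each component tree of $F$ to a point, with the induced cyclic orderings. The *codimension* of a vertex is its valence minus $3$; the codimension of a graph is the sum of the codimensions of its vertices. An *orientation* of $\Gamma$ is an orientation of the real vector space spanned by its vertices and half-edges. If $e=\{e^-,e^+\}$ is a non-loop edge from $v_1$ to $v_2$ and $\Gamma$ is oriented by $v_1\wedge v_2\wedge e^-\wedge e^+\wedge x_1\wedge\dots\wedge x_n$, the *induced orientation* of $\Gamma/e$ is $v_*\wedge x_1\wedge\dots\wedge x_n$, where $v_*$ is the merged vertex. A trivalent ribbon graph has a natural orientation (each vertex is followed by its half-edges in cyclic order). **The forest complex.** Let $\Gamma_0$ be a ribbon graph. $F_k(\Gamma_0)$ is the abelian group generated by the classes $[f:\Gamma\to\Gamma_0]$, where $f$ is a morphism and $\Gamma$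 is an oriented ribbon graph of codimension $k$; orientation preserving isomorphisms $g$ with $f_2\circ g=f_1$ identify $[f_1]$ with $[f_2]$, and reversal of the orientation is reversal of the sign. The boundary map $d:F_k(\Gamma_0)\to F_{k-1}(\Gamma_0)$ is $$d[f:\Gamma\to\Gamma_0]=\sum_i\,[f\circ g_i:\Gamma_i\to\Gamma_0],$$ the sum over all right equivalence classes (that is, up to isomorphism of the source) of morphisms $g_i:\Gamma_i\to\Gamma$ that collapse exactly one edge, $\Gamma_i$ having the orientation that induces the one of $\Gamma$. The augmentation $\epsilon:F_0(\Gamma_0)\to\mathbb Z$ sends $[\Gamma\to\Gamma_0]$ to $+1$ or $-1$ according to whether the orientation of $\Gamma$ is the natural one or its opposite. **The associahedron.** $K^m$ is the $m$-dimensional Stasheff associahedron; its faces of dimension $m-j$ are the isomorphism classes of planar trees with $m+3$ fixed leaves and $j$ internal edges (equivalently, the sets of $j$ pairwise non-crossing diagonals of a convex $(m+3)$-gon), and a face lies in another one if the tree of the second is obtained from the tree of the first by collapsing internal edges. $C_*(K^m)$ is its cellular chain complex, with the usual augmentation (every vertex has value $1$), based by the two fundamental classes $\pm[\sigma]$ of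 each face $\sigma$. **Proposition.** Suppose that $\Gamma_0$ is trivalent except for $r$ distinct vertices $v_1,\dots,v_r$, which have codimensions $n_1,\dots,n_r$. Then: 1. each $F_k(\Gamma_0)$ is a free abelian group, with a basis such that the set of all generators $[f:\Gamma\to\Gamma_0]$ consists of the basis elements and their negatives; 2. $F_*(\Gamma_0)$ is based chain isomorphic to the tensor product $$F_*(\Gamma_0)\;\cong\; C_*(K^{n_1})\otimes C_*(K^{n_2})\otimes\cdots\otimes C_*(K^{n_r})$$ (for $r=0$: to $\mathbb Z$ in degree $0$), i.e. there are isomorphisms of groups in all degrees that commute with the boundary maps and with the augmentations and map the set of generators $[f:\Gamma\to\Gamma_0]$ onto the set of tensors $\pm[\sigma_1]\otimes\cdots\otimes[\sigma_r]$ of faces; 3. $F_*(\Gamma_0)$ is acyclic: $d\circ d=0$, $\epsilon\circ d=0$ and the augmented complex $\cdots\to F_1(\Gamma_0)\to F_0(\Gamma_0)\xrightarrow{\ \epsilon\ }\mathbb Z\to 0$ is exact. -/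

import Mathlib

open scoped Classical TensorProduct DirectSum

universe u v

/-! ### Ribbon graphs -/

/-- A ribbon graph whose half-edges lie in the ambient set `Ω`: a finite connected graph, given by
its finite set `H` of half-edges, with a cyclic ordering of the half-edges at each vertex.
`flip` exchanges the two halves of every edge; `rot` sends a half-edge to the next one in the
cyclic order at its vertex, so that the vertices are the cycles of `rot`.
Every vertex has valence at least three. -/
structure RibbonGraph (Ω : Type u) where
  H : Finset Ω
  rot : Equiv.Perm H
  flip : Equiv.Perm H
  flip_flip : ∀ h, flip (flip h) = h
  flip_ne : ∀ h, flip h ≠ h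
  three_le_valence : ∀ h, 3 ≤ {h' : H | rot.SameCycle h h'}.ncard
  nonempty : Nonempty H
  connected : ∀ h h', Relation.EqvGen (fun a b => b = rot a ∨ b = flip a) h h'

namespace RibbonGraph

/-- The vertices: cycles of `rot`. -/
def Vertex {Ω : Type u} (Γ : RibbonGraph Ω) : Type u :=
  Quotient (Equiv.Perm.SameCycle.setoid Γ.rot)

/-- The edges: cycles of `flip`, i.e. pairs `{h, flip h}`. -/
def Edge {Ω : Type u} (Γ : RibbonGraph Ω) : Type u :=
  Quotient (Equiv.Perm.SameCycle.setoid Γ.flip)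

/-- The vertex to which a half-edge is incident. -/
def vert {Ω : Type u} (Γ : RibbonGraph Ω) (h : Γ.H) : Γ.Vertex := Quotient.mk _ h

/-- The edge that contains a half-edge. -/
def edge {Ω : Type u} (Γ : RibbonGraph Ω) (h : Γ.H) : Γ.Edge := Quotient.mk _ h

instance {Ω : Type u} (Γ : RibbonGraph Ω) : Finite Γ.Vertex :=
  inferInstanceAs (Finite (Quotient _))

instance {Ω : Type u} (Γ : RibbonGraph Ω) : Finite Γ.Edge :=
  inferInstanceAs (Finite (Quotient _))

noncomputable instance {Ω : Type u} (Γ : RibbonGraph Ω) : Fintype Γ.Vertex := Fintype.ofFinite _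

/-- The number of half-edges incident to a vertex. -/
noncomputable def valence {Ω : Type u} (Γ : RibbonGraph Ω) (v : Γ.Vertex) : ℕ :=
  {h : Γ.H | Γ.vert h = v}.ncard

/-- The codimension of a vertex is its valence minus three (valences are at least three). -/
noncomputable def vertexCodim {Ω : Type u} (Γ : RibbonGraph Ω) (v : Γ.Vertex) : ℕ :=
  Γ.valence v - 3

/-- The codimension of a ribbon graph, i.e. the number of edges that have to be collapsed in a
trivalent graph to obtain it. -/
noncomputable def codim {Ω : Type u} (Γ : RibbonGraph Ω) : ℕ := ∑ v, Γ.vertexCodim v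

/-! ### Forests and morphisms -/

/-- Given the set `F` of half-edges of a spanning subgraph of `Γ`, two half-edges of `Γ` are
linked if their vertices lie in the same component of that subgraph. -/
def Linked {Ω : Type u} (Γ : RibbonGraph Ω) (F : Set Γ.H) : Γ.H → Γ.H → Prop :=
  Relation.EqvGen (fun a b => b = Γ.rot a ∨ (a ∈ F ∧ b = Γ.flip a))

/-- `F` is the set of half-edges of a spanning forest: it is a union of edges, and every component
of the spanning subgraph with these edges is a tree, i.e. has one more vertex than edges. -/
def IsForest {Ω : Type u} (Γ : RibbonGraph Ω) (F : Set Γ.H) : Prop :=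
  (∀ a ∈ F, Γ.flip a ∈ F) ∧
  ∀ h, {v | ∃ a, Γ.Linked F h a ∧ Γ.vert a = v}.ncard =
    {e | ∃ a ∈ F, Γ.Linked F h a ∧ Γ.edge a = e}.ncard + 1

/-- The induced cyclic ordering of the leaves of the component trees of a forest `F`: from the leaf
`a` one turns to the next half-edge at the vertex, and as long as one meets a half-edge of `F` one
walks along its edge and turns again; `b` is the first half-edge outside `F` found in this way. -/
def NextLeaf {Ω : Type u} (Γ : RibbonGraph Ω) (F : Set Γ.H) (a b : Γ.H) : Prop :=
  b ∉ F ∧ ∃ n : ℕ, (fun x => Γ.rot (Γ.flip x))^[n] (Γ.rot a) = b ∧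
    ∀ i < n, (fun x => Γ.rot (Γ.flip x))^[i] (Γ.rot a) ∈ F

/-- A morphism of ribbon graphs `Γ ⟶ Γ'`, i.e. an isomorphism of ribbon graphs `Γ / F ≅ Γ'` for
some spanning forest `F` of `Γ`. It is recorded by the map `pre` that sends a half-edge of `Γ'` to
its inverse image in `Γ`; the half-edges of `F` are those outside the image of `pre`. -/
structure Hom {Ω : Type u} (Γ Γ' : RibbonGraph Ω) where
  pre : Γ'.H → Γ.H
  pre_injective : Function.Injective pre
  pre_flip : ∀ h, pre (Γ'.flip h) = Γ.flip (pre h)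
  forest : Γ.IsForest (Set.range pre)ᶜ
  pre_rot : ∀ h, Γ.NextLeaf (Set.range pre)ᶜ (pre h) (pre (Γ'.rot h))

/-- An isomorphism of ribbon graphs. -/
structure Iso {Ω : Type u} (Γ Γ' : RibbonGraph Ω) where
  toEquiv : Γ.H ≃ Γ'.H
  map_flip : ∀ h, toEquiv (Γ.flip h) = Γ'.flip (toEquiv h)
  map_rot : ∀ h, toEquiv (Γ.rot h) = Γ'.rot (toEquiv h)

/-- The inverse isomorphism. -/
def Iso.symm {Ω : Type u} {Γ Γ' : RibbonGraph Ω} (g : Iso Γ Γ') : Iso Γ' Γ where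
  toEquiv := g.toEquiv.symm
  map_flip h := by
    rw [Equiv.symm_apply_eq, g.map_flip, Equiv.apply_symm_apply]
  map_rot h := by
    rw [Equiv.symm_apply_eq, g.map_rot, Equiv.apply_symm_apply]

theorem Iso.sameCycle_iff {Ω : Type u} {Γ Γ' : RibbonGraph Ω} (g : Iso Γ Γ') (a b : Γ.H) :
    Γ.rot.SameCycle a b ↔ Γ'.rot.SameCycle (g.toEquiv a) (g.toEquiv b) := by
  have h : Γ'.rot = g.toEquiv.permCongr Γ.rot := by
    ext x
    simp [Equiv.permCongr_apply, g.map_rot]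
  have hz : ∀ i : ℤ, (Γ'.rot ^ i) (g.toEquiv a) = g.toEquiv ((Γ.rot ^ i) a) := by
    intro i
    have h2 : Γ'.rot ^ i = g.toEquiv.permCongrHom (Γ.rot ^ i) := by
      rw [map_zpow, h]; rfl
    rw [h2]
    simp [Equiv.permCongr_apply]
  simp only [Equiv.Perm.SameCycle, hz, EmbeddingLike.apply_eq_iff_eq]

/-- The bijection of vertices induced by an isomorphism. -/
def Iso.vertexEquiv {Ω : Type u} {Γ Γ' : RibbonGraph Ω} (g : Iso Γ Γ') : Γ.Vertex ≃ Γ'.Vertex :=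
  Quotient.congr g.toEquiv g.sameCycle_iff

/-- The morphism obtained by following a morphism with an isomorphism. -/
def Hom.compIso {Ω : Type u} {Γ Γ' Γ'' : RibbonGraph Ω} (g : Hom Γ Γ') (b : Iso Γ' Γ'') :
    Hom Γ Γ'' where
  pre h := g.pre (b.toEquiv.symm h)
  pre_injective := g.pre_injective.comp b.toEquiv.symm.injective
  pre_flip h := by rw [← g.pre_flip]; exact congrArg _ (b.symm.map_flip h)
  forest := by
    have : Set.range (fun h => g.pre (b.toEquiv.symm h)) = Set.range g.pre :=
      b.toEquiv.symm.surjective.range_comp g.pre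
    rw [this]; exact g.forest
  pre_rot h := by
    have : Set.range (fun h => g.pre (b.toEquiv.symm h)) = Set.range g.pre :=
      b.toEquiv.symm.surjective.range_comp g.pre
    rw [this]
    have h2 := g.pre_rot (b.toEquiv.symm h)
    rwa [show Γ'.rot (b.toEquiv.symm h) = b.toEquiv.symm (Γ''.rot h) from
      (b.symm.map_rot h).symm] at h2

/-! ### Orientations -/

/-- The orientation of the real vector space with basis `X` that is given by an ordering of `X`. -/
noncomputable def orderingOrientation {X : Type u} {n : ℕ} (l : Fin n ≃ X) :
    Orientation ℝ (X →₀ ℝ) (Fin (Nat.card X)) :=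
  ((Finsupp.basisSingleOne (R := ℝ) (ι := X)).reindex
    (l.symm.trans (finCongr (by rw [← Nat.card_congr l, Nat.card_fin])))).orientation

theorem orderingOrientation_eq_neg_iff {X : Type u} {n : ℕ} (l : Fin n ≃ X)
    (o : Orientation ℝ (X →₀ ℝ) (Fin (Nat.card X))) :
    orderingOrientation l = -o ↔ ¬ orderingOrientation l = o := by
  have : Finite X := Finite.of_equiv _ l
  have : Fintype X := Fintype.ofFinite X
  constructor
  · intro h h'
    exact Module.Ray.ne_neg_self o (h'.symm.trans h)
  · intro h
    rcases Orientation.eq_or_eq_neg (orderingOrientation l) o (by simp) with h' | h'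
    · exact absurd h' h
    · exact h'

/-- The set of vertices and half-edges of `Γ`. -/
abbrev Cells {Ω : Type u} (Γ : RibbonGraph Ω) : Type u := Γ.Vertex ⊕ Γ.H

/-- An orientation of `Γ`: an orientation of the vector space spanned by the vertices and the
half-edges. -/
abbrev Ori {Ω : Type u} (Γ : RibbonGraph Ω) : Type u :=
  Orientation ℝ (Γ.Cells →₀ ℝ) (Fin (Nat.card Γ.Cells))

/-- The bijection of vertices and half-edges induced by an isomorphism. -/
def Iso.cellsEquiv {Ω : Type u} {Γ Γ' : RibbonGraph Ω} (g : Iso Γ Γ') : Γ.Cells ≃ Γ'.Cells :=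
  Equiv.sumCongr g.vertexEquiv g.toEquiv

/-- The isomorphism `g` carries the orientation `o` to the orientation `o'`. -/
def Iso.Preserves {Ω : Type u} {Γ Γ' : RibbonGraph Ω} (g : Iso Γ Γ') (o : Γ.Ori) (o' : Γ'.Ori) :
    Prop :=
  ∀ (n : ℕ) (l : Fin n ≃ Γ.Cells),
    orderingOrientation l = o ↔ orderingOrientation (l.trans g.cellsEquiv) = o'

/-- For a morphism `g : Γ ⟶ Γ'` that collapses a single edge: the relation between a vertex or
half-edge of `Γ` and its image in `Γ'`. -/
def Hom.Corresponds {Ω : Type u} {Γ Γ' : RibbonGraph Ω} (g : Hom Γ Γ') :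
    Γ.Cells → Γ'.Cells → Prop
  | Sum.inl v, Sum.inl v' => ∃ h, Γ'.vert h = v' ∧ Γ.vert (g.pre h) = v
  | Sum.inr a, Sum.inr h => g.pre h = a
  | _, _ => False

/-- For a morphism `g : Γ ⟶ Γ'` that collapses a single edge, with halves `a` and `flip a`: the
orientation `o'` of `Γ'` is the one induced by the orientation `o` of `Γ`. If `o` is
`(source of a) ∧ (target of a) ∧ a ∧ flip a ∧ x₁ ∧ ⋯ ∧ xₙ`, the induced orientation is
`(merged vertex) ∧ x₁ ∧ ⋯ ∧ xₙ`. -/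
def Hom.Induces {Ω : Type u} {Γ Γ' : RibbonGraph Ω} (g : Hom Γ Γ') (o : Γ.Ori) (o' : Γ'.Ori) :
    Prop :=
  ∃ (n : ℕ) (l : Fin (n + 4) ≃ Γ.Cells) (l' : Fin (n + 1) ≃ Γ'.Cells) (a : Γ.H),
    a ∉ Set.range g.pre ∧
    l 0 = Sum.inl (Γ.vert a) ∧ l 1 = Sum.inl (Γ.vert (Γ.flip a)) ∧
    l 2 = Sum.inr a ∧ l 3 = Sum.inr (Γ.flip a) ∧
    g.Corresponds (l 0) (l' 0) ∧
    (∀ i : Fin n, g.Corresponds (l (i.addNat 4)) (l' i.succ)) ∧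
    (orderingOrientation l = o ↔ orderingOrientation l' = o')

/-- The natural orientation of a trivalent ribbon graph: each vertex is followed by its three
half-edges in cyclic order. -/
def IsNatural {Ω : Type u} (Γ : RibbonGraph Ω) (o : Γ.Ori) : Prop :=
  ∃ (n : ℕ) (l : Fin (n * 4) ≃ Γ.Cells),
    (∀ i : Fin n, ∃ h : Γ.H,
      l (finProdFinEquiv (i, 0)) = Sum.inl (Γ.vert h) ∧
      l (finProdFinEquiv (i, 1)) = Sum.inr h ∧
      l (finProdFinEquiv (i, 2)) = Sum.inr (Γ.rot h) ∧
      l (finProdFinEquiv (i, 3)) = Sum.inr (Γ.rot (Γ.rot h))) ∧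
    orderingOrientation l = o

/-- The sign by which an orientation of a trivalent ribbon graph compares with the natural
orientation: `1` if `o` is natural, `-1` if `-o` is natural. -/
noncomputable def orientationSign {Ω : Type u} (Γ : RibbonGraph Ω) (o : Γ.Ori) : ℤ :=
  (if Γ.IsNatural o then 1 else 0) - (if Γ.IsNatural (-o) then 1 else 0)

theorem orientationSign_neg {Ω : Type u} (Γ : RibbonGraph Ω) (o : Γ.Ori) :
    Γ.orientationSign (-o) = -Γ.orientationSign o := by
  have h : -(-o) = o := neg_neg (G := Module.Ray ℝ _) o
  simp only [orientationSign, h, neg_sub]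

theorem Iso.Preserves.symm {Ω : Type u} {Γ Γ' : RibbonGraph Ω} {g : Iso Γ Γ'} {o : Γ.Ori}
    {o' : Γ'.Ori} (h : g.Preserves o o') : g.symm.Preserves o' o := by
  intro n l
  have h2 := h n (l.trans g.symm.cellsEquiv)
  have h3 : (l.trans g.symm.cellsEquiv).trans g.cellsEquiv = l := by
    ext i : 1
    change g.cellsEquiv (g.cellsEquiv.symm (l i)) = l i
    simp
  rw [h3] at h2
  exact h2.symm

theorem Iso.Preserves.neg {Ω : Type u} {Γ Γ' : RibbonGraph Ω} {g : Iso Γ Γ'} {o : Γ.Ori}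
    {o' : Γ'.Ori} (h : g.Preserves o o') : g.Preserves (-o) (-o') := by
  intro n l
  rw [orderingOrientation_eq_neg_iff, orderingOrientation_eq_neg_iff, h n l]

theorem Iso.Preserves.isNatural {Ω : Type u} {Γ Γ' : RibbonGraph Ω} {g : Iso Γ Γ'} {o : Γ.Ori}
    {o' : Γ'.Ori} (h : g.Preserves o o') (hn : Γ.IsNatural o) : Γ'.IsNatural o' := by
  obtain ⟨n, l, hl, ho⟩ := hn
  refine ⟨n, l.trans g.cellsEquiv, fun i => ?_, (h _ l).1 ho⟩
  obtain ⟨a, h0, h1, h2, h3⟩ := hl i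
  refine ⟨g.toEquiv a, ?_, ?_, ?_, ?_⟩
  · rw [Equiv.trans_apply, h0]; rfl
  · rw [Equiv.trans_apply, h1]; rfl
  · rw [Equiv.trans_apply, h2, ← g.map_rot]; rfl
  · rw [Equiv.trans_apply, h3, ← g.map_rot, ← g.map_rot]; rfl

theorem Iso.Preserves.orientationSign_eq {Ω : Type u} {Γ Γ' : RibbonGraph Ω} {g : Iso Γ Γ'}
    {o : Γ.Ori} {o' : Γ'.Ori} (h : g.Preserves o o') :
    Γ.orientationSign o = Γ'.orientationSign o' := by
  have h1 : Γ.IsNatural o ↔ Γ'.IsNatural o' := ⟨h.isNatural, h.symm.isNatural⟩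
  have h2 : Γ.IsNatural (-o) ↔ Γ'.IsNatural (-o') := ⟨h.neg.isNatural, h.neg.symm.isNatural⟩
  simp only [orientationSign, h1, h2]

theorem Hom.Induces.neg {Ω : Type u} {Γ Γ' : RibbonGraph Ω} {g : Hom Γ Γ'} {o : Γ.Ori}
    {o' : Γ'.Ori} (h : g.Induces o o') : g.Induces (-o) (-o') := by
  obtain ⟨n, l, l', a, h0, h1, h2, h3, h4, h5, h6, h7⟩ := h
  refine ⟨n, l, l', a, h0, h1, h2, h3, h4, h5, h6, ?_⟩
  rw [orderingOrientation_eq_neg_iff, orderingOrientation_eq_neg_iff, h7]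

theorem Hom.Corresponds.compIso {Ω : Type u} {Γ Γ' Γ'' : RibbonGraph Ω} {g : Hom Γ Γ'}
    (b : Iso Γ' Γ'') {x : Γ.Cells} {y : Γ'.Cells} (h : g.Corresponds x y) :
    (g.compIso b).Corresponds x (b.cellsEquiv y) := by
  rcases x with x | x <;> rcases y with y | y
  · obtain ⟨a, rfl, ha⟩ := h
    refine ⟨b.toEquiv a, rfl, ?_⟩
    rw [← ha]
    exact congrArg (fun z => Γ.vert (g.pre z)) (b.toEquiv.symm_apply_apply a)
  · exact h.elim
  · exact h.elim
  · have h' : g.pre y = x := h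
    rw [← h']
    exact congrArg g.pre (b.toEquiv.symm_apply_apply y)

theorem Hom.Induces.compIso {Ω : Type u} {Γ Γ' Γ'' : RibbonGraph Ω} {g : Hom Γ Γ'} {o : Γ.Ori}
    {o' : Γ'.Ori} {o'' : Γ''.Ori} (h : g.Induces o o') {b : Iso Γ' Γ''}
    (hb : b.Preserves o' o'') : (g.compIso b).Induces o o'' := by
  obtain ⟨n, l, l', a, h0, h1, h2, h3, h4, h5, h6, h7⟩ := h
  refine ⟨n, l, l'.trans b.cellsEquiv, a, ?_, h1, h2, h3, h4, h5.compIso b,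
    fun i => (h6 i).compIso b, h7.trans (hb _ l')⟩
  rintro ⟨c, hc⟩
  exact h0 ⟨_, hc⟩

end RibbonGraph

/-! ### Augmented based complexes -/

/-- A sequence of abelian groups and homomorphisms `⋯ → X 2 → X 1 → X 0 → ℤ`, with a distinguished
set of generators in each degree. The set of generators is symmetric: it contains a basis element
together with its negative (the two orientations of a cell). -/
structure BasedSeq where
  X : ℕ → Type u
  [grp : ∀ k, AddCommGroup (X k)]
  d : ∀ k, X (k + 1) →+ X k
  ε : X 0 →+ ℤ
  gen : ∀ k, Set (X k)

namespace BasedSeq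

attribute [instance] BasedSeq.grp

/-- In each degree the group is free, and the distinguished generators are the elements of a basis
and their negatives. -/
def IsBased (A : BasedSeq.{u}) : Prop :=
  ∀ k, ∃ (I : Type u) (b : Module.Basis I ℤ (A.X k)), A.gen k = {x | ∃ i, x = b i ∨ x = -b i}

/-- The sequence is an augmented chain complex: `d ∘ d = 0` and `ε ∘ d = 0`. -/
def IsComplex (A : BasedSeq.{u}) : Prop :=
  (∀ k x, A.d k (A.d (k + 1) x) = 0) ∧ ∀ x, A.ε (A.d 0 x) = 0

/-- The augmented chain complex `⋯ → X 1 → X 0 → ℤ → 0` is exact. -/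
def IsAcyclic (A : BasedSeq.{u}) : Prop :=
  A.IsComplex ∧ Function.Surjective A.ε ∧ (∀ x, A.ε x = 0 → ∃ y, A.d 0 y = x) ∧
    ∀ k x, A.d k x = 0 → ∃ y, A.d (k + 1) y = x

/-- Based chain isomorphism of augmented complexes: isomorphisms in all degrees that commute with
the boundary maps and the augmentations and map the distinguished generators bijectively to
distinguished generators. -/
def BasedIso (A : BasedSeq.{u}) (B : BasedSeq.{v}) : Prop :=
  ∃ e : ∀ k, A.X k ≃+ B.X k,
    (∀ k x, e k (A.d k x) = B.d k (e (k + 1) x)) ∧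
    (∀ x, B.ε (e 0 x) = A.ε x) ∧
    ∀ k, e k '' A.gen k = B.gen k

/-- The complex `ℤ` concentrated in degree zero. -/
def unit : BasedSeq.{0} where
  X k := ↥(if k = 0 then (⊤ : AddSubgroup ℤ) else ⊥)
  d _ := 0
  ε := AddSubgroup.subtype _
  gen _ := {x | (x : ℤ) = 1 ∨ (x : ℤ) = -1}

/-- The pairs `(p, q)` of natural numbers with `p + q = k`. -/
abbrev Pairs (k : ℕ) : Type := {p : ℕ × ℕ // p.1 + p.2 = k}

/-- The group in degree `k` of the tensor product of two complexes: `⨁_{p + q = k} A_p ⊗ B_q`. -/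
abbrev TensorX (A B : BasedSeq.{0}) (k : ℕ) : Type :=
  ⨁ p : Pairs k, A.X p.1.1 ⊗[ℤ] B.X p.1.2

/-- The inclusion `A_p ⊗ B_q → (A ⊗ B)_k` for `p + q = k`. -/
noncomputable def tensorι (A B : BasedSeq.{0}) {p q k : ℕ} (h : p + q = k) :
    A.X p ⊗[ℤ] B.X q →ₗ[ℤ] TensorX A B k :=
  DirectSum.lof ℤ (Pairs k)
    (fun r : Pairs k => A.X r.1.1 ⊗[ℤ] B.X r.1.2)
    ⟨(p, q), h⟩

/-- `x ⊗ y ↦ d x ⊗ y` on `A_p ⊗ B_q`. -/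
noncomputable def tensorDLeft (A B : BasedSeq.{0}) (k : ℕ) :
    ∀ p q : ℕ, p + q = k + 1 → (A.X p ⊗[ℤ] B.X q →ₗ[ℤ] TensorX A B k)
  | 0, _, _ => 0
  | p + 1, q, h =>
    tensorι A B (p := p) (q := q) (by omega) ∘ₗ (A.d p).toIntLinearMap.rTensor (B.X q)

/-- `x ⊗ y ↦ (-1)^p x ⊗ d y` on `A_p ⊗ B_q`. -/
noncomputable def tensorDRight (A B : BasedSeq.{0}) (k : ℕ) :
    ∀ p q : ℕ, p + q = k + 1 → (A.X p ⊗[ℤ] B.X q →ₗ[ℤ] TensorX A B k)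
  | _, 0, _ => 0
  | p, q + 1, h =>
    (-1 : ℤ) ^ p • (tensorι A B (p := p) (q := q) (by omega) ∘ₗ
      (B.d q).toIntLinearMap.lTensor (A.X p))

/-- The augmentation `x ⊗ y ↦ ε x * ε y` on `A_p ⊗ B_q` for `p + q = 0`. -/
noncomputable def tensorAug (A B : BasedSeq.{0}) :
    ∀ p q : ℕ, p + q = 0 → (A.X p ⊗[ℤ] B.X q →ₗ[ℤ] ℤ)
  | p + 1, q, h => absurd h (by omega)
  | 0, q + 1, h => absurd h (by omega)
  | 0, 0, _ => LinearMap.mul' ℤ ℤ ∘ₗ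
      TensorProduct.map A.ε.toIntLinearMap B.ε.toIntLinearMap

/-- The tensor product of two complexes, with boundary `d (x ⊗ y) = d x ⊗ y + (-1)^p x ⊗ d y` for
`x` of degree `p`. The distinguished generators are the tensors `x ⊗ y` of generators. -/
noncomputable def tensor (A B : BasedSeq.{0}) : BasedSeq.{0} where
  X k := TensorX A B k
  d k := (DirectSum.toModule ℤ (Pairs (k + 1)) (TensorX A B k) fun p =>
    tensorDLeft A B k p.1.1 p.1.2 p.2 +
      tensorDRight A B k p.1.1 p.1.2 p.2).toAddMonoidHom
  ε := (DirectSum.toModule ℤ (Pairs 0) ℤ fun p =>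
    tensorAug A B p.1.1 p.1.2 p.2).toAddMonoidHom
  gen k := {z | ∃ (p q : ℕ) (h : p + q = k), ∃ x ∈ A.gen p, ∃ y ∈ B.gen q,
    z = tensorι A B h (x ⊗ₜ[ℤ] y)}

/-- The tensor product `A 0 ⊗ (A 1 ⊗ (⋯ ⊗ (A (r - 1) ⊗ ℤ)))` of a finite sequence of complexes. -/
noncomputable def tensorFin : ∀ r : ℕ, (Fin r → BasedSeq.{0}) → BasedSeq.{0}
  | 0, _ => unit
  | r + 1, A => tensor (A 0) (tensorFin r fun i => A i.succ)

end BasedSeq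

/-! ### The forest complex -/

namespace RibbonGraph

/-- A ribbon graph `f : Γ ⟶ Γ₀` over `Γ₀` of codimension `k`, together with an orientation
of `Γ`. -/
structure OrientedOver {Ω : Type u} (Γ₀ : RibbonGraph Ω) (k : ℕ) where
  Γ : RibbonGraph Ω
  codim_eq : Γ.codim = k
  f : Hom Γ Γ₀
  o : Γ.Ori

namespace OrientedOver

/-- The same object with the opposite orientation. -/
noncomputable def reverse {Ω : Type u} {Γ₀ : RibbonGraph Ω} {k : ℕ} (x : OrientedOver Γ₀ k) :
    OrientedOver Γ₀ k where
  Γ := x.Γ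
  codim_eq := x.codim_eq
  f := x.f
  o := -x.o

/-- An orientation preserving isomorphism over `Γ₀`, i.e. an isomorphism `g` with `f₂ ∘ g = f₁`. -/
structure OverIso {Ω : Type u} {Γ₀ : RibbonGraph Ω} {k : ℕ} (x y : OrientedOver Γ₀ k) where
  g : Iso x.Γ y.Γ
  over_eq : ∀ h, g.toEquiv (x.f.pre h) = y.f.pre h
  preserves : g.Preserves x.o y.o

/-- The inverse isomorphism. -/
def OverIso.symm {Ω : Type u} {Γ₀ : RibbonGraph Ω} {k : ℕ} {x y : OrientedOver Γ₀ k}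
    (a : OverIso x y) : OverIso y x where
  g := a.g.symm
  over_eq h := by
    change a.g.toEquiv.symm _ = _
    rw [Equiv.symm_apply_eq, a.over_eq]
  preserves := a.preserves.symm

/-- The isomorphism of the same objects with the opposite orientations. -/
noncomputable def OverIso.reverse {Ω : Type u} {Γ₀ : RibbonGraph Ω} {k : ℕ} {x y : OrientedOver Γ₀ k}
    (a : OverIso x y) : OverIso x.reverse y.reverse where
  g := a.g
  over_eq := a.over_eq
  preserves := a.preserves.neg

/-- A morphism `g : Γ' ⟶ Γ` that collapses exactly one edge, where `Γ` is the graph of `x`. Its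
source is regarded as an object over `Γ₀` by `f ∘ g`, with the orientation that induces the
given orientation of `Γ`. -/
structure Expansion {Ω : Type u} {Γ₀ : RibbonGraph Ω} {k : ℕ} (x : OrientedOver Γ₀ (k + 1)) where
  src : OrientedOver Γ₀ k
  g : Hom src.Γ x.Γ
  one_edge : src.Γ.H.card = x.Γ.H.card + 2
  over_eq : ∀ h, g.pre (x.f.pre h) = src.f.pre h
  induces : g.Induces src.o x.o

/-- Right equivalence of morphisms `g : Γ' ⟶ Γ` and `g' : Γ'' ⟶ Γ`: there is an isomorphism
`a : Γ' ≅ Γ''` with `g' ∘ a = g`. -/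
def Expansion.Rel {Ω : Type u} {Γ₀ : RibbonGraph Ω} {k : ℕ} {x : OrientedOver Γ₀ (k + 1)}
    (e e' : Expansion x) : Prop :=
  ∃ a : OverIso e.src e'.src, ∀ h, a.g.toEquiv (e.g.pre h) = e'.g.pre h

/-- Expansions of isomorphic objects correspond to each other. -/
noncomputable def Expansion.mapIso {Ω : Type u} {Γ₀ : RibbonGraph Ω} {k : ℕ} {x y : OrientedOver Γ₀ (k + 1)}
    (b : OverIso x y) (e : Expansion x) : Expansion y where
  src := e.src
  g := e.g.compIso b.g
  one_edge := by
    rw [e.one_edge, Finset.card_eq_of_equiv b.g.toEquiv]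
  over_eq h := by
    rw [← e.over_eq, ← b.over_eq]
    exact congrArg e.g.pre (b.g.toEquiv.symm_apply_apply _)
  induces := e.induces.compIso b.preserves

/-- Expansions of an object and of the reversed object correspond to each other. -/
noncomputable def Expansion.reverse {Ω : Type u} {Γ₀ : RibbonGraph Ω} {k : ℕ} {x : OrientedOver Γ₀ (k + 1)}
    (e : Expansion x) : Expansion x.reverse where
  src := e.src.reverse
  g := e.g
  one_edge := e.one_edge
  over_eq := e.over_eq
  induces := e.induces.neg

/-- Inverse of `Expansion.reverse`. -/
noncomputable def Expansion.unreverse {Ω : Type u} {Γ₀ : RibbonGraph Ω} {k : ℕ} {x : OrientedOver Γ₀ (k + 1)}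
    (e : Expansion x.reverse) : Expansion x where
  src := e.src.reverse
  g := e.g
  one_edge := e.one_edge
  over_eq := e.over_eq
  induces := by
    have h := e.induces.neg
    have h2 : -(x.reverse.o) = x.o := neg_neg (G := Module.Ray ℝ _) x.o
    rw [h2] at h
    exact h

theorem Expansion.ext_ori {Ω : Type u} {Γ₀ : RibbonGraph Ω} {k : ℕ} {x : OrientedOver Γ₀ (k + 1)}
    (e : Expansion x) (o : e.src.Γ.Ori) (ho : e.src.o = o) (hi : e.g.Induces o x.o) :
    (⟨⟨e.src.Γ, e.src.codim_eq, e.src.f, o⟩, e.g, e.one_edge, e.over_eq, hi⟩ : Expansion x) = e := by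
  subst ho
  rfl

end OrientedOver

open OrientedOver FreeAbelianGroup

/-- The relations of the group `F_k(Γ₀)`: isomorphic objects are equal, and reversal of the
orientation is reversal of the sign. -/
def forestRelations {Ω : Type u} (Γ₀ : RibbonGraph Ω) (k : ℕ) :
    AddSubgroup (FreeAbelianGroup (OrientedOver Γ₀ k)) :=
  AddSubgroup.closure
    ({z | ∃ x y : OrientedOver Γ₀ k, Nonempty (OverIso x y) ∧ z = of x - of y} ∪
      {z | ∃ x : OrientedOver Γ₀ k, z = of x.reverse + of x})

/-- The group `F_k(Γ₀)`. -/
abbrev ForestChain {Ω : Type u} (Γ₀ : RibbonGraph Ω) (k : ℕ) : Type u :=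
  FreeAbelianGroup (OrientedOver Γ₀ k) ⧸ forestRelations Γ₀ k

/-- The generator `[f : Γ ⟶ Γ₀]`. -/
def cls {Ω : Type u} {Γ₀ : RibbonGraph Ω} {k : ℕ} (x : OrientedOver Γ₀ k) : ForestChain Γ₀ k :=
  QuotientAddGroup.mk (of x)

theorem cls_eq {Ω : Type u} {Γ₀ : RibbonGraph Ω} {k : ℕ} {x y : OrientedOver Γ₀ k}
    (a : OverIso x y) : cls x = cls y := by
  rw [cls, cls, ← sub_eq_zero, ← QuotientAddGroup.mk_sub, QuotientAddGroup.eq_zero_iff]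
  exact AddSubgroup.subset_closure (Or.inl ⟨x, y, ⟨a⟩, rfl⟩)

theorem cls_reverse {Ω : Type u} {Γ₀ : RibbonGraph Ω} {k : ℕ} (x : OrientedOver Γ₀ k) :
    cls x.reverse = -cls x := by
  rw [cls, cls, eq_neg_iff_add_eq_zero, ← QuotientAddGroup.mk_add, QuotientAddGroup.eq_zero_iff]
  exact AddSubgroup.subset_closure (Or.inr ⟨x, rfl⟩)

/-- A homomorphism out of `F_k(Γ₀)` from its values on generators. -/
def forestLift {Ω : Type u} {Γ₀ : RibbonGraph Ω} {k : ℕ} {M : Type v} [AddCommGroup M]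
    (φ : OrientedOver Γ₀ k → M) (h₁ : ∀ x y, OverIso x y → φ x = φ y)
    (h₂ : ∀ x, φ x.reverse = -φ x) : ForestChain Γ₀ k →+ M :=
  QuotientAddGroup.lift _ (FreeAbelianGroup.lift φ) (by
    rw [forestRelations, AddSubgroup.closure_le]
    rintro z (⟨x, y, ⟨a⟩, rfl⟩ | ⟨x, rfl⟩)
    · simp [h₁ x y a]
    · simp [h₂ x])

/-- The boundary of the generator `x`: the sum over all right equivalence classes of morphisms
`g : Γ' ⟶ Γ` that collapse exactly one edge. -/
noncomputable def boundary {Ω : Type u} {Γ₀ : RibbonGraph Ω} {k : ℕ}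
    (x : OrientedOver Γ₀ (k + 1)) : ForestChain Γ₀ k :=
  ∑ᶠ c : Quot (Expansion.Rel (x := x)),
    Quot.lift (fun e : Expansion x => cls e.src) (fun _ _ ⟨a, _⟩ => cls_eq a) c

theorem boundary_eq_of_iso {Ω : Type u} {Γ₀ : RibbonGraph Ω} {k : ℕ}
    (x y : OrientedOver Γ₀ (k + 1)) (b : OverIso x y) : boundary x = boundary y := by
  have key : ∀ {x y : OrientedOver Γ₀ (k + 1)} (b : OverIso x y) (e e' : Expansion x),
      Expansion.Rel e e' → Expansion.Rel (e.mapIso b) (e'.mapIso b) := by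
    rintro x y b e e' ⟨a, ha⟩
    exact ⟨a, fun h => ha _⟩
  refine finsum_eq_of_bijective (Quot.map (Expansion.mapIso b) (key b)) ?_ ?_
  · refine Function.bijective_iff_has_inverse.2
      ⟨Quot.map (Expansion.mapIso b.symm) (key b.symm), ?_, ?_⟩
    · rintro ⟨e⟩
      refine congrArg (Quot.mk _) ?_
      cases e
      simp [Expansion.mapIso, Hom.compIso, OverIso.symm, Iso.symm]
    · rintro ⟨e⟩
      refine congrArg (Quot.mk _) ?_
      cases e
      simp [Expansion.mapIso, Hom.compIso, OverIso.symm, Iso.symm]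
  · rintro ⟨e⟩
    rfl

theorem boundary_reverse {Ω : Type u} {Γ₀ : RibbonGraph Ω} {k : ℕ}
    (x : OrientedOver Γ₀ (k + 1)) : boundary x.reverse = -boundary x := by
  rw [boundary, boundary, ← finsum_neg_distrib]
  symm
  refine finsum_eq_of_bijective (Quot.map Expansion.reverse ?_) ?_ ?_
  · rintro e e' ⟨a, ha⟩
    exact ⟨a.reverse, ha⟩
  · refine Function.bijective_iff_has_inverse.2 ⟨Quot.map Expansion.unreverse ?_, ?_, ?_⟩
    · rintro e e' ⟨a, ha⟩
      exact ⟨a.reverse, ha⟩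
    · rintro ⟨e⟩
      exact congrArg (Quot.mk _)
        (Expansion.ext_ori e _ (neg_neg (G := Module.Ray ℝ _) e.src.o).symm _)
    · rintro ⟨e⟩
      exact congrArg (Quot.mk _)
        (Expansion.ext_ori e _ (neg_neg (G := Module.Ray ℝ _) e.src.o).symm _)
  · rintro ⟨e⟩
    exact (cls_reverse e.src).symm

/-- The forest complex `F_*(Γ₀)`, with augmentation `[f : Γ ⟶ Γ₀] ↦ o(Γ) = ±1`. -/
noncomputable def forestComplex {Ω : Type u} (Γ₀ : RibbonGraph Ω) : BasedSeq.{u} where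
  X k := ForestChain Γ₀ k
  d _ := forestLift boundary boundary_eq_of_iso boundary_reverse
  ε := forestLift (fun x => x.Γ.orientationSign x.o)
    (fun _ _ a => a.preserves.orientationSign_eq) (fun x => orientationSign_neg x.Γ x.o)
  gen _ := Set.range cls

end RibbonGraph

/-! ### Cellular chains of a regular cell complex

Let `P` be the poset of closed faces of a finite regular cell complex `X`, with dimension function
`dim`. The chains `F₀ < ⋯ < F_k` of faces are the simplices of the barycentric subdivision of `X`,
and the `k`-skeleton `X^k` is the subcomplex of the simplices all of whose vertices are faces of
dimension at most `k`. As `X^k` has no simplices of dimension `k + 1`, the cellular chain group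
`H_k(X^k, X^{k-1})` is the group of simplicial `k`-chains of `X^k` whose boundary lies
in `X^{k-1}`. -/

namespace FacePoset

/-- The simplicial boundary. The simplices are finite totally ordered sets of faces; removing the
element `x` of `insert x t` has the sign `(-1)^i`, where `i` is the number of elements
below `x`. -/
noncomputable def bd {P : Type} [Fintype P] [PartialOrder P] :
    (Finset P → ℤ) →+ (Finset P → ℤ) where
  toFun c t := ∑ x ∈ tᶜ, (-1) ^ (t.filter (· < x)).card * c (insert x t)
  map_zero' := by ext t; simp
  map_add' a b := by ext t; simp [mul_add, Finset.sum_add_distrib]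

theorem bd_bd {P : Type} [Fintype P] [PartialOrder P] (c : Finset P → ℤ)
    (hc : ∀ s, c s ≠ 0 → IsChain (· ≤ ·) (s : Set P)) : bd (bd c) = 0 := by
  ext t
  change ∑ x ∈ tᶜ, (-1) ^ (t.filter (· < x)).card *
    (∑ y ∈ (insert x t)ᶜ, (-1) ^ ((insert x t).filter (· < y)).card *
      c (insert y (insert x t))) = 0
  simp only [Finset.mul_sum]
  rw [Finset.sum_sigma']
  refine Finset.sum_involution (fun p _ => ⟨p.2, p.1⟩) ?_ ?_ ?_ ?_
  · rintro ⟨x, y⟩ h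
    simp only [Finset.mem_sigma, Finset.mem_compl, Finset.mem_insert, not_or] at h
    obtain ⟨hx, hyx, hy⟩ := h
    simp only
    rw [Finset.insert_comm x y t]
    by_cases h0 : c (insert y (insert x t)) = 0
    · rw [h0]; simp
    have hch := hc _ h0
    have hcmp := hch (show y ∈ _ by simp) (show x ∈ _ by simp) hyx
    rw [Finset.filter_insert, Finset.filter_insert]
    rcases hcmp with hle | hle
    · have h1 : y < x := lt_of_le_of_ne hle hyx
      have h2 : ¬ x < y := fun h => absurd (h.trans h1) (lt_irrefl _)
      rw [if_pos h1, if_neg h2, Finset.card_insert_of_notMem (by simp [hy])]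
      ring
    · have h1 : x < y := lt_of_le_of_ne hle (Ne.symm hyx)
      have h2 : ¬ y < x := fun h => absurd (h.trans h1) (lt_irrefl _)
      rw [if_pos h1, if_neg h2, Finset.card_insert_of_notMem (by simp [hx])]
      ring
  · rintro ⟨x, y⟩ h _ he
    simp only [Finset.mem_sigma, Finset.mem_compl, Finset.mem_insert, not_or] at h
    simp only [Sigma.mk.injEq, heq_eq_eq] at he
    exact h.2.1 he.1
  · rintro ⟨x, y⟩ h
    simp only [Finset.mem_sigma, Finset.mem_compl, Finset.mem_insert, not_or] at h ⊢
    exact ⟨h.2.2, fun h' => h.2.1 h'.symm, h.1⟩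
  · rintro ⟨x, y⟩ _
    rfl

/-- The cellular chain group in degree `k`: simplicial `k`-chains of the `k`-skeleton whose
boundary lies in the `(k - 1)`-skeleton. -/
noncomputable def cellularChain {P : Type} [Fintype P] [PartialOrder P] (dim : P → ℕ) (k : ℕ) :
    AddSubgroup (Finset P → ℤ) where
  carrier := {c |
    (∀ s, c s ≠ 0 → IsChain (· ≤ ·) (s : Set P) ∧ s.card = k + 1 ∧ ∀ x ∈ s, dim x ≤ k) ∧
    (∀ t, bd c t ≠ 0 → ∀ x ∈ t, dim x < k)}
  zero_mem' := by simp
  add_mem' := by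
    rintro a b ⟨ha, ha'⟩ ⟨hb, hb'⟩
    refine ⟨fun s hs => ?_, fun t ht => ?_⟩
    · by_cases h : a s = 0
      · exact hb s (by intro h'; simp [h, h'] at hs)
      · exact ha s h
    · by_cases h : bd a t = 0
      · exact hb' t (by intro h'; simp [h, h'] at ht)
      · exact ha' t h
  neg_mem' := by
    rintro a ⟨ha, ha'⟩
    exact ⟨fun s hs => ha s (by simpa using hs), fun t ht => ha' t (by simpa using ht)⟩

theorem bd_mem {P : Type} [Fintype P] [PartialOrder P] (dim : P → ℕ) (k : ℕ)
    (c : Finset P → ℤ) (hc : c ∈ cellularChain dim (k + 1)) : bd c ∈ cellularChain dim k := by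
  obtain ⟨h1, h2⟩ := hc
  refine ⟨fun t ht => ?_, fun t ht => ?_⟩
  · obtain ⟨x, hx, hne⟩ := Finset.exists_ne_zero_of_sum_ne_zero ht
    have h3 := h1 _ (right_ne_zero_of_mul hne)
    refine ⟨h3.1.mono (by simp), ?_, fun y hy => Nat.lt_succ_iff.1 (h2 t ht y hy)⟩
    have h4 := h3.2.1
    rw [Finset.card_insert_of_notMem (by simpa using hx)] at h4
    omega
  · rw [bd_bd c fun s hs => (h1 s hs).1] at ht
    exact absurd rfl ht

/-- The augmented cellular chain complex. The generators in degree `k` are the two fundamental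
classes of each `k`-dimensional face `F`: the cellular chains supported on the simplices with top
vertex `F` that take the values `±1` on all these `k`-simplices. -/
noncomputable def cellularComplex {P : Type} [Fintype P] [PartialOrder P] (dim : P → ℕ) :
    BasedSeq.{0} where
  X k := cellularChain dim k
  d k := ((bd (P := P)).comp (cellularChain dim (k + 1)).subtype).codRestrict
    (cellularChain dim k) (fun c => bd_mem dim k c.1 c.2)
  ε := { toFun := fun c => ∑ x : P, c.1 {x}
         map_zero' := by simp
         map_add' := fun a b => by simp [Finset.sum_add_distrib] }
  gen k := {c | ∃ F : P, dim F = k ∧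
    (∀ s, c.1 s ≠ 0 → F ∈ s ∧ ∀ x ∈ s, x ≤ F) ∧
    ∀ s : Finset P, IsChain (· ≤ ·) (s : Set P) → s.card = k + 1 → F ∈ s → (∀ x ∈ s, x ≤ F) →
      c.1 s = 1 ∨ c.1 s = -1}

end FacePoset

/-! ### The associahedron -/

namespace Associahedron

/-- The diagonals of a convex polygon with vertices `0, …, m + 2`. Under planar duality the sides
of the polygon are the leaves of a planar tree, and a diagonal is an internal edge. -/
def Diagonal (m : ℕ) : Type :=
  {p : Fin (m + 3) × Fin (m + 3) //
    p.1.val + 2 ≤ p.2.val ∧ ¬ (p.1.val = 0 ∧ p.2.val = m + 2)}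

noncomputable instance (m : ℕ) : Fintype (Diagonal m) :=
  inferInstanceAs (Fintype {p : Fin (m + 3) × Fin (m + 3) //
    p.1.val + 2 ≤ p.2.val ∧ ¬ (p.1.val = 0 ∧ p.2.val = m + 2)})

/-- Two diagonals cross if they meet in the interior of the polygon. -/
def Crosses {m : ℕ} (a b : Diagonal m) : Prop :=
  (a.1.1 < b.1.1 ∧ b.1.1 < a.1.2 ∧ a.1.2 < b.1.2) ∨
  (b.1.1 < a.1.1 ∧ a.1.1 < b.1.2 ∧ b.1.2 < a.1.2)

/-- The faces of the `m`-dimensional associahedron `K^m`: sets of pairwise noncrossing diagonals of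
the `(m + 3)`-gon, i.e. planar trees with `m + 3` fixed leaves (up to isomorphism fixing the
leaves), the diagonals being the internal edges. -/
structure Face (m : ℕ) where
  diagonals : Finset (Diagonal m)
  noncrossing : ∀ a ∈ diagonals, ∀ b ∈ diagonals, ¬ Crosses a b

theorem Face.ext' {m : ℕ} {D E : Face m} (h : D.diagonals = E.diagonals) : D = E := by
  cases D; cases E; cases h; rfl

noncomputable instance (m : ℕ) : Fintype (Face m) :=
  Fintype.ofInjective Face.diagonals fun _ _ => Face.ext'

/-- A face `D` is contained in a face `E` if the tree of `E` is obtained from the tree of `D` by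
collapsing internal edges, i.e. if `E` is a subset of `D`. -/
instance (m : ℕ) : PartialOrder (Face m) where
  le D E := E.diagonals ⊆ D.diagonals
  le_refl _ := subset_rfl
  le_trans _ _ _ h h' := Finset.Subset.trans h' h
  le_antisymm _ _ h h' := Face.ext' (Finset.Subset.antisymm h' h)

/-- A tree with `j` internal edges represents a face of dimension `m - j`. -/
def Face.dim {m : ℕ} (D : Face m) : ℕ := m - D.diagonals.card

/-- The cellular chain complex `C_*(K^m)` of the Stasheff associahedron. -/
noncomputable def complex (m : ℕ) : BasedSeq.{0} :=
  FacePoset.cellularComplex (Face.dim (m := m))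

end Associahedron

/-! A graph over `Γ₀` expands each vertex of `Γ₀` into a planar tree, so up to isomorphism over `Γ₀`
it is a set of non-crossing diagonals in one polygon for each vertex `v i`, that is, a face of a
product of associahedra. Morphisms over `Γ₀` correspond to inclusions of sets of diagonals. Hence
both complexes have bases indexed by the same graded poset, and boundary matrices with entries `±1`
exactly at the covering pairs.

The signs are never compared directly. The poset is thin: intervals of length two are diamonds, a
face of dimension one has two ends, and the facets of a face of dimension at least two are connected
through common facets. On such a poset a cycle supported on the facets of a face is a multiple of
the boundary of that face (`IsIncidence.rigid`). By induction on the dimension, any two incidence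
functions then differ only by a sign attached to each face (`IsIncidence.exists_units`), and these
signs are a based isomorphism (`BasedSeq.Models.basedIso`). It remains to see that each complex is
modelled on some incidence function.

For cellular chains, the fundamental class of a face is the cone over its boundary, and `rigid`
shows that there are no further cellular chains (`FacePoset.cellularComplex_models`). This needs an
incidence function on the associahedron; it is obtained by restricting the one of the forest complex
to a factor (`isIncidence_restrict`).

For the forest complex, one walks around the trees of the collapsed forest. Every half-edge is
labelled by the first leaves met from it and from its other side (`Hom.label`). Along the walk the
labels increase lexicographically (`Hom.isCycSucc`), so the cyclic orders can be recovered from the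
labels: maps that preserve labels are morphisms (`Hom.ofLabel`), morphisms over `Γ₀` are unique, and
every non-crossing set of labels occurs (`exists_hom_of_labels`). The incidence relations are two
sign computations. Collapsing two edges in the two orders exchanges two blocks of three cells, each
consisting of a vertex and two half-edges, which is odd (`Hom.indSign_mul_indSign`). The two
expansions of a vertex of valence four are carried to each other by a bijection that rotates four
half-edges, and a four-cycle is odd (`Hom.indSign_mul_orientationSign`).

Acyclicity comes from an acyclic matching of the dissections of a polygon whose only unmatched face
is the fan at the vertex `0` (`Face.isMatching`); such matchings pass to products. -/

set_option linter.unusedSectionVars false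

/-! ### Incidence functions on thin posets -/

/-- The combinatorial properties of the face poset of a polytope that are used below: `cov D E` says
that `E` is a facet of `D`. -/
structure IsThin {P : Type} (dim : P → ℕ) (cov : P → P → Prop) : Prop where
  dim_eq : ∀ {D E}, cov D E → dim D = dim E + 1
  diamond : ∀ {D E G}, cov D E → cov E G →
    ∃ E', E' ≠ E ∧ cov D E' ∧ cov E' G ∧ ∀ A, cov D A → cov A G → A = E ∨ A = E'
  edge : ∀ {D}, dim D = 1 →
    ∃ E E', E ≠ E' ∧ cov D E ∧ cov D E' ∧ ∀ A, cov D A → A = E ∨ A = E'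
  conn : ∀ {D E E'}, 2 ≤ dim D → cov D E → cov D E' →
    Relation.EqvGen (fun A B => cov D A ∧ cov D B ∧ ∃ G, cov A G ∧ cov B G) E E'
  facet : ∀ {D}, dim D ≠ 0 → ∃ E, cov D E

/-- An incidence function `s` and an augmentation `ε` on a graded poset. -/
structure IsIncidence {P : Type} [Fintype P] (dim : P → ℕ) (cov : P → P → Prop)
    (s : P → P → ℤ) (ε : P → ℤ) : Prop where
  unit : ∀ {D E}, cov D E → s D E = 1 ∨ s D E = -1
  zero : ∀ {D E}, ¬ cov D E → s D E = 0
  sq : ∀ D G, ∑ E, s D E * s E G = 0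
  aug : ∀ D, dim D = 1 → ∑ E, s D E * ε E = 0
  aug_unit : ∀ D, dim D = 0 → ε D = 1 ∨ ε D = -1

namespace IsIncidence

variable {P : Type} [Fintype P] {dim : P → ℕ} {cov : P → P → Prop} {s s' : P → P → ℤ}
  {ε ε' : P → ℤ}

theorem cov_of_ne (hI : IsIncidence dim cov s ε) {D E : P} (h : s D E ≠ 0) : cov D E := by
  by_contra h'
  exact h (hI.zero h')

theorem mul_self (hI : IsIncidence dim cov s ε) {D E : P} (h : cov D E) : s D E * s D E = 1 := by
  rcases hI.unit h with h | h <;> simp [h]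

/-- A cycle in the boundary of a face is a multiple of the boundary of the face. -/
theorem rigid (hT : IsThin dim cov) (hI : IsIncidence dim cov s ε) {D : P} (hD : dim D ≠ 0)
    (n : P → ℤ) (hn : ∀ E, ¬ cov D E → n E = 0)
    (h2 : 2 ≤ dim D → ∀ G, ∑ E, n E * s E G = 0)
    (h1 : dim D = 1 → ∑ E, n E * ε E = 0) : ∃ c, ∀ E, n E = c * s D E := by
  -- As `s D E = ±1` on facets, proportionality to `s D` means that this product is constant, and
  -- constancy can be propagated from one facet to an adjacent one.
  suffices h : ∃ c, ∀ E, cov D E → n E * s D E = c by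
    obtain ⟨c, hc⟩ := h
    refine ⟨c, fun E => ?_⟩
    by_cases hE : cov D E
    · rw [← hc E hE, mul_assoc, hI.mul_self hE, mul_one]
    · rw [hn E hE, hI.zero hE, mul_zero]
  -- Two facets with coefficients `a`, `b` in the cycle and `x`, `y` in the boundary; both
  -- combinations vanish at a common facet, whose incidence numbers are `x'`, `y'`.
  have aux : ∀ {a b x y x' y' : ℤ}, (x = 1 ∨ x = -1) → (y = 1 ∨ y = -1) → (x' = 1 ∨ x' = -1) →
      (y' = 1 ∨ y' = -1) → a * x' + b * y' = 0 → x * x' + y * y' = 0 → a * x = b * y := by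
    intro a b x y x' y' hx hy hx' hy' e1 e2
    rcases hx with rfl | rfl <;> rcases hy with rfl | rfl <;> rcases hx' with rfl | rfl <;>
      rcases hy' with rfl | rfl <;> omega
  obtain ⟨E₀, hE₀⟩ := hT.facet hD
  refine ⟨n E₀ * s D E₀, fun E hE => ?_⟩
  -- The two ends of an edge have no common facet; the augmentation takes its place.
  by_cases hd : dim D = 1
  · obtain ⟨A, B, hAB, hA, hB, hall⟩ := hT.edge hd
    have e1 := h1 hd
    have e2 := hI.aug D hd
    rw [Fintype.sum_eq_add A B hAB (fun x hx => by
      rw [hn x (fun h => by rcases hall x h with h | h <;> simp [h] at hx), zero_mul])] at e1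
    rw [Fintype.sum_eq_add A B hAB (fun x hx => by
      rw [hI.zero (fun h => by rcases hall x h with h | h <;> simp [h] at hx), zero_mul])] at e2
    have hA0 : dim A = 0 := by have := hT.dim_eq hA; omega
    have hB0 : dim B = 0 := by have := hT.dim_eq hB; omega
    have key := aux (hI.unit hA) (hI.unit hB) (hI.aug_unit A hA0) (hI.aug_unit B hB0) e1 e2
    rcases hall E hE with rfl | rfl <;> rcases hall E₀ hE₀ with rfl | rfl <;> simp [key]
  · have hd2 : 2 ≤ dim D := by omega
    have hconn := hT.conn hd2 hE hE₀
    clear hE hE₀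
    induction hconn with
    | rel A B h =>
      obtain ⟨hA, hB, G, hAG, hBG⟩ := h
      by_cases hAB : A = B
      · rw [hAB]
      -- By the diamond property `A` and `B` are the only facets of `D` above `G`, so both sums
      -- reduce to two terms.
      obtain ⟨E', -, -, -, hall⟩ := hT.diamond hA hAG
      have hBE : B = E' := (hall B hB hBG).resolve_left (Ne.symm hAB)
      subst hBE
      have e1 := h2 hd2 G
      have e2 := hI.sq D G
      rw [Fintype.sum_eq_add A B hAB (fun x hx => by
        by_cases h : cov D x
        · rw [hI.zero (D := x) (fun h' => by rcases hall x h h' with h | h <;> simp [h] at hx),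
            mul_zero]
        · rw [hn x h, zero_mul])] at e1
      rw [Fintype.sum_eq_add A B hAB (fun x hx => by
        by_cases h : cov D x
        · rw [hI.zero (D := x) (fun h' => by rcases hall x h h' with h | h <;> simp [h] at hx),
            mul_zero]
        · rw [hI.zero h, zero_mul])] at e2
      exact aux (hI.unit hA) (hI.unit hB) (hI.unit hAG) (hI.unit hBG) e1 e2
    | refl A => rfl
    | symm A B _ ih => exact ih.symm
    | trans A B C _ _ ih1 ih2 => exact ih1.trans ih2

/-- Two incidence functions on a thin poset differ by a change of signs of the faces. -/
theorem exists_units (hT : IsThin dim cov) (hI : IsIncidence dim cov s ε)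
    (hI' : IsIncidence dim cov s' ε') :
    ∃ u : P → ℤˣ, (∀ D, dim D = 0 → ε D = u D * ε' D) ∧
      ∀ D E, s D E * u E = u D * s' D E := by
  -- Signs are constructed dimension by dimension; only covering pairs with upper face of dimension
  -- at most `N` are controlled.
  have key : ∀ N : ℕ, ∃ u : P → ℤˣ, (∀ D, dim D = 0 → ε D = u D * ε' D) ∧
      ∀ D E, dim D ≤ N → s D E * u E = u D * s' D E := by
    intro N
    induction N with
    | zero =>
      have h : ∀ D, ∃ c : ℤˣ, dim D = 0 → ε D = c * ε' D := by
        intro D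
        by_cases hD : dim D = 0
        · rcases hI.aug_unit D hD with h | h <;> rcases hI'.aug_unit D hD with h' | h' <;>
            rw [h, h']
          · exact ⟨1, by simp⟩
          · exact ⟨-1, by simp⟩
          · exact ⟨-1, by simp⟩
          · exact ⟨1, by simp⟩
        · exact ⟨1, fun h => absurd h hD⟩
      choose u hu using h
      refine ⟨u, hu, fun D E hD => ?_⟩
      have : ¬ cov D E := fun h => by have := hT.dim_eq h; omega
      rw [hI.zero this, hI'.zero this]; simp
    | succ N ih =>
      obtain ⟨u, hu0, hu⟩ := ih
      have h : ∀ D, ∃ c : ℤˣ, dim D = N + 1 → ∀ E, s D E * u E = c * s' D E := by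
        intro D
        by_cases hD : dim D = N + 1
        swap
        · exact ⟨1, fun h => absurd h hD⟩
        -- The signs already chosen turn the `s`-boundary of `D` into a cycle for `s'`, which
        -- rigidity compares with the `s'`-boundary.
        obtain ⟨c, hc⟩ := rigid hT hI' (D := D) (by omega) (fun E => s D E * u E)
          (fun E hE => by simp [hI.zero hE]) (fun _ G => by
            have : ∀ E, s D E * u E * s' E G = s D E * s E G * u G := by
              intro E
              by_cases hE : cov D E
              · have := hu E G (by have := hT.dim_eq hE; omega)
                rw [mul_assoc, ← this, mul_assoc]
              · simp [hI.zero hE]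
            simp only [this]
            rw [← Finset.sum_mul, hI.sq, zero_mul]) (fun h1 => by
            have : ∀ E, s D E * u E * ε' E = s D E * ε E := by
              intro E
              by_cases hE : cov D E
              · rw [hu0 E (by have := hT.dim_eq hE; omega), mul_assoc]
              · simp [hI.zero hE]
            simp only [this]
            exact hI.aug D h1)
        obtain ⟨E, hE⟩ := hT.facet (D := D) (by omega)
        -- At any facet `c` divides a unit, so the factor is a sign.
        have hcu : IsUnit c := by
          have h := hc E
          have hu1 : IsUnit (c * s' D E) := by
            rw [← h]
            refine IsUnit.mul ?_ (u E).isUnit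
            exact Int.isUnit_iff.2 (hI.unit hE)
          exact isUnit_of_mul_isUnit_left hu1
        exact ⟨hcu.unit, fun _ E => by simpa using hc E⟩
      choose c hc using h
      refine ⟨fun D => if dim D = N + 1 then c D else u D, fun D hD => ?_, fun D E hD => ?_⟩
      · change ε D = ((if dim D = N + 1 then c D else u D : ℤˣ) : ℤ) * ε' D
        rw [if_neg (by omega)]; exact hu0 D hD
      · by_cases hDE : cov D E
        · have hdim := hT.dim_eq hDE
          change s D E * ((if dim E = N + 1 then c E else u E : ℤˣ) : ℤ) =
            ((if dim D = N + 1 then c D else u D : ℤˣ) : ℤ) * s' D E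
          rw [if_neg (show ¬ dim E = N + 1 by omega)]
          split_ifs with h
          · exact hc D h E
          · exact hu D E (by omega)
        · rw [hI.zero hDE, hI'.zero hDE]; simp
  obtain ⟨u, hu0, hu⟩ := key (Finset.univ.sup dim)
  exact ⟨u, hu0, fun D E => hu D E (Finset.le_sup (Finset.mem_univ D))⟩

end IsIncidence

/-! ### Complexes with a basis indexed by a graded poset -/

namespace BasedSeq

/-- The sequence has bases indexed by the elements of `P` in which the boundary map is given by the
matrix `s` and the augmentation by `ε`. -/
def Models (A : BasedSeq.{u}) {P : Type} [Fintype P] (dim : P → ℕ) (s : P → P → ℤ)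
    (ε : P → ℤ) : Prop :=
  ∃ b : ∀ k, Module.Basis {D : P // dim D = k} ℤ (A.X k),
    (∀ k D, A.d k (b (k + 1) D) = ∑ E : {E : P // dim E = k}, s D E • b k E) ∧
    (∀ D, A.ε (b 0 D) = ε D) ∧
    ∀ k, A.gen k = {x | ∃ D, x = b k D ∨ x = -b k D}

namespace Models

variable {A : BasedSeq.{u}} {B : BasedSeq.{v}} {P : Type} [Fintype P] {dim : P → ℕ}
  {cov : P → P → Prop} {s s' : P → P → ℤ} {ε ε' : P → ℤ}

theorem isBased (hA : A.Models dim s ε) : A.IsBased := by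
  obtain ⟨b, -, -, hg⟩ := hA
  intro k
  -- The definition asks for an index type in the universe of the groups.
  refine ⟨ULift.{u} {D : P // dim D = k}, (b k).reindex Equiv.ulift.symm, ?_⟩
  rw [hg]
  ext x
  simp [ULift.exists]

/-- The signs from `exists_units` are a diagonal change of basis. Their defining relation is
commutation with the boundary maps, and a diagonal matrix of signs respects the sets of generators.
-/
theorem basedIso (hT : IsThin dim cov) (hA : A.Models dim s ε) (hB : B.Models dim s' ε')
    (hI : IsIncidence dim cov s ε) (hI' : IsIncidence dim cov s' ε') : A.BasedIso B := by
  obtain ⟨u, hu0, hu⟩ := IsIncidence.exists_units hT hI hI'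
  obtain ⟨a, ha1, ha2, ha3⟩ := hA
  obtain ⟨b, hb1, hb2, hb3⟩ := hB
  let e : ∀ k, A.X k ≃ₗ[ℤ] B.X k := fun k =>
    (a k).equiv ((b k).unitsSMul fun D => u D) (Equiv.refl _)
  have he : ∀ k D, e k (a k D) = (u D : ℤ) • b k D := by
    intro k D
    simp [e, Module.Basis.unitsSMul_apply, Units.smul_def]
  refine ⟨fun k => (e k).toAddEquiv, ?_, ?_, ?_⟩
  · intro k x
    have : (e k).toLinearMap ∘ₗ (A.d k).toIntLinearMap =
        (B.d k).toIntLinearMap ∘ₗ (e (k + 1)).toLinearMap := by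
      refine (a (k + 1)).ext fun D => ?_
      change e k (A.d k (a (k + 1) D)) = B.d k (e (k + 1) (a (k + 1) D))
      rw [ha1, he, map_zsmul, hb1, map_sum, Finset.smul_sum]
      refine Finset.sum_congr rfl fun E _ => ?_
      rw [map_zsmul, he, smul_smul, smul_smul, hu]
    exact LinearMap.congr_fun this x
  · intro x
    have : (B.ε).toIntLinearMap ∘ₗ (e 0).toLinearMap = (A.ε).toIntLinearMap := by
      refine (a 0).ext fun D => ?_
      change B.ε (e 0 (a 0 D)) = A.ε (a 0 D)
      rw [he, map_zsmul, ha2, hb2, hu0 D D.2, smul_eq_mul]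
    exact LinearMap.congr_fun this x
  · intro k
    rw [ha3, hb3]
    have hu1 : ∀ D, (u D : ℤ) = 1 ∨ (u D : ℤ) = -1 := fun D => Int.isUnit_iff.1 (u D).isUnit
    ext y
    constructor
    · rintro ⟨x, ⟨D, rfl | rfl⟩, rfl⟩
      · refine ⟨D, ?_⟩
        change e k (a k D) = _ ∨ e k (a k D) = _
        rw [he]
        rcases hu1 D with h | h <;> simp [h]
      · refine ⟨D, ?_⟩
        change e k (-(a k D)) = _ ∨ e k (-(a k D)) = _
        rw [map_neg, he]
        rcases hu1 D with h | h <;> simp [h]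
    · rintro ⟨D, hD⟩
      have h1 : e k (a k D) = b k D ∨ e k (a k D) = -b k D := by
        rw [he]
        rcases hu1 D with h | h <;> simp [h]
      have h2 : y = e k (a k D) ∨ y = e k (-(a k D)) := by
        rw [map_neg]
        rcases h1 with h1 | h1 <;> rcases hD with hD | hD <;> simp [h1, hD]
      rcases h2 with h2 | h2
      · exact ⟨_, ⟨D, Or.inl rfl⟩, h2.symm⟩
      · exact ⟨_, ⟨D, Or.inr rfl⟩, h2.symm⟩

/-- Coordinates of chains as functions on `P`. -/
theorem exists_coords (hT : IsThin dim cov) (hI : IsIncidence dim cov s ε)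
    (hA : A.Models dim s ε) :
    ∃ c : ∀ k, A.X k →+ (P → ℤ), (∀ k, Function.Injective (c k)) ∧
      (∀ k x D, dim D ≠ k → c k x D = 0) ∧
      (∀ k (f : P → ℤ), (∀ D, dim D ≠ k → f D = 0) → ∃ x, c k x = f) ∧
      (∀ k x G, c k (A.d k x) G = ∑ D, c (k + 1) x D * s D G) ∧
      ∀ x, A.ε x = ∑ D, c 0 x D * ε D := by
  obtain ⟨b, h1, h2, -⟩ := hA
  -- Coordinates are extended by zero to all of `P`, so that sums need not run over subtypes that
  -- depend on the degree.
  let c : ∀ k, A.X k →+ (P → ℤ) := fun k =>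
    { toFun := fun x D => if h : dim D = k then (b k).repr x ⟨D, h⟩ else 0
      map_zero' := by ext D; simp
      map_add' := fun x y => by
        ext D
        by_cases h : dim D = k <;> simp [h] }
  have hc : ∀ k x (D : {D : P // dim D = k}), c k x D = (b k).repr x D := by
    rintro k x ⟨D, h⟩
    change dite _ _ _ = _
    rw [dif_pos h]
  have hc0 : ∀ k x D, dim D ≠ k → c k x D = 0 := fun k x D h => dif_neg h
  have hsum : ∀ k (f : P → ℤ), (∀ D, dim D ≠ k → f D = 0) →
      ∑ D, f D = ∑ D : {D : P // dim D = k}, f D := by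
    intro k f hf
    rw [← Finset.sum_subtype (Finset.univ.filter fun D => dim D = k) (by simp) f,
      Finset.sum_filter_of_ne]
    intro x _ hx
    by_contra h
    exact hx (hf x h)
  refine ⟨c, fun k x y hxy => ?_, hc0, fun k f hf => ?_, fun k x G => ?_, fun x => ?_⟩
  · refine (b k).repr.injective (Finsupp.ext fun D => ?_)
    rw [← hc, ← hc, hxy]
  · refine ⟨∑ D : {D : P // dim D = k}, f D • b k D, ?_⟩
    ext D
    by_cases h : dim D = k
    · have := hc k (∑ D : {D : P // dim D = k}, f D • b k D) ⟨D, h⟩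
      rw [this, (b k).repr_sum_self]
    · rw [hc0 _ _ _ h, hf _ h]
  · by_cases hG : dim G = k
    · rw [hsum (k + 1) _ (fun D hD => by rw [hc0 _ _ _ hD, zero_mul]), hc k _ ⟨G, hG⟩]
      simp only [hc]
      conv_lhs => rw [← (b (k + 1)).sum_repr x]
      simp only [map_sum, map_zsmul, h1, map_smul, Finsupp.coe_finsetSum, Finset.sum_apply,
        Finsupp.smul_apply, Module.Basis.repr_self, smul_eq_mul]
      refine Finset.sum_congr rfl fun D _ => congrArg _ ?_
      rw [Fintype.sum_eq_single (⟨G, hG⟩ : {E : P // dim E = k})]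
      · simp
      · intro E hE
        rw [Finsupp.single_eq_of_ne' hE, mul_zero]
    · rw [hc0 _ _ _ hG]
      symm
      refine Finset.sum_eq_zero fun D _ => ?_
      by_cases hD : cov D G
      · rw [hc0 _ _ _ (by have := hT.dim_eq hD; omega), zero_mul]
      · rw [hI.zero hD, mul_zero]
  · rw [hsum 0 _ (fun D hD => by rw [hc0 _ _ _ hD, zero_mul])]
    simp only [hc]
    refine (congrArg A.ε ((b 0).sum_repr x).symm).trans ?_
    simp only [map_sum, map_zsmul, h2, smul_eq_mul]

end Models
end BasedSeq

/-! ### Acyclic matchings and exactness -/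

/-- An acyclic matching of the faces other than `W`: the faces `D` with `U D` are matched with
faces `μ D` that do not satisfy `U`, and the level `ρ` shows that the matching is acyclic. -/
structure IsMatching {P : Type} (dim : P → ℕ) (cov : P → P → Prop) (W : P) (ρ : P → ℕ)
    (U : P → Prop) (μ : P → P) : Prop where
  dim_top : dim W = 0
  mono : ∀ {D E}, cov D E → ρ D ≤ ρ E
  up : ∀ {D}, U D → cov D (μ D) ∧ ¬ U (μ D) ∧ ρ (μ D) = ρ D ∧ μ D ≠ W
  inj : ∀ {D D'}, U D → U D' → μ D = μ D' → D = D'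
  surj : ∀ {D}, ¬ U D → D ≠ W → ∃ D', U D' ∧ μ D' = D
  key : ∀ {D E}, cov D E → ρ D = ρ E → U D → ¬ U E → E ≠ W → E = μ D

/-- Discrete Morse theory as elimination by levels. Boundaries never lower the level, so a
correction at level `N` does not disturb lower ones. Within a level, the matrix from the faces with
`U` to the faces without is diagonal along the matching, by `key`. Hence the coefficients without
`U` can be removed, and a remaining cycle supported on faces with `U` must vanish. The face `W`
stays uncontrolled. -/
theorem IsMatching.exists_boundary {P : Type} [Fintype P] {dim : P → ℕ} {cov : P → P → Prop}
    {s : P → P → ℤ} {ε : P → ℤ} {W : P} {ρ : P → ℕ} {U : P → Prop} {μ : P → P}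
    (hM : IsMatching dim cov W ρ U μ) (hT : IsThin dim cov) (hI : IsIncidence dim cov s ε)
    {k : ℕ} (z : P → ℤ) (hz : ∀ D, dim D ≠ k → z D = 0) (hdz : ∀ G, ∑ D, z D * s D G = 0) :
    ∃ y : P → ℤ, (∀ D, dim D ≠ k + 1 → y D = 0) ∧ ∀ D, D ≠ W → z D = ∑ E, y E * s E D := by
  have key : ∀ N : ℕ, ∃ y : P → ℤ, (∀ D, dim D ≠ k + 1 → y D = 0) ∧
      ∀ D, D ≠ W → ρ D < N → z D = ∑ E, y E * s E D := by
    intro N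
    induction N with
    | zero => exact ⟨0, by simp, fun _ _ h => absurd h (Nat.not_lt_zero _)⟩
    | succ N ih =>
      obtain ⟨y, hy, hyz⟩ := ih
      set w : P → ℤ := fun D => z D - ∑ E, y E * s E D with hw
      have hwk : ∀ D, dim D ≠ k → w D = 0 := by
        intro D hD
        simp only [hw, hz D hD, zero_sub, neg_eq_zero]
        refine Finset.sum_eq_zero fun E _ => ?_
        by_cases hE : cov E D
        · rw [hy E (by have := hT.dim_eq hE; omega), zero_mul]
        · rw [hI.zero hE, mul_zero]
      have hdw : ∀ G, ∑ D, w D * s D G = 0 := by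
        intro G
        simp only [hw, sub_mul, Finset.sum_sub_distrib, hdz, zero_sub, neg_eq_zero, Finset.sum_mul]
        rw [Finset.sum_comm]
        simp only [mul_assoc, ← Finset.mul_sum, hI.sq, mul_zero, Finset.sum_const_zero]
      have hwN : ∀ D, D ≠ W → ρ D < N → w D = 0 := fun D hD h => sub_eq_zero.2 (hyz D hD h)
      -- The coefficient is chosen so that the boundary of `y'` has the value `w (μ D)` at `μ D`; it
      -- uses that `s D (μ D)` is its own inverse.
      let y' : P → ℤ := fun D => if U D ∧ ρ D = N then s D (μ D) * w (μ D) else 0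
      have hy' : ∀ D, y' D ≠ 0 → U D ∧ ρ D = N := by
        intro D hD
        by_contra h
        exact hD (if_neg h)
      have hA : ∀ D, D ≠ W → ¬ U D → ρ D = N → w D = ∑ E, y' E * s E D := by
        intro D hDW hD hN
        obtain ⟨D', hU, rfl⟩ := hM.surj hD hDW
        obtain ⟨hc, -, hρ, -⟩ := hM.up hU
        rw [Fintype.sum_eq_single D']
        · simp only [y']
          rw [if_pos ⟨hU, by omega⟩]
          linear_combination -(w (μ D')) * hI.mul_self hc
        · intro E hE
          by_contra h
          have hE1 := hy' E (left_ne_zero_of_mul h)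
          have hE2 := hI.cov_of_ne (right_ne_zero_of_mul h)
          exact hE (hM.inj hE1.1 hU (hM.key hE2 (by omega) hE1.1 hD hDW).symm)
      have hB : ∀ D, ρ D < N → ∑ E, y' E * s E D = 0 := by
        intro D hD
        refine Finset.sum_eq_zero fun E _ => ?_
        by_contra h
        have hE1 := hy' E (left_ne_zero_of_mul h)
        have hE2 := hM.mono (hI.cov_of_ne (right_ne_zero_of_mul h))
        omega
      set w' : P → ℤ := fun D => w D - ∑ E, y' E * s E D with hw'
      have hdw' : ∀ G, ∑ D, w' D * s D G = 0 := by
        intro G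
        simp only [hw', sub_mul, Finset.sum_sub_distrib, hdw, zero_sub, neg_eq_zero,
          Finset.sum_mul]
        rw [Finset.sum_comm]
        simp only [mul_assoc, ← Finset.mul_sum, hI.sq, mul_zero, Finset.sum_const_zero]
      have hC : ∀ D, D ≠ W → (ρ D < N ∨ (ρ D = N ∧ ¬ U D)) → w' D = 0 := by
        rintro D hD (h | ⟨h, h'⟩)
        · simp only [hw', hwN D hD h, hB D h, sub_zero]
        · simp only [hw', hA D hD h' h, sub_self]
      -- The coefficient of the boundary of `w'` at `μ D` comes from `D` alone: any other
      -- contribution would be a face with `U` of the same level, hence matched with the same `μ D`.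
      have hE : ∀ D, D ≠ W → ρ D = N → w' D = 0 := by
        intro D hD hN
        by_cases hU : U D
        swap
        · exact hC D hD (Or.inr ⟨hN, hU⟩)
        obtain ⟨hc, hnU, hρ, hne⟩ := hM.up hU
        have h := hdw' (μ D)
        rw [Fintype.sum_eq_single D] at h
        · rcases mul_eq_zero.1 h with h | h
          · exact h
          · rcases hI.unit hc with h' | h' <;> rw [h'] at h <;> norm_num at h
        · intro E hE
          by_contra h
          have hcov := hI.cov_of_ne (right_ne_zero_of_mul h)
          have hw0 := left_ne_zero_of_mul h
          have hEW : E ≠ W := by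
            rintro rfl
            have := hT.dim_eq hcov
            have := hM.dim_top
            omega
          have hle := hM.mono hcov
          have hUE : U E := by
            by_contra hUE
            refine hw0 (hC E hEW ?_)
            rcases lt_or_eq_of_le hle with h1 | h1
            · left; omega
            · right; exact ⟨by omega, hUE⟩
          have hEN : ρ E = N := by
            by_contra h1
            exact hw0 (hC E hEW (Or.inl (by omega)))
          exact hE (hM.inj hUE hU (hM.key hcov (by omega) hUE hnU hne).symm)
      -- Only the part of `y'` in dimension `k + 1` is added; it is the only part with a boundary in
      -- dimension `k`.
      refine ⟨fun D => y D + if dim D = k + 1 then y' D else 0, fun D hD => by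
        simp [hy D hD, hD], fun D hD hN => ?_⟩
      have hyy : ∑ E, (y E + if dim E = k + 1 then y' E else 0) * s E D =
          ∑ E, y E * s E D + if dim D = k then ∑ E, y' E * s E D else 0 := by
        simp only [add_mul, Finset.sum_add_distrib]
        congr 1
        split_ifs with hDk
        · refine Finset.sum_congr rfl fun E _ => ?_
          by_cases hE : cov E D
          · rw [if_pos (by have := hT.dim_eq hE; omega)]
          · rw [hI.zero hE]; simp
        · refine Finset.sum_eq_zero fun E _ => ?_
          by_cases hE : cov E D
          · rw [if_neg (by have := hT.dim_eq hE; omega), zero_mul]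
          · rw [hI.zero hE]; simp
      rw [hyy]
      by_cases hDk : dim D = k
      · rw [if_pos hDk]
        have h0 : w' D = 0 := by
          rcases Nat.lt_succ_iff_lt_or_eq.1 hN with h | h
          · exact hC D hD (Or.inl h)
          · exact hE D hD h
        simp only [hw', hw] at h0
        linarith
      · rw [if_neg hDk, add_zero]
        have := hwk D hDk
        simp only [hw] at this
        linarith
  obtain ⟨y, hy, h⟩ := key (Finset.univ.sup ρ + 1)
  exact ⟨y, hy, fun D hD => h D hD (Nat.lt_succ_of_le (Finset.le_sup (Finset.mem_univ D)))⟩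

/-- The matching gives a preimage that is correct except perhaps at `W`. This face has dimension
zero, so in positive degrees nothing is left to check, and in degree zero the augmentation detects
its coefficient because `ε W = ±1`. -/
theorem BasedSeq.Models.isAcyclic {A : BasedSeq.{u}} {P : Type} [Fintype P] {dim : P → ℕ}
    {cov : P → P → Prop} {s : P → P → ℤ} {ε : P → ℤ} {W : P} {ρ : P → ℕ} {U : P → Prop}
    {μ : P → P} (hA : A.Models dim s ε) (hM : IsMatching dim cov W ρ U μ)
    (hT : IsThin dim cov) (hI : IsIncidence dim cov s ε) : A.IsAcyclic := by
  obtain ⟨c, hinj, hsupp, hsurj, hd, hε⟩ := hA.exists_coords hT hI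
  have hW : ε W * ε W = 1 := by
    rcases hI.aug_unit W hM.dim_top with h | h <;> simp [h]
  refine ⟨⟨fun k x => hinj k ?_, fun x => ?_⟩, fun n => ?_, fun x hx => ?_, fun k x hx => ?_⟩
  · ext G
    rw [hd]
    simp only [hd, Finset.sum_mul, map_zero, Pi.zero_apply]
    rw [Finset.sum_comm]
    simp only [mul_assoc, ← Finset.mul_sum, hI.sq, mul_zero, Finset.sum_const_zero]
  · rw [hε]
    simp only [hd, Finset.sum_mul]
    rw [Finset.sum_comm]
    refine Finset.sum_eq_zero fun D _ => ?_
    simp only [mul_assoc, ← Finset.mul_sum]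
    by_cases hD : dim D = 1
    · rw [hI.aug D hD, mul_zero]
    · rw [hsupp 1 x D hD, zero_mul]
  · obtain ⟨x, hx⟩ := hsurj 0 (fun D => if D = W then n * ε W else 0) (fun D hD => if_neg (by
      rintro rfl; exact hD hM.dim_top))
    refine ⟨x, ?_⟩
    rw [hε, hx]
    simp [mul_assoc, hW]
  · obtain ⟨y, hy, hyz⟩ := hM.exists_boundary hT hI (k := 0) (c 0 x) (hsupp 0 x) (fun G => by
      refine Finset.sum_eq_zero fun D _ => ?_
      by_cases hD : cov D G
      · rw [hsupp 0 x D (by have := hT.dim_eq hD; omega), zero_mul]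
      · rw [hI.zero hD, mul_zero])
    obtain ⟨y, rfl⟩ := hsurj 1 y hy
    refine ⟨y, hinj 0 ?_⟩
    have hne : ∀ D, D ≠ W → c 0 (A.d 0 y) D = c 0 x D := fun D hD => by rw [hd, hyz D hD]
    ext D
    by_cases hD : D = W
    swap
    · exact hne D hD
    subst hD
    -- The difference is a multiple of the vertex `W` with augmentation zero.
    have h0 : A.ε (A.d 0 y - x) = 0 := by
      rw [map_sub, hx, sub_zero, hε]
      simp only [hd, Finset.sum_mul]
      rw [Finset.sum_comm]
      refine Finset.sum_eq_zero fun E _ => ?_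
      simp only [mul_assoc, ← Finset.mul_sum]
      by_cases hE : dim E = 1
      · rw [hI.aug E hE, mul_zero]
      · rw [hsupp 1 y E hE, zero_mul]
    rw [hε, Fintype.sum_eq_single D] at h0
    · rcases mul_eq_zero.1 h0 with h | h
      · rw [map_sub] at h
        exact sub_eq_zero.1 h
      · rw [h] at hW; norm_num at hW
    · intro E hE
      rw [map_sub, Pi.sub_apply, hne E hE, sub_self, zero_mul]
  · obtain ⟨y, hy, hyz⟩ := hM.exists_boundary hT hI (k := k + 1) (c (k + 1) x) (hsupp (k + 1) x)
      (fun G => by rw [← hd, hx]; simp)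
    obtain ⟨y, rfl⟩ := hsurj (k + 2) y hy
    refine ⟨y, hinj (k + 1) ?_⟩
    ext D
    by_cases hD : D = W
    · subst hD
      have := hM.dim_top
      rw [hsupp _ _ _ (by omega), hsupp _ _ _ (by omega)]
    · rw [hd, hyz D hD]

/-! ### Models of tensor products -/

/-- The incidence function of a product. -/
noncomputable def prodInc {P Q : Type} (dimP : P → ℕ) (s : P → P → ℤ) (t : Q → Q → ℤ)
    (D E : P × Q) : ℤ :=
  (if D.2 = E.2 then s D.1 E.1 else 0) +
    (-1) ^ dimP D.1 * (if D.1 = E.1 then t D.2 E.2 else 0)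

theorem sum_prodInc {P Q M : Type} [Fintype P] [Fintype Q] [AddCommGroup M] (dimP : P → ℕ)
    (s : P → P → ℤ) (t : Q → Q → ℤ) (D : P × Q) (f : P × Q → M) :
    ∑ E, prodInc dimP s t D E • f E =
      ∑ E, s D.1 E • f (E, D.2) + ∑ E, ((-1) ^ dimP D.1 * t D.2 E) • f (D.1, E) := by
  simp only [prodInc, add_smul, Finset.sum_add_distrib, Fintype.sum_prod_type]
  congr 1
  · refine Finset.sum_congr rfl fun E _ => ?_
    rw [Fintype.sum_eq_single D.2]
    · simp
    · intro x hx
      rw [if_neg hx.symm, zero_smul]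
  · rw [Fintype.sum_eq_single D.1]
    · simp
    · intro x hx
      refine Finset.sum_eq_zero fun E _ => ?_
      rw [if_neg hx.symm, mul_zero, zero_smul]

namespace BasedSeq

/-- The basis vector of `D` in degree `k`, or zero if `D` has another dimension. -/
noncomputable def vec {A : BasedSeq.{u}} {P : Type} {dim : P → ℕ}
    (b : ∀ k, Module.Basis {D : P // dim D = k} ℤ (A.X k)) (k : ℕ) (D : P) : A.X k :=
  if h : dim D = k then b k ⟨D, h⟩ else 0

theorem vec_coe {A : BasedSeq.{u}} {P : Type} {dim : P → ℕ}
    (b : ∀ k, Module.Basis {D : P // dim D = k} ℤ (A.X k)) {k : ℕ} (D : {D : P // dim D = k}) :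
    vec b k D = b k D := dif_pos D.2

theorem vec_of_ne {A : BasedSeq.{u}} {P : Type} {dim : P → ℕ}
    (b : ∀ k, Module.Basis {D : P // dim D = k} ℤ (A.X k)) {k : ℕ} {D : P} (h : dim D ≠ k) :
    vec b k D = 0 := dif_neg h

theorem sum_smul_vec {A : BasedSeq.{u}} {P : Type} [Fintype P] {dim : P → ℕ}
    (b : ∀ k, Module.Basis {D : P // dim D = k} ℤ (A.X k)) (k : ℕ) (f : P → ℤ) :
    ∑ D : {D : P // dim D = k}, f D • b k D = ∑ D, f D • vec b k D := by
  have h : ∀ D : {D : P // dim D = k}, f D • b k D = f D • vec b k D := fun D => by rw [vec_coe]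
  simp only [h]
  rw [← Finset.sum_subtype (Finset.univ.filter fun D => dim D = k) (by simp)
    fun D => f D • vec b k D, Finset.sum_filter_of_ne]
  intro D _ hD
  by_contra h
  exact hD (by rw [vec_of_ne b h, smul_zero])

theorem dfinsupp_basis_apply {ι R : Type*} [DecidableEq ι] {M : ι → Type*} [Semiring R] [∀ i, AddCommMonoid (M i)]
    [∀ i, Module R (M i)] {η : ι → Type*} (b : ∀ i, Module.Basis (η i) R (M i)) (i : ι) (j : η i) :
    DFinsupp.basis b ⟨i, j⟩ = DFinsupp.single i (b i j) := by
  apply (DFinsupp.basis b).repr.injective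
  rw [Module.Basis.repr_self]
  change _ = (sigmaFinsuppLequivDFinsupp R).symm
    (DFinsupp.mapRange (fun i x => (b i).repr x) (fun i => map_zero _) (DFinsupp.single i (b i j)))
  rw [DFinsupp.mapRange_single, Module.Basis.repr_self, LinearEquiv.eq_symm_apply]
  exact sigmaFinsuppEquivDFinsupp_single _ _

section Tensor

variable {A B : BasedSeq.{0}} {P Q : Type} {dimP : P → ℕ} {dimQ : Q → ℕ}
  (a : ∀ k, Module.Basis {D : P // dimP D = k} ℤ (A.X k))
  (b : ∀ k, Module.Basis {D : Q // dimQ D = k} ℤ (B.X k))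

/-- Pairs of elements of total dimension `k`. -/
def pairsEquiv (dimP : P → ℕ) (dimQ : Q → ℕ) (k : ℕ) :
    (Σ p : Pairs k, {D : P // dimP D = p.1.1} × {D : Q // dimQ D = p.1.2}) ≃
      {D : P × Q // dimP D.1 + dimQ D.2 = k} where
  toFun x := ⟨(x.2.1, x.2.2), by rw [x.2.1.2, x.2.2.2, x.1.2]⟩
  invFun D := ⟨⟨(dimP D.1.1, dimQ D.1.2), D.2⟩, ⟨D.1.1, rfl⟩, ⟨D.1.2, rfl⟩⟩
  left_inv := by
    rintro ⟨⟨⟨p, q⟩, h⟩, ⟨D, hD⟩, ⟨E, hE⟩⟩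
    dsimp only at hD hE
    subst hD hE
    rfl
  right_inv _ := rfl

/-- The identity map of a group in the tensor product, between two forms of its module structure. -/
noncomputable def tensorXEquiv (A B : BasedSeq.{0}) (k : ℕ) :
    TensorX A B k ≃ₗ[ℤ] (tensor A B).X k :=
  { AddEquiv.refl (TensorX A B k) with
    map_smul' := fun n x => int_smul_eq_zsmul _ n x }

/-- The basis of the tensor product. -/
noncomputable def tensorBasis (k : ℕ) :
    Module.Basis {D : P × Q // dimP D.1 + dimQ D.2 = k} ℤ ((tensor A B).X k) :=
  ((DFinsupp.basis (R := ℤ) (M := fun p : Pairs k => A.X p.1.1 ⊗[ℤ] B.X p.1.2)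
    fun p => (a p.1.1).tensorProduct (b p.1.2)).map (tensorXEquiv A B k)).reindex
      (pairsEquiv dimP dimQ k)

theorem tensorBasis_apply {p q k : ℕ} (h : p + q = k) (D : {D : P // dimP D = p})
    (E : {E : Q // dimQ E = q}) :
    tensorBasis a b k ⟨(D, E), by rw [D.2, E.2, h]⟩ = tensorι A B h (a p D ⊗ₜ[ℤ] b q E) := by
  have h1 : (⟨(D, E), by rw [D.2, E.2, h]⟩ : {D : P × Q // dimP D.1 + dimQ D.2 = k}) =
      pairsEquiv dimP dimQ k ⟨⟨(p, q), h⟩, D, E⟩ := rfl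
  rw [h1, tensorBasis, Module.Basis.reindex_apply, Equiv.symm_apply_apply,
    Module.Basis.map_apply]
  refine congrArg (tensorXEquiv A B k) (a₂ := tensorι A B h (a p D ⊗ₜ[ℤ] b q E)) ?_
  refine (dfinsupp_basis_apply (M := fun p : Pairs k => A.X p.1.1 ⊗[ℤ] B.X p.1.2)
    (fun p : Pairs k => (a p.1.1).tensorProduct (b p.1.2)) ⟨(p, q), h⟩ (D, E)).trans ?_
  exact congrArg (DirectSum.lof ℤ (Pairs k)
    (fun r : Pairs k => A.X r.1.1 ⊗[ℤ] B.X r.1.2) ⟨(p, q), h⟩)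
    (Module.Basis.tensorProduct_apply (a p) (b q) D E)

/-- With `vec` a face can be used in every degree, at the price of being zero in the wrong one. This
makes both sides of the boundary formula sums over all faces. -/
theorem tensorι_vec {p q k : ℕ} (h : p + q = k) (D : P) (E : Q) :
    tensorι A B h (vec a p D ⊗ₜ[ℤ] vec b q E) =
      if dimP D = p ∧ dimQ E = q then
        vec (A := tensor A B) (dim := fun D : P × Q => dimP D.1 + dimQ D.2)
          (tensorBasis a b) k (D, E) else 0 := by
  split_ifs with h'
  · obtain ⟨rfl, rfl⟩ := h'
    rw [vec, dif_pos rfl, vec, dif_pos rfl, vec, dif_pos h]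
    exact (tensorBasis_apply a b h ⟨D, rfl⟩ ⟨E, rfl⟩).symm
  · rw [not_and_or] at h'
    rcases h' with h' | h'
    · rw [vec_of_ne a h', TensorProduct.zero_tmul, map_zero]; rfl
    · rw [vec_of_ne b h', TensorProduct.tmul_zero, map_zero]; rfl

theorem tensor_d_tmul {p q k : ℕ} (h : p + q = k + 1) (x : A.X p) (y : B.X q) :
    (tensor A B).d k (tensorι A B h (x ⊗ₜ[ℤ] y)) =
      tensorDLeft A B k p q h (x ⊗ₜ[ℤ] y) + tensorDRight A B k p q h (x ⊗ₜ[ℤ] y) := by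
  change (DirectSum.toModule ℤ (Pairs (k + 1)) (TensorX A B k) fun p =>
    tensorDLeft A B k p.1.1 p.1.2 p.2 + tensorDRight A B k p.1.1 p.1.2 p.2)
    (DirectSum.lof ℤ (Pairs (k + 1)) _ ⟨(p, q), h⟩ (x ⊗ₜ[ℤ] y)) = _
  rw [DirectSum.toModule_lof]
  rfl

theorem tensor_ε_tmul (x : A.X 0) (y : B.X 0) :
    (tensor A B).ε (tensorι A B (rfl : 0 + 0 = 0) (x ⊗ₜ[ℤ] y)) = A.ε x * B.ε y := by
  change (DirectSum.toModule ℤ (Pairs 0) ℤ fun p => tensorAug A B p.1.1 p.1.2 p.2)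
    (DirectSum.lof ℤ (Pairs 0) _ ⟨(0, 0), rfl⟩ (x ⊗ₜ[ℤ] y)) = _
  rw [DirectSum.toModule_lof]
  rfl

end Tensor

/-- By `sum_prodInc` the boundary splits into the facets that change the first component and those
that change the second; these are the two summands of the tensor boundary. -/
theorem Models.tensor {A B : BasedSeq.{0}} {P Q : Type} [Fintype P] [Fintype Q] {dimP : P → ℕ}
    {dimQ : Q → ℕ} {s : P → P → ℤ} {t : Q → Q → ℤ} {ε : P → ℤ} {η : Q → ℤ}
    (hA : A.Models dimP s ε) (hB : B.Models dimQ t η) :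
    (tensor A B).Models (fun D : P × Q => dimP D.1 + dimQ D.2) (prodInc dimP s t)
      (fun D => ε D.1 * η D.2) := by
  obtain ⟨a, ha1, ha2, ha3⟩ := hA
  obtain ⟨b, hb1, hb2, hb3⟩ := hB
  refine ⟨tensorBasis a b, ?_, ?_, ?_⟩
  · rintro k ⟨⟨D, E⟩, hDE⟩
    dsimp only at hDE
    rw [sum_smul_vec (A := BasedSeq.tensor A B) (dim := fun D : P × Q => dimP D.1 + dimQ D.2)
      (tensorBasis a b) k (fun F => prodInc dimP s t (D, E) F)]
    refine Eq.trans ?_ (sum_prodInc (M := TensorX A B k) dimP s t (D, E) _).symm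
    have h0 := tensorBasis_apply a b hDE ⟨D, rfl⟩ ⟨E, rfl⟩
    dsimp only at h0
    rw [h0, tensor_d_tmul]
    congr 1
    · obtain hp | ⟨p, hp⟩ : dimP D = 0 ∨ ∃ p, dimP D = p + 1 :=
        (Nat.eq_zero_or_pos _).imp_right fun h => ⟨_, (Nat.succ_pred_eq_of_pos h).symm⟩
      · have : ∀ F : P, vec (A := BasedSeq.tensor A B)
            (dim := fun D : P × Q => dimP D.1 + dimQ D.2) (tensorBasis a b) k (F, E) = 0 := by
          intro F
          refine vec_of_ne _ ?_
          dsimp only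
          omega
        refine Eq.trans ?_ (Finset.sum_eq_zero fun F _ => by rw [this]; exact zsmul_zero _).symm
        have h2 : ∀ (p' : ℕ) (h : p' + dimQ E = k + 1) (x : A.X p' ⊗[ℤ] B.X (dimQ E)), p' = 0 →
            tensorDLeft A B k p' (dimQ E) h x = 0 := by
          rintro _ h x rfl
          rfl
        exact h2 _ hDE _ hp
      · have h1 : (a (dimP D) ⟨D, rfl⟩ ⊗ₜ[ℤ] b (dimQ E) ⟨E, rfl⟩ :
            A.X (dimP D) ⊗[ℤ] B.X (dimQ E)) =
            vec a (dimP D) D ⊗ₜ[ℤ] vec b (dimQ E) E := by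
          rw [vec, dif_pos rfl, vec, dif_pos rfl]
        rw [h1]
        -- The degree is made a variable: `tensorDLeft` is defined by cases and unfolds only after
        -- the degree has been replaced by a successor.
        have h2 : ∀ (p' : ℕ) (h : p' + dimQ E = k + 1), p' = p + 1 →
            tensorDLeft A B k p' (dimQ E) h (vec a p' D ⊗ₜ[ℤ] vec b (dimQ E) E) =
              ∑ F, s D F • tensorι A B (show p + dimQ E = k by omega)
                (vec a p F ⊗ₜ[ℤ] vec b (dimQ E) E) := by
          rintro _ h rfl
          change tensorι A B _ (A.d p (vec a (p + 1) D) ⊗ₜ[ℤ] vec b (dimQ E) E) = _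
          rw [vec, dif_pos hp, ha1, sum_smul_vec a p (fun F => s D F), TensorProduct.sum_tmul,
            map_sum]
          refine Finset.sum_congr rfl fun F _ => ?_
          exact map_zsmul (tensorι A B (show p + dimQ E = k by omega) ∘ₗ
            (TensorProduct.mk ℤ (A.X p) (B.X (dimQ E))).flip (vec b (dimQ E) E)) (s D F)
            (vec a p F)
        rw [h2 _ hDE hp]
        refine Finset.sum_congr rfl fun F _ => ?_
        rw [tensorι_vec]
        split_ifs with hF
        · rfl
        · refine congrArg _ (Eq.symm (vec_of_ne _ ?_))
          dsimp only
          intro h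
          exact hF ⟨by omega, rfl⟩
    · obtain hq | ⟨q, hq⟩ : dimQ E = 0 ∨ ∃ q, dimQ E = q + 1 :=
        (Nat.eq_zero_or_pos _).imp_right fun h => ⟨_, (Nat.succ_pred_eq_of_pos h).symm⟩
      · have : ∀ F : Q, vec (A := BasedSeq.tensor A B)
            (dim := fun D : P × Q => dimP D.1 + dimQ D.2) (tensorBasis a b) k (D, F) = 0 := by
          intro F
          refine vec_of_ne _ ?_
          dsimp only
          omega
        refine Eq.trans ?_ (Finset.sum_eq_zero fun F _ => by rw [this]; exact zsmul_zero _).symm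
        have h2 : ∀ (p' q' : ℕ) (h : p' + q' = k + 1) (x : A.X p' ⊗[ℤ] B.X q'), q' = 0 →
            tensorDRight A B k p' q' h x = 0 := by
          rintro p' _ h x rfl
          rcases p' with _ | _ <;> rfl
        exact h2 _ _ hDE _ hq
      · have h1 : (a (dimP D) ⟨D, rfl⟩ ⊗ₜ[ℤ] b (dimQ E) ⟨E, rfl⟩ :
            A.X (dimP D) ⊗[ℤ] B.X (dimQ E)) =
            vec a (dimP D) D ⊗ₜ[ℤ] vec b (dimQ E) E := by
          rw [vec, dif_pos rfl, vec, dif_pos rfl]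
        rw [h1]
        -- Again the degree of the second factor has to become a literal successor before
        -- `tensorDRight` unfolds.
        have h2 : ∀ (q' : ℕ) (h : dimP D + q' = k + 1), q' = q + 1 →
            tensorDRight A B k (dimP D) q' h (vec a (dimP D) D ⊗ₜ[ℤ] vec b q' E) =
              ∑ F, ((-1) ^ dimP D * t E F) • tensorι A B (show dimP D + q = k by omega)
                (vec a (dimP D) D ⊗ₜ[ℤ] vec b q F) := by
          rintro _ h rfl
          have h3 : tensorDRight A B k (dimP D) (q + 1) h
              (vec a (dimP D) D ⊗ₜ[ℤ] vec b (q + 1) E) =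
              (-1 : ℤ) ^ dimP D • tensorι A B (show dimP D + q = k by omega)
                (vec a (dimP D) D ⊗ₜ[ℤ] B.d q (vec b (q + 1) E)) := by
            have h4 : ∀ (p : ℕ) (h : p + (q + 1) = k + 1) (x : A.X p) (y : B.X (q + 1)),
                tensorDRight A B k p (q + 1) h (x ⊗ₜ[ℤ] y) = (-1 : ℤ) ^ p •
                  tensorι A B (show p + q = k by omega) (x ⊗ₜ[ℤ] B.d q y) := by
              intro p h x y
              rcases p with _ | p <;> rfl
            exact h4 _ h _ _
          rw [h3, vec, vec, dif_pos hq, hb1, sum_smul_vec b q (fun F => t E F),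
            TensorProduct.tmul_sum, map_sum, Finset.smul_sum]
          refine Finset.sum_congr rfl fun F _ => ?_
          rw [← smul_smul]
          exact congrArg _ (map_zsmul (tensorι A B (show dimP D + q = k by omega) ∘ₗ
            TensorProduct.mk ℤ (A.X (dimP D)) (B.X q) (vec a (dimP D) D)) (t E F) (vec b q F))
        rw [h2 _ hDE hq]
        refine Finset.sum_congr rfl fun F _ => ?_
        rw [tensorι_vec]
        split_ifs with hF
        · rfl
        · refine congrArg _ (Eq.symm (vec_of_ne _ ?_))
          dsimp only
          intro h
          exact hF ⟨rfl, by omega⟩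
  · rintro ⟨⟨D, E⟩, hDE⟩
    dsimp only at hDE
    have hD : dimP D = 0 := by omega
    have hE : dimQ E = 0 := by omega
    have h0 := tensorBasis_apply a b (rfl : 0 + 0 = 0) ⟨D, hD⟩ ⟨E, hE⟩
    dsimp only at h0
    rw [h0, tensor_ε_tmul, ha2, hb2]
  · intro k
    ext z
    constructor
    · rintro ⟨p, q, h, x, hx, y, hy, rfl⟩
      rw [ha3] at hx
      rw [hb3] at hy
      obtain ⟨D, hD⟩ := hx
      obtain ⟨E, hE⟩ := hy
      refine ⟨⟨(D, E), (congrArg₂ (· + ·) D.2 E.2).trans h⟩, ?_⟩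
      rw [tensorBasis_apply a b h D E]
      rcases hD with rfl | rfl <;> rcases hE with rfl | rfl
      · left; rfl
      · right; rw [TensorProduct.tmul_neg, map_neg]; rfl
      · right; rw [TensorProduct.neg_tmul, map_neg]; rfl
      · left; rw [TensorProduct.tmul_neg, TensorProduct.neg_tmul, neg_neg]
    · rintro ⟨⟨⟨D, E⟩, hDE⟩, hz⟩
      have h0 := tensorBasis_apply a b hDE ⟨D, rfl⟩ ⟨E, rfl⟩
      dsimp only at h0
      rw [h0] at hz
      rcases hz with rfl | rfl
      · exact ⟨_, _, hDE, _, by rw [ha3]; exact ⟨_, Or.inl rfl⟩, _,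
          by rw [hb3]; exact ⟨_, Or.inl rfl⟩, rfl⟩
      · refine ⟨_, _, hDE, _, by rw [ha3]; exact ⟨⟨D, rfl⟩, Or.inr rfl⟩, _,
          by rw [hb3]; exact ⟨⟨E, rfl⟩, Or.inl rfl⟩, ?_⟩
        rw [TensorProduct.neg_tmul, map_neg]
        rfl

theorem Models.congr {A : BasedSeq.{u}} {P Q : Type} [Fintype P] [Fintype Q] {dim : P → ℕ}
    {s : P → P → ℤ} {ε : P → ℤ} (e : Q ≃ P) (hA : A.Models dim s ε) :
    A.Models (fun D => dim (e D)) (fun D E => s (e D) (e E)) (fun D => ε (e D)) := by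
  obtain ⟨b, h1, h2, h3⟩ := hA
  let f : ∀ k, {D : P // dim D = k} ≃ {D : Q // dim (e D) = k} := fun k =>
    (e.subtypeEquiv fun _ => Iff.rfl).symm
  have hf : ∀ k D, ((f k).symm D : P) = e D := fun k D => rfl
  refine ⟨fun k => (b k).reindex (f k), fun k D => ?_, fun D => ?_, fun k => ?_⟩
  · rw [Module.Basis.reindex_apply, h1, ← (f k).symm.sum_comp]
    simp only [Module.Basis.reindex_apply, hf]
  · rw [Module.Basis.reindex_apply, h2, hf]
  · rw [h3]
    ext x
    simp only [Module.Basis.reindex_apply]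
    constructor
    · rintro ⟨D, h⟩
      exact ⟨f k D, by simpa using h⟩
    · rintro ⟨D, h⟩
      exact ⟨(f k).symm D, h⟩

/-- In positive degrees the group is zero and so has no element with value `±1`; the set of
generators is empty there, as is the index set. -/
theorem unit_models {P : Type} [Fintype P] [Unique P] :
    unit.Models (fun _ : P => 0) (fun _ _ => 0) (fun _ => 1) := by
  let e : ℤ ≃ₗ[ℤ] unit.X 0 :=
    { toFun := fun n => ⟨n, by simp⟩
      invFun := fun n => n.1
      map_add' := fun _ _ => rfl
      map_smul' := fun _ _ => rfl
      left_inv := fun _ => rfl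
      right_inv := fun _ => rfl }
  have hsub : ∀ k, Subsingleton (unit.X (k + 1)) := by
    intro k
    refine ⟨fun x y => Subtype.ext ?_⟩
    have hx := x.2
    have hy := y.2
    simp only [Nat.add_eq_zero_iff, one_ne_zero, and_false, if_false, AddSubgroup.mem_bot] at hx hy
    exact hx.trans hy.symm
  have hemp : ∀ k, IsEmpty {D : P // 0 = k + 1} := fun k => ⟨fun D => by have := D.2; omega⟩
  let b : ∀ k, Module.Basis {D : P // 0 = k} ℤ (unit.X k) := fun k =>
    match k with
    | 0 => ((Module.Basis.singleton P ℤ).map e).reindex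
        ((Equiv.subtypeUnivEquiv (p := fun _ : P => 0 = 0) fun _ => rfl).symm)
    | k + 1 => haveI := hsub k; haveI := hemp k; Module.Basis.empty _
  have hb0 : ∀ D, b 0 D = e 1 := fun D => by simp [b]
  refine ⟨b, fun k D => (hemp k).elim D, fun D => ?_, fun k => ?_⟩
  · rw [hb0]; rfl
  · rcases k with _ | k
    · ext x
      simp only [Set.mem_ofPred_eq, hb0]
      constructor
      · rintro (h | h)
        · exact ⟨⟨default, rfl⟩, Or.inl (Subtype.ext h)⟩
        · exact ⟨⟨default, rfl⟩, Or.inr (Subtype.ext h)⟩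
      · rintro ⟨-, rfl | rfl⟩
        · exact Or.inl rfl
        · exact Or.inr rfl
    · ext x
      have hx0 : x.1 = 0 := congrArg Subtype.val ((hsub k).elim x 0)
      constructor
      · rintro (h | h) <;> rw [hx0] at h <;> norm_num at h
      · rintro ⟨D, -⟩
        exact (hemp k).elim D


end BasedSeq

/-! ### Products of graded posets -/

/-- The covering relation of a product. -/
def prodCov {P Q : Type} (cP : P → P → Prop) (cQ : Q → Q → Prop) (D E : P × Q) : Prop :=
  (cP D.1 E.1 ∧ D.2 = E.2) ∨ (D.1 = E.1 ∧ cQ D.2 E.2)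

/-- In the square of the boundary the terms that stay in one factor cancel by hypothesis. The mixed
terms occur twice, with signs `(-1) ^ dim` before and after a step in the first factor, and this
step lowers the dimension by one. -/
theorem isIncidence_prod {P Q : Type} [Fintype P] [Fintype Q] {dimP : P → ℕ} {dimQ : Q → ℕ}
    {cP : P → P → Prop} {cQ : Q → Q → Prop} {s : P → P → ℤ} {t : Q → Q → ℤ} {ε : P → ℤ} {η : Q → ℤ}
    (hP : ∀ {D E}, cP D E → dimP D = dimP E + 1) (hQ : ∀ {D E}, cQ D E → dimQ D = dimQ E + 1)
    (hs : IsIncidence dimP cP s ε) (ht : IsIncidence dimQ cQ t η) :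
    IsIncidence (fun D : P × Q => dimP D.1 + dimQ D.2) (prodCov cP cQ) (prodInc dimP s t)
      (fun D => ε D.1 * η D.2) := by
  have hP' : ∀ D, s D D = 0 := fun D => hs.zero fun h => by have := hP h; omega
  have hQ' : ∀ D, t D D = 0 := fun D => ht.zero fun h => by have := hQ h; omega
  refine ⟨?_, ?_, ?_, ?_, ?_⟩
  · rintro ⟨D, D'⟩ ⟨E, E'⟩ (⟨h, rfl : D' = E'⟩ | ⟨rfl : D = E, h⟩)
    · simpa [prodInc, hQ'] using hs.unit h
    · rcases neg_one_pow_eq_or ℤ (dimP D) with h1 | h1 <;> rcases ht.unit h with h2 | h2 <;>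
        dsimp only at h2 <;> simp [prodInc, hP', h1, h2]
  · rintro ⟨D, D'⟩ ⟨E, E'⟩ h
    simp only [prodCov, not_or, not_and] at h
    simp only [prodInc]
    rw [ite_eq_right_iff.2 fun h' => hs.zero fun h'' => h.1 h'' h',
      ite_eq_right_iff.2 fun h' => ht.zero (h.2 h')]
    simp
  · rintro ⟨D, D'⟩ ⟨G, G'⟩
    have h1 := sum_prodInc dimP s t (D, D') (fun E => prodInc dimP s t E (G, G'))
    simp only [smul_eq_mul] at h1
    rw [h1]
    simp only [prodInc, mul_add, Finset.sum_add_distrib]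
    have e1 : ∑ x, s D x * (if D' = G' then s x G else 0) = 0 := by
      split_ifs
      · exact hs.sq D G
      · simp
    have e2 : ∑ x, (-1) ^ dimP D * t D' x * ((-1) ^ dimP D * if D = G then t x G' else 0) = 0 := by
      split_ifs
      · have : ∀ x, (-1) ^ dimP D * t D' x * ((-1) ^ dimP D * t x G') =
            (-1) ^ dimP D * (-1) ^ dimP D * (t D' x * t x G') := fun x => by ring
        simp only [this, ← Finset.mul_sum, ht.sq, mul_zero]
      · simp
    have e3 : ∑ x, s D x * ((-1) ^ dimP x * if x = G then t D' G' else 0) =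
        s D G * (-1) ^ dimP G * t D' G' := by
      rw [Fintype.sum_eq_single G (fun x hx => by simp [hx])]
      simp [mul_assoc]
    have e4 : ∑ x, (-1) ^ dimP D * t D' x * (if x = G' then s D G else 0) =
        (-1) ^ dimP D * t D' G' * s D G := by
      rw [Fintype.sum_eq_single G' (fun x hx => by simp [hx])]
      simp
    rw [e1, e2, e3, e4]
    by_cases h : cP D G
    · rw [hP h]; ring
    · rw [hs.zero h]; ring
  · rintro ⟨D, D'⟩ h
    dsimp only at h
    have h1 := sum_prodInc dimP s t (D, D') (fun E => ε E.1 * η E.2)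
    simp only [smul_eq_mul] at h1
    rw [h1]
    have e1 : ∀ x, s D x * (ε x * η D') = s D x * ε x * η D' := fun x => by ring
    have e2 : ∀ x, (-1) ^ dimP D * t D' x * (ε D * η x) =
      (-1) ^ dimP D * ε D * (t D' x * η x) := fun x => by ring
    simp only [e1, e2, ← Finset.sum_mul, ← Finset.mul_sum]
    rcases (by omega : (dimP D = 1 ∧ dimQ D' = 0) ∨ (dimP D = 0 ∧ dimQ D' = 1)) with ⟨h2, h3⟩ | ⟨h2, h3⟩
    · have : ∀ x, t D' x = 0 := fun x => ht.zero fun h => by have := hQ h; omega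
      simp [hs.aug D h2, this]
    · have : ∀ x, s D x = 0 := fun x => hs.zero fun h => by have := hP h; omega
      simp [ht.aug D' h3, this]
  · rintro ⟨D, D'⟩ h
    dsimp only at h
    rcases hs.aug_unit D (by omega) with h1 | h1 <;>
      rcases ht.aug_unit D' (by omega) with h2 | h2 <;> simp [h1, h2]

theorem IsIncidence.congr {P Q : Type} [Fintype P] [Fintype Q] {dim : P → ℕ}
    {cov : P → P → Prop} {s : P → P → ℤ} {ε : P → ℤ} (e : Q ≃ P)
    (hI : IsIncidence dim cov s ε) :
    IsIncidence (fun D => dim (e D)) (fun D E => cov (e D) (e E)) (fun D E => s (e D) (e E))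
      (fun D => ε (e D)) where
  unit h := hI.unit h
  zero h := hI.zero h
  sq D G := by
    rw [← hI.sq (e D) (e G), ← e.sum_comp]
  aug D h := by
    rw [← hI.aug (e D) h, ← e.sum_comp]
  aug_unit D h := hI.aug_unit _ h

/-- The covering relation of a finite product. -/
def piCov {r : ℕ} {P : Fin r → Type} (cov : ∀ i, P i → P i → Prop) (D E : ∀ i, P i) : Prop :=
  ∃ i F, cov i (D i) F ∧ E = Function.update D i F

/-- The dimension function of a finite product. -/
def piDim {r : ℕ} {P : Fin r → Type} (dim : ∀ i, P i → ℕ) (D : ∀ i, P i) : ℕ := ∑ i, dim i (D i)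

theorem piDim_update {r : ℕ} {P : Fin r → Type} (dim : ∀ i, P i → ℕ) (D : ∀ i, P i) (i : Fin r)
    (F : P i) : piDim dim (Function.update D i F) + dim i (D i) = piDim dim D + dim i F := by
  have h1 := Fintype.sum_eq_add_sum_compl i fun j => dim j (D j)
  have h2 := Fintype.sum_eq_add_sum_compl i fun j => dim j (Function.update D i F j)
  have h3 : ∑ j ∈ {i}ᶜ, dim j (Function.update D i F j) = ∑ j ∈ {i}ᶜ, dim j (D j) := by
    refine Finset.sum_congr rfl fun j hj => ?_
    rw [Function.update_of_ne (by simpa using hj)]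
  rw [Function.update_self] at h2
  simp only [piDim]
  omega

/-- This reduces statements on finite products to products of two factors, by induction on `r`. -/
theorem piCov_cons {r : ℕ} {P : Fin (r + 1) → Type} (cov : ∀ i, P i → P i → Prop)
    (D E : ∀ i, P i) :
    piCov cov D E ↔ prodCov (cov 0) (piCov fun i => cov i.succ) ((Fin.consEquiv P).symm D)
      ((Fin.consEquiv P).symm E) := by
  constructor
  · rintro ⟨i, F, h, rfl⟩
    refine Fin.cases ?_ ?_ i F h
    · rintro F h
      left
      refine ⟨by simpa [Fin.consEquiv] using h, ?_⟩
      funext j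
      simp [Fin.consEquiv, Fin.tail]
    · rintro i F h
      right
      refine ⟨?_, i, F, h, ?_⟩
      · simp [Fin.consEquiv, Function.update_of_ne (Fin.succ_ne_zero i).symm]
      · exact Fin.tail_update_succ _ _ _
  · rintro (⟨h, h'⟩ | ⟨h, i, F, h', h''⟩)
    · refine ⟨0, E 0, h, ?_⟩
      funext j
      refine Fin.cases ?_ (fun j => ?_) j
      · simp
      · rw [Function.update_of_ne (Fin.succ_ne_zero j)]
        exact (congrFun h' j).symm
    · refine ⟨i.succ, F, h', ?_⟩
      funext j
      refine Fin.cases ?_ (fun j => ?_) j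
      · rw [Function.update_of_ne (Fin.succ_ne_zero i).symm]
        exact h.symm
      · have := congrFun h'' j
        refine this.trans ?_
        exact congrFun (Fin.tail_update_succ D i F).symm j

-- The incidence function of the product is left unspecified: only its existence matters, since any
-- two of them are equivalent up to signs of the faces.
open BasedSeq in
theorem BasedSeq.exists_tensorFin_models (r : ℕ) (A : Fin r → BasedSeq.{0}) (P : Fin r → Type)
    [∀ i, Fintype (P i)] (dim : ∀ i, P i → ℕ) (cov : ∀ i, P i → P i → Prop)
    (hcov : ∀ i {D E}, cov i D E → dim i D = dim i E + 1)
    (h : ∀ i, ∃ s ε, (A i).Models (dim i) s ε ∧ IsIncidence (dim i) (cov i) s ε) :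
    ∃ s ε, (tensorFin r A).Models (piDim dim) s ε ∧
      IsIncidence (piDim dim) (piCov cov) s ε := by
  induction r with
  | zero =>
    refine ⟨fun _ _ => 0, fun _ => 1, unit_models, ⟨?_, fun _ => rfl, ?_, ?_, ?_⟩⟩
    · rintro D E ⟨i, -⟩
      exact i.elim0
    · simp
    · intro D hD
      simp [piDim] at hD
    · simp
  | succ r ih =>
    obtain ⟨s, ε, h1, h2⟩ := h 0
    obtain ⟨t, η, h3, h4⟩ := ih (fun i => A i.succ) (fun i => P i.succ) (fun i => dim i.succ)
      (fun i => cov i.succ) (fun i => hcov i.succ) (fun i => h i.succ)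
    have hdim : piDim dim = fun D => dim 0 ((Fin.consEquiv P).symm D).1 +
        piDim (fun i => dim i.succ) ((Fin.consEquiv P).symm D).2 := by
      funext D
      exact Fin.sum_univ_succ _
    have hc : piCov cov = fun D E => prodCov (cov 0) (piCov fun i => cov i.succ)
        ((Fin.consEquiv P).symm D) ((Fin.consEquiv P).symm E) := by
      funext D E
      exact propext (piCov_cons cov D E)
    rw [hdim, hc]
    refine ⟨_, _, (h1.tensor h3).congr (Fin.consEquiv P).symm,
      (isIncidence_prod (hcov 0 ·) ?_ h2 h4).congr (Fin.consEquiv P).symm⟩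
    rintro D E ⟨i, F, h, rfl⟩
    have := piDim_update (fun i => dim i.succ) D i F
    have := hcov _ h
    omega

/-! ### Products of thin posets and of matchings -/

/-- A chain of two covers in one factor has the diamond of that factor; if the two covers are in
different factors, the diamond is a square of the product. Connectivity rests on the fact that
facets in different directions always share a facet. -/
theorem isThin_prod {P Q : Type} {dimP : P → ℕ} {dimQ : Q → ℕ} {cP : P → P → Prop}
    {cQ : Q → Q → Prop} (hP : IsThin dimP cP) (hQ : IsThin dimQ cQ) :
    IsThin (fun D : P × Q => dimP D.1 + dimQ D.2) (prodCov cP cQ) := by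
  have nP : ∀ {D E}, cP D E → D ≠ E := by
    rintro D E h rfl
    have := hP.dim_eq h
    omega
  have nQ : ∀ {D E}, cQ D E → D ≠ E := by
    rintro D E h rfl
    have := hQ.dim_eq h
    omega
  refine ⟨?_, ?_, ?_, ?_, ?_⟩
  · rintro ⟨D, D'⟩ ⟨E, E'⟩ (⟨h, hh⟩ | ⟨hh, h⟩) <;> dsimp only at h hh <;> subst hh
    · have := hP.dim_eq h
      dsimp only at this ⊢
      omega
    · have := hQ.dim_eq h
      dsimp only at this ⊢
      omega
  · rintro ⟨D, D'⟩ ⟨E, E'⟩ ⟨G, G'⟩ (⟨h, hh⟩ | ⟨hh, h⟩) (⟨k, hk⟩ | ⟨hk, k⟩) <;>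
      dsimp only at h hh k hk <;> subst hh hk
    · obtain ⟨A, h1, h2, h3, h4⟩ := hP.diamond h k
      refine ⟨(A, D'), by simpa using h1, Or.inl ⟨h2, rfl⟩, Or.inl ⟨h3, rfl⟩, ?_⟩
      rintro ⟨B, B'⟩ (⟨k1, e1⟩ | ⟨e1, k1⟩) (⟨k2, e2⟩ | ⟨e2, k2⟩) <;> dsimp only at k1 e1 k2 e2
      · rw [← e1]
        simpa using h4 B k1 k2
      · exact absurd e1 (nQ k2).symm
      · exact absurd e2.symm (nQ k1)
      · have h5 := hP.dim_eq h
        have h6 := hP.dim_eq k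
        rw [e1, e2] at h5
        omega
    · refine ⟨(D, G'), ?_, Or.inr ⟨rfl, k⟩, Or.inl ⟨h, rfl⟩, ?_⟩
      · simp only [ne_eq, Prod.mk.injEq, not_and]
        intro h'
        exact absurd h' (nP h)
      rintro ⟨B, B'⟩ (⟨k1, e1⟩ | ⟨e1, k1⟩) (⟨k2, e2⟩ | ⟨e2, k2⟩) <;> dsimp only at k1 e1 k2 e2
      · exact absurd (e1.trans e2) (nQ k)
      · left; rw [e2, e1]
      · right; rw [e1, e2]
      · exact absurd (e1.trans e2) (nP h)
    · refine ⟨(G, D'), ?_, Or.inl ⟨k, rfl⟩, Or.inr ⟨rfl, h⟩, ?_⟩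
      · simp only [ne_eq, Prod.mk.injEq, not_and]
        intro h'
        exact absurd h'.symm (nP k)
      rintro ⟨B, B'⟩ (⟨k1, e1⟩ | ⟨e1, k1⟩) (⟨k2, e2⟩ | ⟨e2, k2⟩) <;> dsimp only at k1 e1 k2 e2
      · exact absurd (e1.trans e2) (nQ h)
      · right; rw [e2, e1]
      · left; rw [e1, e2]
      · exact absurd (e1.trans e2) (nP k)
    · obtain ⟨A, h1, h2, h3, h4⟩ := hQ.diamond h k
      refine ⟨(D, A), by simpa using h1, Or.inr ⟨rfl, h2⟩, Or.inr ⟨rfl, h3⟩, ?_⟩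
      rintro ⟨B, B'⟩ (⟨k1, e1⟩ | ⟨e1, k1⟩) (⟨k2, e2⟩ | ⟨e2, k2⟩) <;> dsimp only at k1 e1 k2 e2
      · have h5 := hQ.dim_eq h
        have h6 := hQ.dim_eq k
        rw [e1, e2] at h5
        omega
      · exact absurd e2.symm (nP k1)
      · exact absurd e1 (nP k2).symm
      · rw [← e1]
        simpa using h4 B' k1 k2
  · rintro ⟨D, D'⟩ h
    dsimp only at h
    rcases (by omega : (dimP D = 1 ∧ dimQ D' = 0) ∨ (dimP D = 0 ∧ dimQ D' = 1)) with ⟨h2, h3⟩ | ⟨h2, h3⟩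
    · obtain ⟨A, B, h4, h5, h6, h7⟩ := hP.edge h2
      refine ⟨(A, D'), (B, D'), by simpa using h4, Or.inl ⟨h5, rfl⟩, Or.inl ⟨h6, rfl⟩, ?_⟩
      rintro ⟨C, C'⟩ (⟨k1, e1⟩ | ⟨e1, k1⟩) <;> dsimp only at k1 e1 <;> subst e1
      · simpa using h7 C k1
      · have := hQ.dim_eq k1
        omega
    · obtain ⟨A, B, h4, h5, h6, h7⟩ := hQ.edge h3
      refine ⟨(D, A), (D, B), by simpa using h4, Or.inr ⟨rfl, h5⟩, Or.inr ⟨rfl, h6⟩, ?_⟩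
      rintro ⟨C, C'⟩ (⟨k1, e1⟩ | ⟨e1, k1⟩) <;> dsimp only at k1 e1 <;> subst e1
      · have := hP.dim_eq k1
        omega
      · simpa using h7 C' k1
  · rintro ⟨D, D'⟩ ⟨E, E'⟩ ⟨F, F'⟩ hd h k
    dsimp only at hd
    -- Facets of `(D, D')` in the two directions are adjacent through `(A, A')`.
    have mixed : ∀ {A A'}, cP D A → cQ D' A' → prodCov cP cQ (D, D') (A, D') ∧
        prodCov cP cQ (D, D') (D, A') ∧ ∃ G, prodCov cP cQ (A, D') G ∧ prodCov cP cQ (D, A') G :=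
      fun {A A'} h h' => ⟨Or.inl ⟨h, rfl⟩, Or.inr ⟨rfl, h'⟩, (A, A'), Or.inr ⟨rfl, h'⟩,
        Or.inl ⟨h, rfl⟩⟩
    rcases h with ⟨h, hh⟩ | ⟨hh, h⟩ <;> rcases k with ⟨k, hk⟩ | ⟨hk, k⟩ <;>
      dsimp only at h k hh hk <;> subst hh hk
    · by_cases h2 : 2 ≤ dimP D
      · have := hP.conn h2 h k
        clear h k
        induction this with
        | rel A B h =>
          obtain ⟨h1, h2, G, h3, h4⟩ := h
          exact .rel _ _ ⟨Or.inl ⟨h1, rfl⟩, Or.inl ⟨h2, rfl⟩, (G, D'), Or.inl ⟨h3, rfl⟩,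
            Or.inl ⟨h4, rfl⟩⟩
        | refl A => exact .refl _
        | symm A B _ ih => exact .symm _ _ ih
        | trans A B C _ _ ih1 ih2 => exact .trans _ _ _ ih1 ih2
      -- If `D` is only one-dimensional, its two ends are joined by a detour through a facet in the
      -- other direction, which exists as the total dimension is at least two.
      · obtain ⟨A', hA'⟩ := hQ.facet (D := D') (by have := hP.dim_eq h; omega)
        exact .trans _ (D, A') _ (.rel _ _ (mixed h hA')) (.symm _ _ (.rel _ _ (mixed k hA')))
    · exact .rel _ _ (mixed h k)
    · exact .symm _ _ (.rel _ _ (mixed k h))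
    · by_cases h2 : 2 ≤ dimQ D'
      · have := hQ.conn h2 h k
        clear h k
        induction this with
        | rel A B h =>
          obtain ⟨h1, h2, G, h3, h4⟩ := h
          exact .rel _ _ ⟨Or.inr ⟨rfl, h1⟩, Or.inr ⟨rfl, h2⟩, (D, G), Or.inr ⟨rfl, h3⟩,
            Or.inr ⟨rfl, h4⟩⟩
        | refl A => exact .refl _
        | symm A B _ ih => exact .symm _ _ ih
        | trans A B C _ _ ih1 ih2 => exact .trans _ _ _ ih1 ih2
      · obtain ⟨A, hA⟩ := hP.facet (D := D) (by have := hQ.dim_eq h; omega)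
        exact .trans _ (A, D') _ (.symm _ _ (.rel _ _ (mixed hA h))) (.rel _ _ (mixed hA k))
  · rintro ⟨D, D'⟩ h
    dsimp only at h
    by_cases h1 : dimP D = 0
    · obtain ⟨E, hE⟩ := hQ.facet (D := D') (by omega)
      exact ⟨(D, E), Or.inr ⟨rfl, hE⟩⟩
    · obtain ⟨E, hE⟩ := hP.facet h1
      exact ⟨(E, D'), Or.inl ⟨hE, rfl⟩⟩

theorem IsThin.congr {P Q : Type} {dim : P → ℕ} {cov : P → P → Prop} (e : Q ≃ P)
    (hT : IsThin dim cov) : IsThin (fun D => dim (e D)) (fun D E => cov (e D) (e E)) where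
  dim_eq h := hT.dim_eq h
  diamond h k := by
    obtain ⟨A, h1, h2, h3, h4⟩ := hT.diamond h k
    refine ⟨e.symm A, ?_, by simpa using h2, by simpa using h3, fun B hB hB' => ?_⟩
    · rw [Ne, Equiv.symm_apply_eq]; exact h1
    · rw [Equiv.eq_symm_apply, ← e.injective.eq_iff]
      exact h4 _ hB hB'
  edge h := by
    obtain ⟨A, B, h4, h5, h6, h7⟩ := hT.edge h
    refine ⟨e.symm A, e.symm B, by simpa using h4, by simpa using h5, by simpa using h6,
      fun C hC => ?_⟩
    rw [Equiv.eq_symm_apply, Equiv.eq_symm_apply]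
    exact h7 _ hC
  conn {D E E'} h h1 h2 := by
    have key : ∀ A B, Relation.EqvGen (fun A B => cov (e D) A ∧ cov (e D) B ∧
        ∃ G, cov A G ∧ cov B G) A B → Relation.EqvGen (fun A B => cov (e D) (e A) ∧
        cov (e D) (e B) ∧ ∃ G, cov (e A) (e G) ∧ cov (e B) (e G)) (e.symm A) (e.symm B) := by
      intro A B hAB
      induction hAB with
      | rel A B h =>
        obtain ⟨h1, h2, G, h3, h4⟩ := h
        exact .rel _ _ ⟨by simpa using h1, by simpa using h2, e.symm G, by simpa using h3,
          by simpa using h4⟩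
      | refl A => exact .refl _
      | symm A B _ ih => exact .symm _ _ ih
      | trans A B C _ _ ih1 ih2 => exact .trans _ _ _ ih1 ih2
    simpa using key _ _ (hT.conn h h1 h2)
  facet h := by
    obtain ⟨A, hA⟩ := hT.facet h
    exact ⟨e.symm A, by simpa using hA⟩

theorem isThin_pi (r : ℕ) (P : Fin r → Type) (dim : ∀ i, P i → ℕ) (cov : ∀ i, P i → P i → Prop)
    (h : ∀ i, IsThin (dim i) (cov i)) : IsThin (piDim dim) (piCov cov) := by
  induction r with
  | zero =>
    have hc : ∀ D E, ¬ piCov cov D E := by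
      rintro D E ⟨i, -⟩
      exact i.elim0
    have hd : ∀ D, piDim dim D = 0 := fun D => by simp [piDim]
    exact ⟨fun h => absurd h (hc _ _), fun h => absurd h (hc _ _),
      fun {D} h => by rw [hd] at h; norm_num at h, fun _ h => absurd h (hc _ _),
      fun {D} h => absurd (hd D) h⟩
  | succ r ih =>
    have hdim : piDim dim = fun D => dim 0 ((Fin.consEquiv P).symm D).1 +
        piDim (fun i => dim i.succ) ((Fin.consEquiv P).symm D).2 := by
      funext D
      exact Fin.sum_univ_succ _
    have hc : piCov cov = fun D E => prodCov (cov 0) (piCov fun i => cov i.succ)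
        ((Fin.consEquiv P).symm D) ((Fin.consEquiv P).symm E) := by
      funext D E
      exact propext (piCov_cons cov D E)
    rw [hdim, hc]
    exact (isThin_prod (h 0) (ih _ _ _ fun i => h i.succ)).congr (Fin.consEquiv P).symm

/-- Faces are matched in the first component, except over its unmatched face `W`, where the second
component is used. -/
theorem exists_isMatching_prod {P Q : Type} [Fintype P] {dimP : P → ℕ} {dimQ : Q → ℕ}
    {cP : P → P → Prop} {cQ : Q → Q → Prop} (hP : IsThin dimP cP)
    (hMP : ∃ W ρ U μ, IsMatching dimP cP W ρ U μ) (hMQ : ∃ W ρ U μ, IsMatching dimQ cQ W ρ U μ) :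
    ∃ W ρ U μ, IsMatching (fun D : P × Q => dimP D.1 + dimQ D.2) (prodCov cP cQ) W ρ U μ := by
  obtain ⟨W, ρ, U, μ, h⟩ := hMP
  obtain ⟨W', ρ', U', μ', h'⟩ := hMQ
  have hW : ∀ {E}, ¬ cP W E := fun {E} hE => by
    have := hP.dim_eq hE
    have := h.dim_top
    omega
  have hN : ∀ D, ρ D < Finset.univ.sup ρ + 1 := fun D =>
    Nat.lt_succ_of_le (Finset.le_sup (Finset.mem_univ D))
  generalize Finset.univ.sup ρ + 1 = N at hN
  -- The levels over `W` lie above all levels of the first factor, because the boundary may lead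
  -- into `W` but not out of it.
  refine ⟨(W, W'), fun D => if D.1 = W then N + ρ' D.2 else ρ D.1,
    fun D => if D.1 = W then U' D.2 else U D.1,
    fun D => if D.1 = W then (W, μ' D.2) else (μ D.1, D.2), ?_, ?_, ?_, ?_, ?_, ?_⟩
  · simp [h.dim_top, h'.dim_top]
  · rintro ⟨D, D'⟩ ⟨E, E'⟩ (⟨k, hk⟩ | ⟨hk, k⟩) <;> dsimp only at k hk ⊢ <;> subst hk
    · rw [if_neg (fun hD => hW (hD ▸ k))]
      split_ifs
      · have := hN D; omega
      · exact h.mono k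
    · split_ifs
      · have := h'.mono k; omega
      · exact le_rfl
  · rintro ⟨D, D'⟩ hU
    dsimp only at hU ⊢
    by_cases hD : D = W
    · rw [if_pos hD] at hU
      obtain ⟨h1, h2, h3, h4⟩ := h'.up hU
      subst hD
      simp only [if_true]
      exact ⟨Or.inr ⟨rfl, h1⟩, h2, by rw [h3], by simpa using h4⟩
    · rw [if_neg hD] at hU
      obtain ⟨h1, h2, h3, h4⟩ := h.up hU
      simp only [hD, if_false, h4]
      exact ⟨Or.inl ⟨h1, rfl⟩, h2, h3, by simp [h4]⟩
  · rintro ⟨D, D'⟩ ⟨E, E'⟩ hU hV hDE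
    dsimp only at hU hV hDE
    by_cases hD : D = W <;> by_cases hE : E = W
    · rw [if_pos hD] at hU hDE
      rw [if_pos hE] at hV hDE
      rw [hD, hE, h'.inj hU hV (Prod.mk.inj hDE).2]
    · rw [if_pos hD] at hU hDE
      rw [if_neg hE] at hV hDE
      exact absurd (Prod.mk.inj hDE).1.symm (h.up hV).2.2.2
    · rw [if_neg hD] at hU hDE
      rw [if_pos hE] at hV hDE
      exact absurd (Prod.mk.inj hDE).1 (h.up hU).2.2.2
    · rw [if_neg hD] at hU hDE
      rw [if_neg hE] at hV hDE
      rw [h.inj hU hV (Prod.mk.inj hDE).1, (Prod.mk.inj hDE).2]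
  · rintro ⟨D, D'⟩ hU hne
    dsimp only at hU
    by_cases hD : D = W
    · rw [if_pos hD] at hU
      subst hD
      obtain ⟨E, hE, rfl⟩ := h'.surj hU (by simpa using hne)
      exact ⟨(D, E), by simpa using hE, by simp⟩
    · rw [if_neg hD] at hU
      obtain ⟨E, hE, rfl⟩ := h.surj hU hD
      have hEW : E ≠ W := fun h1 => hW (h1 ▸ (h.up hE).1)
      exact ⟨(E, D'), by simpa [hEW] using hE, by simp [hEW]⟩
  · rintro ⟨D, D'⟩ ⟨E, E'⟩ (⟨k, hk⟩ | ⟨hk, k⟩) hρ hU hV hne <;>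
      dsimp only at k hk hρ hU hV ⊢ <;> subst hk
    · have hDW : D ≠ W := fun hD => hW (hD ▸ k)
      rw [if_neg hDW] at hρ hU ⊢
      by_cases hE : E = W
      · rw [if_pos hE] at hρ
        have := hN D
        omega
      · rw [if_neg hE] at hρ hV
        rw [h.key k hρ hU hV hE]
    · by_cases hD : D = W
      · simp only [hD, if_true] at hρ hU hV hne ⊢
        rw [h'.key k (by omega) hU hV (by simpa using hne)]
      · rw [if_neg hD] at hU hV
        exact absurd hU hV

theorem IsMatching.congr {P Q : Type} {dim : P → ℕ} {cov : P → P → Prop} {W : P} {ρ : P → ℕ}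
    {U : P → Prop} {μ : P → P} (e : Q ≃ P) (h : IsMatching dim cov W ρ U μ) :
    IsMatching (fun D => dim (e D)) (fun D E => cov (e D) (e E)) (e.symm W) (fun D => ρ (e D))
      (fun D => U (e D)) (fun D => e.symm (μ (e D))) where
  dim_top := by simpa using h.dim_top
  mono k := h.mono k
  up k := by
    have := h.up k
    simpa using this
  inj h1 h2 h3 := e.injective (h.inj h1 h2 (e.symm.injective h3))
  surj {D} h1 h2 := by
    obtain ⟨E, h3, h4⟩ := h.surj h1 (by rwa [Ne, ← Equiv.eq_symm_apply])
    exact ⟨e.symm E, by simpa using h3, by simp [h4]⟩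
  key h1 h2 h3 h4 h5 := by
    rw [Equiv.eq_symm_apply]
    exact h.key h1 h2 h3 h4 (by rwa [Ne, ← Equiv.eq_symm_apply])

theorem exists_isMatching_pi (r : ℕ) (P : Fin r → Type) [∀ i, Fintype (P i)] (dim : ∀ i, P i → ℕ)
    (cov : ∀ i, P i → P i → Prop) (hT : ∀ i, IsThin (dim i) (cov i))
    (h : ∀ i, ∃ W ρ U μ, IsMatching (dim i) (cov i) W ρ U μ) :
    ∃ W ρ U μ, IsMatching (piDim dim) (piCov cov) W ρ U μ := by
  induction r with
  | zero =>
    have hc : ∀ D E, ¬ piCov cov D E := by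
      rintro D E ⟨i, -⟩
      exact i.elim0
    exact ⟨fun i => i.elim0, fun _ => 0, fun _ => False, id, by simp [piDim], fun h => absurd h (hc _ _),
      fun h => h.elim, fun h => h.elim, fun _ h => absurd (Subsingleton.elim _ _) h,
      fun h => absurd h (hc _ _)⟩
  | succ r ih =>
    have hdim : piDim dim = fun D => dim 0 ((Fin.consEquiv P).symm D).1 +
        piDim (fun i => dim i.succ) ((Fin.consEquiv P).symm D).2 := by
      funext D
      exact Fin.sum_univ_succ _
    have hc : piCov cov = fun D E => prodCov (cov 0) (piCov fun i => cov i.succ)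
        ((Fin.consEquiv P).symm D) ((Fin.consEquiv P).symm E) := by
      funext D E
      exact propext (piCov_cons cov D E)
    rw [hdim, hc]
    obtain ⟨W, ρ, U, μ, hM⟩ := exists_isMatching_prod (hT 0) (h 0)
      (ih _ _ _ (fun i => hT i.succ) fun i => h i.succ)
    exact ⟨_, _, _, _, hM.congr (Fin.consEquiv P).symm⟩

/-! ### Dissections of polygons -/

namespace Associahedron

variable {m : ℕ}

/-- `E` is a facet of `D`: it has one more diagonal. -/
def Face.Cov (D E : Face m) : Prop := ∃ a ∉ D.diagonals, E.diagonals = insert a D.diagonals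

/-- The pair `(i, j)` is a diagonal of `D`. -/
def Face.Has (D : Face m) (i j : ℕ) : Prop := ∃ a ∈ D.diagonals, a.1.1.val = i ∧ a.1.2.val = j

/-- The pair `(i, j)` is a diagonal of `D` or a side of the polygon. -/
def Face.Seg (D : Face m) (i j : ℕ) : Prop := D.Has i j ∨ j = i + 1 ∨ (i = 0 ∧ j = m + 2)

theorem Diagonal.ext' {a b : Diagonal m} (h1 : a.1.1.val = b.1.1.val) (h2 : a.1.2.val = b.1.2.val) :
    a = b := Subtype.ext (Prod.ext (Fin.ext h1) (Fin.ext h2))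

theorem Diagonal.exists_mk {i j : ℕ} (h : i + 2 ≤ j) (hj : j ≤ m + 2) (h0 : ¬ (i = 0 ∧ j = m + 2)) :
    ∃ a : Diagonal m, a.1.1.val = i ∧ a.1.2.val = j :=
  ⟨⟨(⟨i, by omega⟩, ⟨j, by omega⟩), h, h0⟩, rfl, rfl⟩

theorem crosses_iff (a b : Diagonal m) : Crosses a b ↔
    (a.1.1.val < b.1.1.val ∧ b.1.1.val < a.1.2.val ∧ a.1.2.val < b.1.2.val) ∨
    (b.1.1.val < a.1.1.val ∧ a.1.1.val < b.1.2.val ∧ b.1.2.val < a.1.2.val) := Iff.rfl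

theorem Crosses.symm {a b : Diagonal m} (h : Crosses a b) : Crosses b a := Or.symm h

theorem not_crosses_self (a : Diagonal m) : ¬ Crosses a a := by
  rw [crosses_iff]; omega

theorem Diagonal.bounds (a : Diagonal m) : a.1.1.val + 2 ≤ a.1.2.val ∧ a.1.2.val ≤ m + 2 ∧
    ¬ (a.1.1.val = 0 ∧ a.1.2.val = m + 2) := ⟨a.2.1, by have := a.1.2.2; omega, a.2.2⟩

namespace Face

theorem has_iff {D : Face m} (a : Diagonal m) : D.Has a.1.1.val a.1.2.val ↔ a ∈ D.diagonals := by
  constructor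
  · rintro ⟨b, hb, h1, h2⟩
    rwa [← Diagonal.ext' h1 h2]
  · exact fun h => ⟨a, h, rfl, rfl⟩

theorem Has.bounds {D : Face m} {i j : ℕ} (h : D.Has i j) :
    i + 2 ≤ j ∧ j ≤ m + 2 ∧ ¬ (i = 0 ∧ j = m + 2) := by
  obtain ⟨a, -, rfl, rfl⟩ := h
  exact a.bounds

theorem Seg.not_cross {D : Face m} {i j k l : ℕ} (h : D.Seg i j) (h' : D.Seg k l)
    (hj : j ≤ m + 2) (hl : l ≤ m + 2) :
    ¬ (i < k ∧ k < j ∧ j < l) ∧ ¬ (k < i ∧ i < l ∧ l < j) := by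
  rcases h with ⟨a, ha, rfl, rfl⟩ | h | h
  · rcases h' with ⟨b, hb, rfl, rfl⟩ | h' | h'
    · have := D.noncrossing a ha b hb
      rw [crosses_iff, not_or] at this
      exact this
    · omega
    · omega
  · omega
  · omega

/-- The face obtained by adding a diagonal. -/
noncomputable def add (D : Face m) (a : Diagonal m) (h : ∀ b ∈ D.diagonals, ¬ Crosses a b) : Face m where
  diagonals := insert a D.diagonals
  noncrossing := by
    intro b hb c hc
    rcases Finset.mem_insert.1 hb with hb | hb <;> rcases Finset.mem_insert.1 hc with hc | hc
    · rw [hb, hc]; exact not_crosses_self _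
    · rw [hb]; exact h c hc
    · rw [hc]; exact fun h' => h b hb h'.symm
    · exact D.noncrossing b hb c hc

theorem cov_add {D : Face m} {a : Diagonal m} (h : ∀ b ∈ D.diagonals, ¬ Crosses a b)
    (ha : a ∉ D.diagonals) : D.Cov (D.add a h) := ⟨a, ha, rfl⟩

/-- Inside every segment `(i, j)` there is a vertex `k` that splits the diagonals. -/
theorem exists_split (D : Face m) {i j : ℕ} (hij : i + 2 ≤ j) :
    ∃ k, i < k ∧ k < j ∧ (D.Has i k ∨ k = i + 1) ∧
      ∀ y z, D.Has y z → i ≤ y → z ≤ j → (y = i ∧ z = j) ∨ z ≤ k ∨ k ≤ y := by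
  let p : ℕ → Prop := fun k => D.Has i k ∨ k = i + 1
  have hp : p (i + 1) := Or.inr rfl
  -- The split vertex is the farthest one before `j` that is joined to `i`; the neighbour `i + 1`
  -- always qualifies.
  set k := Nat.findGreatest p (j - 1) with hk
  have h1 : p k := Nat.findGreatest_spec (m := i + 1) (by omega) hp
  have h2 : k ≤ j - 1 := Nat.findGreatest_le _
  have h3 : i + 1 ≤ k := Nat.le_findGreatest (by omega) hp
  refine ⟨k, by omega, by omega, h1, fun y z hyz hy hz => ?_⟩
  by_contra hcon
  have hb := hyz.bounds
  have h4 : i < y := by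
    by_contra h
    have : y = i := by omega
    subst this
    have : z ≤ k := Nat.le_findGreatest (by omega) (Or.inl hyz)
    omega
  rcases h1 with h1 | h1
  · have := Seg.not_cross (Or.inl h1) (Or.inl hyz) h1.bounds.2.1 hyz.bounds.2.1
    omega
  · omega

/-- The diagonals of `D` between `i` and `j`. -/
noncomputable def within (D : Face m) (i j : ℕ) : Finset (Diagonal m) :=
  D.diagonals.filter fun a => i ≤ a.1.1.val ∧ a.1.2.val ≤ j

/-- The split vertex distributes the diagonals over two shorter segments, with lengths `k - i - 1`
and `j - k - 1` in place of `n`; the segment `(i, j)` itself accounts for the remaining one. -/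
theorem card_within_le (D : Face m) (n : ℕ) : ∀ i j, j = i + 1 + n → (D.within i j).card ≤ n := by
  induction n using Nat.strong_induction_on with
  | _ n ih =>
    intro i j hj
    rcases Nat.eq_zero_or_pos n with rfl | hn
    · rw [Nat.le_zero, Finset.card_eq_zero, within, Finset.filter_eq_empty_iff]
      intro a _
      have := a.bounds
      omega
    obtain ⟨k, h1, h2, h3, h4⟩ := D.exists_split (i := i) (j := j) (by omega)
    have h5 := ih (k - i - 1) (by omega) i k (by omega)
    have h6 := ih (j - k - 1) (by omega) k j (by omega)
    have h7 : D.within i j ⊆ (D.diagonals.filter fun a => a.1.1.val = i ∧ a.1.2.val = j) ∪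
        (D.within i k ∪ D.within k j) := by
      intro a ha
      simp only [within, Finset.mem_filter, Finset.mem_union] at ha ⊢
      have := h4 _ _ ((has_iff a).2 ha.1) ha.2.1 ha.2.2
      have := ha.1
      tauto
    have h8 : (D.diagonals.filter fun a => a.1.1.val = i ∧ a.1.2.val = j).card ≤ 1 := by
      rw [Finset.card_le_one]
      intro a ha b hb
      simp only [Finset.mem_filter] at ha hb
      exact Diagonal.ext' (by omega) (by omega)
    have := Finset.card_le_card h7
    have := Finset.card_union_le (D.diagonals.filter fun a => a.1.1.val = i ∧ a.1.2.val = j)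
      (D.within i k ∪ D.within k j)
    have := Finset.card_union_le (D.within i k) (D.within k j)
    omega

/-- The same count for the whole polygon, where the segment `(0, m + 2)` is a side and not a
diagonal, which saves one. -/
theorem card_le (D : Face m) : D.diagonals.card ≤ m := by
  obtain ⟨k, h1, h2, h3, h4⟩ := D.exists_split (i := 0) (j := m + 2) (by omega)
  have h5 := D.card_within_le (k - 1) 0 k (by omega)
  have h6 := D.card_within_le (m + 2 - k - 1) k (m + 2) (by omega)
  have h7 : D.diagonals ⊆ D.within 0 k ∪ D.within k (m + 2) := by
    intro a ha
    have hb := a.bounds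
    simp only [within, Finset.mem_filter, Finset.mem_union]
    have := h4 _ _ ((has_iff a).2 ha) (by omega) (by omega)
    rcases this with h | h | h
    · omega
    · exact Or.inl ⟨ha, by omega, h⟩
    · exact Or.inr ⟨ha, h, by omega⟩
  have := Finset.card_le_card h7
  have := Finset.card_union_le (D.within 0 k) (D.within k (m + 2))
  omega

/-- The face is a triangulation: every diagonal that crosses none of its diagonals belongs to it. -/
def IsMax (D : Face m) : Prop :=
  ∀ a : Diagonal m, (∀ b ∈ D.diagonals, ¬ Crosses a b) → a ∈ D.diagonals

theorem exists_cov_of_not_isMax {D : Face m} (h : ¬ D.IsMax) : ∃ E, D.Cov E := by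
  simp only [IsMax, not_forall] at h
  obtain ⟨a, h1, h2⟩ := h
  exact ⟨_, cov_add h1 h2⟩

/-- Every segment of a triangulation is the side of a triangle below it. -/
theorem IsMax.exists_apex {D : Face m} (hD : D.IsMax) {i j : ℕ} (h : D.Seg i j) (hij : i + 2 ≤ j)
    (hj : j ≤ m + 2) :
    ∃ k, i < k ∧ k < j ∧ (D.Has i k ∨ k = i + 1) ∧ (D.Has k j ∨ j = k + 1) := by
  obtain ⟨k, h1, h2, h3, h4⟩ := D.exists_split hij
  refine ⟨k, h1, h2, h3, ?_⟩
  by_cases hk : j = k + 1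
  · exact Or.inr hk
  left
  obtain ⟨a, rfl, rfl⟩ := Diagonal.exists_mk (m := m) (i := k) (j := j) (by omega) hj (by omega)
  rw [has_iff]
  -- The segment from the split vertex to `j` crosses no diagonal, so maximality puts it into the
  -- triangulation.
  refine hD a fun b hb => ?_
  rw [crosses_iff]
  have hb' := b.bounds
  have hbH := (has_iff b).2 hb
  have h5 := h4 _ _ hbH
  have h6 := h.not_cross (Or.inl hbH) hj (by omega)
  have h7 : D.Seg i a.1.1.val := h3.imp_right Or.inl
  have h8 := h7.not_cross (Or.inl hbH) (by omega) (by omega)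
  omega

theorem IsMax.le_card_within {D : Face m} (hD : D.IsMax) (n : ℕ) :
    ∀ i j, j = i + 1 + n → (D.Has i j ∨ j = i + 1) → n ≤ (D.within i j).card := by
  induction n using Nat.strong_induction_on with
  | _ n ih =>
    intro i j hj hS
    rcases Nat.eq_zero_or_pos n with rfl | hn
    · exact Nat.zero_le _
    have hS' : D.Has i j := hS.resolve_right (by omega)
    have hb := hS'.bounds
    obtain ⟨k, h1, h2, h3, h4⟩ := hD.exists_apex (Or.inl hS') (by omega) (by omega)
    have h5 := ih (k - i - 1) (by omega) i k (by omega) h3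
    have h6 := ih (j - k - 1) (by omega) k j (by omega) h4
    obtain ⟨a, ha, rfl, rfl⟩ := hS'
    have h7 : insert a (D.within a.1.1 k ∪ D.within k a.1.2) ⊆ D.within a.1.1 a.1.2 := by
      intro b hb
      simp only [within, Finset.mem_filter, Finset.mem_union, Finset.mem_insert] at hb ⊢
      rcases hb with rfl | hb | hb
      · exact ⟨ha, le_rfl, le_rfl⟩
      · exact ⟨hb.1, hb.2.1, by omega⟩
      · exact ⟨hb.1, by omega, hb.2.2⟩
    have h8 : a ∉ D.within a.1.1 k ∪ D.within k a.1.2 := by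
      simp only [within, Finset.mem_filter, Finset.mem_union]
      omega
    have h9 : Disjoint (D.within a.1.1 k) (D.within k a.1.2) := by
      rw [Finset.disjoint_left]
      intro b hb hb'
      simp only [within, Finset.mem_filter] at hb hb'
      have := b.bounds
      omega
    have := Finset.card_le_card h7
    rw [Finset.card_insert_of_notMem h8, Finset.card_union_of_disjoint h9] at this
    omega

/-- In a triangulation both segments at the split vertex are present, so the inequalities in the
count of `card_le` become equalities. Consequently the faces of dimension zero are exactly the
triangulations. -/
theorem IsMax.card_eq {D : Face m} (hD : D.IsMax) : D.diagonals.card = m := by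
  refine le_antisymm D.card_le ?_
  obtain ⟨k, h1, h2, h3, h4⟩ := hD.exists_apex (i := 0) (j := m + 2) (Or.inr (Or.inr ⟨rfl, rfl⟩))
    (by omega) le_rfl
  have h5 := hD.le_card_within (k - 1) 0 k (by omega) h3
  have h6 := hD.le_card_within (m + 2 - k - 1) k (m + 2) (by omega) h4
  have h7 : D.within 0 k ∪ D.within k (m + 2) ⊆ D.diagonals := by
    intro a ha
    simp only [within, Finset.mem_filter, Finset.mem_union] at ha
    tauto
  have h9 : Disjoint (D.within 0 k) (D.within k (m + 2)) := by
    rw [Finset.disjoint_left]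
    intro b hb hb'
    simp only [within, Finset.mem_filter] at hb hb'
    have := b.bounds
    omega
  have := Finset.card_le_card h7
  rw [Finset.card_union_of_disjoint h9] at this
  omega

theorem Cov.card {D E : Face m} (h : D.Cov E) : E.diagonals.card = D.diagonals.card + 1 := by
  obtain ⟨a, ha, h⟩ := h
  rw [h, Finset.card_insert_of_notMem ha]

theorem Cov.dim_eq {D E : Face m} (h : D.Cov E) : D.dim = E.dim + 1 := by
  have h1 := h.card
  have h2 := E.card_le
  rw [dim, dim]
  omega

theorem isMax_of_dim {D : Face m} (h : D.dim = 0) : D.IsMax := by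
  by_contra h'
  obtain ⟨E, hE⟩ := exists_cov_of_not_isMax h'
  have := hE.dim_eq
  omega

theorem exists_cov {D : Face m} (h : D.dim ≠ 0) : ∃ E, D.Cov E := by
  refine exists_cov_of_not_isMax fun h' => h ?_
  rw [dim, h'.card_eq]
  omega

theorem Cov.compat {D E : Face m} {a : Diagonal m} (h : E.diagonals = insert a D.diagonals) :
    ∀ b ∈ D.diagonals, ¬ Crosses a b := fun b hb =>
  E.noncrossing a (by simp [h]) b (by simp [h, hb])

theorem dim_add {D : Face m} {a : Diagonal m} (h : ∀ b ∈ D.diagonals, ¬ Crosses a b)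
    (ha : a ∉ D.diagonals) : D.dim = (D.add a h).dim + 1 := (cov_add h ha).dim_eq

theorem seg_of_add {D E : Face m} {a : Diagonal m} (h : E.diagonals = insert a D.diagonals)
    {i j : ℕ} (hS : E.Seg i j) (hne : ¬ (i = a.1.1.val ∧ j = a.1.2.val)) : D.Seg i j := by
  rcases hS with ⟨b, hb, rfl, rfl⟩ | hS
  · rw [h, Finset.mem_insert] at hb
    rcases hb with rfl | hb
    · exact absurd ⟨rfl, rfl⟩ hne
    · exact Or.inl ⟨b, hb, rfl, rfl⟩
  · exact Or.inr hS

/-- In a triangulation, a diagonal is the side of a triangle above it. -/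
theorem IsMax.exists_parent {D : Face m} (hD : D.IsMax) {i j : ℕ} (h : D.Has i j) :
    (∃ p, p < i ∧ D.Seg p i ∧ D.Seg p j) ∨ (∃ p, j < p ∧ p ≤ m + 2 ∧ D.Seg j p ∧ D.Seg i p) := by
  have hb := h.bounds
  -- The parent triangle lies below the shortest segment that strictly contains `(i, j)`: by
  -- minimality, the side of its apex that still contains `(i, j)` equals `(i, j)`.
  let q : ℕ → Prop := fun n => ∃ y z, n = z - y ∧ D.Seg y z ∧ z ≤ m + 2 ∧ y ≤ i ∧ j ≤ z ∧
    ¬ (y = i ∧ z = j)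
  have hq : ∃ n, q n := ⟨_, 0, m + 2, rfl, Or.inr (Or.inr ⟨rfl, rfl⟩), le_rfl, by omega, by omega,
    by omega⟩
  obtain ⟨y, z, hn, h1, h2, h3, h4, h5⟩ := Nat.find_spec hq
  have hmin : ∀ y' z', D.Seg y' z' → z' ≤ m + 2 → y' ≤ i → j ≤ z' → z' - y' < z - y →
      y' = i ∧ z' = j := by
    intro y' z' k1 k2 k3 k4 k5
    by_contra k6
    exact Nat.find_min hq (by rw [hn]; exact k5) ⟨y', z', rfl, k1, k2, k3, k4, k6⟩
  obtain ⟨k, k1, k2, k3, k4⟩ := hD.exists_apex h1 (by omega) h2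
  have k3' : D.Seg y k := k3.imp_right Or.inl
  have k4' : D.Seg k z := k4.imp_right Or.inl
  have c1 := k3'.not_cross (Or.inl h) (by omega) (by omega)
  have c2 := k4'.not_cross (Or.inl h) (by omega) (by omega)
  rcases (by omega : k ≤ i ∨ j ≤ k) with h6 | h6
  · obtain ⟨rfl, rfl⟩ := hmin k z k4' h2 h6 h4 (by omega)
    exact Or.inl ⟨y, k1, k3', h1⟩
  · obtain ⟨rfl, rfl⟩ := hmin y k k3' (by omega) h3 h6 (by omega)
    exact Or.inr ⟨z, k2, h2, k4', h1⟩

/-- The flip of the diagonal `a` of a triangulation. -/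
theorem exists_flip {D E : Face m} {a : Diagonal m} (ha : a ∉ D.diagonals)
    (h : E.diagonals = insert a D.diagonals) (hE : E.IsMax) :
    ∃ b, b ∉ D.diagonals ∧ b ≠ a ∧ (∀ c ∈ D.diagonals, ¬ Crosses b c) ∧
      ∀ c, (∀ d ∈ D.diagonals, ¬ Crosses c d) → Crosses c a → c = b := by
  have haE : E.Has a.1.1.val a.1.2.val := (has_iff a).2 (by simp [h])
  have hab := a.bounds
  obtain ⟨k, k1, k2, k3, k4⟩ := hE.exists_apex (Or.inl haE) hab.1 hab.2.1
  have s1 : D.Seg a.1.1.val k := seg_of_add h (k3.imp_right Or.inl) (by omega)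
  have s2 : D.Seg k a.1.2.val := seg_of_add h (k4.imp_right Or.inl) (by omega)
  -- The triangles below and above `a` form a quadrilateral. A diagonal compatible with `D` crosses
  -- none of its sides, so inside it can only be one of its two diagonals.
  have segc : ∀ {i j : ℕ} (_ : D.Seg i j) (_ : j ≤ m + 2) (c : Diagonal m),
      (∀ d ∈ D.diagonals, ¬ Crosses c d) →
      ¬ (i < c.1.1.val ∧ c.1.1.val < j ∧ j < c.1.2.val) ∧
        ¬ (c.1.1.val < i ∧ i < c.1.2.val ∧ c.1.2.val < j) := by
    intro i j hS hj c hc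
    have hc1 := (has_iff (D := D.add c hc) c).2 (Finset.mem_insert_self c D.diagonals)
    have hS' : (D.add c hc).Seg i j := by
      rcases hS with ⟨d, hd, h1, h2⟩ | hS
      · exact Or.inl ⟨d, Finset.mem_insert_of_mem hd, h1, h2⟩
      · exact Or.inr hS
    exact hS'.not_cross (Or.inl hc1) hj c.bounds.2.1
  have hDa : ∀ c ∈ D.diagonals, c ≠ a := fun c hc h' => ha (h' ▸ hc)
  have hself : ∀ c ∈ D.diagonals, ∀ d ∈ D.diagonals, ¬ Crosses c d := D.noncrossing
  have hac : ∀ c ∈ D.diagonals, ¬ Crosses c a := fun c hc h' => Cov.compat h c hc h'.symm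
  have hne : ∀ c : Diagonal m, c ≠ a → ¬ (c.1.1.val = a.1.1.val ∧ c.1.2.val = a.1.2.val) :=
    fun c hc h' => hc (Diagonal.ext' h'.1 h'.2)
  rcases hE.exists_parent haE with ⟨p, p1, p2, p3⟩ | ⟨p, p1, p0, p2, p3⟩
  · have s3 := seg_of_add h p2 (by omega)
    have s4 := seg_of_add h p3 (by omega)
    -- The other diagonal of the quadrilateral joins the two apexes; here the upper apex `p` comes
    -- before `a`.
    obtain ⟨b, hb1, hb2⟩ := Diagonal.exists_mk (m := m) (i := p) (j := k) (by omega) (by omega)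
      (by omega)
    have hba : Crosses b a := by rw [crosses_iff]; omega
    refine ⟨b, fun hb => hac b hb hba, fun hb => ?_, fun c hc => ?_, fun c hc hca => ?_⟩
    · rw [hb] at hba; exact not_crosses_self a hba
    · have c1 := segc s1 (by omega) c (hself c hc)
      have c2 := segc s2 (by omega) c (hself c hc)
      have c3 := segc s3 (by omega) c (hself c hc)
      have c4 := segc s4 (by omega) c (hself c hc)
      have c5 := hac c hc
      have c6 := hne c (hDa c hc)
      have c7 := c.bounds
      rw [crosses_iff] at c5 ⊢
      omega
    · have c1 := segc s1 (by omega) c hc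
      have c2 := segc s2 (by omega) c hc
      have c3 := segc s3 (by omega) c hc
      have c4 := segc s4 (by omega) c hc
      have c7 := c.bounds
      rw [crosses_iff] at hca
      exact Diagonal.ext' (by omega) (by omega)
  · have s3 := seg_of_add h p2 (by omega)
    have s4 := seg_of_add h p3 (by omega)
    obtain ⟨b, hb1, hb2⟩ := Diagonal.exists_mk (m := m) (i := k) (j := p) (by omega) (by omega)
      (by omega)
    have hba : Crosses b a := by rw [crosses_iff]; omega
    refine ⟨b, fun hb => hac b hb hba, fun hb => ?_, fun c hc => ?_, fun c hc hca => ?_⟩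
    · rw [hb] at hba; exact not_crosses_self a hba
    · have c1 := segc s1 (by omega) c (hself c hc)
      have c2 := segc s2 (by omega) c (hself c hc)
      have c3 := segc s3 (by omega) c (hself c hc)
      have c4 := segc s4 (by omega) c (hself c hc)
      have c5 := hac c hc
      have c6 := hne c (hDa c hc)
      have c7 := c.bounds
      rw [crosses_iff] at c5 ⊢
      omega
    · have c1 := segc s1 (by omega) c hc
      have c2 := segc s2 (by omega) c hc
      have c3 := segc s3 (by omega) c hc
      have c4 := segc s4 (by omega) c hc
      have c7 := c.bounds
      rw [crosses_iff] at hca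
      exact Diagonal.ext' (by omega) (by omega)

theorem Cov.eq_add {D E : Face m} (h : D.Cov E) : ∃ (a : Diagonal m)
    (ha : ∀ b ∈ D.diagonals, ¬ Crosses a b), a ∉ D.diagonals ∧ E = D.add a ha := by
  obtain ⟨a, ha, h⟩ := h
  exact ⟨a, Cov.compat h, ha, Face.ext' h⟩

theorem compat_add {D : Face m} {a b : Diagonal m} (ha : ∀ c ∈ D.diagonals, ¬ Crosses a c)
    (hb : ∀ c ∈ D.diagonals, ¬ Crosses b c) (hab : ¬ Crosses b a) :
    ∀ c ∈ (D.add a ha).diagonals, ¬ Crosses b c := by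
  intro c hc
  rcases Finset.mem_insert.1 hc with rfl | hc
  · exact hab
  · exact hb c hc

theorem adjacent_of_not_crosses {D : Face m} {a b : Diagonal m}
    (ha : ∀ c ∈ D.diagonals, ¬ Crosses a c) (hb : ∀ c ∈ D.diagonals, ¬ Crosses b c)
    (ha' : a ∉ D.diagonals) (hb' : b ∉ D.diagonals) (hne : a ≠ b) (hab : ¬ Crosses a b) :
    D.Cov (D.add a ha) ∧ D.Cov (D.add b hb) ∧ ∃ G, (D.add a ha).Cov G ∧ (D.add b hb).Cov G := by
  refine ⟨cov_add ha ha', cov_add hb hb', (D.add a ha).add b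
    (compat_add ha hb fun h => hab h.symm), cov_add _ ?_, a, ?_, ?_⟩
  · simp [add, hne.symm, hb']
  · simp [add, hne, ha']
  · simp [add, Finset.insert_comm]

/-- The two intermediate faces of a diamond add the same two diagonals in either order. The ends of
an edge differ by a flip. Facets obtained by adding non-crossing diagonals have a common facet, and
if the diagonals cross, a third diagonal crossing neither of them connects the two facets. -/
theorem isThin : IsThin (Face.dim (m := m)) Face.Cov := by
  refine ⟨fun h => h.dim_eq, ?_, ?_, ?_, fun h => exists_cov h⟩
  · rintro D E G h ⟨b, hb, hG⟩
    obtain ⟨a, ha, ha', rfl⟩ := h.eq_add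
    have hab : a ≠ b := by
      rintro rfl
      exact hb (Finset.mem_insert_self _ _)
    have hbD : b ∉ D.diagonals := fun h => hb (Finset.mem_insert_of_mem h)
    have hGi : G.diagonals = insert b (insert a D.diagonals) := hG
    have hbc : ∀ c ∈ D.diagonals, ¬ Crosses b c := fun c hc =>
      G.noncrossing b (by simp [hGi]) c (by simp [hGi, hc])
    refine ⟨D.add b hbc, ?_, cov_add hbc hbD, ⟨a, by simp [add, hab, ha'],
      by rw [hGi, add, Finset.insert_comm]⟩, ?_⟩
    · intro h
      have : b ∈ (D.add a ha).diagonals := by rw [← h]; exact Finset.mem_insert_self _ _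
      exact hb this
    · rintro A ⟨c, hc, hA⟩ ⟨d, hd, hG'⟩
      have hcG : c ∈ insert b (insert a D.diagonals) := by rw [← hGi, hG', hA]; simp
      simp only [Finset.mem_insert] at hcG
      rcases hcG with rfl | rfl | hcG
      · exact Or.inr (Face.ext' hA)
      · exact Or.inl (Face.ext' hA)
      · exact absurd hcG hc
  · intro D hD
    obtain ⟨E, hE⟩ := exists_cov (D := D) (by omega)
    have hE0 : E.dim = 0 := by have := hE.dim_eq; omega
    obtain ⟨a, ha, hE⟩ := hE
    obtain ⟨b, hb, hba, hbc, huniq⟩ := exists_flip ha hE (isMax_of_dim hE0)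
    refine ⟨E, D.add b hbc, ?_, ⟨a, ha, hE⟩, cov_add hbc hb, ?_⟩
    · rintro rfl
      have : b ∈ insert a D.diagonals := by rw [← hE]; exact Finset.mem_insert_self _ _
      simp [hba, hb] at this
    · intro A hA
      obtain ⟨c, hc, hc', rfl⟩ := hA.eq_add
      by_cases hca : c = a
      · left
        subst hca
        exact Face.ext' hE.symm
      right
      -- If `c` did not cross `a`, both could be added to a face of dimension one.
      have hcross : Crosses c a := by
        by_contra hcross
        obtain ⟨-, -, G, hG, -⟩ := adjacent_of_not_crosses hc (Cov.compat hE) hc' ha hca hcross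
        have := hG.dim_eq
        have := dim_add hc hc'
        omega
      obtain rfl := huniq c hc hcross
      rfl
  · intro D E E' hd hE hE'
    obtain ⟨a, ha, ha', rfl⟩ := hE.eq_add
    obtain ⟨b, hb, hb', rfl⟩ := hE'.eq_add
    clear hE hE'
    by_cases hab : a = b
    · subst hab
      exact .refl _
    by_cases hcr : Crosses a b
    swap
    · exact .rel _ _ (adjacent_of_not_crosses ha hb ha' hb' hab hcr)
    suffices h : ∃ c, ∃ _ : ∀ d ∈ D.diagonals, ¬ Crosses c d,
        c ∉ D.diagonals ∧ c ≠ a ∧ c ≠ b ∧ ¬ Crosses c a ∧ ¬ Crosses c b by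
      obtain ⟨c, hc, hc', hca, hcb, hxa, hxb⟩ := h
      exact .trans _ (D.add c hc) _
        (.rel _ _ (adjacent_of_not_crosses ha hc ha' hc' hca.symm fun h => hxa h.symm))
        (.rel _ _ (adjacent_of_not_crosses hc hb hc' hb' hcb hxb))
    have key : ∀ a b : Diagonal m, (∀ c ∈ D.diagonals, ¬ Crosses a c) →
        (∀ c ∈ D.diagonals, ¬ Crosses b c) → a ∉ D.diagonals →
        a.1.1.val < b.1.1.val → b.1.1.val < a.1.2.val → a.1.2.val < b.1.2.val →
        ∃ c, ∃ _ : ∀ d ∈ D.diagonals, ¬ Crosses c d,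
          c ∉ D.diagonals ∧ c ≠ a ∧ c ≠ b ∧ ¬ Crosses c a ∧ ¬ Crosses c b := by
      clear ha hb ha' hb' hab hcr a b
      intro a b ha hb ha' h1 h2 h3
      have hab := a.bounds
      have hbb := b.bounds
      -- The ends of `a` and `b` span a quadrilateral. If its sides all belong to `D`, any further
      -- diagonal compatible with `a` lies outside of it; it exists as the dimension is at least
      -- two. Otherwise a missing side serves.
      by_cases hQ : D.Seg a.1.1.val b.1.1.val ∧ D.Seg b.1.1.val a.1.2.val ∧
          D.Seg a.1.2.val b.1.2.val ∧ D.Seg a.1.1.val b.1.2.val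
      · obtain ⟨s1, s2, s3, s4⟩ := hQ
        obtain ⟨E, hE⟩ := exists_cov (D := D.add a ha) (by have := dim_add ha ha'; omega)
        obtain ⟨c, hc, hc', -⟩ := hE.eq_add
        have hcD : ∀ d ∈ D.diagonals, ¬ Crosses c d :=
          fun d hd => hc d (Finset.mem_insert_of_mem hd)
        have hca := hc a (Finset.mem_insert_self _ _)
        have hcb := c.bounds
        have sub : ∀ {i j}, D.Seg i j → j ≤ m + 2 → _ := fun {i j} (h : D.Seg i j) hj =>
          Seg.not_cross (D := D.add c hcD) (h.imp_left fun ⟨e, he, h1, h2⟩ =>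
            ⟨e, Finset.mem_insert_of_mem he, h1, h2⟩) (Or.inl ((has_iff c).2
            (Finset.mem_insert_self _ _))) hj c.bounds.2.1
        have c1 := sub s1 (by omega)
        have c2 := sub s2 (by omega)
        have c3 := sub s3 (by omega)
        have c4 := sub s4 (by omega)
        refine ⟨c, hcD, fun h => hc' (Finset.mem_insert_of_mem h),
          fun h => hc' (h ▸ Finset.mem_insert_self _ _), ?_, hca, ?_⟩
        · rintro rfl
          rw [crosses_iff] at hca
          omega
        · have hne : ¬ (c.1.1.val = a.1.1.val ∧ c.1.2.val = a.1.2.val) := fun h =>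
            hc' (Diagonal.ext' h.1 h.2 ▸ Finset.mem_insert_self _ _)
          rw [crosses_iff] at hca ⊢
          omega
      · have hside : ∃ i j, i + 2 ≤ j ∧ j ≤ m + 2 ∧ ¬ (i = 0 ∧ j = m + 2) ∧ ¬ D.Has i j ∧
            ((i = a.1.1.val ∧ j = b.1.1.val) ∨ (i = b.1.1.val ∧ j = a.1.2.val) ∨
              (i = a.1.2.val ∧ j = b.1.2.val) ∨ (i = a.1.1.val ∧ j = b.1.2.val)) := by
          simp only [Seg, not_and_or, not_or] at hQ
          rcases hQ with h | h | h | h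
          · exact ⟨_, _, by omega, by omega, by omega, h.1, by omega⟩
          · exact ⟨_, _, by omega, by omega, by omega, h.1, by omega⟩
          · exact ⟨_, _, by omega, by omega, by omega, h.1, by omega⟩
          · exact ⟨_, _, by omega, by omega, by omega, h.1, by omega⟩
        obtain ⟨i, j, q1, q2, q3, q4, q5⟩ := hside
        obtain ⟨c, rfl, rfl⟩ := Diagonal.exists_mk q1 q2 q3
        rw [has_iff] at q4
        refine ⟨c, fun d hd => ?_, q4, ?_, ?_, ?_, ?_⟩
        -- A diagonal that crosses a side of the quadrilateral also crosses one of its two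
        -- diagonals.
        · have k1 := ha d hd
          have k2 := hb d hd
          have k3 := d.bounds
          rw [crosses_iff] at k1 k2 ⊢
          omega
        · rintro rfl; omega
        · rintro rfl; omega
        · rw [crosses_iff]; omega
        · rw [crosses_iff]; omega
    rcases (crosses_iff a b).1 hcr with ⟨h1, h2, h3⟩ | ⟨h1, h2, h3⟩
    · exact key a b ha hb ha' h1 h2 h3
    · obtain ⟨c, k1, k2, k3, k4, k5, k6⟩ := key b a hb ha hb' h1 h2 h3
      exact ⟨c, k1, k2, k4, k3, k6, k5⟩

end Face
end Associahedron

/-! ### The acyclic matching of the dissections of a polygon -/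

namespace Associahedron

variable {m : ℕ}

namespace Face

/-- The first vertex `j ≥ 2` that is not joined to the vertex `0`. -/
noncomputable def gap (D : Face m) : ℕ := sInf {j | 2 ≤ j ∧ ¬ D.Has 0 j}

/-- The last vertex that is joined to the vertex `j`. -/
noncomputable def reach (D : Face m) (j : ℕ) : ℕ := sSup {u | u = j + 1 ∨ D.Has j u}

theorem gap_spec (D : Face m) : 2 ≤ D.gap ∧ ¬ D.Has 0 D.gap :=
  Nat.sInf_mem (s := {j | 2 ≤ j ∧ ¬ D.Has 0 j}) ⟨m + 2, by omega, fun h => by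
    have := h.bounds; omega⟩

theorem gap_le {D : Face m} {j : ℕ} (h : 2 ≤ j) (hj : ¬ D.Has 0 j) : D.gap ≤ j :=
  Nat.sInf_le (s := {j | 2 ≤ j ∧ ¬ D.Has 0 j}) ⟨h, hj⟩

theorem has_of_lt_gap {D : Face m} {j : ℕ} (h : 2 ≤ j) (hj : j < D.gap) : D.Has 0 j := by
  by_contra h'
  have := gap_le h h'
  omega

theorem gap_le_top (D : Face m) : D.gap ≤ m + 2 := gap_le (by omega) fun h => by
  have := h.bounds; omega

theorem bddAbove_reach (D : Face m) (j : ℕ) : BddAbove {u | u = j + 1 ∨ D.Has j u} := by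
  refine ⟨j + m + 2, ?_⟩
  rintro u (h | h)
  · omega
  · have := h.bounds; omega

theorem reach_spec (D : Face m) (j : ℕ) : D.reach j = j + 1 ∨ D.Has j (D.reach j) :=
  Nat.sSup_mem (s := {u | u = j + 1 ∨ D.Has j u}) ⟨j + 1, Or.inl rfl⟩ (D.bddAbove_reach j)

theorem le_reach {D : Face m} {j u : ℕ} (h : u = j + 1 ∨ D.Has j u) : u ≤ D.reach j :=
  le_csSup (D.bddAbove_reach j) h

theorem reach_bounds (D : Face m) {j : ℕ} (hj : j ≤ m + 1) :
    j + 1 ≤ D.reach j ∧ D.reach j ≤ m + 2 := by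
  refine ⟨le_reach (Or.inl rfl), ?_⟩
  rcases D.reach_spec j with h | h
  · omega
  · exact h.bounds.2.1

theorem exists_toggle {D : Face m} (h : D.gap ≤ m + 1) :
    ∃ t : Diagonal m, t.1.1.val = D.gap - 1 ∧ t.1.2.val = D.reach D.gap := by
  have := D.gap_spec
  have := D.reach_bounds h
  exact Diagonal.exists_mk (by omega) (by omega) (by omega)

/-- A diagonal that crosses the toggle and neither of the segments `(0, gap - 1)` and `(gap, reach)`
has to end or start at the vertex `gap`: it is `(0, gap)`, which is absent by definition of the gap,
or it goes beyond the last neighbour of `gap`. -/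
theorem toggle_compat {D : Face m} (hg : D.gap ≤ m + 1) {t : Diagonal m}
    (h1 : t.1.1.val = D.gap - 1) (h2 : t.1.2.val = D.reach D.gap) :
    ∀ b ∈ D.diagonals, ¬ Crosses t b := by
  intro b hb hc
  have g1 := D.gap_spec
  have r1 := D.reach_bounds hg
  have hbH := (has_iff b).2 hb
  have hbb := b.bounds
  have s1 : D.Seg 0 (D.gap - 1) := by
    by_cases h : D.gap = 2
    · rw [h]; exact Or.inr (Or.inl rfl)
    · exact Or.inl (has_of_lt_gap (by omega) (by omega))
  have c1 := s1.not_cross (Or.inl hbH) (by omega) (by omega)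
  have s2 : D.Seg D.gap (D.reach D.gap) := by
    rcases D.reach_spec D.gap with h | h
    · exact Or.inr (Or.inl h)
    · exact Or.inl h
  have c2 := s2.not_cross (Or.inl hbH) (by omega) (by omega)
  have n1 : ¬ (b.1.1.val = 0 ∧ b.1.2.val = D.gap) := by
    rintro ⟨k1, k2⟩
    rw [k1, k2] at hbH
    exact g1.2 hbH
  have n2 : b.1.1.val = D.gap → b.1.2.val ≤ D.reach D.gap := by
    intro k
    rw [k] at hbH
    exact le_reach (Or.inr hbH)
  rw [crosses_iff] at hc
  omega

/-- The number of diagonals that start at the vertex `j`. -/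
noncomputable def outdegree (D : Face m) (j : ℕ) : ℕ :=
  (D.diagonals.filter fun a => a.1.1.val = j).card

theorem has_mono {D E : Face m} (h : D.diagonals ⊆ E.diagonals) {i j : ℕ} (hD : D.Has i j) :
    E.Has i j := by
  obtain ⟨a, ha, k⟩ := hD
  exact ⟨a, h ha, k⟩

theorem gap_mono {D E : Face m} (h : D.diagonals ⊆ E.diagonals) : D.gap ≤ E.gap :=
  gap_le E.gap_spec.1 fun h' => E.gap_spec.2 (has_mono h h')

theorem outdegree_mono {D E : Face m} (h : D.diagonals ⊆ E.diagonals) (j : ℕ) :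
    D.outdegree j ≤ E.outdegree j := Finset.card_le_card (Finset.filter_subset_filter _ h)

theorem outdegree_le (D : Face m) (j : ℕ) : D.outdegree j ≤ m :=
  (Finset.card_le_card (Finset.filter_subset _ _)).trans D.card_le

theorem reach_eq_of_outdegree {D E : Face m} (h : D.diagonals ⊆ E.diagonals) {j : ℕ}
    (hj : D.outdegree j = E.outdegree j) : D.reach j = E.reach j := by
  have h1 := Finset.eq_of_subset_of_card_le
    (Finset.filter_subset_filter (fun a : Diagonal m => a.1.1.val = j) h) hj.ge
  have h2 : ∀ u, D.Has j u ↔ E.Has j u := by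
    refine fun u => ⟨has_mono h, ?_⟩
    rintro ⟨a, ha, k1, k2⟩
    have : a ∈ D.diagonals.filter fun a => a.1.1.val = j := by
      rw [h1]; exact Finset.mem_filter.2 ⟨ha, k1⟩
    exact ⟨a, (Finset.mem_filter.1 this).1, k1, k2⟩
  simp only [reach, h2]

/-- The level used in the matching of the faces. -/
noncomputable def level (D : Face m) : ℕ := D.gap * (m + 1) + D.outdegree D.gap

/-- The level orders the pairs of gap and outdegree lexicographically, because the outdegree is at
most `m`. Additional diagonals can only increase the gap, and for fixed gap the outdegree. In case
of equality no diagonal was added at the gap, so the reach is unchanged. -/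
theorem level_mono {D E : Face m} (h : D.diagonals ⊆ E.diagonals) :
    D.level ≤ E.level ∧ (D.level = E.level → D.gap = E.gap ∧ D.reach D.gap = E.reach E.gap) := by
  have h1 := gap_mono h
  have h2 := D.outdegree_le D.gap
  rcases h1.lt_or_eq with h1 | h1
  · have : (D.gap + 1) * (m + 1) ≤ E.gap * (m + 1) := Nat.mul_le_mul_right _ h1
    rw [add_mul] at this
    have : D.level < E.level := by rw [level, level]; omega
    exact ⟨this.le, fun h => absurd h this.ne⟩
  · have h3 := outdegree_mono h D.gap
    rw [level, level, ← h1]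
    refine ⟨by omega, fun h4 => ⟨rfl, ?_⟩⟩
    exact reach_eq_of_outdegree h (by omega)

/-- The toggle starts at `gap - 1`, which is neither `0` nor `gap`, so it affects none of the data
from which it was defined. -/
theorem toggle_congr {D E : Face m} {t : Diagonal m} (ht : t ∉ D.diagonals)
    (hE : E.diagonals = insert t D.diagonals) (hg : t.1.1.val = D.gap - 1 ∨ t.1.1.val = E.gap - 1) :
    E.gap = D.gap ∧ E.reach D.gap = D.reach D.gap ∧ E.level = D.level := by
  have g1 := D.gap_spec
  have g1' := E.gap_spec
  have sub : D.diagonals ⊆ E.diagonals := by rw [hE]; exact Finset.subset_insert _ _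
  have h0 : ∀ i, E.Has 0 i → D.Has 0 i := by
    rintro i ⟨a, ha, k1, k2⟩
    rw [hE, Finset.mem_insert] at ha
    rcases ha with rfl | ha
    · omega
    · exact ⟨a, ha, k1, k2⟩
  have h1 : E.gap = D.gap :=
    le_antisymm (gap_le g1.1 fun h => g1.2 (h0 _ h)) (gap_mono sub)
  have h2 : E.outdegree D.gap = D.outdegree D.gap := by
    rw [outdegree, outdegree, hE, Finset.filter_insert, if_neg (by omega)]
  exact ⟨h1, (reach_eq_of_outdegree sub h2.symm).symm, by rw [level, level, h1, h2]⟩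

/-- The fan of all diagonals at the vertex `0`. -/
noncomputable def fan (m : ℕ) : Face m where
  diagonals := Finset.univ.filter fun a => a.1.1.val = 0
  noncrossing := by
    intro a ha b hb
    simp only [Finset.mem_filter, Finset.mem_univ, true_and] at ha hb
    rw [crosses_iff]
    omega

theorem fan_isMax : (fan m).IsMax := by
  intro a ha
  refine Finset.mem_filter.2 ⟨Finset.mem_univ _, ?_⟩
  by_contra h
  have := a.bounds
  obtain ⟨b, hb1, hb2⟩ := Diagonal.exists_mk (m := m) (i := 0) (j := a.1.1.val + 1) (by omega)
    (by omega) (by omega)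
  refine ha b (Finset.mem_filter.2 ⟨Finset.mem_univ _, hb1⟩) ?_
  rw [crosses_iff]
  omega

theorem gap_fan : (fan m).gap = m + 2 := by
  refine le_antisymm (gap_le_top _) ?_
  have h := (fan m).gap_spec
  by_contra h'
  obtain ⟨b, hb1, hb2⟩ := Diagonal.exists_mk (m := m) (i := 0) (j := (fan m).gap) (by omega)
    (by omega) (by omega)
  exact h.2 ⟨b, Finset.mem_filter.2 ⟨Finset.mem_univ _, hb1⟩, hb1, hb2⟩

/-- Without a gap before `m + 2` every vertex is joined to `0`, and the fan is already maximal. -/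
theorem eq_fan {D : Face m} (h : ¬ D.gap ≤ m + 1) : D = fan m := by
  have h1 := D.gap_le_top
  have sub : (fan m).diagonals ⊆ D.diagonals := by
    intro a ha
    have ha := (Finset.mem_filter.1 ha).2
    have := a.bounds
    rw [← has_iff, ha]
    exact has_of_lt_gap (by omega) (by omega)
  refine Face.ext' (Finset.Subset.antisymm (fun a ha => ?_) sub)
  exact fan_isMax a fun b hb => D.noncrossing a ha b (sub hb)

/-- The face can be matched with a facet. -/
def Up (D : Face m) : Prop := D.gap ≤ m + 1 ∧ ¬ D.Has (D.gap - 1) (D.reach D.gap)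

theorem exists_partner {D : Face m} (h : D.Up) : ∃ E : Face m, ∃ t : Diagonal m,
    t.1.1.val = D.gap - 1 ∧ t.1.2.val = D.reach D.gap ∧ t ∉ D.diagonals ∧
      E.diagonals = insert t D.diagonals := by
  obtain ⟨t, h1, h2⟩ := exists_toggle h.1
  refine ⟨D.add t (toggle_compat h.1 h1 h2), t, h1, h2, fun h' => h.2 ?_, rfl⟩
  rw [← h1, ← h2]
  exact (has_iff t).2 h'

/-- The facet with which a face is matched. -/
noncomputable def partner (D : Face m) : Face m :=
  if h : D.Up then (exists_partner h).choose else D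

theorem Up.partner {D : Face m} (h : D.Up) : ∃ t : Diagonal m,
    t.1.1.val = D.gap - 1 ∧ t.1.2.val = D.reach D.gap ∧ t ∉ D.diagonals ∧
      D.partner.diagonals = insert t D.diagonals := by
  rw [Face.partner, dif_pos h]
  exact (exists_partner h).choose_spec

/-- Inserting or deleting the diagonal from `gap - 1` to `reach gap` is an involution on all faces
except the fan, since the gap and its reach do not notice it. Within one level the gap and the reach
do not change along inclusions, which makes the matching acyclic. -/
theorem isMatching : IsMatching (Face.dim (m := m)) Face.Cov (fan m) level Up partner := by
  refine ⟨?_, ?_, ?_, ?_, ?_, ?_⟩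
  · rw [dim, fan_isMax.card_eq, Nat.sub_self]
  · rintro D E ⟨a, ha, h⟩
    exact (level_mono (by rw [h]; exact Finset.subset_insert _ _)).1
  · intro D h
    obtain ⟨t, h1, h2, h3, h4⟩ := h.partner
    obtain ⟨c1, c2, c3⟩ := toggle_congr h3 h4 (Or.inl h1)
    refine ⟨⟨t, h3, h4⟩, fun h' => h'.2 ?_, c3, fun h' => ?_⟩
    · rw [c1, c2, ← h1, ← h2, has_iff, h4]
      exact Finset.mem_insert_self _ _
    · have := h.1
      rw [h', gap_fan] at c1
      omega
  · intro D D' h h' he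
    obtain ⟨t, h1, h2, h3, h4⟩ := h.partner
    obtain ⟨c1, c2, -⟩ := toggle_congr h3 h4 (Or.inl h1)
    obtain ⟨t', h1', h2', h3', h4'⟩ := h'.partner
    obtain ⟨c1', c2', -⟩ := toggle_congr h3' h4' (Or.inl h1')
    rw [← he] at h4' c1' c2'
    have hg : D.gap = D'.gap := by rw [← c1, ← c1']
    have htt : t = t' := Diagonal.ext' (by rw [h1, h1', hg]) (by rw [h2, h2', ← c2, ← c2', hg])
    subst htt
    refine Face.ext' ?_
    rw [← Finset.erase_insert h3, ← h4, h4', Finset.erase_insert h3']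
  · intro D h hW
    have hg : D.gap ≤ m + 1 := by
      by_contra h'
      exact hW (eq_fan h')
    have hH : D.Has (D.gap - 1) (D.reach D.gap) := by
      by_contra h'
      exact h ⟨hg, h'⟩
    obtain ⟨t, h0, h1, h2⟩ := hH
    let D' : Face m := ⟨D.diagonals.erase t, fun a ha b hb =>
      D.noncrossing a (Finset.mem_of_mem_erase ha) b (Finset.mem_of_mem_erase hb)⟩
    have ht : t ∉ D'.diagonals := Finset.notMem_erase _ _
    have hD : D.diagonals = insert t D'.diagonals := (Finset.insert_erase h0).symm
    obtain ⟨c1, c2, -⟩ := toggle_congr ht hD (Or.inr h1)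
    have hU : D'.Up := by
      refine ⟨c1 ▸ hg, ?_⟩
      rw [← c2, ← c1, ← h1, ← h2, has_iff]
      exact ht
    refine ⟨D', hU, ?_⟩
    obtain ⟨t', h1', h2', h3', h4'⟩ := hU.partner
    have : t' = t := Diagonal.ext' (by rw [h1', h1, c1]) (by rw [h2', h2, ← c2, c1])
    rw [this] at h4'
    exact Face.ext' (h4'.trans hD.symm)
  · rintro D E ⟨a, ha, hE⟩ hρ hU hE' hW
    have sub : D.diagonals ⊆ E.diagonals := by rw [hE]; exact Finset.subset_insert _ _
    obtain ⟨g1, g2⟩ := (level_mono sub).2 hρ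
    obtain ⟨t, h1, h2, h3, h4⟩ := hU.partner
    have hH : E.Has (E.gap - 1) (E.reach E.gap) := by
      by_contra h'
      exact hE' ⟨g1 ▸ hU.1, h'⟩
    -- The toggles of `D` and `E` coincide; it belongs to `E` and not to `D`, so it is the diagonal
    -- that was added.
    rw [← g2, ← g1, ← h1, ← h2, has_iff, hE, Finset.mem_insert] at hH
    rcases hH with rfl | hH
    · exact Face.ext' (hE.trans h4.symm)
    · exact absurd hH h3

end Face
end Associahedron

/-! ### Cellular chains -/

namespace FacePoset

variable {P : Type} [Fintype P] [PartialOrder P]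

/-- The simplices whose top vertex is `D`. -/
def HasTop (S : Finset P) (D : P) : Prop := D ∈ S ∧ ∀ x ∈ S, x ≤ D

theorem HasTop.unique {S : Finset P} {D E : P} (h : HasTop S D) (h' : HasTop S E) : D = E :=
  le_antisymm (h'.2 _ h.1) (h.2 _ h'.1)

theorem exists_hasTop {S : Finset P} (hS : IsChain (· ≤ ·) (S : Set P)) (hne : S.Nonempty) :
    ∃ D, HasTop S D := by
  obtain ⟨D, hD⟩ := S.exists_maximal hne
  refine ⟨D, hD.1, fun x hx => ?_⟩
  rcases hS.total hx hD.1 with h | h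
  · exact h
  · exact hD.2 hx h

theorem HasTop.erase_lt {S : Finset P} {D x : P} (h : HasTop S D) (hx : x ∈ S.erase D) : x < D :=
  lt_of_le_of_ne (h.2 x (Finset.mem_of_mem_erase hx)) (Finset.ne_of_mem_erase hx)

theorem card_le_of_hasTop {dim : P → ℕ} (hdim : StrictMono dim) {S : Finset P}
    (hS : IsChain (· ≤ ·) (S : Set P)) {D : P} (h : HasTop S D) : S.card ≤ dim D + 1 := by
  rw [← Finset.card_range (dim D + 1)]
  refine Finset.card_le_card_of_injOn dim (fun x hx => ?_) fun x hx y hy hxy => ?_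
  · exact Finset.mem_coe.2 (Finset.mem_range.2 (Nat.lt_succ_of_le (hdim.monotone (h.2 x hx))))
  · by_contra hne
    rcases hS.total hx hy with h | h
    · exact (hdim (lt_of_le_of_ne h hne)).ne hxy
    · exact (hdim (lt_of_le_of_ne h (Ne.symm hne))).ne hxy.symm

/-- A simplex of full dimension with top vertex `D`. -/
def IsFlag (dim : P → ℕ) (S : Finset P) (D : P) : Prop :=
  IsChain (· ≤ ·) (S : Set P) ∧ S.card = dim D + 1 ∧ HasTop S D

theorem isChain_erase {S : Finset P} (hS : IsChain (· ≤ ·) (S : Set P)) (D : P) :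
    IsChain (· ≤ ·) (S.erase D : Set P) := hS.mono (by simp)

theorem IsFlag.insert {dim : P → ℕ} {S : Finset P} {D E : P} (h : IsFlag dim S E) (hlt : E < D)
    (hd : dim D = dim E + 1) : IsFlag dim (insert D S) D := by
  have hD : D ∉ S := fun hD => absurd (h.2.2.2 D hD) (not_le_of_gt hlt)
  refine ⟨?_, ?_, Finset.mem_insert_self _ _, fun x hx => ?_⟩
  · rw [Finset.coe_insert]
    exact h.1.insert fun x hx _ => Or.inr ((h.2.2.2 x hx).trans hlt.le)
  · rw [Finset.card_insert_of_notMem hD, h.2.1, hd]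
  · rcases Finset.mem_insert.1 hx with rfl | hx
    · exact le_rfl
    · exact (h.2.2.2 x hx).trans hlt.le

theorem IsFlag.erase {dim : P → ℕ} (hdim : StrictMono dim) {S : Finset P} {D : P}
    (h : IsFlag dim S D) (hd : dim D ≠ 0) :
    ∃ E, IsFlag dim (S.erase D) E ∧ E < D ∧ dim D = dim E + 1 := by
  have hc : (S.erase D).card = dim D := by rw [Finset.card_erase_of_mem h.2.2.1, h.2.1]; omega
  obtain ⟨E, hE⟩ := exists_hasTop (isChain_erase h.1 D) (Finset.card_pos.1 (by omega))
  have hlt := h.2.2.erase_lt hE.1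
  have h1 := card_le_of_hasTop hdim (isChain_erase h.1 D) hE
  have h2 := hdim hlt
  exact ⟨E, ⟨isChain_erase h.1 D, by omega, hE⟩, hlt, by omega⟩

/-- The cone with apex `D` over a chain. -/
noncomputable def cone (D : P) (z : Finset P → ℤ) (S : Finset P) : ℤ :=
  if D ∈ S then z (S.erase D) else 0

theorem bd_apply (c : Finset P → ℤ) (T : Finset P) :
    bd c T = ∑ x ∈ Tᶜ, (-1) ^ (T.filter (· < x)).card * c (insert x T) := rfl

/-- The apex lies above the base, so it is the last vertex of every simplex of the cone: removing it
has the sign `(-1) ^ j`, and it does not influence the signs of the other faces. -/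
theorem bd_cone (D : P) (z : Finset P → ℤ) (j : ℕ)
    (hz : ∀ S, z S ≠ 0 → S.card = j ∧ ∀ x ∈ S, x < D) (T : Finset P) :
    bd (cone D z) T = if D ∈ T then bd z (T.erase D) else (-1) ^ j * z T := by
  split_ifs with hD
  · rw [bd_apply, bd_apply]
    have h1 : (T.erase D)ᶜ = insert D Tᶜ := by
      ext x
      simp only [Finset.mem_compl, Finset.mem_erase, Finset.mem_insert]
      tauto
    rw [h1, Finset.sum_insert (by simpa using hD)]
    have h2 : z (insert D (T.erase D)) = 0 := by
      by_contra h
      exact lt_irrefl _ ((hz _ h).2 D (Finset.mem_insert_self _ _))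
    rw [h2, mul_zero, zero_add]
    refine Finset.sum_congr rfl fun x hx => ?_
    have hx' : x ≠ D := by rintro rfl; simp [hD] at hx
    rw [cone, if_pos (Finset.mem_insert_of_mem hD), Finset.erase_insert_of_ne hx']
    by_cases h0 : z (insert x (T.erase D)) = 0
    · rw [h0, mul_zero, mul_zero]
    have hlt := (hz _ h0).2 x (Finset.mem_insert_self _ _)
    have h3 : (T.erase D).filter (· < x) = T.filter (· < x) := by
      ext y
      simp only [Finset.mem_filter, Finset.mem_erase]
      refine ⟨fun h => ⟨h.1.2, h.2⟩, fun h => ⟨⟨?_, h.1⟩, h.2⟩⟩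
      rintro rfl
      exact lt_asymm h.2 hlt
    rw [h3]
  · rw [bd_apply, Finset.sum_eq_single D]
    · rw [cone, if_pos (Finset.mem_insert_self _ _), Finset.erase_insert hD]
      by_cases h0 : z T = 0
      · rw [h0, mul_zero, mul_zero]
      rw [Finset.filter_true_of_mem (hz _ h0).2, (hz _ h0).1]
    · intro x _ hx
      rw [cone, if_neg, mul_zero]
      simp [hD, hx.symm]
    · simp [hD]

variable {dim : P → ℕ} {cov : P → P → Prop} {s : P → P → ℤ} {ε : P → ℤ}

/-- The fundamental class of a face of dimension `k`. -/
noncomputable def cellAux (s : P → P → ℤ) (ε : P → ℤ) : ℕ → P → Finset P → ℤ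
  | 0, D => fun S => if S = {D} then ε D else 0
  | k + 1, D => cone D (∑ E, s D E • cellAux s ε k E)

/-- The fundamental class of a face. -/
noncomputable def cell (dim : P → ℕ) (s : P → P → ℤ) (ε : P → ℤ) (D : P) : Finset P → ℤ :=
  cellAux s ε (dim D) D

/-- The boundary of the fundamental class, up to sign. -/
noncomputable def cellBd (dim : P → ℕ) (s : P → P → ℤ) (ε : P → ℤ) (D : P) : Finset P → ℤ :=
  ∑ E, s D E • cell dim s ε E

theorem cell_zero {D : P} (h : dim D = 0) (S : Finset P) :
    cell dim s ε D S = if S = {D} then ε D else 0 := by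
  rw [cell, h]; rfl

theorem cell_succ (hT : IsThin dim cov) (hI : IsIncidence dim cov s ε) {D : P} (h : dim D ≠ 0) :
    cell dim s ε D = cone D (cellBd dim s ε D) := by
  obtain ⟨k, hk⟩ := Nat.exists_eq_succ_of_ne_zero h
  rw [cell, hk, cellAux, cellBd]
  congr 1
  refine Finset.sum_congr rfl fun E _ => ?_
  by_cases hE : cov D E
  · have := hT.dim_eq hE
    rw [cell, show dim E = k by omega]
  · rw [hI.zero hE, zero_smul, zero_smul]

theorem cellBd_apply (D : P) (S : Finset P) :
    cellBd dim s ε D S = ∑ E, s D E * cell dim s ε E S := by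
  simp [cellBd, Finset.sum_apply]

section

variable (hdim : StrictMono dim) (hcov : ∀ {D E}, cov D E ↔ E < D ∧ dim D = dim E + 1)
  (hT : IsThin dim cov) (hI : IsIncidence dim cov s ε)

include hcov hT hI

theorem isFlag_of_cell_ne : ∀ (k : ℕ) (D : P), dim D = k → ∀ S : Finset P,
    cell dim s ε D S ≠ 0 → IsFlag dim S D := by
  intro k
  induction k with
  | zero =>
    intro D hD S hS
    rw [cell_zero hD] at hS
    have : S = {D} := by by_contra h; simp [h] at hS
    subst this
    refine ⟨by simp, by simp [hD], by simp [HasTop]⟩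
  | succ k ih =>
    intro D hD S hS
    rw [cell_succ hT hI (by omega), cone] at hS
    have hDS : D ∈ S := by by_contra h; simp [h] at hS
    rw [if_pos hDS, cellBd_apply] at hS
    obtain ⟨E, -, hE⟩ := Finset.exists_ne_zero_of_sum_ne_zero hS
    have hc := hI.cov_of_ne (left_ne_zero_of_mul hE)
    have hd := hT.dim_eq hc
    have := (ih E (by omega) _ (right_ne_zero_of_mul hE)).insert (hcov.1 hc).1 hd
    rwa [Finset.insert_erase hDS] at this

theorem isFlag_of_cell {D : P} {S : Finset P} (h : cell dim s ε D S ≠ 0) : IsFlag dim S D :=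
  isFlag_of_cell_ne hcov hT hI _ D rfl S h

theorem cellBd_supp {D : P} {S : Finset P} (h : cellBd dim s ε D S ≠ 0) :
    S.card = dim D ∧ ∀ x ∈ S, x < D := by
  rw [cellBd_apply] at h
  obtain ⟨E, -, hE⟩ := Finset.exists_ne_zero_of_sum_ne_zero h
  have hc := hI.cov_of_ne (left_ne_zero_of_mul hE)
  have hf := isFlag_of_cell hcov hT hI (right_ne_zero_of_mul hE)
  exact ⟨hf.2.1.trans (hT.dim_eq hc).symm, fun x hx => (hf.2.2.2 x hx).trans_lt (hcov.1 hc).1⟩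

theorem exists_isFlag : ∀ (k : ℕ) (D : P), dim D = k → ∃ S, IsFlag dim S D := by
  intro k
  induction k with
  | zero => exact fun D hD => ⟨{D}, by simp, by simp [hD], by simp [HasTop]⟩
  | succ k ih =>
    intro D hD
    obtain ⟨E, hE⟩ := hT.facet (D := D) (by omega)
    have hd := hT.dim_eq hE
    obtain ⟨S, hS⟩ := ih E (by omega)
    exact ⟨_, hS.insert (hcov.1 hE).1 hd⟩

/-- The empty simplex is not excluded from `bd`; its coefficient carries the augmentation. -/
theorem bd_cell_zero {D : P} (h : dim D = 0) (T : Finset P) :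
    bd (cell dim s ε D) T = if T = ∅ then ε D else 0 := by
  rw [bd_apply]
  split_ifs with hT'
  · subst hT'
    rw [Finset.sum_eq_single D]
    · rw [cell_zero h]; simp
    · intro x _ hx
      rw [cell_zero h, if_neg (by simpa using hx), mul_zero]
    · simp
  · refine Finset.sum_eq_zero fun x hx => ?_
    rw [cell_zero h, if_neg, mul_zero]
    intro h'
    obtain ⟨y, hy⟩ := Finset.nonempty_iff_ne_empty.2 hT'
    have h1 : y ∈ ({D} : Finset P) := by rw [← h']; exact Finset.mem_insert_of_mem hy
    have h2 : x ∈ ({D} : Finset P) := by rw [← h']; exact Finset.mem_insert_self _ _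
    rw [Finset.mem_singleton] at h1 h2
    subst h1
    subst h2
    simp [hy] at hx

/-- The boundary of a cone over a cycle is its base, up to sign. The base is a cycle by induction,
through `sq`; in dimension one its boundary sits on the empty simplex and vanishes by `aug`. -/
theorem bd_cell_succ : ∀ (k : ℕ) (D : P), dim D = k + 1 →
    bd (cell dim s ε D) = (-1) ^ (k + 1) • cellBd dim s ε D := by
  have bdz : ∀ D, bd (cellBd dim s ε D) = ∑ E, s D E • bd (cell dim s ε E) := by
    intro D
    rw [cellBd, map_sum]
    simp only [map_zsmul]
  have aux : ∀ (k : ℕ) (D : P), dim D = k + 1 → bd (cellBd dim s ε D) = 0 →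
      bd (cell dim s ε D) = (-1) ^ (k + 1) • cellBd dim s ε D := by
    intro k D hD h0
    ext T
    rw [cell_succ hT hI (by omega),
      bd_cone D _ (dim D) fun S hS => cellBd_supp hcov hT hI hS, hD, h0]
    split_ifs with h
    · have : cellBd dim s ε D T = 0 := by
        by_contra h'
        exact lt_irrefl _ ((cellBd_supp hcov hT hI h').2 D h)
      simp [this]
    · simp
  intro k
  induction k with
  | zero =>
    intro D hD
    refine aux 0 D hD ?_
    ext T
    rw [bdz, Finset.sum_apply]
    have : ∀ E, (s D E • bd (cell dim s ε E)) T = if T = ∅ then s D E * ε E else 0 := by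
      intro E
      by_cases hE : cov D E
      · have := hT.dim_eq hE
        rw [Pi.smul_apply, bd_cell_zero hcov hT hI (by omega), smul_eq_mul, mul_ite, mul_zero]
      · simp [hI.zero hE]
    simp only [this]
    split_ifs
    · exact hI.aug D hD
    · simp
  | succ k ih =>
    intro D hD
    refine aux _ D hD ?_
    rw [bdz]
    have : ∀ E, s D E • bd (cell dim s ε E) =
        ∑ G, ((-1) ^ (k + 1) * (s D E * s E G)) • cell dim s ε G := by
      intro E
      by_cases hE : cov D E
      · have := hT.dim_eq hE
        rw [ih E (by omega), cellBd, Finset.smul_sum, Finset.smul_sum]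
        refine Finset.sum_congr rfl fun G _ => ?_
        rw [smul_smul, smul_smul]
        congr 1
        ring
      · simp [hI.zero hE]
    simp only [this]
    rw [Finset.sum_comm]
    simp only [← Finset.sum_smul, ← Finset.mul_sum, hI.sq, mul_zero, zero_smul,
      Finset.sum_const_zero]


include hdim

theorem cell_mem (D : P) : cell dim s ε D ∈ cellularChain dim (dim D) := by
  refine ⟨fun S hS => ?_, fun T hT' x hx => ?_⟩
  · have h := isFlag_of_cell hcov hT hI hS
    exact ⟨h.1, h.2.1, fun x hx => hdim.monotone (h.2.2.2 x hx)⟩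
  · rcases Nat.eq_zero_or_pos (dim D) with h | h
    · rw [bd_cell_zero hcov hT hI h] at hT'
      have : T = ∅ := by by_contra h'; simp [h'] at hT'
      simp [this] at hx
    · obtain ⟨k, hk⟩ := Nat.exists_eq_succ_of_ne_zero h.ne'
      rw [bd_cell_succ hcov hT hI k D hk, Pi.smul_apply] at hT'
      exact hdim ((cellBd_supp hcov hT hI (right_ne_zero_of_mul hT')).2 x hx)

/-- Removing `D` from a flag leaves a flag of a single facet `E`, so only one term of the boundary
contributes. -/
theorem cell_unit : ∀ (k : ℕ) (D : P), dim D = k → ∀ S : Finset P, IsFlag dim S D →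
    cell dim s ε D S = 1 ∨ cell dim s ε D S = -1 := by
  intro k
  induction k with
  | zero =>
    intro D hD S hS
    have hc := hS.2.1
    rw [hD, zero_add, Finset.card_eq_one] at hc
    obtain ⟨x, rfl⟩ := hc
    have := Finset.mem_singleton.1 hS.2.2.1
    subst this
    rw [cell_zero hD, if_pos rfl]
    exact hI.aug_unit D hD
  | succ k ih =>
    intro D hD S hS
    obtain ⟨E, hE, hlt, hd⟩ := hS.erase hdim (by omega)
    rw [cell_succ hT hI (by omega), cone, if_pos hS.2.2.1, cellBd_apply, Finset.sum_eq_single E]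
    · rcases hI.unit (hcov.2 ⟨hlt, hd⟩) with h | h <;> rcases ih E (by omega) _ hE with h' | h' <;>
        simp [h, h']
    · intro E' _ hne
      by_contra h
      have := isFlag_of_cell hcov hT hI (right_ne_zero_of_mul h)
      exact hne (this.2.2.unique hE.2.2)
    · simp

theorem sum_cell_flag (n : P → ℤ) {S : Finset P} {D : P} (h : IsFlag dim S D) :
    (∑ E, n E • cell dim s ε E) S = n D * cell dim s ε D S := by
  rw [Finset.sum_apply, Finset.sum_eq_single D]
  · rfl
  · intro E _ hne
    by_contra h'
    have := isFlag_of_cell hcov hT hI (right_ne_zero_of_mul h')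
    exact hne (this.2.2.unique h.2.2)
  · simp

theorem cell_ne_zero {S : Finset P} {D : P} (h : IsFlag dim S D) : cell dim s ε D S ≠ 0 := by
  rcases cell_unit hdim hcov hT hI _ D rfl S h with h | h <;> simp [h]

theorem eq_zero_of_sum_cell (n : P → ℤ) (h : ∑ E, n E • cell dim s ε E = 0) : n = 0 := by
  ext D
  obtain ⟨S, hS⟩ := exists_isFlag hcov hT hI _ D rfl
  have := sum_cell_flag hdim hcov hT hI n hS
  rw [h] at this
  exact (mul_eq_zero.1 this.symm).resolve_right (cell_ne_zero hdim hcov hT hI hS)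

/-- A cellular chain is the sum of the cones over its links at the faces of top dimension. Each link
is a cellular cycle of one degree less, supported below one face; by induction it is a combination
of cells, and rigidity makes it a multiple of the boundary of that face. -/
theorem exists_coords_cell : ∀ (k : ℕ) (c : Finset P → ℤ), c ∈ cellularChain dim k →
    ∃ n : P → ℤ, (∀ D, dim D ≠ k → n D = 0) ∧ c = ∑ D, n D • cell dim s ε D := by
  intro k
  induction k with
  | zero =>
    intro c hc
    -- The cell of a vertex has the value `ε D = ±1`, which is its own inverse.
    refine ⟨fun D => c {D} * if dim D = 0 then ε D else 0, fun D hD => by simp [hD], ?_⟩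
    ext S
    rw [Finset.sum_apply]
    have hterm : ∀ D, ((c {D} * if dim D = 0 then ε D else 0) • cell dim s ε D) S =
        if S = {D} then c S else 0 := by
      intro D
      by_cases hD : dim D = 0
      · rw [Pi.smul_apply, cell_zero hD, if_pos hD]
        split_ifs with hS
        · rcases hI.aug_unit D hD with h | h <;> simp [h, hS]
        · simp
      · rw [if_neg hD, mul_zero, zero_smul, Pi.zero_apply]
        split_ifs with hS
        · by_contra h0
          have := (hc.1 S (Ne.symm h0)).2.2 D (by simp [hS])
          omega
        · rfl
    simp only [hterm]
    by_cases h0 : c S = 0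
    · simp [h0]
    obtain ⟨x, hx⟩ := Finset.card_eq_one.1 (hc.1 S h0).2.1
    subst hx
    simp
  | succ k ih =>
    intro c hc
    -- The link of `D` in `c`.
    let z : P → Finset P → ℤ := fun D S => if D ∉ S then c (insert D S) else 0
    have hz : ∀ D, dim D = k + 1 → ∀ S, z D S ≠ 0 → IsChain (· ≤ ·) (S : Set P) ∧
        S.card = k + 1 ∧ ∀ x ∈ S, x < D := by
      intro D hD S hS
      have hDS : D ∉ S := by by_contra h; simp [z, h] at hS
      simp only [z, if_pos hDS] at hS
      obtain ⟨h1, h2, h3⟩ := hc.1 _ hS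
      refine ⟨h1.mono (by simp), ?_, fun x hx => ?_⟩
      · rw [Finset.card_insert_of_notMem hDS] at h2
        omega
      · have hne : x ≠ D := by rintro rfl; exact hDS hx
        rcases h1.total (Finset.mem_coe.2 (Finset.mem_insert_of_mem hx))
          (Finset.mem_coe.2 (Finset.mem_insert_self _ _)) with h | h
        · exact lt_of_le_of_ne h hne
        · have := hdim (lt_of_le_of_ne h hne.symm)
          have := h3 x (Finset.mem_insert_of_mem hx)
          omega
    -- The boundary of the link is the part of `bd c` on the simplices that contain `D`; it vanishes
    -- because `bd c` lies in the lower skeleton.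
    have hbd : ∀ D, dim D = k + 1 → bd (z D) = 0 := by
      intro D hD
      ext T
      by_cases hDT : D ∈ T
      · rw [bd_apply]
        refine Finset.sum_eq_zero fun x _ => ?_
        simp [z, hDT]
      have h0 : bd c (insert D T) = 0 := by
        by_contra h
        have := hc.2 _ h D (Finset.mem_insert_self _ _)
        omega
      rw [Pi.zero_apply, ← h0, bd_apply, bd_apply]
      have h1 : Tᶜ = insert D (insert D T)ᶜ := by
        ext x
        simp only [Finset.mem_compl, Finset.mem_insert]
        by_cases hx : x = D
        · simp [hx, hDT]
        · simp [hx]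
      rw [h1, Finset.sum_insert (by simp)]
      have h2 : z D (insert D T) = 0 := by simp [z]
      rw [h2, mul_zero, zero_add]
      refine Finset.sum_congr rfl fun x hx => ?_
      simp only [Finset.mem_compl, Finset.mem_insert, not_or] at hx
      have h3 : z D (insert x T) = c (insert x (insert D T)) := by
        simp only [z, Finset.mem_insert, not_or]
        rw [if_pos ⟨fun h => hx.1 h.symm, hDT⟩, Finset.insert_comm]
      rw [← h3]
      by_cases h4 : z D (insert x T) = 0
      · rw [h4, mul_zero, mul_zero]
      have h5 := (hz D hD _ h4).2.2 x (Finset.mem_insert_self _ _)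
      rw [Finset.filter_insert, if_neg h5.not_gt]
    -- A simplex with `k + 2` vertices in the skeleton contains exactly one face of dimension `k +
    -- 1`, its top.
    have hcz : c = ∑ D, if dim D = k + 1 then cone D (z D) else 0 := by
      ext S
      rw [Finset.sum_apply]
      have hterm : ∀ D, (if dim D = k + 1 then cone D (z D) else 0) S =
          if dim D = k + 1 ∧ D ∈ S then c S else 0 := by
        intro D
        by_cases hD : dim D = k + 1
        · by_cases hS : D ∈ S
          · simp [hD, hS, cone, z, Finset.insert_erase hS]
          · simp [hD, hS, cone]
        · simp [hD]
      simp only [hterm]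
      by_cases h0 : c S = 0
      · simp [h0]
      obtain ⟨h1, h2, h3⟩ := hc.1 S h0
      obtain ⟨M, hM⟩ := exists_hasTop h1 (Finset.card_pos.1 (by omega))
      have h4 := card_le_of_hasTop hdim h1 hM
      have h5 := h3 M hM.1
      rw [Finset.sum_eq_single M]
      · rw [if_pos ⟨by omega, hM.1⟩]
      · intro D _ hne
        rw [if_neg]
        rintro ⟨h6, h7⟩
        have := hdim (lt_of_le_of_ne (hM.2 D h7) hne)
        omega
      · simp
    have hn : ∀ D, dim D = k + 1 → ∃ a : ℤ, z D = a • cellBd dim s ε D := by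
      intro D hD
      have hmem : z D ∈ cellularChain dim k := by
        refine ⟨fun S hS => ?_, fun S hS => ?_⟩
        · obtain ⟨h1, h2, h3⟩ := hz D hD S hS
          exact ⟨h1, h2, fun x hx => by have := hdim (h3 x hx); omega⟩
        · rw [hbd D hD] at hS
          exact absurd rfl hS
      obtain ⟨n, hn, hzn⟩ := ih (z D) hmem
      -- A cell `E` with nonzero coefficient is seen on a flag with top `E`, and the link is
      -- supported below `D`.
      have hsupp : ∀ E, ¬ cov D E → n E = 0 := by
        intro E hE
        by_contra h
        have hdE : dim E = k := by by_contra h'; exact h (hn E h')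
        obtain ⟨S, hS⟩ := exists_isFlag hcov hT hI _ E rfl
        have h1 := sum_cell_flag hdim hcov hT hI n hS
        rw [← hzn] at h1
        have h2 : z D S ≠ 0 := by
          rw [h1]; exact mul_ne_zero h (cell_ne_zero hdim hcov hT hI hS)
        exact hE (hcov.2 ⟨(hz D hD S h2).2.2 E hS.2.2.1, by omega⟩)
      have hcyc : 2 ≤ dim D → ∀ G, ∑ E, n E * s E G = 0 := by
        intro h2 G
        have h1 := hbd D hD
        rw [hzn, map_sum] at h1
        have h3 : ∀ E, bd (n E • cell dim s ε E) =
            ∑ G, ((-1) ^ k * (n E * s E G)) • cell dim s ε G := by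
          intro E
          by_cases hE : dim E = k
          · obtain ⟨l, rfl⟩ := Nat.exists_eq_add_one.2 (by omega : 0 < k)
            rw [map_zsmul, bd_cell_succ hcov hT hI l E hE, cellBd, Finset.smul_sum,
              Finset.smul_sum]
            refine Finset.sum_congr rfl fun G _ => ?_
            rw [smul_smul, smul_smul]
            congr 1
            ring
          · simp [hn E hE]
        simp only [h3] at h1
        rw [Finset.sum_comm] at h1
        simp only [← Finset.sum_smul, ← Finset.mul_sum] at h1
        have h4 := congrFun (eq_zero_of_sum_cell hdim hcov hT hI _ h1) G
        simpa using h4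
      have haug : dim D = 1 → ∑ E, n E * ε E = 0 := by
        intro h2
        -- The value on the empty simplex is the augmentation.
        have h1 := congrFun (hbd D hD) ∅
        rw [hzn, map_sum, Finset.sum_apply] at h1
        rw [Pi.zero_apply] at h1
        rw [← h1]
        refine Finset.sum_congr rfl fun E _ => ?_
        by_cases hE : dim E = k
        · rw [map_zsmul, Pi.smul_apply, bd_cell_zero hcov hT hI (by omega), if_pos rfl, smul_eq_mul]
        · simp [hn E hE]
      obtain ⟨a, ha⟩ := hI.rigid hT (D := D) (by omega) n hsupp hcyc haug
      refine ⟨a, ?_⟩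
      rw [hzn, cellBd, Finset.smul_sum]
      refine Finset.sum_congr rfl fun E _ => ?_
      rw [ha E, smul_smul]
    choose! a ha using hn
    refine ⟨fun D => if dim D = k + 1 then a D else 0, fun D hD => if_neg hD, ?_⟩
    rw [hcz]
    refine Finset.sum_congr rfl fun D _ => ?_
    by_cases hD : dim D = k + 1
    · simp only [if_pos hD]
      rw [cell_succ hT hI (by omega), ha D hD]
      ext S
      simp [cone]
    · simp [hD]

/-- The additional sign `(-1) ^ dim D` is the one from `bd_cone`. -/
theorem cellularComplex_models :
    (cellularComplex dim).Models dim (fun D E => (-1) ^ dim D * s D E) ε := by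
  let v : ∀ k, {D : P // dim D = k} → cellularChain dim k := fun k D =>
    ⟨cell dim s ε D, by have := cell_mem hdim hcov hT hI D.1; rwa [D.2] at this⟩
  have hext : ∀ {k : ℕ} (n : {D : P // dim D = k} → ℤ), ∃ N : P → ℤ, (∀ D, N D.1 = n D) ∧
      ∀ D, dim D ≠ k → N D = 0 := fun {k} n =>
    ⟨fun D => if h : dim D = k then n ⟨D, h⟩ else 0, fun D => dif_pos D.2, fun D hD => dif_neg hD⟩
  have hsum : ∀ {k : ℕ} (N : P → ℤ), (∀ D, dim D ≠ k → N D = 0) →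
      ((∑ D, N D.1 • v k D : cellularChain dim k) : Finset P → ℤ) = ∑ D, N D • cell dim s ε D := by
    intro k N hN
    rw [AddSubgroup.val_finsetSum]
    have : ∀ D : {D : P // dim D = k}, ((N D.1 • v k D : cellularChain dim k) : Finset P → ℤ) =
      (fun D => N D • cell dim s ε D) D.1 := fun D => rfl
    simp only [this]
    rw [← Finset.sum_subset (Finset.subset_univ (Finset.univ.filter fun D => dim D = k))]
    · exact (Finset.sum_subtype (Finset.univ.filter fun D => dim D = k) (by simp)
        fun D => N D • cell dim s ε D).symm
    · intro D _ hD
      rw [hN D (by simpa using hD), zero_smul]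
  have hli : ∀ k, LinearIndependent ℤ (v k) := by
    intro k
    rw [Fintype.linearIndependent_iff]
    intro n hn D
    obtain ⟨N, hN, hN'⟩ := hext n
    have h1 := hsum N hN'
    simp only [hN] at h1
    rw [hn] at h1
    rw [← hN D, eq_zero_of_sum_cell hdim hcov hT hI N h1.symm]
    rfl
  have hcoord : ∀ k (c : cellularChain dim k), ∃ n : P → ℤ, (∀ D, dim D ≠ k → n D = 0) ∧
      c = ∑ D, n D.1 • v k D := by
    intro k c
    obtain ⟨n, hn, h⟩ := exists_coords_cell hdim hcov hT hI k c.1 c.2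
    exact ⟨n, hn, Subtype.ext (h.trans (hsum n hn).symm)⟩
  have hsp : ∀ k, ⊤ ≤ Submodule.span ℤ (Set.range (v k)) := by
    intro k c _
    obtain ⟨n, -, h⟩ := hcoord k c
    rw [h]
    exact Submodule.sum_mem _ fun D _ =>
      Submodule.smul_mem _ _ (Submodule.subset_span (Set.mem_range_self D))
  obtain ⟨b, hb⟩ : ∃ b : ∀ k, Module.Basis {D : P // dim D = k} ℤ ((cellularComplex dim).X k),
      ∀ k D, b k D = v k D :=
    ⟨fun k => Module.Basis.mk (hli k) (hsp k), fun k D => Module.Basis.mk_apply _ _ _⟩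
  refine ⟨b, fun k D => ?_, fun D => ?_, fun k => ?_⟩
  · simp only [hb]
    refine Subtype.ext ((?_ : bd (cell dim s ε D.1) = _).trans (hsum (fun E => (-1) ^ dim D.1 * s D.1 E) ?_).symm)
    · rw [bd_cell_succ hcov hT hI k D.1 D.2, cellBd, Finset.smul_sum, D.2]
      exact Finset.sum_congr rfl fun E _ => smul_smul _ _ _
    · intro E hE
      rw [hI.zero, mul_zero]
      intro h
      have := hT.dim_eq h
      have := D.2
      omega
  · simp only [hb]
    change ∑ x : P, cell dim s ε D.1 {x} = _
    simp [cell_zero D.2]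
  · simp only [hb]
    ext (c : cellularChain dim k)
    constructor
    · rintro ⟨F, hF, h1, h2⟩
      obtain ⟨n, hn, h⟩ := hcoord k c
      have hc : (c : Finset P → ℤ) = ∑ D, n D • cell dim s ε D := by
        rw [← hsum n hn]; exact congrArg _ h
      -- A chain supported on simplices with top `F` has no other cells, as any such cell would show
      -- on its own flags; the values `±1` on the flags then leave the coefficient `±1` only.
      have hn0 : ∀ D, D ≠ F → n D = 0 := by
        intro D hD
        by_contra h0
        obtain ⟨S, hS⟩ := exists_isFlag hcov hT hI _ D rfl
        have h3 := sum_cell_flag hdim hcov hT hI n hS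
        rw [← hc] at h3
        exact hD (hS.2.2.unique (h1 S (by
          rw [h3]; exact mul_ne_zero h0 (cell_ne_zero hdim hcov hT hI hS))))
      have hc' : (c : Finset P → ℤ) = n F • cell dim s ε F := by
        rw [hc, Finset.sum_eq_single F]
        · intro D _ hD
          rw [hn0 D hD, zero_smul]
        · simp
      obtain ⟨S, hS⟩ := exists_isFlag hcov hT hI _ F rfl
      have h3 := h2 S hS.1 (by rw [hS.2.1, hF]) hS.2.2.1 hS.2.2.2
      rw [hc', Pi.smul_apply, smul_eq_mul] at h3
      have h4 := cell_unit hdim hcov hT hI _ F rfl S hS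
      have h5 : n F = 1 ∨ n F = -1 := by
        rcases h3 with h3 | h3 <;> rcases h4 with h4 | h4 <;> rw [h4] at h3 <;> omega
      refine ⟨⟨F, hF⟩, ?_⟩
      rcases h5 with h5 | h5
      · left; refine Subtype.ext ?_; rw [hc', h5, one_smul]
      · right; refine Subtype.ext ?_; rw [hc', h5, neg_smul, one_smul]; rfl
    · have hmem : ∀ D : {D : P // dim D = k}, ∀ S : Finset P, cell dim s ε D.1 S ≠ 0 →
          D.1 ∈ S ∧ ∀ x ∈ S, x ≤ D.1 := fun D S hS => (isFlag_of_cell hcov hT hI hS).2.2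
      have hun : ∀ D : {D : P // dim D = k}, ∀ S : Finset P, IsChain (· ≤ ·) (S : Set P) →
          S.card = k + 1 → D.1 ∈ S → (∀ x ∈ S, x ≤ D.1) →
          cell dim s ε D.1 S = 1 ∨ cell dim s ε D.1 S = -1 := fun D S h1 h2 h3 h4 =>
        cell_unit hdim hcov hT hI _ D.1 rfl S ⟨h1, by rw [h2, D.2], h3, h4⟩
      rintro ⟨D, rfl | rfl⟩
      · exact ⟨D.1, D.2, hmem D, hun D⟩
      · refine ⟨D.1, D.2, fun S hS => hmem D S fun h => hS ?_, fun S h1 h2 h3 h4 => ?_⟩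
        · change -(cell dim s ε D.1 S) = 0
          rw [h, neg_zero]
        · change -(cell dim s ε D.1 S) = 1 ∨ -(cell dim s ε D.1 S) = -1
          have := hun D S h1 h2 h3 h4
          omega

end

end FacePoset

/-! ### Changes of sign and restriction to a factor -/

/-- Dimensions along a cover differ by one, so every product in `sq` changes its sign. This covers
the matrix that occurs in `cellularComplex_models`. -/
theorem IsIncidence.twist {P : Type} [Fintype P] {dim : P → ℕ} {cov : P → P → Prop}
    {s : P → P → ℤ} {ε : P → ℤ} (hI : IsIncidence dim cov s ε)
    (hcov : ∀ {D E}, cov D E → dim D = dim E + 1) :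
    IsIncidence dim cov (fun D E => (-1) ^ dim D * s D E) ε := by
  have hsgn : ∀ k : ℕ, (-1 : ℤ) ^ k = 1 ∨ (-1 : ℤ) ^ k = -1 := neg_one_pow_eq_or ℤ
  refine ⟨fun {D E} h => ?_, fun {D E} h => ?_, fun D G => ?_, fun D hD => ?_, hI.aug_unit⟩
  · rcases hI.unit h with h | h <;> rcases hsgn (dim D) with h' | h' <;> simp [h, h']
  · rw [hI.zero h, mul_zero]
  · have h : ∀ E, (-1) ^ dim D * s D E * ((-1) ^ dim E * s E G) = -(s D E * s E G) := by
      intro E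
      by_cases hE : cov D E
      · rw [hcov hE]
        have : ((-1 : ℤ) ^ dim E) * (-1) ^ dim E = 1 := by rcases hsgn (dim E) with h | h <;> simp [h]
        linear_combination -(s D E * s E G) * this
      · simp [hI.zero hE]
    simp only [h, Finset.sum_neg_distrib, hI.sq, neg_zero]
  · simp only [mul_assoc, ← Finset.mul_sum, hI.aug D hD, mul_zero]

/-- A vertex has no facets, so if all components but the `i`th are vertices, the facets change the
`i`th component only. In this way an incidence function on each associahedron is obtained without
constructing orientations of its faces. -/
theorem isIncidence_restrict {r : ℕ} {P : Fin r → Type} [∀ i, Fintype (P i)]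
    {dim : ∀ i, P i → ℕ} {cov : ∀ i, P i → P i → Prop} {s : (∀ i, P i) → (∀ i, P i) → ℤ}
    {ε : (∀ i, P i) → ℤ} (hI : IsIncidence (piDim dim) (piCov cov) s ε)
    (hcov : ∀ i {D E}, cov i D E → dim i D = dim i E + 1) (W : ∀ i, P i)
    (hW : ∀ i, dim i (W i) = 0) (i : Fin r) :
    IsIncidence (dim i) (cov i) (fun D E => s (Function.update W i D) (Function.update W i E))
      (fun D => ε (Function.update W i D)) := by
  have hdim : ∀ D, piDim dim (Function.update W i D) = dim i D := by
    intro D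
    rw [piDim, Finset.sum_eq_single i]
    · rw [Function.update_self]
    · intro j _ hj
      rw [Function.update_of_ne hj, hW]
    · simp
  have hc : ∀ D X, piCov cov (Function.update W i D) X ↔
      ∃ E, cov i D E ∧ X = Function.update W i E := by
    intro D X
    constructor
    · rintro ⟨j, F, hF, rfl⟩
      by_cases hj : j = i
      · subst hj
        rw [Function.update_self] at hF
        exact ⟨F, hF, by rw [Function.update_idem]⟩
      · rw [Function.update_of_ne hj] at hF
        have := hcov j hF
        rw [hW] at this
        omega
    · rintro ⟨E, hE, rfl⟩
      exact ⟨i, E, by rwa [Function.update_self], by rw [Function.update_idem]⟩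
  have hsum : ∀ (D : P i) (f : (∀ i, P i) → ℤ),
      ∑ E, s (Function.update W i D) (Function.update W i E) * f (Function.update W i E) =
        ∑ X, s (Function.update W i D) X * f X := by
    intro D f
    rw [← Finset.sum_image (s := Finset.univ) (g := Function.update W i)
      (f := fun X => s (Function.update W i D) X * f X)
      (fun x _ y _ h => Function.update_injective W i h)]
    refine Finset.sum_subset (Finset.subset_univ _) fun X _ hX => ?_
    rw [hI.zero, zero_mul]
    rw [hc]
    rintro ⟨E, -, rfl⟩
    exact hX (Finset.mem_image_of_mem _ (Finset.mem_univ E))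
  refine ⟨fun {D E} h => hI.unit ((hc _ _).2 ⟨E, h, rfl⟩), fun {D E} h => hI.zero ?_,
    fun D G => ?_, fun D hD => ?_, fun D hD => hI.aug_unit _ (by rw [hdim, hD])⟩
  · rw [hc]
    rintro ⟨E', hE', h'⟩
    rw [Function.update_injective W i h'] at h
    exact h hE'
  · exact (hsum D fun X => s X (Function.update W i G)).trans (hI.sq _ _)
  · exact (hsum D ε).trans (hI.aug _ (by rw [hdim, hD]))

/-! ### Complexes modelled on products of associahedra -/

namespace Associahedron

variable {m : ℕ}

theorem Face.dim_strictMono : StrictMono (Face.dim (m := m)) := by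
  intro E D h
  have h1 : D.diagonals ⊆ E.diagonals := h.le
  have h2 := Finset.card_lt_card (Finset.ssubset_iff_subset_ne.2
    ⟨h1, fun h' => h.ne (Face.ext' h'.symm)⟩)
  have := E.card_le
  rw [Face.dim, Face.dim]
  omega

theorem Face.cov_iff {D E : Face m} : D.Cov E ↔ E < D ∧ D.dim = E.dim + 1 := by
  constructor
  · intro h
    refine ⟨lt_of_le_of_ne ?_ ?_, h.dim_eq⟩
    · obtain ⟨a, -, h⟩ := h
      change D.diagonals ⊆ E.diagonals
      rw [h]
      exact Finset.subset_insert _ _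
    · rintro rfl
      have := h.dim_eq
      omega
  · rintro ⟨h, hd⟩
    have h1 : D.diagonals ⊆ E.diagonals := h.le
    have := E.card_le
    have hc : (E.diagonals \ D.diagonals).card = 1 := by
      rw [Finset.card_sdiff_of_subset h1]
      rw [Face.dim, Face.dim] at hd
      omega
    obtain ⟨a, ha⟩ := Finset.card_eq_one.1 hc
    refine ⟨a, (Finset.mem_sdiff.1 (ha ▸ Finset.mem_singleton_self a)).2, ?_⟩
    rw [Finset.insert_eq, ← ha, Finset.sdiff_union_of_subset h1]

end Associahedron

open Associahedron in
/-- A complex that is modelled on a product of associahedra is the tensor product of their cellular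
complexes, and it is acyclic. -/
theorem BasedSeq.Models.associahedra {A : BasedSeq.{u}} {r : ℕ} {n : Fin r → ℕ}
    {s : (∀ i, Face (n i)) → (∀ i, Face (n i)) → ℤ} {ε : (∀ i, Face (n i)) → ℤ}
    (hA : A.Models (piDim fun _ => Face.dim) s ε)
    (hI : IsIncidence (piDim fun _ => Face.dim) (piCov fun _ => Face.Cov) s ε) :
    A.IsBased ∧ A.BasedIso (BasedSeq.tensorFin r fun i => Associahedron.complex (n i)) ∧
      A.IsAcyclic := by
  have hT := isThin_pi r (fun i => Face (n i)) (fun _ => Face.dim) (fun _ => Face.Cov)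
    (fun _ => Face.isThin)
  -- The given signs, restricted to the faces whose other components are fans, model the cellular
  -- chains of the single factors.
  have hres := fun i => isIncidence_restrict hI (fun _ {_ _} h => h.dim_eq) (fun i => Face.fan (n i))
    (fun _ => Face.isMatching.dim_top) i
  obtain ⟨s', ε', hB, hI'⟩ := BasedSeq.exists_tensorFin_models r
    (fun i => Associahedron.complex (n i)) (fun i => Face (n i)) (fun _ => Face.dim)
    (fun _ => Face.Cov) (fun _ {_ _} h => h.dim_eq) (fun i => ⟨_, _, FacePoset.cellularComplex_models
      Face.dim_strictMono Face.cov_iff Face.isThin (hres i), (hres i).twist fun h => h.dim_eq⟩)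
  obtain ⟨W, ρ, U, μ, hM⟩ := exists_isMatching_pi r (fun i => Face (n i)) (fun _ => Face.dim)
    (fun _ => Face.Cov) (fun _ => Face.isThin) (fun _ => ⟨_, _, _, _, Face.isMatching⟩)
  exact ⟨hA.isBased, hA.basedIso hT hB hI hI', hA.isAcyclic hM hT hI⟩

/-! ### Forests in ribbon graphs -/

namespace RibbonGraph

variable {Ω : Type u} {Γ : RibbonGraph Ω}

theorem vert_eq_iff {a b : Γ.H} : Γ.vert a = Γ.vert b ↔ Γ.rot.SameCycle a b := Quotient.eq

theorem vert_rot (a : Γ.H) : Γ.vert (Γ.rot a) = Γ.vert a :=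
  vert_eq_iff.2 (Equiv.Perm.sameCycle_apply_left.2 (Equiv.Perm.SameCycle.refl _ _))

theorem edge_eq_iff {a b : Γ.H} : Γ.edge a = Γ.edge b ↔ b = a ∨ b = Γ.flip a := by
  rw [show Γ.edge a = Γ.edge b ↔ Γ.flip.SameCycle a b from Quotient.eq]
  constructor
  · rintro ⟨i, rfl⟩
    have h2 : Γ.flip ^ (2 : ℤ) = 1 := by
      ext x
      rw [zpow_two, Equiv.Perm.mul_apply, Γ.flip_flip]
      rfl
    rcases Int.even_or_odd' i with ⟨k, rfl | rfl⟩
    · left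
      rw [zpow_mul, h2, one_zpow]
      rfl
    · right
      rw [zpow_add, zpow_mul, h2, one_zpow, one_mul, zpow_one]
  · rintro (rfl | rfl)
    · exact Equiv.Perm.SameCycle.refl _ _
    · exact Equiv.Perm.sameCycle_apply_right.2 (Equiv.Perm.SameCycle.refl _ _)

variable {F F' : Set Γ.H}

theorem Linked.refl (F : Set Γ.H) (a : Γ.H) : Γ.Linked F a a := Relation.EqvGen.refl a

theorem Linked.symm {a b : Γ.H} (h : Γ.Linked F a b) : Γ.Linked F b a := Relation.EqvGen.symm _ _ h

theorem Linked.trans {a b c : Γ.H} (h : Γ.Linked F a b) (h' : Γ.Linked F b c) : Γ.Linked F a c :=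
  Relation.EqvGen.trans _ _ _ h h'

theorem linked_rot (F : Set Γ.H) (a : Γ.H) : Γ.Linked F a (Γ.rot a) := .rel _ _ (Or.inl rfl)

theorem linked_flip {a : Γ.H} (h : a ∈ F) : Γ.Linked F a (Γ.flip a) := .rel _ _ (Or.inr ⟨h, rfl⟩)

/-- An equivalence relation that is compatible with `rot` and with `flip` on `F` contains
`Linked F`. -/
theorem Linked.rec_on {p : Γ.H → Γ.H → Prop} (hp : Equivalence p) (h1 : ∀ a, p a (Γ.rot a))
    (h2 : ∀ a ∈ F, p a (Γ.flip a)) {a b : Γ.H} (h : Γ.Linked F a b) : p a b := by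
  induction h with
  | rel a b h =>
    rcases h with rfl | ⟨h, rfl⟩
    · exact h1 a
    · exact h2 a h
  | refl a => exact hp.refl a
  | symm a b _ ih => exact hp.symm ih
  | trans a b c _ _ ih ih' => exact hp.trans ih ih'

theorem linked_equivalence (F : Set Γ.H) : Equivalence (Γ.Linked F) :=
  ⟨Linked.refl F, Linked.symm, Linked.trans⟩

theorem Linked.mono (h : F ⊆ F') {a b : Γ.H} (hab : Γ.Linked F a b) : Γ.Linked F' a b :=
  hab.rec_on (linked_equivalence F') (linked_rot F') fun _ ha => linked_flip (h ha)

theorem linked_of_vert_eq (F : Set Γ.H) {a b : Γ.H} (h : Γ.vert a = Γ.vert b) :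
    Γ.Linked F a b := by
  obtain ⟨n, rfl⟩ := (vert_eq_iff.1 h).exists_nat_pow_eq
  clear h
  induction n with
  | zero => exact Linked.refl F a
  | succ n ih =>
    rw [pow_succ', Equiv.Perm.mul_apply]
    exact ih.trans (linked_rot F _)

theorem linked_empty_iff {a b : Γ.H} : Γ.Linked ∅ a b ↔ Γ.vert a = Γ.vert b := by
  refine ⟨fun h => ?_, linked_of_vert_eq ∅⟩
  exact h.rec_on (p := fun a b => Γ.vert a = Γ.vert b) ⟨fun _ => rfl, Eq.symm, Eq.trans⟩
    (fun a => (vert_rot a).symm) fun _ h => h.elim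

/-- The spanning subgraph without the edge of `a`. -/
def cut (Γ : RibbonGraph Ω) (F : Set Γ.H) (a : Γ.H) : Set Γ.H := F \ {a, Γ.flip a}

theorem cut_subset (F : Set Γ.H) (a : Γ.H) : Γ.cut F a ⊆ F := Set.sdiff_subset

theorem mem_cut {a b : Γ.H} : b ∈ Γ.cut F a ↔ b ∈ F ∧ b ≠ a ∧ b ≠ Γ.flip a := by
  simp [cut]

theorem flip_eq_iff {a b : Γ.H} : Γ.flip a = b ↔ a = Γ.flip b := by
  constructor
  · rintro rfl; rw [Γ.flip_flip]
  · rintro rfl; rw [Γ.flip_flip]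

theorem cut_flip (F : Set Γ.H) (a : Γ.H) : Γ.cut F (Γ.flip a) = Γ.cut F a := by
  rw [cut, cut, Γ.flip_flip, Set.pair_comm]

theorem cut_closed (hF : ∀ a ∈ F, Γ.flip a ∈ F) (a : Γ.H) :
    ∀ b ∈ Γ.cut F a, Γ.flip b ∈ Γ.cut F a := by
  intro b hb
  rw [mem_cut] at hb ⊢
  refine ⟨hF b hb.1, fun h => hb.2.2 (flip_eq_iff.1 h), fun h => hb.2.1 (Γ.flip.injective h)⟩

/-- A path needs to use the edge of `a` at most once. Formally, the right-hand side is an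
equivalence relation that contains the generating steps. -/
theorem linked_cut {a : Γ.H} (ha : a ∈ F) {x y : Γ.H} : Γ.Linked F x y ↔
    Γ.Linked (Γ.cut F a) x y ∨
      (Γ.Linked (Γ.cut F a) x a ∧ Γ.Linked (Γ.cut F a) (Γ.flip a) y) ∨
      (Γ.Linked (Γ.cut F a) x (Γ.flip a) ∧ Γ.Linked (Γ.cut F a) a y) := by
  have hr := Linked.refl (Γ.cut F a)
  constructor
  · intro h
    refine h.rec_on (p := fun x y => Γ.Linked (Γ.cut F a) x y ∨
      (Γ.Linked (Γ.cut F a) x a ∧ Γ.Linked (Γ.cut F a) (Γ.flip a) y) ∨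
      (Γ.Linked (Γ.cut F a) x (Γ.flip a) ∧ Γ.Linked (Γ.cut F a) a y)) ⟨fun x => Or.inl (hr x), ?_, ?_⟩
      (fun x => Or.inl (linked_rot _ x)) fun x hx => ?_
    · intro x y h
      rcases h with h | ⟨h, h'⟩ | ⟨h, h'⟩
      · exact Or.inl h.symm
      · exact Or.inr (Or.inr ⟨h'.symm, h.symm⟩)
      · exact Or.inr (Or.inl ⟨h'.symm, h.symm⟩)
    · intro x y z h k
      rcases h with h | ⟨h, h'⟩ | ⟨h, h'⟩ <;> rcases k with k | ⟨k, k'⟩ | ⟨k, k'⟩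
      · exact Or.inl (h.trans k)
      · exact Or.inr (Or.inl ⟨h.trans k, k'⟩)
      · exact Or.inr (Or.inr ⟨h.trans k, k'⟩)
      · exact Or.inr (Or.inl ⟨h, h'.trans k⟩)
      · exact Or.inl (h.trans ((h'.trans k).symm.trans k'))
      · exact Or.inl (h.trans k')
      · exact Or.inr (Or.inr ⟨h, h'.trans k⟩)
      · exact Or.inl (h.trans k')
      · exact Or.inl (h.trans ((h'.trans k).symm.trans k'))
    · by_cases h1 : x = a
      · subst h1; exact Or.inr (Or.inl ⟨hr _, hr _⟩)
      by_cases h2 : x = Γ.flip a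
      · subst h2; rw [Γ.flip_flip]; exact Or.inr (Or.inr ⟨hr _, hr _⟩)
      · exact Or.inl (linked_flip (mem_cut.2 ⟨hx, h1, h2⟩))
  · have hm := fun {x y} (h : Γ.Linked (Γ.cut F a) x y) => h.mono (cut_subset F a)
    rintro (h | ⟨h, h'⟩ | ⟨h, h'⟩)
    · exact hm h
    · exact (hm h).trans ((linked_flip ha).trans (hm h'))
    · exact (hm h).trans ((linked_flip ha).symm.trans (hm h'))

/-- The vertices of the component of `h`. -/
def compVerts (Γ : RibbonGraph Ω) (F : Set Γ.H) (h : Γ.H) : Set Γ.Vertex :=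
  {v | ∃ a, Γ.Linked F h a ∧ Γ.vert a = v}

/-- The edges of the component of `h`. -/
def compEdges (Γ : RibbonGraph Ω) (F : Set Γ.H) (h : Γ.H) : Set Γ.Edge :=
  {e | ∃ a ∈ F, Γ.Linked F h a ∧ Γ.edge a = e}

theorem vert_mem_compVerts {h a : Γ.H} : Γ.vert a ∈ Γ.compVerts F h ↔ Γ.Linked F h a := by
  constructor
  · rintro ⟨b, hb, hab⟩
    exact hb.trans (linked_of_vert_eq F hab)
  · exact fun h => ⟨a, h, rfl⟩

theorem edge_mem_compEdges (hF : ∀ a ∈ F, Γ.flip a ∈ F) {h a : Γ.H} :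
    Γ.edge a ∈ Γ.compEdges F h ↔ a ∈ F ∧ Γ.Linked F h a := by
  constructor
  · rintro ⟨b, hb, hl, hab⟩
    rcases edge_eq_iff.1 hab with rfl | rfl
    · exact ⟨hb, hl⟩
    · exact ⟨hF b hb, hl.trans (linked_flip hb)⟩
  · exact fun h => ⟨a, h.1, h.2, rfl⟩

theorem vertex_ind {p : Γ.Vertex → Prop} (h : ∀ a, p (Γ.vert a)) (v : Γ.Vertex) : p v :=
  Quotient.ind h v

theorem edge_ind {p : Γ.Edge → Prop} (h : ∀ a, p (Γ.edge a)) (v : Γ.Edge) : p v :=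
  Quotient.ind h v

section counting

variable (hF : ∀ a ∈ F, Γ.flip a ∈ F) {a : Γ.H} (ha : a ∈ F) {h : Γ.H}
include hF ha

theorem compVerts_cut_of_not (hh : ¬ Γ.Linked F h a) :
    Γ.compVerts F h = Γ.compVerts (Γ.cut F a) h ∧
      Γ.compEdges F h = Γ.compEdges (Γ.cut F a) h := by
  have hl : ∀ b, Γ.Linked F h b ↔ Γ.Linked (Γ.cut F a) h b := by
    refine fun b => ⟨fun hb => ?_, fun hb => hb.mono (cut_subset F a)⟩
    rcases (linked_cut ha).1 hb with h' | ⟨h', -⟩ | ⟨h', -⟩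
    · exact h'
    · exact absurd (h'.mono (cut_subset F a)) hh
    · exact absurd ((h'.mono (cut_subset F a)).trans (linked_flip ha).symm) hh
  constructor
  · ext v
    induction v using vertex_ind with
    | _ b => rw [vert_mem_compVerts, vert_mem_compVerts, hl]
  · ext e
    induction e using edge_ind with
    | _ b =>
      rw [edge_mem_compEdges hF, edge_mem_compEdges (cut_closed hF a), hl, mem_cut]
      refine ⟨fun hb => ⟨⟨hb.1, ?_, ?_⟩, hb.2⟩, fun hb => ⟨hb.1.1, hb.2⟩⟩
      · rintro rfl
        exact hh ((hl _).2 hb.2)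
      · rintro rfl
        exact hh (((hl _).2 hb.2).trans (linked_flip ha).symm)

theorem compVerts_cut (hh : Γ.Linked F h a) :
    Γ.compVerts F h = Γ.compVerts (Γ.cut F a) a ∪ Γ.compVerts (Γ.cut F a) (Γ.flip a) ∧
      Γ.compEdges F h = insert (Γ.edge a)
        (Γ.compEdges (Γ.cut F a) a ∪ Γ.compEdges (Γ.cut F a) (Γ.flip a)) := by
  have hl : ∀ b, Γ.Linked F h b ↔ Γ.Linked (Γ.cut F a) a b ∨
      Γ.Linked (Γ.cut F a) (Γ.flip a) b := by
    intro b
    constructor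
    · intro hb
      rcases (linked_cut ha).1 (hh.symm.trans hb) with h' | ⟨-, h'⟩ | ⟨-, h'⟩
      · exact Or.inl h'
      · exact Or.inr h'
      · exact Or.inl h'
    · rintro (hb | hb)
      · exact hh.trans (hb.mono (cut_subset F a))
      · exact hh.trans ((linked_flip ha).trans (hb.mono (cut_subset F a)))
  constructor
  · ext v
    induction v using vertex_ind with
    | _ b => rw [Set.mem_union, vert_mem_compVerts, vert_mem_compVerts, vert_mem_compVerts, hl]
  · ext e
    induction e using edge_ind with
    | _ b =>
      rw [Set.mem_insert_iff, Set.mem_union, edge_mem_compEdges hF,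
        edge_mem_compEdges (cut_closed hF a), edge_mem_compEdges (cut_closed hF a), hl, mem_cut,
        eq_comm, edge_eq_iff]
      have h1 := Linked.refl (Γ.cut F a) a
      have h2 := Linked.refl (Γ.cut F a) (Γ.flip a)
      constructor
      · rintro ⟨h3, h4⟩
        tauto
      · rintro ((rfl | rfl) | h)
        · exact ⟨ha, Or.inl h1⟩
        · exact ⟨hF _ ha, Or.inr h2⟩
        · tauto

theorem edge_notMem_compEdges_cut (b : Γ.H) : Γ.edge a ∉ Γ.compEdges (Γ.cut F a) b := by
  rw [edge_mem_compEdges (cut_closed hF a), mem_cut]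
  tauto

theorem ncard_comp_of_linked (hh : Γ.Linked F h a) (hl : Γ.Linked (Γ.cut F a) a (Γ.flip a)) :
    (Γ.compVerts F h).ncard = (Γ.compVerts (Γ.cut F a) a).ncard ∧
      (Γ.compEdges F h).ncard = (Γ.compEdges (Γ.cut F a) a).ncard + 1 := by
  obtain ⟨h1, h2⟩ := compVerts_cut hF ha hh
  have h3 : Γ.compVerts (Γ.cut F a) (Γ.flip a) = Γ.compVerts (Γ.cut F a) a := by
    ext v
    induction v using vertex_ind with
    | _ b =>
      rw [vert_mem_compVerts, vert_mem_compVerts]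
      exact ⟨hl.trans, hl.symm.trans⟩
  have h4 : Γ.compEdges (Γ.cut F a) (Γ.flip a) = Γ.compEdges (Γ.cut F a) a := by
    ext v
    induction v using edge_ind with
    | _ b =>
      rw [edge_mem_compEdges (cut_closed hF a), edge_mem_compEdges (cut_closed hF a)]
      exact and_congr_right fun _ => ⟨hl.trans, hl.symm.trans⟩
  rw [h3, Set.union_self] at h1
  rw [h4, Set.union_self] at h2
  rw [h1, h2, Set.ncard_insert_of_notMem (edge_notMem_compEdges_cut hF ha a) (Set.toFinite _)]
  exact ⟨rfl, rfl⟩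

theorem ncard_comp_of_not_linked (hh : Γ.Linked F h a)
    (hl : ¬ Γ.Linked (Γ.cut F a) a (Γ.flip a)) :
    (Γ.compVerts F h).ncard = (Γ.compVerts (Γ.cut F a) a).ncard +
        (Γ.compVerts (Γ.cut F a) (Γ.flip a)).ncard ∧
      (Γ.compEdges F h).ncard = (Γ.compEdges (Γ.cut F a) a).ncard +
        (Γ.compEdges (Γ.cut F a) (Γ.flip a)).ncard + 1 := by
  obtain ⟨h1, h2⟩ := compVerts_cut hF ha hh
  have hd : ∀ b, Γ.Linked (Γ.cut F a) a b → ¬ Γ.Linked (Γ.cut F a) (Γ.flip a) b :=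
    fun b hb hb' => hl (hb.trans hb'.symm)
  rw [h1, h2, Set.ncard_insert_of_notMem _ (Set.toFinite _),
    Set.ncard_union_eq _ (Set.toFinite _) (Set.toFinite _),
    Set.ncard_union_eq _ (Set.toFinite _) (Set.toFinite _)]
  · exact ⟨rfl, rfl⟩
  · rw [Set.disjoint_left]
    intro e
    induction e using edge_ind with
    | _ b =>
      rw [edge_mem_compEdges (cut_closed hF a), edge_mem_compEdges (cut_closed hF a)]
      exact fun h h' => hd b h.2 h'.2
  · rw [Set.disjoint_left]
    intro v
    induction v using vertex_ind with
    | _ b =>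
      rw [vert_mem_compVerts, vert_mem_compVerts]
      exact hd b
  · rw [Set.mem_union, not_or]
    exact ⟨edge_notMem_compEdges_cut hF ha _, edge_notMem_compEdges_cut hF ha _⟩

end counting

theorem ncard_comp_empty (h : Γ.H) : (Γ.compVerts ∅ h).ncard = 1 ∧ (Γ.compEdges ∅ h).ncard = 0 := by
  constructor
  · rw [Set.ncard_eq_one]
    refine ⟨Γ.vert h, ?_⟩
    ext v
    induction v using vertex_ind with
    | _ b => rw [vert_mem_compVerts, linked_empty_iff, Set.mem_singleton_iff, eq_comm]
  · rw [Set.ncard_eq_zero (Set.toFinite _)]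
    ext e
    simp [compEdges]

theorem ncard_cut_lt {a : Γ.H} (ha : a ∈ F) : (Γ.cut F a).ncard < F.ncard := by
  refine Set.ncard_lt_ncard ⟨cut_subset F a, fun h => ?_⟩ (Set.toFinite _)
  exact (mem_cut.1 (h ha)).2.1 rfl

/-- Every edge of the spanning subgraph `F` is a bridge. -/
def Bridges (Γ : RibbonGraph Ω) (F : Set Γ.H) : Prop :=
  ∀ a ∈ F, ¬ Γ.Linked (Γ.cut F a) a (Γ.flip a)

theorem Bridges.mono (hF' : Γ.Bridges F') (h : F ⊆ F') : Γ.Bridges F :=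
  fun a ha hl => hF' a (h ha) (hl.mono (Set.sdiff_subset_sdiff_left h))

/-- Removing an edge that is not a bridge keeps the vertices of the component and loses one edge;
removing a bridge leaves two components that share its vertices and remaining edges. The inequality
follows by induction, with equality if only bridges occur. -/
theorem ncard_comp : ∀ (n : ℕ) (F : Set Γ.H), F.ncard = n → (∀ a ∈ F, Γ.flip a ∈ F) → ∀ h,
    (Γ.compVerts F h).ncard ≤ (Γ.compEdges F h).ncard + 1 ∧
      (Γ.Bridges F → (Γ.compVerts F h).ncard = (Γ.compEdges F h).ncard + 1) := by
  intro n
  induction n using Nat.strong_induction_on with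
  | _ n ih =>
    intro F hn hF h
    rcases F.eq_empty_or_nonempty with rfl | ⟨a, ha⟩
    · rw [(ncard_comp_empty h).1, (ncard_comp_empty h).2]
      simp
    have ih' := ih _ (hn ▸ ncard_cut_lt ha) (Γ.cut F a) rfl (cut_closed hF a)
    by_cases hh : Γ.Linked F h a
    · by_cases hl : Γ.Linked (Γ.cut F a) a (Γ.flip a)
      · obtain ⟨h1, h2⟩ := ncard_comp_of_linked hF ha hh hl
        rw [h1, h2]
        have := (ih' a).1
        exact ⟨by omega, fun h => absurd hl (h a ha)⟩
      · obtain ⟨h1, h2⟩ := ncard_comp_of_not_linked hF ha hh hl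
        rw [h1, h2]
        refine ⟨?_, fun hb => ?_⟩
        · have := (ih' a).1
          have := (ih' (Γ.flip a)).1
          omega
        · have := (ih' a).2 (hb.mono (cut_subset F a))
          have := (ih' (Γ.flip a)).2 (hb.mono (cut_subset F a))
          omega
    · obtain ⟨h1, h2⟩ := compVerts_cut_of_not hF ha hh
      rw [h1, h2]
      exact ⟨(ih' h).1, fun hb => (ih' h).2 (hb.mono (cut_subset F a))⟩

/-- If some edge of a forest were not a bridge, the component without this edge would violate the
inequality of `ncard_comp`. Unlike the count of vertices and edges, the bridge condition passes
directly to subsets. -/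
theorem isForest_iff : Γ.IsForest F ↔ (∀ a ∈ F, Γ.flip a ∈ F) ∧ Γ.Bridges F := by
  constructor
  · rintro ⟨hF, hc⟩
    refine ⟨hF, fun a ha hl => ?_⟩
    have h0 : (Γ.compVerts F a).ncard = (Γ.compEdges F a).ncard + 1 := hc a
    obtain ⟨h1, h2⟩ := ncard_comp_of_linked hF ha (Linked.refl F a) hl
    have := (ncard_comp _ (Γ.cut F a) rfl (cut_closed hF a) a).1
    omega
  · rintro ⟨hF, hb⟩
    exact ⟨hF, fun h => (ncard_comp _ F rfl hF h).2 hb⟩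

end RibbonGraph

/-! ### Walking around the trees of a forest -/

/-- A transposition of elements of two different cycles merges these cycles: from `a` the product
jumps into the cycle of `b` and runs around it once. -/
theorem pow_mul_swap {X : Type u} [DecidableEq X] (σ : Equiv.Perm X) {a b : X} (h : ¬ σ.SameCycle a b) :
    ∀ j, 0 < j → j ≤ Function.minimalPeriod σ b →
      ((σ * Equiv.swap a b) ^ j) a = (σ ^ j) b := by
  intro j
  induction j with
  | zero => exact fun h => absurd h (lt_irrefl _)
  | succ j ih =>
    intro _ hj
    rcases Nat.eq_zero_or_pos j with rfl | h0
    · simp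
    rw [pow_succ', Equiv.Perm.mul_apply, ih h0 (by omega), pow_succ', Equiv.Perm.mul_apply,
      Equiv.Perm.mul_apply, Equiv.swap_apply_of_ne_of_ne]
    · intro h'
      exact h (h' ▸ (Equiv.Perm.sameCycle_pow_left.2 (Equiv.Perm.SameCycle.refl σ b)))
    · intro h'
      have h2 : Function.IsPeriodicPt σ j b := by
        rw [Function.IsPeriodicPt, Function.IsFixedPt, ← Equiv.Perm.coe_pow]
        exact h'
      exact absurd (h2.minimalPeriod_le h0) (by omega)

theorem exists_pow_le_minimalPeriod {X : Type u} [Finite X] {σ : Equiv.Perm X} {b z : X} (h : σ.SameCycle b z) :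
    ∃ j, 0 < j ∧ j ≤ Function.minimalPeriod σ b ∧ (σ ^ j) b = z := by
  obtain ⟨n, rfl⟩ := h.exists_nat_pow_eq
  have hp : 0 < Function.minimalPeriod σ b := Function.minimalPeriod_pos_of_mem_periodicPts
    (σ.injective.mem_periodicPts b)
  have hmod : (σ ^ (n % Function.minimalPeriod σ b)) b = (σ ^ n) b := by
    rw [Equiv.Perm.coe_pow, Equiv.Perm.coe_pow, Function.iterate_mod_minimalPeriod_eq]
  rcases Nat.eq_zero_or_pos (n % Function.minimalPeriod σ b) with h0 | h0
  · refine ⟨_, hp, le_rfl, ?_⟩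
    rw [← hmod, h0, Equiv.Perm.coe_pow, Function.iterate_minimalPeriod]
    rfl
  · exact ⟨_, h0, (Nat.mod_lt _ hp).le, hmod⟩

theorem sameCycle_mul_swap_of {X : Type u} [Finite X] [DecidableEq X] {σ : Equiv.Perm X} {a b z : X}
    (h : ¬ σ.SameCycle a b) (hz : σ.SameCycle b z) : (σ * Equiv.swap a b).SameCycle a z := by
  obtain ⟨j, h1, h2, rfl⟩ := exists_pow_le_minimalPeriod hz
  rw [← pow_mul_swap σ h j h1 h2]
  exact Equiv.Perm.sameCycle_pow_right.2 (Equiv.Perm.SameCycle.refl _ _)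

theorem sameCycle_mul_swap {X : Type u} [Finite X] [DecidableEq X] {σ : Equiv.Perm X} {a b x y : X}
    (h : ¬ σ.SameCycle a b) (hxy : σ.SameCycle x y) : (σ * Equiv.swap a b).SameCycle x y := by
  by_cases hb : σ.SameCycle b x
  · exact (sameCycle_mul_swap_of h hb).symm.trans (sameCycle_mul_swap_of h (hb.trans hxy))
  by_cases ha : σ.SameCycle a x
  · have h' : ¬ σ.SameCycle b a := fun h' => h h'.symm
    rw [Equiv.swap_comm]
    exact (sameCycle_mul_swap_of h' ha).symm.trans (sameCycle_mul_swap_of h' (ha.trans hxy))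
  obtain ⟨n, rfl⟩ := hxy.exists_nat_pow_eq
  have : ((σ * Equiv.swap a b) ^ n) x = (σ ^ n) x := by
    clear hxy
    induction n with
    | zero => rfl
    | succ n ih =>
      rw [pow_succ', Equiv.Perm.mul_apply, ih, pow_succ', Equiv.Perm.mul_apply,
        Equiv.Perm.mul_apply, Equiv.swap_apply_of_ne_of_ne]
      · rintro rfl
        exact ha (Equiv.Perm.sameCycle_pow_left.2 (Equiv.Perm.SameCycle.refl _ _))
      · rintro rfl
        exact hb (Equiv.Perm.sameCycle_pow_left.2 (Equiv.Perm.SameCycle.refl _ _))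
  rw [← this]
  exact Equiv.Perm.sameCycle_pow_right.2 (Equiv.Perm.SameCycle.refl _ _)

namespace RibbonGraph

variable {Ω : Type u} {Γ : RibbonGraph Ω} {F : Set Γ.H}

/-- The involution that is `flip` on `F` and the identity elsewhere. -/
noncomputable def tau (Γ : RibbonGraph Ω) (F : Set Γ.H) : Equiv.Perm Γ.H :=
  Function.Involutive.toPerm (fun x => if x ∈ F ∧ Γ.flip x ∈ F then Γ.flip x else x) (by
    intro x
    by_cases h : x ∈ F ∧ Γ.flip x ∈ F
    · simp [h.1, h.2, Γ.flip_flip]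
    · simp only [if_neg h])

theorem tau_apply (x : Γ.H) :
    Γ.tau F x = if x ∈ F ∧ Γ.flip x ∈ F then Γ.flip x else x := rfl

theorem tau_of_mem (hF : ∀ a ∈ F, Γ.flip a ∈ F) {x : Γ.H} (h : x ∈ F) : Γ.tau F x = Γ.flip x := by
  rw [tau_apply, if_pos ⟨h, hF x h⟩]

theorem tau_of_notMem {x : Γ.H} (h : x ∉ F) : Γ.tau F x = x := by
  rw [tau_apply, if_neg fun h' => h h'.1]

theorem tau_tau (x : Γ.H) : Γ.tau F (Γ.tau F x) = x :=
  Function.Involutive.toPerm_involutive _ x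

/-- Walking around the components of `F`: at a half-edge of `F` walk along its edge, then turn. -/
noncomputable def turn (Γ : RibbonGraph Ω) (F : Set Γ.H) : Equiv.Perm Γ.H := Γ.rot * Γ.tau F

theorem turn_apply (x : Γ.H) : Γ.turn F x = Γ.rot (Γ.tau F x) := rfl

theorem turn_of_mem (hF : ∀ a ∈ F, Γ.flip a ∈ F) {x : Γ.H} (h : x ∈ F) :
    Γ.turn F x = Γ.rot (Γ.flip x) := by rw [turn_apply, tau_of_mem hF h]

theorem turn_of_notMem {x : Γ.H} (h : x ∉ F) : Γ.turn F x = Γ.rot x := by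
  rw [turn_apply, tau_of_notMem h]

theorem turn_tau (x : Γ.H) : Γ.turn F (Γ.tau F x) = Γ.rot x := by rw [turn_apply, tau_tau]

theorem linked_tau (hF : ∀ a ∈ F, Γ.flip a ∈ F) (x : Γ.H) : Γ.Linked F x (Γ.tau F x) := by
  by_cases h : x ∈ F
  · rw [tau_of_mem hF h]; exact linked_flip h
  · rw [tau_of_notMem h]; exact Linked.refl F x

theorem linked_turn (hF : ∀ a ∈ F, Γ.flip a ∈ F) (x : Γ.H) : Γ.Linked F x (Γ.turn F x) :=
  (linked_tau hF x).trans (linked_rot F _)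

theorem linked_of_sameCycle (hF : ∀ a ∈ F, Γ.flip a ∈ F) {x y : Γ.H}
    (h : (Γ.turn F).SameCycle x y) : Γ.Linked F x y := by
  obtain ⟨n, rfl⟩ := h.exists_nat_pow_eq
  clear h
  induction n with
  | zero => exact Linked.refl F x
  | succ n ih =>
    rw [pow_succ', Equiv.Perm.mul_apply]
    exact ih.trans (linked_turn hF _)

/-- Adding an edge to the forest multiplies the walk by the transposition of its halves. -/
theorem turn_cut (hF : ∀ a ∈ F, Γ.flip a ∈ F) {a : Γ.H} (ha : a ∈ F) :
    Γ.turn F = Γ.turn (Γ.cut F a) * Equiv.swap a (Γ.flip a) := by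
  ext1 x
  rw [Equiv.Perm.mul_apply, turn_apply, turn_apply]
  congr 1
  by_cases h1 : x = a
  · subst h1
    rw [Equiv.swap_apply_left, tau_of_mem hF ha, tau_of_notMem]
    rw [mem_cut]; tauto
  by_cases h2 : x = Γ.flip a
  · subst h2
    rw [Equiv.swap_apply_right, tau_of_mem hF (hF a ha), Γ.flip_flip, tau_of_notMem]
    rw [mem_cut]; tauto
  rw [Equiv.swap_apply_of_ne_of_ne h1 h2]
  by_cases h3 : x ∈ F
  · rw [tau_of_mem hF h3, tau_of_mem (cut_closed hF a) (mem_cut.2 ⟨h3, h1, h2⟩)]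
  · rw [tau_of_notMem h3, tau_of_notMem fun h => h3 (cut_subset F a h)]

/-- There is a single closed walk around a tree: the halves of a bridge lie on different walks of
the smaller forest, and the transposition merges these walks just as the edge merges the components.
-/
theorem sameCycle_of_linked : ∀ (n : ℕ) (F : Set Γ.H), F.ncard = n → (∀ a ∈ F, Γ.flip a ∈ F) →
    Γ.Bridges F → ∀ {x y}, Γ.Linked F x y → (Γ.turn F).SameCycle x y := by
  intro n
  induction n using Nat.strong_induction_on with
  | _ n ih =>
    intro F hn hF hb x y hxy
    rcases F.eq_empty_or_nonempty with rfl | ⟨a, ha⟩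
    · have : Γ.turn ∅ = Γ.rot := by
        ext1 z
        exact turn_of_notMem (fun h => h.elim)
      rw [this]
      exact vert_eq_iff.1 (linked_empty_iff.1 hxy)
    have ih' := @ih _ (hn ▸ ncard_cut_lt ha) (Γ.cut F a) rfl (cut_closed hF a)
      (hb.mono (cut_subset F a))
    have hne : ¬ (Γ.turn (Γ.cut F a)).SameCycle a (Γ.flip a) := fun h =>
      hb a ha (linked_of_sameCycle (cut_closed hF a) h)
    have hab := sameCycle_mul_swap_of hne (Equiv.Perm.SameCycle.refl _ _)
    rw [turn_cut hF ha]
    rcases (linked_cut ha).1 hxy with h | ⟨h, h'⟩ | ⟨h, h'⟩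
    · exact sameCycle_mul_swap hne (ih' h)
    · exact (sameCycle_mul_swap hne (ih' h)).trans (hab.trans (sameCycle_mul_swap hne (ih' h')))
    · exact (sameCycle_mul_swap hne (ih' h)).trans
        (hab.symm.trans (sameCycle_mul_swap hne (ih' h')))

theorem linked_iff_sameCycle (hF : ∀ a ∈ F, Γ.flip a ∈ F) (hb : Γ.Bridges F) {x y : Γ.H} :
    Γ.Linked F x y ↔ (Γ.turn F).SameCycle x y :=
  ⟨sameCycle_of_linked _ F rfl hF hb, linked_of_sameCycle hF⟩

/-- The walk from `a` to `flip a` has length `n`; it runs around the part of the tree at the head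
of `a`. -/
structure IsArc (Γ : RibbonGraph Ω) (F : Set Γ.H) (a : Γ.H) (n : ℕ) : Prop where
  pos : 0 < n
  last : (Γ.turn F ^ n) a = Γ.flip a
  ne : ∀ i, 0 < i → i < n → (Γ.turn F ^ i) a ≠ Γ.flip a
  mem : ∀ z, Γ.Linked (Γ.cut F a) (Γ.flip a) z ↔ ∃ i, 0 < i ∧ i ≤ n ∧ (Γ.turn F ^ i) a = z

/-- The length is the period of `flip a` under the walk without the edge of `a`; with the edge
restored, the walk from `a` runs once around this cycle, by `pow_mul_swap`. -/
theorem exists_isArc (hF : ∀ a ∈ F, Γ.flip a ∈ F) (hb : Γ.Bridges F) {a : Γ.H} (ha : a ∈ F) :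
    ∃ n, Γ.IsArc F a n := by
  have hF' := cut_closed hF a
  have hb' := hb.mono (cut_subset F a)
  have hne : ¬ (Γ.turn (Γ.cut F a)).SameCycle a (Γ.flip a) := fun h =>
      hb a ha (linked_of_sameCycle hF' h)
  have hpow := pow_mul_swap _ hne
  rw [← turn_cut hF ha] at hpow
  have hp : 0 < Function.minimalPeriod (Γ.turn (Γ.cut F a)) (Γ.flip a) :=
    Function.minimalPeriod_pos_of_mem_periodicPts ((Γ.turn (Γ.cut F a)).injective.mem_periodicPts _)
  refine ⟨Function.minimalPeriod (Γ.turn (Γ.cut F a)) (Γ.flip a), hp, ?_, fun i hi hin h => ?_,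
    fun z => ?_⟩
  · rw [hpow _ hp le_rfl, Equiv.Perm.coe_pow, Function.iterate_minimalPeriod]
  · rw [hpow i hi hin.le] at h
    have h2 : Function.IsPeriodicPt (Γ.turn (Γ.cut F a)) i (Γ.flip a) := by
      rw [Function.IsPeriodicPt, Function.IsFixedPt, ← Equiv.Perm.coe_pow]
      exact h
    exact absurd (h2.minimalPeriod_le hi) (by omega)
  · rw [linked_iff_sameCycle hF' hb']
    constructor
    · intro h
      obtain ⟨j, h1, h2, rfl⟩ := exists_pow_le_minimalPeriod h
      exact ⟨j, h1, h2, hpow j h1 h2⟩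
    · rintro ⟨i, h1, h2, rfl⟩
      rw [hpow i h1 h2]
      exact Equiv.Perm.sameCycle_pow_right.2 (Equiv.Perm.SameCycle.refl _ _)

section arcs

variable (hF : ∀ a ∈ F, Γ.flip a ∈ F) (hb : Γ.Bridges F) {a : Γ.H} {n : ℕ}

include hF hb in
theorem IsArc.ne_self (ha : a ∈ F) (h : Γ.IsArc F a n) {i : ℕ} (h0 : 0 < i) (hi : i ≤ n) :
    (Γ.turn F ^ i) a ≠ a := by
  intro h'
  exact hb a ha ((h.mem a).2 ⟨i, h0, hi, h'⟩).symm

include hF in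
theorem IsArc.flip_mem (h : Γ.IsArc F a n) {i : ℕ} (h0 : 0 < i) (hi : i < n)
    (hb : Γ.Bridges F) (ha : a ∈ F) (hz : (Γ.turn F ^ i) a ∈ F) :
    ∃ j, 0 < j ∧ j < n ∧ (Γ.turn F ^ j) a = Γ.flip ((Γ.turn F ^ i) a) := by
  have h1 : (Γ.turn F ^ i) a ∈ Γ.cut F a :=
    mem_cut.2 ⟨hz, h.ne_self hF hb ha h0 hi.le, h.ne i h0 hi⟩
  have h2 := ((h.mem _).2 ⟨i, h0, hi.le, rfl⟩).trans (linked_flip h1)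
  obtain ⟨j, h3, h4, h5⟩ := (h.mem _).1 h2
  refine ⟨j, h3, lt_of_le_of_ne h4 ?_, h5⟩
  rintro rfl
  rw [h.last] at h5
  exact h.ne_self hF hb ha h0 hi.le (Γ.flip.injective h5).symm

include hF in
-- Arcs are nested. An arc contains both halves of each inner edge of the forest; the arc of the
-- half that is met first ends when the other half is met.
theorem IsArc.inner (h : Γ.IsArc F a n) {i : ℕ} (h0 : 0 < i) (hi : i < n)
    (hb : Γ.Bridges F) (ha : a ∈ F) (hz : (Γ.turn F ^ i) a ∈ F)
    {k : ℕ} (hk : Γ.IsArc F ((Γ.turn F ^ i) a) k) :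
    i + k < n ∨ ∃ j, 0 < j ∧ j < i ∧ (Γ.turn F ^ j) a = Γ.flip ((Γ.turn F ^ i) a) := by
  obtain ⟨j, h1, h2, h3⟩ := h.flip_mem hF h0 hi hb ha hz
  rcases lt_trichotomy j i with h4 | rfl | h4
  · exact Or.inr ⟨j, h1, h4, h3⟩
  · exact absurd h3.symm (Γ.flip_ne _)
  · left
    by_contra h5
    refine hk.ne (j - i) (by omega) (by omega) ?_
    rw [← h3, ← Equiv.Perm.mul_apply, ← pow_add]
    congr 2
    omega

theorem exists_rot_ne (x : Γ.H) : Γ.rot x ≠ x ∧ Γ.rot (Γ.rot x) ≠ x := by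
  have h := Γ.three_le_valence x
  have key : ∀ y, Γ.rot (Γ.rot x) = x → Γ.rot.SameCycle x y → y = x ∨ y = Γ.rot x := by
    intro y hx hy
    obtain ⟨n, rfl⟩ := hy.exists_nat_pow_eq
    clear hy
    induction n with
    | zero => exact Or.inl rfl
    | succ n ih =>
      rw [pow_succ', Equiv.Perm.mul_apply]
      rcases ih with ih | ih <;> rw [ih]
      · exact Or.inr rfl
      · exact Or.inl hx
  have h2 : Γ.rot (Γ.rot x) ≠ x := by
    intro hx
    have hsub : {h' : Γ.H | Γ.rot.SameCycle x h'} ⊆ {x, Γ.rot x} := fun y hy => by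
      simpa using key y hx hy
    have := Set.ncard_le_ncard hsub (Set.toFinite _)
    have := Set.ncard_insert_le x {Γ.rot x}
    rw [Set.ncard_singleton] at this
    omega
  exact ⟨fun hx => h2 (by rw [hx, hx]), h2⟩

include hF hb in
/-- Every arc contains a half-edge outside the forest. -/
theorem IsArc.exists_leaf : ∀ (n : ℕ) {a : Γ.H}, a ∈ F → Γ.IsArc F a n →
    ∃ j, 0 < j ∧ j < n ∧ (Γ.turn F ^ j) a ∉ F := by
  intro n
  induction n using Nat.strong_induction_on with
  | _ n ih =>
    intro a ha h
    have h1 : 1 < n := by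
      by_contra h1
      have hn : n = 1 := by have := h.pos; omega
      have := h.last
      rw [hn, pow_one, turn_of_mem hF ha] at this
      exact (exists_rot_ne _).1 this
    -- If the next half-edge belongs to the forest, its flip cannot have been met before, so its arc
    -- is shorter and lies inside.
    by_cases hy : (Γ.turn F ^ 1) a ∈ F
    · obtain ⟨k, hk⟩ := exists_isArc hF hb hy
      rcases h.inner hF one_pos h1 hb ha hy hk with h2 | ⟨j, h2, h3, -⟩
      · obtain ⟨j, h3, h4, h5⟩ := ih k (by omega) hy hk
        refine ⟨j + 1, by omega, by omega, ?_⟩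
        rwa [pow_add]
      · omega
    · exact ⟨1, one_pos, h1, hy⟩

include hF hb in
/-- The arc of the next half-edge in an arc misses a half-edge outside the forest. -/
theorem IsArc.exists_leaf_after (ha : a ∈ F) (h : Γ.IsArc F a n) (hy : (Γ.turn F ^ 1) a ∈ F)
    {k : ℕ} (hk : Γ.IsArc F ((Γ.turn F ^ 1) a) k) :
    k + 1 < n ∧ ∃ j, k + 1 < j ∧ j < n ∧ (Γ.turn F ^ j) a ∉ F := by
  have h1 : 1 < n := by
    obtain ⟨j, h1, h2, -⟩ := h.exists_leaf hF hb _ ha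
    omega
  have h2 : 1 + k < n := by
    rcases h.inner hF one_pos h1 hb ha hy hk with h2 | ⟨j, h2, h3, -⟩
    · exact h2
    · omega
  refine ⟨by omega, ?_⟩
  have hlast : (Γ.turn F ^ (k + 1)) a = Γ.flip ((Γ.turn F ^ 1) a) := by
    rw [← hk.last, pow_add]; rfl
  -- After the inner arc the walk is back at the head of `a` and turns to the second half-edge after
  -- `flip a`, which differs from `flip a` as the valence is at least three.
  have hz : (Γ.turn F ^ (k + 2)) a = Γ.rot (Γ.rot (Γ.flip a)) := by
    rw [show k + 2 = 1 + (k + 1) by omega, pow_add, Equiv.Perm.mul_apply, hlast, pow_one,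
      turn_of_mem hF (hF _ (by simpa using hy)), Γ.flip_flip, turn_of_mem hF ha]
  have h3 : k + 2 < n := by
    by_contra h3
    have hn : n = k + 2 := by omega
    have := h.last
    rw [hn, hz] at this
    exact (exists_rot_ne _).2 this
  by_cases hw : (Γ.turn F ^ (k + 2)) a ∈ F
  · obtain ⟨l, hl⟩ := exists_isArc hF hb hw
    rcases h.inner hF (by omega) h3 hb ha hw hl with h4 | ⟨j, h4, h5, h6⟩
    · obtain ⟨j, h5, h6, h7⟩ := hl.exists_leaf hF hb _ hw
      refine ⟨j + (k + 2), by omega, by omega, ?_⟩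
      rwa [pow_add]
    -- If the flip of this half-edge had been met earlier, it would have been at the start, at the
    -- end or inside of the inner arc; in each case the half-edge itself belongs to an earlier place
    -- of the walk.
    · exfalso
      rcases (by omega : j = 1 ∨ j = k + 1 ∨ (1 < j ∧ j < k + 1)) with rfl | rfl | ⟨h7, h8⟩
      · rw [h6, Γ.flip_flip] at hlast
        have h9 : (Γ.turn F ^ (k + 1)) a = (Γ.turn F ^ (k + 2)) a := hlast
        rw [show k + 2 = (k + 1) + 1 by omega, pow_succ, Equiv.Perm.mul_apply] at h9
        have h10 := (Γ.turn F ^ (k + 1)).injective h9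
        exact h.ne_self hF hb ha one_pos h1.le (by rw [pow_one]; exact h10.symm)
      · rw [hlast] at h6
        have h9 := Γ.flip.injective h6
        rw [show k + 2 = (k + 1) + 1 by omega, pow_succ (n := k + 1)] at h9
        have h9' : (Γ.turn F ^ 1) a = (Γ.turn F ^ 1) ((Γ.turn F ^ (k + 1)) a) := by
          rw [h9, ← Equiv.Perm.mul_apply, pow_one, ← pow_succ, ← pow_succ']
        exact h.ne_self hF hb ha (by omega) (by omega) ((Γ.turn F ^ 1).injective h9').symm
      · have h9 : (Γ.turn F ^ (j - 1)) ((Γ.turn F ^ 1) a) = (Γ.turn F ^ j) a := by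
          rw [← Equiv.Perm.mul_apply, ← pow_add]; congr 2; omega
        have h10 : (Γ.turn F ^ (j - 1)) ((Γ.turn F ^ 1) a) ∈ F := by
          rw [h9, h6]; exact hF _ hw
        obtain ⟨i, h11, h12, h13⟩ := hk.flip_mem hF (by omega) (by omega) hb hy h10
        rw [h9, h6, Γ.flip_flip, ← Equiv.Perm.mul_apply, ← pow_add] at h13
        have h14 : (Γ.turn F ^ (i + 1)) a = (Γ.turn F ^ (i + 1)) ((Γ.turn F ^ (k + 1 - i)) a) := by
          rw [h13, ← Equiv.Perm.mul_apply, ← pow_add]; congr 2; omega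
        exact h.ne_self hF hb ha (by omega) (by omega) ((Γ.turn F ^ (i + 1)).injective h14).symm
  · exact ⟨k + 2, by omega, h3, hw⟩

end arcs

end RibbonGraph

namespace RibbonGraph

variable {Ω : Type u} {Γ Γ₀ : RibbonGraph Ω}

/-! ### Positions of half-edges at their vertices -/

theorem valence_vert (h : Γ.H) : Γ.valence (Γ.vert h) = Function.minimalPeriod Γ.rot h := by
  have hp : 0 < Function.minimalPeriod Γ.rot h := Function.minimalPeriod_pos_of_mem_periodicPts
    (Γ.rot.injective.mem_periodicPts h)
  have hset : {h' : Γ.H | Γ.vert h' = Γ.vert h} =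
      (fun i => (Γ.rot ^ i) h) '' (Set.Iio (Function.minimalPeriod Γ.rot h)) := by
    ext x
    simp only [Set.mem_ofPred_eq, Set.mem_image, Set.mem_Iio]
    constructor
    · intro hx
      obtain ⟨n, rfl⟩ := (vert_eq_iff.1 hx.symm).exists_nat_pow_eq
      refine ⟨n % Function.minimalPeriod Γ.rot h, Nat.mod_lt _ hp, ?_⟩
      rw [Equiv.Perm.coe_pow, Equiv.Perm.coe_pow, Function.iterate_mod_minimalPeriod_eq]
    · rintro ⟨i, -, rfl⟩
      exact vert_eq_iff.2 (Equiv.Perm.sameCycle_pow_left.2 (Equiv.Perm.SameCycle.refl _ _))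
  rw [valence, hset, Set.InjOn.ncard_image]
  · simp [Set.ncard_eq_toFinset_card']
  · intro i hi j hj hij
    simp only [Equiv.Perm.coe_pow] at hij
    exact (Function.iterate_eq_iterate_iff_of_lt_minimalPeriod hi hj).1 hij

theorem three_le_valence' (h : Γ.H) : 3 ≤ Γ.valence (Γ.vert h) := by
  have := Γ.three_le_valence h
  rw [valence]
  convert this using 4
  rw [eq_comm, vert_eq_iff]

theorem vert_pow (i : ℕ) (h : Γ.H) : Γ.vert ((Γ.rot ^ i) h) = Γ.vert h :=
  vert_eq_iff.2 (Equiv.Perm.sameCycle_pow_left.2 (Equiv.Perm.SameCycle.refl _ _))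

theorem vert_out (v : Γ.Vertex) : Γ.vert (Quotient.out v) = v := Quotient.out_eq v

theorem exists_pos (h : Γ.H) : ∃ i, i < Γ.valence (Γ.vert h) ∧
    (Γ.rot ^ i) (Quotient.out (Γ.vert h)) = h := by
  have h1 := vert_out (Γ.vert h)
  obtain ⟨j, h2, h3, h4⟩ := exists_pow_le_minimalPeriod (vert_eq_iff.1 h1)
  rw [← valence_vert, h1] at h3
  rcases h3.lt_or_eq with h3 | h3
  · exact ⟨j, h3, h4⟩
  · refine ⟨0, by omega, ?_⟩
    have h5 : (Γ.rot ^ j) (Quotient.out (Γ.vert h)) = Quotient.out (Γ.vert h) := by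
      have h6 := valence_vert (Quotient.out (Γ.vert h))
      rw [h1] at h6
      rw [h3, h6, Equiv.Perm.coe_pow, Function.iterate_minimalPeriod]
    rw [pow_zero, Equiv.Perm.one_apply, ← h5, h4]

/-- The position of a half-edge in the cyclic order at its vertex. -/
noncomputable def pos (Γ : RibbonGraph Ω) (h : Γ.H) : ℕ := (exists_pos h).choose

theorem pos_lt (h : Γ.H) : Γ.pos h < Γ.valence (Γ.vert h) := (exists_pos h).choose_spec.1

theorem rot_pow_pos (h : Γ.H) : (Γ.rot ^ Γ.pos h) (Quotient.out (Γ.vert h)) = h :=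
  (exists_pos h).choose_spec.2

theorem pos_eq {h : Γ.H} {i : ℕ} (hi : i < Γ.valence (Γ.vert h))
    (h1 : (Γ.rot ^ i) (Quotient.out (Γ.vert h)) = h) : Γ.pos h = i := by
  have h2 := (rot_pow_pos h).trans h1.symm
  rw [Equiv.Perm.coe_pow, Equiv.Perm.coe_pow] at h2
  refine (Function.iterate_eq_iterate_iff_of_lt_minimalPeriod ?_ ?_).1 h2
  · rw [← valence_vert, vert_out]; exact pos_lt h
  · rw [← valence_vert, vert_out]; exact hi

theorem exists_of_pos {v : Γ.Vertex} {i : ℕ} (hi : i < Γ.valence v) :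
    ∃ h, Γ.vert h = v ∧ Γ.pos h = i := by
  have hv : Γ.vert ((Γ.rot ^ i) (Quotient.out v)) = v := by rw [vert_pow, vert_out]
  exact ⟨_, hv, pos_eq (by rw [hv]; exact hi) (by rw [hv])⟩

theorem eq_of_pos {h h' : Γ.H} (hv : Γ.vert h = Γ.vert h') (hp : Γ.pos h = Γ.pos h') : h = h' := by
  rw [← rot_pow_pos h, ← rot_pow_pos h', hv, hp]

theorem pos_rot (h : Γ.H) :
    Γ.pos (Γ.rot h) = if Γ.pos h + 1 = Γ.valence (Γ.vert h) then 0 else Γ.pos h + 1 := by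
  have h1 := pos_lt h
  refine pos_eq ?_ ?_
  · rw [vert_rot]
    split_ifs <;> omega
  · rw [vert_rot]
    have h2 : Γ.rot h = (Γ.rot ^ (Γ.pos h + 1)) (Quotient.out (Γ.vert h)) := by
      rw [pow_succ', Equiv.Perm.mul_apply, rot_pow_pos]
    rw [h2]
    split_ifs with h3
    · rw [h3, Equiv.Perm.coe_pow, Equiv.Perm.coe_pow]
      conv_rhs => rw [← vert_out (Γ.vert h), valence_vert, vert_out, Function.iterate_minimalPeriod]
      rfl
    · rfl

/-- The number of steps from `p` to `q` in the cyclic order at a vertex. -/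
noncomputable def dist (Γ : RibbonGraph Ω) (p q : Γ.H) : ℕ :=
  if Γ.pos p ≤ Γ.pos q then Γ.pos q - Γ.pos p else Γ.pos q + Γ.valence (Γ.vert p) - Γ.pos p

theorem dist_spec {p q : Γ.H} (h : Γ.vert p = Γ.vert q) :
    Γ.pos p < Γ.valence (Γ.vert p) ∧ Γ.pos q < Γ.valence (Γ.vert p) ∧
      ((Γ.pos p ≤ Γ.pos q ∧ Γ.dist p q = Γ.pos q - Γ.pos p) ∨
        (Γ.pos q < Γ.pos p ∧ Γ.dist p q = Γ.pos q + Γ.valence (Γ.vert p) - Γ.pos p)) := by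
  have := pos_lt p
  have := pos_lt q
  rw [← h] at this
  rw [dist]
  split_ifs <;> omega

theorem dist_self (p : Γ.H) : Γ.dist p p = 0 := by simp [dist]

theorem pos_rot_pow (p : Γ.H) : ∀ i, i < Γ.valence (Γ.vert p) →
    Γ.pos ((Γ.rot ^ i) p) = if Γ.pos p + i < Γ.valence (Γ.vert p) then Γ.pos p + i else
      Γ.pos p + i - Γ.valence (Γ.vert p) := by
  have := pos_lt p
  intro i
  induction i with
  | zero => intro _; simp [this]
  | succ i ih =>
    intro hi
    rw [pow_succ', Equiv.Perm.mul_apply, pos_rot, vert_pow, ih (by omega)]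
    split_ifs <;> omega

theorem dist_rot_pow (p : Γ.H) {i : ℕ} (hi : i < Γ.valence (Γ.vert p)) :
    Γ.dist p ((Γ.rot ^ i) p) = i := by
  have := pos_lt p
  rw [dist, pos_rot_pow p i hi]
  split_ifs <;> omega

/-- The key by which the pairs of half-edges at a vertex are ordered. -/
noncomputable def key (Γ : RibbonGraph Ω) (x : Γ.H × Γ.H) : ℕ ×ₗ ℤ :=
  toLex (Γ.pos x.1, -(Γ.dist x.1 x.2 : ℤ))

theorem key_lt {x y : Γ.H × Γ.H} : Γ.key x < Γ.key y ↔
    Γ.pos x.1 < Γ.pos y.1 ∨ (Γ.pos x.1 = Γ.pos y.1 ∧ Γ.dist y.1 y.2 < Γ.dist x.1 x.2) := by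
  rw [key, key, Prod.Lex.toLex_lt_toLex]
  simp

theorem key_le {x y : Γ.H × Γ.H} : Γ.key x ≤ Γ.key y ↔
    Γ.pos x.1 < Γ.pos y.1 ∨ (Γ.pos x.1 = Γ.pos y.1 ∧ Γ.dist y.1 y.2 ≤ Γ.dist x.1 x.2) := by
  rw [key, key, Prod.Lex.toLex_le_toLex]
  simp

/-! ### Morphisms -/

namespace Hom

variable (f : Hom Γ Γ₀)

/-- The half-edges of the forest that is collapsed by a morphism. -/
def coll : Set Γ.H := (Set.range f.pre)ᶜ

theorem closed : ∀ a ∈ f.coll, Γ.flip a ∈ f.coll := (isForest_iff.1 f.forest).1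

theorem bridges : Γ.Bridges f.coll := (isForest_iff.1 f.forest).2

theorem notMem_coll {x : Γ.H} : x ∉ f.coll ↔ ∃ h, f.pre h = x := by
  simp [coll]

theorem pre_notMem (h : Γ₀.H) : f.pre h ∉ f.coll := f.notMem_coll.2 ⟨h, rfl⟩

end Hom

theorem iterate_eq_turn {F : Set Γ.H} (hF : ∀ a ∈ F, Γ.flip a ∈ F) {a : Γ.H} (ha : a ∉ F)
    (n : ℕ) : (∀ i < n, (fun x => Γ.rot (Γ.flip x))^[i] (Γ.rot a) ∈ F) ∨
      (∀ i < n, (Γ.turn F ^ (i + 1)) a ∈ F) → ∀ i ≤ n,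
      (fun x => Γ.rot (Γ.flip x))^[i] (Γ.rot a) = (Γ.turn F ^ (i + 1)) a := by
  intro h i
  induction i with
  | zero => intro _; rw [zero_add, pow_one, turn_of_notMem ha]; rfl
  | succ i ih =>
    intro hi
    have h1 := ih (by omega)
    have h2 : (Γ.turn F ^ (i + 1)) a ∈ F := by
      rcases h with h | h
      · rw [← h1]; exact h i (by omega)
      · exact h i (by omega)
    rw [Function.iterate_succ_apply', h1, pow_succ' _ (i + 1), Equiv.Perm.mul_apply,
      turn_of_mem hF h2]

/-- The shift by one arises because the first turn at the leaf `a` already is a step of the walk. -/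
theorem nextLeaf_iff {F : Set Γ.H} (hF : ∀ a ∈ F, Γ.flip a ∈ F) {a b : Γ.H} (ha : a ∉ F) :
    Γ.NextLeaf F a b ↔ b ∉ F ∧ ∃ n, (Γ.turn F ^ (n + 1)) a = b ∧
      ∀ i < n, (Γ.turn F ^ (i + 1)) a ∈ F := by
  refine and_congr_right fun _ => exists_congr fun n => ?_
  constructor
  · rintro ⟨h1, h2⟩
    have h3 := iterate_eq_turn hF ha n (Or.inl h2)
    exact ⟨by rw [← h3 n le_rfl, h1], fun i hi => by rw [← h3 i hi.le]; exact h2 i hi⟩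
  · rintro ⟨h1, h2⟩
    have h3 := iterate_eq_turn hF ha n (Or.inr h2)
    exact ⟨by rw [h3 n le_rfl, h1], fun i hi => by rw [h3 i hi.le]; exact h2 i hi⟩

namespace Hom

variable (f : Hom Γ Γ₀)

theorem turn_pre (h : Γ₀.H) : ∃ n, (Γ.turn f.coll ^ (n + 1)) (f.pre h) = f.pre (Γ₀.rot h) ∧
    ∀ i < n, (Γ.turn f.coll ^ (i + 1)) (f.pre h) ∈ f.coll :=
  ((nextLeaf_iff f.closed (f.pre_notMem h)).1 (f.pre_rot h)).2

/-- The first half-edge outside the forest on the walk that starts with `x` is `pre h`. -/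
def Reaches (x : Γ.H) (h : Γ₀.H) : Prop :=
  ∃ n, (Γ.turn f.coll ^ n) x = f.pre h ∧ ∀ i < n, (Γ.turn f.coll ^ i) x ∈ f.coll

theorem Reaches.unique {f : Hom Γ Γ₀} {x : Γ.H} {h h' : Γ₀.H} (hx : f.Reaches x h)
    (hx' : f.Reaches x h') : h = h' := by
  obtain ⟨n, h1, h2⟩ := hx
  obtain ⟨n', h1', h2'⟩ := hx'
  rcases lt_trichotomy n n' with hn | rfl | hn
  · exact absurd (h1 ▸ h2' n hn) (f.pre_notMem h)
  · exact f.pre_injective (h1.symm.trans h1')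
  · exact absurd (h1' ▸ h2 n' hn) (f.pre_notMem h')

/-- If the walk met forest half-edges only, the component of `x` would be closed under `rot` and
`flip`; by connectedness the forest would contain every half-edge, but `Γ₀` has half-edges. -/
theorem exists_reaches (x : Γ.H) : ∃ h, f.Reaches x h := by
  by_cases hall : ∀ n : ℕ, (Γ.turn f.coll ^ n) x ∈ f.coll
  · exfalso
    have hl : ∀ y, Γ.Linked f.coll x y → y ∈ f.coll := by
      intro y hy
      obtain ⟨n, rfl⟩ := ((linked_iff_sameCycle f.closed f.bridges).1 hy).exists_nat_pow_eq
      exact hall n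
    have hl2 : ∀ y, Γ.Linked f.coll x y := by
      intro y
      have hE : Equivalence fun a b => Γ.Linked f.coll x a ↔ Γ.Linked f.coll x b :=
        ⟨fun _ => Iff.rfl, Iff.symm, Iff.trans⟩
      have key : ∀ a b, Relation.EqvGen (fun a b => b = Γ.rot a ∨ b = Γ.flip a) a b →
          (Γ.Linked f.coll x a ↔ Γ.Linked f.coll x b) := by
        intro a b hab
        induction hab with
        | rel a b h =>
          rcases h with rfl | rfl
          · exact ⟨fun h => h.trans (linked_rot _ _), fun h => h.trans (linked_rot _ _).symm⟩
          · refine ⟨fun h => h.trans (linked_flip (hl _ h)), fun h => ?_⟩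
            have := h.trans (linked_flip (hl _ h))
            rwa [Γ.flip_flip] at this
        | refl a => exact Iff.rfl
        | symm a b _ ih => exact ih.symm
        | trans a b c _ _ ih ih' => exact ih.trans ih'
      exact (key x y (Γ.connected x y)).1 (Linked.refl _ _)
    obtain ⟨h⟩ := Γ₀.nonempty
    exact f.pre_notMem h (hl _ (hl2 _))
  · rw [not_forall] at hall
    obtain ⟨h, hh⟩ := f.notMem_coll.1 (Nat.find_spec hall)
    exact ⟨h, Nat.find hall, hh.symm, fun i hi => not_not.1 (Nat.find_min hall hi)⟩

/-- The corner of a half-edge: the first leaf on the walk that starts with it. -/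
noncomputable def corner (x : Γ.H) : Γ₀.H := (f.exists_reaches x).choose

theorem reaches_corner (x : Γ.H) : f.Reaches x (f.corner x) := (f.exists_reaches x).choose_spec

theorem corner_eq {x : Γ.H} {h : Γ₀.H} (hx : f.Reaches x h) : f.corner x = h :=
  (f.reaches_corner x).unique hx

theorem corner_pre (h : Γ₀.H) : f.corner (f.pre h) = h :=
  f.corner_eq ⟨0, rfl, fun i hi => absurd hi (Nat.not_lt_zero i)⟩

theorem corner_turn_of_mem {x : Γ.H} (hx : x ∈ f.coll) :
    f.corner (Γ.turn f.coll x) = f.corner x := by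
  symm
  refine f.corner_eq ?_
  obtain ⟨n, h1, h2⟩ := f.reaches_corner (Γ.turn f.coll x)
  refine ⟨n + 1, by rw [← h1, pow_succ, Equiv.Perm.mul_apply], fun i hi => ?_⟩
  rcases i with _ | i
  · exact hx
  · rw [pow_succ, Equiv.Perm.mul_apply]
    exact h2 i (by omega)

theorem corner_turn_pre (h : Γ₀.H) : f.corner (Γ.turn f.coll (f.pre h)) = Γ₀.rot h := by
  refine f.corner_eq ?_
  obtain ⟨n, h1, h2⟩ := f.turn_pre h
  refine ⟨n, by rw [← h1, pow_succ, Equiv.Perm.mul_apply], fun i hi => ?_⟩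
  rw [← Equiv.Perm.mul_apply, ← pow_succ]
  exact h2 i hi

theorem corner_turn_of_notMem {x : Γ.H} (hx : x ∉ f.coll) :
    f.corner (Γ.turn f.coll x) = Γ₀.rot (f.corner x) := by
  obtain ⟨h, rfl⟩ := f.notMem_coll.1 hx
  rw [corner_turn_pre, corner_pre]

theorem vert_corner_turn (x : Γ.H) :
    Γ₀.vert (f.corner (Γ.turn f.coll x)) = Γ₀.vert (f.corner x) := by
  by_cases hx : x ∈ f.coll
  · rw [f.corner_turn_of_mem hx]
  · rw [f.corner_turn_of_notMem hx, vert_rot]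

theorem vert_corner_pow (x : Γ.H) (i : ℕ) :
    Γ₀.vert (f.corner ((Γ.turn f.coll ^ i) x)) = Γ₀.vert (f.corner x) := by
  induction i with
  | zero => rfl
  | succ i ih => rw [pow_succ', Equiv.Perm.mul_apply, vert_corner_turn, ih]

theorem sameCycle_pre_corner (x : Γ.H) : (Γ.turn f.coll).SameCycle x (f.pre (f.corner x)) := by
  obtain ⟨n, h, -⟩ := f.reaches_corner x
  rw [← h]
  exact Equiv.Perm.sameCycle_pow_right.2 (Equiv.Perm.SameCycle.refl _ _)

theorem sameCycle_pre {h h' : Γ₀.H} (hv : Γ₀.vert h = Γ₀.vert h') :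
    (Γ.turn f.coll).SameCycle (f.pre h) (f.pre h') := by
  obtain ⟨n, rfl⟩ := (vert_eq_iff.1 hv).exists_nat_pow_eq
  clear hv
  induction n with
  | zero => exact Equiv.Perm.SameCycle.refl _ _
  | succ n ih =>
    refine ih.trans ?_
    obtain ⟨k, hk, -⟩ := f.turn_pre ((Γ₀.rot ^ n) h)
    rw [pow_succ', Equiv.Perm.mul_apply, ← hk]
    exact Equiv.Perm.sameCycle_pow_right.2 (Equiv.Perm.SameCycle.refl _ _)

/-- The leaves on a closed walk occur in the order of `Γ₀.rot`, so closed walks correspond to the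
vertices of `Γ₀`. -/
theorem vert_corner_eq_iff {x y : Γ.H} :
    Γ₀.vert (f.corner x) = Γ₀.vert (f.corner y) ↔ (Γ.turn f.coll).SameCycle x y := by
  constructor
  · intro h
    exact (f.sameCycle_pre_corner x).trans ((f.sameCycle_pre h).trans (f.sameCycle_pre_corner y).symm)
  · intro h
    obtain ⟨n, rfl⟩ := h.exists_nat_pow_eq
    exact (f.vert_corner_pow x n).symm

theorem linked_iff {x y : Γ.H} :
    Γ.Linked f.coll x y ↔ Γ₀.vert (f.corner x) = Γ₀.vert (f.corner y) := by
  rw [linked_iff_sameCycle f.closed f.bridges, vert_corner_eq_iff]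

theorem vert_corner_tau (x : Γ.H) :
    Γ₀.vert (f.corner (Γ.tau f.coll x)) = Γ₀.vert (f.corner x) :=
  (f.linked_iff.1 (linked_tau f.closed x)).symm

/-- The label of a half-edge: its corners on both sides. -/
noncomputable def label (x : Γ.H) : Γ₀.H × Γ₀.H := (f.corner x, f.corner (Γ.tau f.coll x))

theorem label_pre (h : Γ₀.H) : f.label (f.pre h) = (h, h) := by
  rw [label, tau_of_notMem (f.pre_notMem h), corner_pre]

theorem label_tau (x : Γ.H) : f.label (Γ.tau f.coll x) = (f.label x).swap := by
  rw [label, label, tau_tau]; rfl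

/-- The number of leaves among the first `i` half-edges of a walk. -/
noncomputable def count (x : Γ.H) (i : ℕ) : ℕ :=
  ((Finset.range i).filter fun j => (Γ.turn f.coll ^ j) x ∉ f.coll).card

theorem corner_pow (x : Γ.H) (i : ℕ) :
    f.corner ((Γ.turn f.coll ^ i) x) = (Γ₀.rot ^ f.count x i) (f.corner x) := by
  induction i with
  | zero => simp [count]
  | succ i ih =>
    rw [pow_succ', Equiv.Perm.mul_apply, count, Finset.range_add_one, Finset.filter_insert]
    by_cases h : (Γ.turn f.coll ^ i) x ∈ f.coll
    · rw [if_neg (not_not.2 h), f.corner_turn_of_mem h, ih]; rfl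
    · rw [if_pos h, f.corner_turn_of_notMem h, ih, Finset.card_insert_of_notMem (by simp), pow_succ']
      rfl

theorem count_add (x : Γ.H) (i j : ℕ) :
    f.count x (i + j) = f.count x i + f.count ((Γ.turn f.coll ^ i) x) j := by
  induction j with
  | zero => simp [count]
  | succ j ih =>
    rw [← add_assoc, count, Finset.range_add_one, Finset.filter_insert, count, count,
      Finset.range_add_one, Finset.filter_insert]
    have h : (Γ.turn f.coll ^ (i + j)) x = (Γ.turn f.coll ^ j) ((Γ.turn f.coll ^ i) x) := by
      rw [← Equiv.Perm.mul_apply, ← pow_add, add_comm]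
    rw [← h]
    rw [count, count, count] at ih
    split_ifs
    · exact ih
    · rw [Finset.card_insert_of_notMem (by simp), Finset.card_insert_of_notMem (by simp)]
      omega

theorem count_mono (x : Γ.H) {i j : ℕ} (h : i ≤ j) : f.count x i ≤ f.count x j := by
  obtain ⟨k, rfl⟩ := Nat.exists_eq_add_of_le h
  rw [count_add]
  omega

theorem count_pos {x : Γ.H} {i j : ℕ} (h : j < i) (hj : (Γ.turn f.coll ^ j) x ∉ f.coll) :
    0 < f.count x i :=
  Finset.card_pos.2 ⟨j, Finset.mem_filter.2 ⟨Finset.mem_range.2 h, hj⟩⟩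

variable {f} {a : Γ.H} {n : ℕ}

/-- The leaves on the arc of `a` are distinct leaves at one vertex of `Γ₀`, and the arc of `flip a`
contains at least one more. -/
theorem count_lt (ha : a ∈ f.coll) (h : Γ.IsArc f.coll a n) :
    f.count a n < Γ₀.valence (Γ₀.vert (f.corner a)) := by
  have hfa := f.closed a ha
  -- This produces the leaf `h0` on the other side of the edge, which the arc of `a` cannot meet
  -- because the edge is a bridge.
  obtain ⟨k, hk⟩ := exists_isArc f.closed f.bridges hfa
  obtain ⟨j, hj0, hjk, hj⟩ := hk.exists_leaf f.closed f.bridges _ hfa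
  obtain ⟨h0, hh0⟩ := f.notMem_coll.1 hj
  have hinj : ∀ i₁ i₂, i₁ < i₂ → i₂ < n → (Γ.turn f.coll ^ i₁) a ≠ (Γ.turn f.coll ^ i₂) a := by
    intro i₁ i₂ h1 h2 h3
    rw [show i₂ = i₁ + (i₂ - i₁) by omega, pow_add, Equiv.Perm.mul_apply] at h3
    exact h.ne_self f.closed f.bridges ha (by omega) (by omega)
      ((Γ.turn f.coll ^ i₁).injective h3).symm
  have hv : ∀ i, Γ₀.vert (f.corner ((Γ.turn f.coll ^ i) a)) = Γ₀.vert (f.corner a) :=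
    f.vert_corner_pow a
  have hv0 : Γ₀.vert h0 = Γ₀.vert (f.corner a) := by
    rw [← f.corner_pre h0, hh0, f.vert_corner_pow, ← f.linked_iff]
    exact (linked_flip ha).symm
  have hpre : ∀ i, (Γ.turn f.coll ^ i) a ∉ f.coll →
      f.pre (f.corner ((Γ.turn f.coll ^ i) a)) = (Γ.turn f.coll ^ i) a := by
    intro i hi
    obtain ⟨h', h''⟩ := f.notMem_coll.1 hi
    rw [← h'', corner_pre]
  have hcard : f.count a n ≤ (({h | Γ₀.vert h = Γ₀.vert (f.corner a)} : Finset Γ₀.H).erase h0).card := by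
    refine Finset.card_le_card_of_injOn (fun i => f.corner ((Γ.turn f.coll ^ i) a)) ?_ ?_
    · intro i hi
      obtain ⟨hi, hil⟩ := Finset.mem_filter.1 hi
      refine Finset.mem_coe.2 (Finset.mem_erase.2 ⟨fun he => ?_, by simp [hv]⟩)
      have h1 := hpre i hil
      simp only at he
      rw [he, hh0] at h1
      have hi0 : 0 < i := by
        rcases Nat.eq_zero_or_pos i with rfl | h
        · exact absurd ha hil
        · exact h
      have h2 := (h.mem _).2 ⟨i, hi0, (Finset.mem_range.1 hi).le, rfl⟩
      have h3 := (hk.mem _).2 ⟨j, hj0, hjk.le, rfl⟩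
      rw [Γ.flip_flip, cut_flip, h1] at h3
      exact f.bridges a ha (h3.trans h2.symm)
    · intro i hi i' hi' hii
      obtain ⟨hi, hil⟩ := Finset.mem_filter.1 hi
      obtain ⟨hi', hil'⟩ := Finset.mem_filter.1 hi'
      have h1 := (hpre i hil).symm.trans ((congrArg f.pre hii).trans (hpre i' hil'))
      rw [Finset.mem_range] at hi hi'
      rcases lt_trichotomy i i' with h | h | h
      · exact absurd h1 (hinj _ _ h hi')
      · exact h
      · exact absurd h1.symm (hinj _ _ h hi)
  rw [Finset.card_erase_of_mem (by simp [hv0])] at hcard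
  have h3 := three_le_valence' (f.corner a)
  have h4 : Γ₀.valence (Γ₀.vert (f.corner a)) =
      ({h | Γ₀.vert h = Γ₀.vert (f.corner a)} : Finset Γ₀.H).card := by
    rw [valence, Set.ncard_eq_toFinset_card']
    congr 1
    ext; simp
  omega

theorem dist_corner (ha : a ∈ f.coll) (h : Γ.IsArc f.coll a n) {i : ℕ} (hi : i ≤ n) :
    Γ₀.dist (f.corner a) (f.corner ((Γ.turn f.coll ^ i) a)) = f.count a i := by
  rw [corner_pow, dist_rot_pow]
  exact (f.count_mono a hi).trans_lt (count_lt ha h)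

/-- Each leaf that is passed advances the corner by one step, and by `count_lt` there are too few
leaves to go around the vertex. -/
theorem dist_label (ha : a ∈ f.coll) (h : Γ.IsArc f.coll a n) :
    Γ₀.dist (f.label a).1 (f.label a).2 = f.count a n := by
  rw [← dist_corner ha h le_rfl, h.last, label, tau_of_mem f.closed ha]

/-- The arc of the next forest half-edge is contained in the arc of `a` and misses one of its
leaves; if the next half-edge is itself a leaf, its distance is zero. -/
theorem dist_label_turn_lt (ha : a ∈ f.coll) :
    Γ₀.dist (f.label (Γ.turn f.coll a)).1 (f.label (Γ.turn f.coll a)).2 <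
      Γ₀.dist (f.label a).1 (f.label a).2 := by
  obtain ⟨n, hn⟩ := exists_isArc f.closed f.bridges ha
  rw [dist_label ha hn]
  by_cases hy : Γ.turn f.coll a ∈ f.coll
  · obtain ⟨k, hk⟩ := exists_isArc f.closed f.bridges hy
    rw [dist_label hy hk]
    obtain ⟨h1, j, h2, h3, h4⟩ := hn.exists_leaf_after f.closed f.bridges ha
      (by rwa [pow_one]) (by rwa [pow_one])
    have e1 := f.count_add a 1 k
    have e2 := f.count_add a (1 + k) (n - (1 + k))
    rw [show 1 + k + (n - (1 + k)) = n by omega] at e2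
    have e3 : 0 < f.count ((Γ.turn f.coll ^ (1 + k)) a) (n - (1 + k)) := by
      refine f.count_pos (j := j - (1 + k)) (by omega) ?_
      rw [← Equiv.Perm.mul_apply, ← pow_add, show j - (1 + k) + (1 + k) = j by omega]
      exact h4
    rw [pow_one] at e1
    omega
  · obtain ⟨h, hh⟩ := f.notMem_coll.1 hy
    rw [← hh, label_pre, dist_self]
    obtain ⟨j, -, h2, h3⟩ := hn.exists_leaf f.closed f.bridges _ ha
    exact f.count_pos h2 h3

/-- At the head of `a` there are at least two half-edges besides `flip a`, and each of them is a
leaf or leads to one. -/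
theorem two_le_dist_label (ha : a ∈ f.coll) : 2 ≤ Γ₀.dist (f.label a).1 (f.label a).2 := by
  obtain ⟨n, hn⟩ := exists_isArc f.closed f.bridges ha
  by_cases hy : Γ.turn f.coll a ∈ f.coll
  · have h1 := dist_label_turn_lt ha
    have h2 := dist_label_turn_lt hy
    omega
  rw [dist_label ha hn]
  have e1 := f.count_add a 2 (n - 2)
  have e2 : f.count a 2 = _ := f.count_add a 1 1
  have e3 : 0 < f.count ((Γ.turn f.coll ^ 1) a) 1 := f.count_pos one_pos (by rwa [pow_zero, pow_one])
  obtain ⟨j, h0, h2, h3⟩ := hn.exists_leaf f.closed f.bridges _ ha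
  have hz : (Γ.turn f.coll ^ 2) a = Γ.rot (Γ.rot (Γ.flip a)) := by
    rw [pow_two, Equiv.Perm.mul_apply, turn_of_notMem hy, turn_of_mem f.closed ha]
  have h2n : 2 < n := by
    rcases lt_trichotomy n 2 with h | h | h
    · omega
    · have := hn.last
      rw [h, hz] at this
      exact absurd this (exists_rot_ne _).2
    · exact h
  rw [show 2 + (n - 2) = n by omega] at e1
  have e4 : 0 < f.count ((Γ.turn f.coll ^ 2) a) (n - 2) := by
    by_cases hw : (Γ.turn f.coll ^ 2) a ∈ f.coll
    · obtain ⟨l, hl⟩ := exists_isArc f.closed f.bridges hw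
      rcases hn.inner f.closed two_pos h2n f.bridges ha hw hl with h4 | ⟨j, h4, h5, h6⟩
      · obtain ⟨j, h5, h6, h7⟩ := hl.exists_leaf f.closed f.bridges _ hw
        exact f.count_pos (j := j) (by omega) h7
      · exfalso
        obtain rfl : j = 1 := by omega
        rw [pow_one] at h6
        exact hy (h6 ▸ f.closed _ hw)
    · exact f.count_pos (j := 0) (by omega) hw
  omega

/-- The labels of two half-edges of the forest do not cross. -/
theorem label_noncrossing {b : Γ.H} (ha : a ∈ f.coll) (hb : b ∈ f.coll)
    (hv : Γ₀.vert (f.corner a) = Γ₀.vert (f.corner b)) :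
    (Γ₀.dist (f.label a).1 (f.label b).1 ≤ Γ₀.dist (f.label a).1 (f.label a).2 ∧
      Γ₀.dist (f.label a).1 (f.label b).2 ≤ Γ₀.dist (f.label a).1 (f.label a).2) ∨
    (Γ₀.dist (f.label a).2 (f.label b).1 ≤ Γ₀.dist (f.label a).2 (f.label a).1 ∧
      Γ₀.dist (f.label a).2 (f.label b).2 ≤ Γ₀.dist (f.label a).2 (f.label a).1) := by
  -- If `b` lies beyond the head of `a`, the arc of `a` meets both halves of its edge, except that
  -- `a` itself is its starting point; so both corners occur before the arc ends.
  have key : ∀ {a b : Γ.H}, a ∈ f.coll → b ∈ f.coll → Γ.Linked (Γ.cut f.coll a) (Γ.flip a) b →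
      Γ₀.dist (f.label a).1 (f.label b).1 ≤ Γ₀.dist (f.label a).1 (f.label a).2 ∧
        Γ₀.dist (f.label a).1 (f.label b).2 ≤ Γ₀.dist (f.label a).1 (f.label a).2 := by
    intro a b ha hb hl
    obtain ⟨n, hn⟩ := exists_isArc f.closed f.bridges ha
    have key2 : ∀ c, Γ.Linked (Γ.cut f.coll a) (Γ.flip a) c ∨ c = a →
        Γ₀.dist (f.corner a) (f.corner c) ≤ f.count a n := by
      rintro c (hc | rfl)
      · obtain ⟨i, -, hi, rfl⟩ := (hn.mem c).1 hc
        rw [dist_corner ha hn hi]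
        exact f.count_mono a hi
      · rw [dist_self]
        exact Nat.zero_le _
    rw [dist_label ha hn]
    refine ⟨key2 b (Or.inl hl), ?_⟩
    have hb2 : (f.label b).2 = f.corner (Γ.flip b) := by rw [label, tau_of_mem f.closed hb]
    rw [hb2]
    refine key2 _ ?_
    by_cases h1 : b = a
    · rw [h1]; exact Or.inl (Linked.refl _ _)
    by_cases h2 : b = Γ.flip a
    · rw [h2, Γ.flip_flip]; exact Or.inr rfl
    exact Or.inl (hl.trans (linked_flip (mem_cut.2 ⟨hb, h1, h2⟩)))
  have hl := f.linked_iff.2 hv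
  have hfa := f.closed a ha
  have hlab : f.label (Γ.flip a) = (f.label a).swap := by
    rw [← tau_of_mem f.closed ha, label_tau]
  rcases (linked_cut ha).1 hl with h | ⟨-, h⟩ | ⟨-, h⟩
  · right
    have := key hfa hb (by rwa [cut_flip, Γ.flip_flip])
    rwa [hlab] at this
  · left
    exact key ha hb h
  · right
    have := key hfa hb (by rwa [cut_flip, Γ.flip_flip])
    rwa [hlab] at this

end Hom

end RibbonGraph

/-! ### Cyclic successors -/

/-- On every class of `c`, the map `φ` is the successor in the cyclic order that is defined by the
linear order of the keys `K`. -/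
structure IsCycSucc {X : Type*} {C : Type*} {T : Type*} [LinearOrder T] (c : X → C) (K : X → T)
    (φ : X → X) : Prop where
  inj : ∀ {x y}, c x = c y → K x = K y → x = y
  cls : ∀ x, c (φ x) = c x
  step : ∀ {x y}, c y = c x → K x < K y → K x < K (φ x) ∧ K (φ x) ≤ K y
  wrap : ∀ {x}, (∀ y, c y = c x → K y ≤ K x) → ∀ y, c y = c x → K (φ x) ≤ K y

namespace IsCycSucc

variable {X X' : Type*} {C : Type*} {T : Type*} [LinearOrder T] {c : X → C} {K : X → T}
  {φ ψ : X → X}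

theorem unique (hφ : IsCycSucc c K φ) (hψ : IsCycSucc c K ψ) : φ = ψ := by
  funext x
  refine hφ.inj (by rw [hφ.cls, hψ.cls]) ?_
  by_cases h : ∀ y, c y = c x → K y ≤ K x
  · exact le_antisymm (hφ.wrap h _ (hψ.cls x)) (hψ.wrap h _ (hφ.cls x))
  · push Not at h
    obtain ⟨y, hy, hlt⟩ := h
    exact le_antisymm (hφ.step (hψ.cls x) (hψ.step hy hlt).1).2
      (hψ.step (hφ.cls x) (hφ.step hy hlt).1).2

theorem exists_perm [Finite X] (hinj : ∀ {x y}, c x = c y → K x = K y → x = y) :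
    ∃ φ : Equiv.Perm X, IsCycSucc c K φ := by
  have : Fintype X := Fintype.ofFinite X
  have hex : ∀ x, ∃ z, c z = c x ∧ (∀ y, c y = c x → K x < K y → K x < K z ∧ K z ≤ K y) ∧
      ((∀ y, c y = c x → K y ≤ K x) → ∀ y, c y = c x → K z ≤ K y) := by
    intro x
    by_cases h : ∀ y, c y = c x → K y ≤ K x
    · obtain ⟨z, hz, hmin⟩ := (Finset.univ.filter fun y => c y = c x).exists_min_image K
        ⟨x, by simp⟩
      simp only [Finset.mem_filter, Finset.mem_univ, true_and] at hz hmin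
      exact ⟨z, hz, fun y hy hlt => absurd (h y hy) (not_le_of_gt hlt), fun _ => hmin⟩
    · obtain ⟨w, hw, hlt⟩ : ∃ w, c w = c x ∧ K x < K w := by
        push Not at h
        exact h
      obtain ⟨z, hz, hmin⟩ := (Finset.univ.filter fun y => c y = c x ∧ K x < K y).exists_min_image K
        ⟨w, by simp [hw, hlt]⟩
      simp only [Finset.mem_filter, Finset.mem_univ, true_and] at hz hmin
      exact ⟨z, hz.1, fun y hy hlt => ⟨hz.2, hmin y ⟨hy, hlt⟩⟩, fun h' => absurd h' h⟩
  choose φ h1 h2 h3 using hex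
  have hφ : IsCycSucc c K φ := ⟨hinj, h1, fun {x y} => h2 x y, fun {x} => h3 x⟩
  -- For `K x < K y`, the successor of `x` has a key above that of `x` and at most that of `y`; the
  -- successor of `y` is above `y`, or it is the minimum of the class.
  have hφi : Function.Injective φ := by
    have key : ∀ x y, c x = c y → φ x = φ y → ¬ K x < K y := by
      intro x y hc he hlt
      have h4 := (hφ.step hc.symm hlt)
      by_cases hy : ∀ z, c z = c y → K z ≤ K y
      · have := hφ.wrap hy x hc
        rw [← he] at this
        exact absurd h4.1 (not_lt_of_ge this)
      · push Not at hy
        obtain ⟨z, hz, hlt'⟩ := hy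
        have := (hφ.step hz hlt').1
        rw [← he] at this
        exact absurd h4.2 (not_le_of_gt this)
    intro x y he
    have hc : c x = c y := by rw [← h1 x, he, h1]
    rcases lt_trichotomy (K x) (K y) with h | h | h
    · exact absurd h (key x y hc he)
    · exact hinj hc h
    · exact absurd h (key y x hc.symm he.symm)
  exact ⟨Equiv.ofBijective φ (Finite.injective_iff_bijective.1 hφi), hφ⟩

theorem sameCycle [Finite X] {φ : Equiv.Perm X} (hφ : IsCycSucc c K φ) {x y : X}
    (h : c x = c y) : φ.SameCycle x y := by
  have : Fintype X := Fintype.ofFinite X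
  have key : ∀ x, ∃ z, φ.SameCycle x z ∧ c z = c x ∧ ∀ y, c y = c x → K y ≤ K z := by
    intro x
    have hcl : ∀ z, φ.SameCycle x z → c z = c x := by
      intro z hz
      obtain ⟨n, rfl⟩ := hz.exists_nat_pow_eq
      clear hz
      induction n with
      | zero => rfl
      | succ n ih => rw [pow_succ', Equiv.Perm.mul_apply, hφ.cls, ih]
    obtain ⟨z, hz, hmax⟩ := (Finset.univ.filter fun z => φ.SameCycle x z).exists_max_image K
      ⟨x, by simp [Equiv.Perm.SameCycle.refl]⟩
    simp only [Finset.mem_filter, Finset.mem_univ, true_and] at hz hmax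
    refine ⟨z, hz, hcl z hz, fun y hy => ?_⟩
    by_contra hlt
    have h1 := (hφ.step (hy.trans (hcl z hz).symm) (not_le.1 hlt)).1
    exact absurd (hmax _ (Equiv.Perm.sameCycle_apply_right.2 hz)) (not_le_of_gt h1)
  obtain ⟨z, h1, h2, h3⟩ := key x
  obtain ⟨w, k1, k2, k3⟩ := key y
  have hzw : z = w := hφ.inj (by rw [h2, k2, h]) (le_antisymm (k3 z (h2.trans h)) (h3 w (k2.trans h.symm)))
  subst hzw
  exact h1.trans k1.symm

/-- A permutation along whose cycles the keys increase, except at one element of each cycle. -/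
theorem of_increasing [Finite X] {φ : Equiv.Perm X} (hc : ∀ {x y}, c x = c y ↔ φ.SameCycle x y)
    (Last : X → Prop) (hlast : ∀ {x y}, Last x → Last y → c x = c y → x = y)
    (hlt : ∀ {x}, ¬ Last x → K x < K (φ x)) : IsCycSucc c K φ := by
  have : Fintype X := Fintype.ofFinite X
  have hcls : ∀ x, c (φ x) = c x := fun x =>
    hc.2 (Equiv.Perm.sameCycle_apply_left.2 (Equiv.Perm.SameCycle.refl _ _))
  have main : ∀ x, ∃ M, ∃ N, c M = c x ∧ (∀ y, c y = c x → ∃ i, 0 < i ∧ i ≤ N ∧ (φ ^ i) M = y) ∧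
      (φ ^ N) M = M ∧ ∀ i j, 0 < i → i < j → j ≤ N → K ((φ ^ i) M) < K ((φ ^ j) M) := by
    intro x
    -- An element of maximal key has no larger successor, so it is the unique exceptional element of
    -- its class. Listing the class after it, the keys increase all the way.
    obtain ⟨M, hM, hMx⟩ : ∃ M, Last M ∧ c M = c x := by
      obtain ⟨M, hM, hmax⟩ := (Finset.univ.filter fun z => c z = c x).exists_max_image K
        ⟨x, by simp⟩
      simp only [Finset.mem_filter, Finset.mem_univ, true_and] at hM hmax
      refine ⟨M, ?_, hM⟩
      by_contra h
      exact absurd (hmax (φ M) ((hcls M).trans hM)) (not_le_of_gt (hlt h))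
    have hN : (φ ^ Function.minimalPeriod φ M) M = M := by
      rw [Equiv.Perm.coe_pow, Function.iterate_minimalPeriod]
    refine ⟨M, Function.minimalPeriod φ M, hMx, fun y hy => ?_, hN, ?_⟩
    · exact exists_pow_le_minimalPeriod (hc.1 (hMx.trans hy.symm))
    · intro i j hi hij hj
      induction j with
      | zero => omega
      | succ j ih =>
        have hL : ¬ Last ((φ ^ j) M) := by
          intro hL
          have h1 := hlast hL hM (hc.2 (Equiv.Perm.sameCycle_pow_left.2 (Equiv.Perm.SameCycle.refl _ _)))
          have h2 : Function.IsPeriodicPt φ j M := by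
            rw [Function.IsPeriodicPt, Function.IsFixedPt, ← Equiv.Perm.coe_pow]
            exact h1
          exact absurd (h2.minimalPeriod_le (by omega)) (by omega)
        have h3 := hlt hL
        rw [← Equiv.Perm.mul_apply, ← pow_succ'] at h3
        rcases (by omega : i < j ∨ i = j) with h | rfl
        · exact (ih h (by omega)).trans h3
        · exact h3
  have hle : ∀ {M : X} {N : ℕ}, (∀ i j, 0 < i → i < j → j ≤ N → K ((φ ^ i) M) < K ((φ ^ j) M)) →
      ∀ i j, 0 < i → i ≤ j → j ≤ N → K ((φ ^ i) M) ≤ K ((φ ^ j) M) := by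
    intro M N h i j hi hij hj
    rcases hij.lt_or_eq with h' | rfl
    · exact (h i j hi h' hj).le
    · exact le_rfl
  refine ⟨fun {x y} hxy hK => ?_, hcls, fun {x y} hxy hK => ?_, fun {x} hmax y hy => ?_⟩
  · obtain ⟨M, N, -, h1, -, h2⟩ := main x
    obtain ⟨i, hi, hi', rfl⟩ := h1 x rfl
    obtain ⟨j, hj, hj', rfl⟩ := h1 y hxy.symm
    rcases lt_trichotomy i j with h | rfl | h
    · exact absurd hK (h2 i j hi h hj').ne
    · rfl
    · exact absurd hK (h2 j i hj h hi').ne'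
  · obtain ⟨M, N, -, h1, -, h2⟩ := main x
    obtain ⟨i, hi, hi', rfl⟩ := h1 x rfl
    obtain ⟨j, hj, hj', rfl⟩ := h1 y hxy
    have hij : i < j := by
      by_contra h
      exact absurd hK (not_lt_of_ge (hle h2 j i hj (by omega) hi'))
    rw [← Equiv.Perm.mul_apply, ← pow_succ']
    exact ⟨h2 i (i + 1) hi (by omega) (by omega), hle h2 _ _ (by omega) (by omega) hj'⟩
  · obtain ⟨M, N, hM, h1, h3, h2⟩ := main x
    obtain ⟨i, hi, hi', rfl⟩ := h1 x rfl
    obtain ⟨j, hj, hj', rfl⟩ := h1 y hy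
    have hiN : i = N := by
      by_contra h
      have := hmax ((φ ^ N) M) (by rw [h3, hM])
      exact absurd (h2 i N hi (by omega) le_rfl) (not_lt_of_ge this)
    rw [hiN, h3]
    have := hle h2 1 j one_pos (by omega) hj'
    rwa [pow_one] at this

/-- The first return of a cyclic successor to a subset is again a cyclic successor for the same
keys, and cyclic successors are unique. -/
theorem first_return [Finite X] {φ' : Equiv.Perm X'} [Finite X'] {c' : X' → C} {K' : X' → T}
    (hφ : IsCycSucc c K φ) (hφ' : IsCycSucc c' K' φ') (j : X → X') (hc : ∀ x, c' (j x) = c x)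
    (hK : ∀ x, K' (j x) = K x) (x : X) :
    ∃ n, (φ' ^ (n + 1)) (j x) = j (φ x) ∧ ∀ i < n, (φ' ^ (i + 1)) (j x) ∉ Set.range j := by
  have hex : ∀ x, ∃ n, (φ' ^ (n + 1)) (j x) ∈ Set.range j := by
    intro x
    obtain ⟨m, h1, -, h2⟩ := exists_pow_le_minimalPeriod (Equiv.Perm.SameCycle.refl φ' (j x))
    refine ⟨m - 1, x, ?_⟩
    rw [show m - 1 + 1 = m by omega, h2]
  have hspec := fun x => Nat.find_spec (hex x)
  have hmin : ∀ x i, i < Nat.find (hex x) → (φ' ^ (i + 1)) (j x) ∉ Set.range j :=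
    fun x i hi => Nat.find_min (hex x) hi
  choose ψ hψ using hspec
  have hcp : ∀ x i, c' ((φ' ^ i) (j x)) = c x := by
    intro x i
    induction i with
    | zero => exact hc x
    | succ i ih => rw [pow_succ', Equiv.Perm.mul_apply, hφ'.cls, ih]
  have hψc : ∀ x, c (ψ x) = c x := fun x => by rw [← hc, hψ, hcp]
  suffices h : IsCycSucc c K ψ by
    refine ⟨Nat.find (hex x), ?_, hmin x⟩
    rw [hφ.unique h, hψ]
  -- Before the return no element has the key of an element of the subset, so the walk cannot jump
  -- over one.
  have hneK : ∀ x i y, i < Nat.find (hex x) → c y = c x → K' ((φ' ^ (i + 1)) (j x)) ≠ K y := by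
    intro x i y hi hy he
    refine hmin x i hi ⟨y, hφ'.inj ?_ ?_⟩
    · rw [hc, hcp, hy]
    · rw [hK, he]
  refine ⟨hφ.inj, hψc, fun {x y} hxy hlt => ?_, fun {x} hmax => ?_⟩
  · have key : ∀ i ≤ Nat.find (hex x), K x < K' ((φ' ^ (i + 1)) (j x)) ∧
        K' ((φ' ^ (i + 1)) (j x)) ≤ K y := by
      intro i
      induction i with
      | zero =>
        intro _
        have := hφ'.step (x := j x) (y := j y) (by rw [hc, hc, hxy]) (by rwa [hK, hK])
        rwa [hK, hK] at this
      | succ i ih =>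
        intro hi
        obtain ⟨h1, h2⟩ := ih (by omega)
        have h3 := lt_of_le_of_ne h2 (hneK x i y (by omega) hxy)
        have := hφ'.step (x := (φ' ^ (i + 1)) (j x)) (y := j y) (by rw [hc, hcp, hxy]) (by rwa [hK])
        rw [hK] at this
        rw [pow_succ', Equiv.Perm.mul_apply]
        exact ⟨h1.trans this.1, this.2⟩
    have := key _ le_rfl
    rwa [← hψ, hK] at this
  · have key : ∀ i ≤ Nat.find (hex x), K x < K' ((φ' ^ (i + 1)) (j x)) ∨
        ∀ y, c y = c x → K' ((φ' ^ (i + 1)) (j x)) ≤ K y := by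
      have aux : ∀ z, c' z = c x → K x ≤ K' z →
          K x < K' (φ' z) ∨ ∀ y, c y = c x → K' (φ' z) ≤ K y := by
        intro z hz hle
        by_cases hzm : ∀ w, c' w = c' z → K' w ≤ K' z
        · right
          intro y hy
          rw [← hK y]
          exact hφ'.wrap hzm _ (by rw [hc, hy, hz])
        · push Not at hzm
          obtain ⟨w, hw, hlt⟩ := hzm
          exact Or.inl (hle.trans_lt (hφ'.step hw hlt).1)
      intro i
      induction i with
      | zero =>
        intro _
        exact aux (j x) (hc x) (hK x).ge
      | succ i ih =>
        intro hi
        rw [pow_succ', Equiv.Perm.mul_apply]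
        rcases ih (by omega) with h | h
        · exact aux _ (hcp x _) h.le
        · right
          intro y hy
          have h3 := lt_of_le_of_ne (h y hy) (hneK x i y (by omega) hy)
          have := hφ'.step (x := (φ' ^ (i + 1)) (j x)) (y := j y) (by rw [hc, hcp, hy]) (by rwa [hK])
          rw [hK] at this
          exact this.2
    rcases key _ le_rfl with h | h
    · rw [← hψ, hK] at h
      exact absurd (hmax _ (hψc x)) (not_le_of_gt h)
    · intro y hy
      have := h y hy
      rwa [← hψ, hK] at this

end IsCycSucc

/-! ### The labels determine the morphism -/

namespace RibbonGraph

variable {Ω : Type u} {Γ Γ' Γ₀ : RibbonGraph Ω}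

/-- The vertex of `Γ₀` at which a label is located. -/
def labelVert (Γ₀ : RibbonGraph Ω) (x : Γ₀.H × Γ₀.H) : Γ₀.Vertex := Γ₀.vert x.1

namespace Hom

variable (f : Hom Γ Γ₀) (f' : Hom Γ' Γ₀)

/-- At a half-edge of the forest the walk keeps the corner and decreases the distance. At a leaf the
corner moves to the next position, except at the last leaf of each vertex. Hence the keys increase
along the walk, and the labels alone determine it. -/
theorem isCycSucc : IsCycSucc (fun x => Γ₀.labelVert (f.label x)) (fun x => Γ₀.key (f.label x))
    (Γ.turn f.coll) := by
  refine IsCycSucc.of_increasing f.vert_corner_eq_iff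
    (fun x => x ∉ f.coll ∧ Γ₀.pos (f.corner x) + 1 = Γ₀.valence (Γ₀.vert (f.corner x)))
    ?_ ?_
  · rintro x y ⟨hx, hx'⟩ ⟨hy, hy'⟩ hc
    have hc' : Γ₀.vert (f.corner x) = Γ₀.vert (f.corner y) := hc
    obtain ⟨h, rfl⟩ := f.notMem_coll.1 hx
    obtain ⟨h', rfl⟩ := f.notMem_coll.1 hy
    rw [corner_pre] at hx'
    rw [corner_pre] at hy'
    rw [corner_pre, corner_pre] at hc'
    rw [eq_of_pos hc' (by rw [hc'] at hx'; omega)]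
  · intro x hx
    by_cases hm : x ∈ f.coll
    · refine key_lt.2 (Or.inr ⟨?_, dist_label_turn_lt hm⟩)
      exact congrArg Γ₀.pos (f.corner_turn_of_mem hm).symm
    · refine key_lt.2 (Or.inl ?_)
      change Γ₀.pos (f.corner x) < Γ₀.pos (f.corner _)
      rw [f.corner_turn_of_notMem hm, pos_rot, if_neg fun h => hx ⟨hm, h⟩]
      omega

theorem label_injective : Function.Injective f.label := fun x y h =>
  f.isCycSucc.inj (by simp only [h]) (by simp only [h])

theorem mem_coll_iff {x : Γ.H} : x ∈ f.coll ↔ (f.label x).1 ≠ (f.label x).2 := by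
  constructor
  · intro hx h
    have := two_le_dist_label hx
    rw [h, dist_self] at this
    omega
  · intro h
    by_contra hx
    obtain ⟨h', rfl⟩ := f.notMem_coll.1 hx
    rw [label_pre] at h
    exact h rfl

theorem vert_label (x : Γ.H) : Γ₀.vert (f.label x).1 = Γ₀.vert (f.label x).2 :=
  (f.vert_corner_tau x).symm

end Hom

/-- Along a walk that does not leave the smaller forest, the two walks agree. -/
theorem turn_pow_eq {F F' : Set Γ.H} (hF : ∀ a ∈ F, Γ.flip a ∈ F) (hF' : ∀ a ∈ F', Γ.flip a ∈ F')
    (hsub : F ⊆ F') {y : Γ.H} (hy : y ∉ F) (n : ℕ)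
    (h : (∀ i < n, (Γ.turn F ^ (i + 1)) y ∈ F) ∨
      ∀ i < n, (Γ.turn F' ^ (i + 1)) (Γ.tau F' y) ∈ F) :
    ∀ i ≤ n, (Γ.turn F ^ (i + 1)) y = (Γ.turn F' ^ (i + 1)) (Γ.tau F' y) := by
  intro i
  induction i with
  | zero => intro _; rw [zero_add, pow_one, pow_one, turn_tau, turn_of_notMem hy]
  | succ i ih =>
    intro hi
    have h1 := ih (by omega)
    have h2 : (Γ.turn F ^ (i + 1)) y ∈ F := by
      rcases h with h | h
      · exact h i (by omega)
      · rw [h1]; exact h i (by omega)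
    rw [pow_succ' _ (i + 1), Equiv.Perm.mul_apply, pow_succ' _ (i + 1), Equiv.Perm.mul_apply, ← h1,
      turn_of_mem hF h2, turn_of_mem hF' (hsub h2)]

namespace Hom

variable {f : Hom Γ Γ₀} {f' : Hom Γ' Γ₀} {j : Γ.H → Γ'.H}

section labels

variable (hj : ∀ x, f'.label (j x) = f.label x)
include hj

theorem apply_pre_of_label (h : Γ₀.H) : j (f.pre h) = f'.pre h :=
  f'.label_injective (by rw [hj, label_pre, label_pre])

theorem injective_of_label : Function.Injective j := fun x y h =>
  f.label_injective (by rw [← hj, h, hj])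

theorem apply_tau_of_label (x : Γ.H) : j (Γ.tau f.coll x) = Γ'.tau f'.coll (j x) :=
  f'.label_injective (by rw [hj, label_tau, label_tau, hj])

theorem mem_coll_of_label (x : Γ.H) : j x ∈ f'.coll ↔ x ∈ f.coll := by
  rw [mem_coll_iff, mem_coll_iff, hj]

theorem apply_flip_of_label (x : Γ.H) : j (Γ.flip x) = Γ'.flip (j x) := by
  by_cases hx : x ∈ f.coll
  · rw [← tau_of_mem f.closed hx, apply_tau_of_label hj,
      tau_of_mem f'.closed ((mem_coll_of_label hj x).2 hx)]
  · obtain ⟨h, rfl⟩ := f.notMem_coll.1 hx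
    rw [← f.pre_flip, apply_pre_of_label hj, apply_pre_of_label hj, f'.pre_flip]

theorem compl_range_subset : (Set.range j)ᶜ ⊆ f'.coll := by
  intro y hy
  by_contra h
  obtain ⟨h', rfl⟩ := f'.notMem_coll.1 h
  exact hy ⟨f.pre h', apply_pre_of_label hj h'⟩

theorem compl_range_closed : ∀ a ∈ (Set.range j)ᶜ, Γ'.flip a ∈ (Set.range j)ᶜ := by
  rintro a ha ⟨x, hx⟩
  refine ha ⟨Γ.flip x, ?_⟩
  rw [apply_flip_of_label hj, hx, Γ'.flip_flip]

/-- Both walks are cyclic successors for the keys of the labels, so the walk of `Γ` is the first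
return of the walk of `Γ'` to the image of `j`; in between it stays in the forest that is collapsed
by `j`. -/
theorem nextLeaf_of_label (x : Γ.H) :
    Γ'.NextLeaf (Set.range j)ᶜ (j x) (j (Γ.rot x)) := by
  have hc := compl_range_closed hj
  have hx : j x ∉ (Set.range j)ᶜ := fun h => h ⟨x, rfl⟩
  rw [nextLeaf_iff hc hx]
  refine ⟨fun h => h ⟨_, rfl⟩, ?_⟩
  -- The start is `tau x` because one step of the walk from there is `rot x`.
  obtain ⟨n, h1, h2⟩ := f.isCycSucc.first_return f'.isCycSucc j (fun x => by simp only [hj])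
    (fun x => by simp only [hj]) (Γ.tau f.coll x)
  rw [turn_tau] at h1
  rw [apply_tau_of_label hj] at h1 h2
  have h3 := turn_pow_eq hc f'.closed (compl_range_subset hj) hx n (Or.inr h2)
  exact ⟨n, by rw [h3 n le_rfl, h1], fun i hi => by rw [h3 i hi.le]; exact h2 i hi⟩

/-- A map of half-edges that preserves the labels is a morphism in the opposite direction. -/
def ofLabel : Hom Γ' Γ where
  pre := j
  pre_injective := injective_of_label hj
  pre_flip := apply_flip_of_label hj
  forest := isForest_iff.2 ⟨compl_range_closed hj, f'.bridges.mono (compl_range_subset hj)⟩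
  pre_rot := nextLeaf_of_label hj

end labels

theorem apply_turn_of_label {e : Γ.H ≃ Γ'.H} (he : ∀ x, f'.label (e x) = f.label x) (x : Γ.H) :
    e (Γ.turn f.coll x) = Γ'.turn f'.coll (e x) := by
  obtain ⟨n, h1, h2⟩ := f.isCycSucc.first_return f'.isCycSucc e (fun x => by simp only [he])
    (fun x => by simp only [he]) x
  have : n = 0 := by
    by_contra hn
    exact h2 0 (by omega) (e.surjective _)
  subst this
  rw [← h1, zero_add, pow_one]

/-- A bijection of half-edges that preserves the labels is an isomorphism. -/
def isoOfLabel (e : Γ.H ≃ Γ'.H) (he : ∀ x, f'.label (e x) = f.label x) : Iso Γ Γ' where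
  toEquiv := e
  map_flip := apply_flip_of_label he
  map_rot x := by
    rw [← turn_tau (F := f.coll), apply_turn_of_label he, apply_tau_of_label he, turn_tau]

theorem Reaches.of_pow {x : Γ.H} {h : Γ₀.H} {n : ℕ}
    (hx : f.Reaches ((Γ.turn f.coll ^ n) x) h) (hn : ∀ i < n, (Γ.turn f.coll ^ i) x ∈ f.coll) :
    f.Reaches x h := by
  obtain ⟨m, h1, h2⟩ := hx
  refine ⟨m + n, by rw [pow_add]; exact h1, fun i hi => ?_⟩
  by_cases hin : i < n
  · exact hn i hin
  · have := h2 (i - n) (by omega)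
    rwa [← Equiv.Perm.mul_apply, ← pow_add, show i - n + n = i by omega] at this

section lifts

variable {g : Hom Γ' Γ} (hg : ∀ h, g.pre (f.pre h) = f'.pre h)
include hg

theorem mem_coll_of_over (x : Γ.H) : g.pre x ∈ f'.coll ↔ x ∈ f.coll := by
  rw [← not_iff_not, notMem_coll, notMem_coll]
  refine exists_congr fun h => ?_
  rw [← hg]
  exact ⟨fun h => g.pre_injective h, fun h => by rw [h]⟩

theorem coll_subset_of_over : g.coll ⊆ f'.coll := by
  intro y hy
  by_contra h
  obtain ⟨h', rfl⟩ := f'.notMem_coll.1 h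
  exact hy ⟨f.pre h', hg h'⟩

theorem tau_of_over (x : Γ.H) : Γ'.tau f'.coll (g.pre x) = g.pre (Γ.tau f.coll x) := by
  by_cases hx : x ∈ f.coll
  · rw [tau_of_mem f.closed hx, tau_of_mem f'.closed ((mem_coll_of_over hg x).2 hx), g.pre_flip]
  · rw [tau_of_notMem hx, tau_of_notMem fun h => hx ((mem_coll_of_over hg x).1 h)]

/-- One step of the walk in `Γ` lifts to a stretch of the walk in `Γ'` that passes only through
half-edges collapsed by `g`, hence through no leaf over `Γ₀`. -/
theorem reaches_of_over (n : ℕ) : ∀ (x : Γ.H) (h : Γ₀.H), (Γ.turn f.coll ^ n) x = f.pre h →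
    (∀ i < n, (Γ.turn f.coll ^ i) x ∈ f.coll) → f'.Reaches (g.pre x) h := by
  induction n with
  | zero =>
    intro x h hx _
    refine ⟨0, ?_, fun i hi => absurd hi (Nat.not_lt_zero i)⟩
    rw [← hg, ← hx]
    rfl
  | succ n ih =>
    intro x h hx hi
    have h1 := ih (Γ.turn f.coll x) h (by rw [← hx, pow_succ, Equiv.Perm.mul_apply]) fun i hin => by
      have := hi (i + 1) (by omega)
      rwa [pow_succ, Equiv.Perm.mul_apply] at this
    obtain ⟨m, h2, h3⟩ := g.turn_pre (Γ.tau f.coll x)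
    have h4 := turn_pow_eq g.closed f'.closed (coll_subset_of_over hg) (g.pre_notMem _) m (Or.inl h3)
    rw [← tau_of_over hg, tau_tau] at h4
    refine Reaches.of_pow (n := m + 1) ?_ fun i hin => ?_
    · rw [← h4 m le_rfl, tau_of_over hg, h2]
      exact h1
    · rcases i with _ | i
      · exact (mem_coll_of_over hg x).2 (hi 0 (by omega))
      · rw [← h4 i (by omega), tau_of_over hg]
        exact coll_subset_of_over hg (h3 i (by omega))

theorem corner_of_over (x : Γ.H) : f'.corner (g.pre x) = f.corner x := by
  obtain ⟨n, h1, h2⟩ := f.reaches_corner x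
  exact f'.corner_eq (reaches_of_over hg n x _ h1 h2)

/-- Morphisms over `Γ₀` preserve the labels. -/
theorem label_of_over (x : Γ.H) : f'.label (g.pre x) = f.label x := by
  rw [label, label, tau_of_over hg, corner_of_over hg, corner_of_over hg]

end lifts

end Hom

end RibbonGraph

namespace RibbonGraph

variable {Ω : Type u} {Γ Γ₀ : RibbonGraph Ω}

/-! ### Ribbon graphs with prescribed labels -/

theorem valence_ge_three_of_ne {X : Type u} [Finite X] {σ : Equiv.Perm X} {x : X} (h1 : σ x ≠ x)
    (h2 : σ (σ x) ≠ x) : 3 ≤ {y | σ.SameCycle x y}.ncard := by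
  have hs : ({x, σ x, σ (σ x)} : Set X) ⊆ {y | σ.SameCycle x y} := by
    have h0 := Equiv.Perm.SameCycle.refl σ x
    have h1 := Equiv.Perm.sameCycle_apply_right.2 h0
    have h2 := Equiv.Perm.sameCycle_apply_right.2 h1
    rintro y (rfl | rfl | rfl)
    · exact h0
    · exact h1
    · exact h2
  refine le_trans ?_ (Set.ncard_le_ncard hs (Set.toFinite _))
  rw [Set.ncard_eq_three.2 ⟨x, σ x, σ (σ x), h1.symm, h2.symm, fun h => h1 (σ.injective h).symm, rfl⟩]

theorem eqvGen_map {X Y : Type u} {p : X → X → Prop} {q : Y → Y → Prop} (j : X → Y)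
    (h : ∀ x y, p x y → Relation.EqvGen q (j x) (j y)) {x y : X} (hxy : Relation.EqvGen p x y) :
    Relation.EqvGen q (j x) (j y) := by
  induction hxy with
  | rel a b hab => exact h a b hab
  | refl a => exact .refl _
  | symm a b _ ih => exact .symm _ _ ih
  | trans a b c _ _ ih ih' => exact .trans _ _ _ ih ih'

/-- A ribbon graph with half-edges in `Ω` from one with half-edges in any finite type. -/
theorem exists_ribbonGraph [Infinite Ω] {X : Type u} [Finite X] [Nonempty X]
    (rot flip : Equiv.Perm X) (hff : ∀ x, flip (flip x) = x) (hfn : ∀ x, flip x ≠ x)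
    (hr : ∀ x, rot x ≠ x ∧ rot (rot x) ≠ x)
    (hc : ∀ x y, Relation.EqvGen (fun a b => b = rot a ∨ b = flip a) x y) :
    ∃ (Γ : RibbonGraph Ω) (e : Γ.H ≃ X), (∀ h, e (Γ.rot h) = rot (e h)) ∧
      ∀ h, e (Γ.flip h) = flip (e h) := by
  obtain ⟨H, hH⟩ := Infinite.exists_subset_card_eq Ω (Nat.card X)
  have hcard : Nat.card H = Nat.card X := by simpa using hH
  obtain ⟨e⟩ : Nonempty (H ≃ X) := Finite.card_eq.1 hcard
  have hpow : ∀ (σ : Equiv.Perm X) (x : H), e ((e.symm.permCongr σ) x) = σ (e x) := by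
    intro σ x
    simp [Equiv.permCongr_apply]
  refine ⟨⟨H, e.symm.permCongr rot, e.symm.permCongr flip, fun h => ?_, fun h => ?_, fun h => ?_,
    ⟨e.symm (Classical.arbitrary X)⟩, fun h h' => ?_⟩, e, hpow rot, hpow flip⟩
  · apply e.injective
    rw [hpow, hpow, hff]
  · intro h'
    have := congrArg e h'
    rw [hpow] at this
    exact hfn _ this
  · have := valence_ge_three_of_ne (σ := e.symm.permCongr rot) (x := h)
      (fun h' => (hr (e h)).1 (by rw [← hpow, h'])) (fun h' => (hr (e h)).2 (by
        rw [← hpow, ← hpow, h']))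
    exact this
  · have := eqvGen_map (q := fun a b => b = (e.symm.permCongr rot) a ∨ b = (e.symm.permCongr flip) a)
      e.symm (fun x y hxy => .rel _ _ ?_) (hc (e h) (e h'))
    · simpa using this
    · rcases hxy with rfl | rfl
      · left; simp [Equiv.permCongr_apply]
      · right; simp [Equiv.permCongr_apply]

/-- The sets of labels of the half-edges of forests. -/
structure IsLabelSet (Γ₀ : RibbonGraph Ω) (R : Set (Γ₀.H × Γ₀.H)) : Prop where
  symm : ∀ {x}, x ∈ R → x.swap ∈ R
  vert : ∀ {x}, x ∈ R → Γ₀.vert x.1 = Γ₀.vert x.2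
  two : ∀ {x}, x ∈ R → 2 ≤ Γ₀.dist x.1 x.2
  noncrossing : ∀ {x y}, x ∈ R → y ∈ R → Γ₀.vert x.1 = Γ₀.vert y.1 →
    (Γ₀.dist x.1 y.1 ≤ Γ₀.dist x.1 x.2 ∧ Γ₀.dist x.1 y.2 ≤ Γ₀.dist x.1 x.2) ∨
    (Γ₀.dist x.2 y.1 ≤ Γ₀.dist x.2 x.1 ∧ Γ₀.dist x.2 y.2 ≤ Γ₀.dist x.2 x.1)

/-- The labels of the half-edges of the forest of a morphism. -/
def Hom.labels (f : Hom Γ Γ₀) : Set (Γ₀.H × Γ₀.H) := f.label '' f.coll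

theorem Hom.isLabelSet (f : Hom Γ Γ₀) : Γ₀.IsLabelSet f.labels := by
  refine ⟨?_, ?_, ?_, ?_⟩
  · rintro _ ⟨a, ha, rfl⟩
    refine ⟨Γ.tau f.coll a, ?_, f.label_tau a⟩
    rw [tau_of_mem f.closed ha]
    exact f.closed a ha
  · rintro _ ⟨a, -, rfl⟩
    exact f.vert_label a
  · rintro _ ⟨a, ha, rfl⟩
    exact two_le_dist_label ha
  · rintro _ _ ⟨a, ha, rfl⟩ ⟨b, hb, rfl⟩ hv
    exact label_noncrossing ha hb hv

theorem Hom.range_label (f : Hom Γ Γ₀) : Set.range f.label = {x | x.1 = x.2 ∨ x ∈ f.labels} := by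
  ext ⟨p, q⟩
  constructor
  · rintro ⟨y, hy⟩
    by_cases h : y ∈ f.coll
    · exact Or.inr ⟨y, h, hy⟩
    · left
      obtain ⟨h', rfl⟩ := f.notMem_coll.1 h
      rw [f.label_pre] at hy
      rw [← hy]
  · rintro (h | ⟨y, -, hy⟩)
    · exact ⟨f.pre p, by rw [f.label_pre]; exact Prod.ext rfl h⟩
    · exact ⟨y, hy⟩

theorem isCycSucc_rot : IsCycSucc Γ₀.vert (fun h => Γ₀.key (h, h)) Γ₀.rot := by
  refine IsCycSucc.of_increasing vert_eq_iff
    (fun h => Γ₀.pos h + 1 = Γ₀.valence (Γ₀.vert h)) ?_ ?_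
  · intro x y hx hy hc
    refine eq_of_pos hc ?_
    rw [hc] at hx
    omega
  · intro x hx
    refine key_lt.2 (Or.inl ?_)
    change _ < Γ₀.pos (Γ₀.rot x)
    rw [pos_rot, if_neg hx]
    exact Nat.lt_succ_self _

theorem dist_rot (p : Γ₀.H) : Γ₀.dist p (Γ₀.rot p) = 1 := by
  have := dist_rot_pow p (i := 1) (by have := three_le_valence' p; omega)
  rwa [pow_one] at this

section model

variable {R : Set (Γ₀.H × Γ₀.H)}

/-- The half-edges of the ribbon graph with the set `R` of labels. -/
abbrev LabelType (R : Set (Γ₀.H × Γ₀.H)) : Type u := {x : Γ₀.H × Γ₀.H // x.1 = x.2 ∨ x ∈ R}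

/-- The reversed label. -/
def labelSwap (hR : Γ₀.IsLabelSet R) : Equiv.Perm (LabelType R) :=
  Function.Involutive.toPerm (fun x => ⟨x.1.swap, x.2.imp Eq.symm hR.symm⟩) fun _ => rfl

/-- The other half of the edge of a label. -/
noncomputable def labelFlip (hR : Γ₀.IsLabelSet R) : Equiv.Perm (LabelType R) :=
  Function.Involutive.toPerm (fun x => if x.1.1 = x.1.2 then
      ⟨(Γ₀.flip x.1.1, Γ₀.flip x.1.1), Or.inl rfl⟩ else labelSwap hR x) (by
    rintro ⟨⟨p, q⟩, hx⟩
    by_cases h : p = q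
    · subst h
      simp [Γ₀.flip_flip]
    · have h' : ¬ q = p := fun h' => h h'.symm
      simp only [h, if_false]
      exact if_neg h')

theorem IsLabelSet.vert' (hR : Γ₀.IsLabelSet R) (x : LabelType R) :
    Γ₀.vert x.1.1 = Γ₀.vert x.1.2 := by
  rcases x.2 with h | h
  · rw [h]
  · exact hR.vert h

variable (hR : Γ₀.IsLabelSet R) {φ : Equiv.Perm (LabelType R)}
  (hφ : IsCycSucc (fun x : LabelType R => Γ₀.vert x.1.1) (fun x => Γ₀.key x.1) φ)

theorem labelSwap_val (x : LabelType R) : (labelSwap hR x).1 = x.1.swap := rfl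

theorem labelSwap_labelSwap (x : LabelType R) : labelSwap hR (labelSwap hR x) = x := rfl

theorem labelFlip_labelFlip (x : LabelType R) : labelFlip hR (labelFlip hR x) = x :=
  Function.Involutive.toPerm_involutive _ x

theorem labelFlip_of_eq {x : LabelType R} (h : x.1.1 = x.1.2) :
    labelFlip hR x = ⟨(Γ₀.flip x.1.1, Γ₀.flip x.1.1), Or.inl rfl⟩ := if_pos h

theorem labelFlip_of_ne {x : LabelType R} (h : x.1.1 ≠ x.1.2) :
    labelFlip hR x = labelSwap hR x := if_neg h

theorem labelSwap_of_eq {x : LabelType R} (h : x.1.1 = x.1.2) : labelSwap hR x = x :=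
  Subtype.ext (Prod.ext h.symm h)

include hR in
theorem exists_label_perm : ∃ φ : Equiv.Perm (LabelType R),
    IsCycSucc (fun x : LabelType R => Γ₀.vert x.1.1) (fun x => Γ₀.key x.1) φ := by
  refine IsCycSucc.exists_perm ?_
  rintro ⟨⟨p, q⟩, hx⟩ ⟨⟨p', q'⟩, hy⟩ hc hk
  have h1 := hR.vert' ⟨⟨p, q⟩, hx⟩
  have h2 := hR.vert' ⟨⟨p', q'⟩, hy⟩
  simp only at hc hk h1 h2
  have h3 : ¬ Γ₀.key (p, q) < Γ₀.key (p', q') := hk.not_lt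
  have h4 : ¬ Γ₀.key (p', q') < Γ₀.key (p, q) := hk.not_gt
  rw [key_lt] at h3 h4
  simp only at h3 h4
  obtain rfl : p = p' := eq_of_pos hc (by omega)
  have h5 := dist_spec h1
  have h6 := dist_spec h2
  obtain rfl : q = q' := eq_of_pos (h1.symm.trans h2) (by omega)
  rfl

include hR hφ in
-- Among the labels with first component `p` the label `(p, p)` has the largest key, so the
-- successor of any other one does not leave the corner `p`.
theorem label_succ_of_ne {x : LabelType R} (hx : x.1.1 ≠ x.1.2) :
    (φ x).1.1 = x.1.1 ∧ Γ₀.dist (φ x).1.1 (φ x).1.2 < Γ₀.dist x.1.1 x.1.2 := by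
  have hc := hφ.cls x
  have h0 : Γ₀.dist x.1.1 x.1.2 ≠ 0 := by
    intro h
    rcases x.2 with h' | h'
    · exact hx h'
    · have := hR.two h'
      omega
  have h1 := hφ.step (x := x) (y := ⟨(x.1.1, x.1.1), Or.inl rfl⟩) rfl (by
    rw [key_lt]
    right
    rw [dist_self]
    exact ⟨rfl, by omega⟩)
  rw [key_lt, key_le] at h1
  simp only at h1
  have h2 : (φ x).1.1 = x.1.1 := eq_of_pos hc (by omega)
  refine ⟨h2, ?_⟩
  rw [h2] at h1 ⊢
  omega

include hφ in
-- The label of the leaf `Γ₀.rot p` bounds the successor of `(p, p)` from above; after the last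
-- position the successor is the minimum of the class, which starts at position zero.
theorem label_succ_of_eq {x : LabelType R} (hx : x.1.1 = x.1.2) :
    (φ x).1.1 = Γ₀.rot x.1.1 := by
  have hc : Γ₀.vert (φ x).1.1 = Γ₀.vert x.1.1 := hφ.cls x
  have hr := pos_rot x.1.1
  have hd : Γ₀.dist x.1.1 x.1.2 = 0 := by rw [← hx, dist_self]
  refine eq_of_pos (by rw [vert_rot, hc]) ?_
  let y : LabelType R := ⟨(Γ₀.rot x.1.1, Γ₀.rot x.1.1), Or.inl rfl⟩
  have hy : Γ₀.vert y.1.1 = Γ₀.vert x.1.1 := vert_rot _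
  by_cases hl : Γ₀.pos x.1.1 + 1 = Γ₀.valence (Γ₀.vert x.1.1)
  · rw [if_pos hl] at hr
    have h1 := hφ.wrap (x := x) (fun z hz => ?_) y hy
    · rw [key_le] at h1
      simp only [y] at h1
      omega
    · rw [key_le]
      have := pos_lt z.1.1
      have hz' : Γ₀.vert z.1.1 = Γ₀.vert x.1.1 := hz
      rw [hz'] at this
      omega
  · rw [if_neg hl] at hr
    have h1 := hφ.step (x := x) (y := y) hy (by
      rw [key_lt]
      simp only [y]
      omega)
    rw [key_lt, key_le] at h1
    simp only [y] at h1
    omega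

include hφ hR in
-- A step of the future `rot` moves to the next half-edge of `Γ₀` or decreases a distance. A cycle
-- of length one or two would give a half-edge fixed by `rot` or its square in `Γ₀`, a label of
-- distance at most one, or a distance smaller than itself.
theorem label_rot_ne (x : LabelType R) : φ (labelSwap hR x) ≠ x ∧
    φ (labelSwap hR (φ (labelSwap hR x))) ≠ x := by
  have hs1 : ∀ z : LabelType R, (labelSwap hR z).1.1 = z.1.2 := fun z => by rw [labelSwap_val, Prod.fst_swap]
  have hs2 : ∀ z : LabelType R, (labelSwap hR z).1.2 = z.1.1 := fun z => by rw [labelSwap_val, Prod.snd_swap]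
  have hd : ∀ z : LabelType R, z.1.1 ≠ z.1.2 → 2 ≤ Γ₀.dist z.1.2 z.1.1 := by
    intro z hz
    rcases (labelSwap hR z).2 with h | h
    · rw [hs1, hs2] at h
      exact absurd h.symm hz
    · have := hR.two h
      rwa [hs1, hs2] at this
  have hsucc : ∀ z : LabelType R, (z.1.1 = z.1.2 ∧ (φ (labelSwap hR z)).1.1 = Γ₀.rot z.1.2) ∨
      (z.1.1 ≠ z.1.2 ∧ (φ (labelSwap hR z)).1.1 = z.1.2 ∧
        Γ₀.dist z.1.2 (φ (labelSwap hR z)).1.2 < Γ₀.dist z.1.2 z.1.1) := by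
    intro z
    by_cases h : z.1.1 = z.1.2
    · exact Or.inl ⟨h, (label_succ_of_eq hφ (x := labelSwap hR z)
        (by rw [hs1, hs2, h])).trans (by rw [hs1])⟩
    · have := label_succ_of_ne hR hφ (x := labelSwap hR z) (fun h' => h (by
        rw [← hs1 z, h', hs2]))
      have h1 := this.1.trans (hs1 z)
      rw [h1, hs1, hs2] at this
      exact Or.inr ⟨h, h1, this.2⟩
  obtain ⟨hr1, hr2⟩ := exists_rot_ne x.1.1
  have hr3 := exists_rot_ne x.1.2
  constructor
  · intro hx
    rcases hsucc x with ⟨h1, h2⟩ | ⟨h1, h2, -⟩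
    · rw [hx] at h2
      exact hr3.1 (h2.symm.trans h1)
    · rw [hx] at h2
      exact h1 h2
  · intro hx
    set y := φ (labelSwap hR x) with hy
    rcases hsucc x with ⟨h1, h2⟩ | ⟨h1, h2, h3⟩
    · rw [← hy] at h2
      rcases hsucc y with ⟨h4, h5⟩ | ⟨h4, h5, -⟩
      · rw [hx, ← h4, h2, h1] at h5
        exact hr3.2 h5.symm
      · rw [hx] at h5
        have h6 := hd y h4
        rw [h2, ← h5, h1, dist_rot] at h6
        omega
    · rw [← hy] at h2 h3
      have h7 : y.1.2 ≠ x.1.1 := by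
        intro h
        rw [h] at h3
        omega
      rcases hsucc y with ⟨h4, h5⟩ | ⟨h4, h5, -⟩
      · rw [hx, ← h4, h2] at h5
        have h6 := hd x h1
        rw [h5, dist_rot] at h6
        omega
      · rw [hx] at h5
        exact h7 h5.symm

include hφ in
theorem label_connected (x y : LabelType R) : Relation.EqvGen
    (fun a b => b = (labelSwap hR).trans φ a ∨ b = labelFlip hR a) x y := by
  set L := Relation.EqvGen (fun a b => b = (labelSwap hR).trans φ a ∨ b = labelFlip hR a) with hL
  have hstep : ∀ z, L z (φ z) := by
    intro z
    have h1 : φ z = (labelSwap hR).trans φ (labelSwap hR z) := rfl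
    have h2 : L (labelSwap hR z) (φ z) := .rel _ _ (Or.inl h1)
    by_cases h : z.1.1 = z.1.2
    · rwa [labelSwap_of_eq hR h] at h2
    · exact .trans _ _ _ (.rel _ _ (Or.inr (labelFlip_of_ne hR h).symm)) h2
  have hcls : ∀ z w : LabelType R, Γ₀.vert z.1.1 = Γ₀.vert w.1.1 → L z w := by
    intro z w h
    obtain ⟨n, rfl⟩ := (hφ.sameCycle h).exists_nat_pow_eq
    clear h
    induction n with
    | zero => exact .refl _
    | succ n ih =>
      rw [pow_succ', Equiv.Perm.mul_apply]
      exact .trans _ _ _ ih (hstep _)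
  have hleaf : ∀ p q, L ⟨(p, p), Or.inl rfl⟩ ⟨(q, q), Or.inl rfl⟩ := by
    intro p q
    refine eqvGen_map (fun p : Γ₀.H => (⟨(p, p), Or.inl rfl⟩ : LabelType R)) ?_ (Γ₀.connected p q)
    rintro p q (rfl | rfl)
    · exact hcls _ _ (vert_rot _).symm
    · exact .rel _ _ (Or.inr (labelFlip_of_eq hR (x := ⟨(p, p), Or.inl rfl⟩) rfl).symm)
  exact .trans _ _ _ (hcls x ⟨(x.1.1, x.1.1), Or.inl rfl⟩ rfl)
    (.trans _ _ _ (hleaf _ _) (hcls ⟨(y.1.1, y.1.1), Or.inl rfl⟩ y rfl))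

/-- The labels between `x` and the reversed label in the cyclic order. -/
def between (x : Γ₀.H × Γ₀.H) (z : Γ₀.H × Γ₀.H) : Prop :=
  Γ₀.vert z.1 = Γ₀.vert x.1 ∧ Γ₀.key x < Γ₀.key z ∧ Γ₀.key z ≤ Γ₀.key x.swap

include hφ in
-- These labels form an interval of the cyclic order, which begins right after `x` and ends with the
-- reversed label.
theorem between_succ {x : LabelType R} (hp : Γ₀.pos x.1.1 < Γ₀.pos x.1.2) (z : LabelType R) :
    between x.1 (φ z).1 ↔ (between x.1 z.1 ∧ z ≠ labelSwap hR x) ∨ z = x := by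
  have hv := hR.vert' x
  have hc : Γ₀.vert (φ z).1.1 = Γ₀.vert z.1.1 := hφ.cls z
  have hlt : Γ₀.key x.1 < Γ₀.key x.1.swap := key_lt.2 (Or.inl hp)
  constructor
  · rintro ⟨h1, h2, h3⟩
    have hzx : Γ₀.vert z.1.1 = Γ₀.vert x.1.1 := hc.symm.trans h1
    have hmax : ∃ w : LabelType R, Γ₀.vert w.1.1 = Γ₀.vert z.1.1 ∧ Γ₀.key z.1 < Γ₀.key w.1 := by
      by_contra hmax
      push Not at hmax
      have := hφ.wrap (x := z) hmax x hzx.symm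
      exact absurd h2 (not_lt_of_ge this)
    obtain ⟨w, hw, hzw⟩ := hmax
    have h4 := (hφ.step hw hzw).1
    rcases lt_trichotomy (Γ₀.key z.1) (Γ₀.key x.1) with h | h | h
    · exact absurd h2 (not_lt_of_ge (hφ.step hzx.symm h).2)
    · exact Or.inr (hφ.inj hzx h)
    · left
      have h5 := h4.trans_le h3
      refine ⟨⟨hzx, h, h5.le⟩, ?_⟩
      rintro rfl
      exact lt_irrefl _ h5
  · rintro (⟨⟨h1, h2, h3⟩, h4⟩ | rfl)
    · have h5 : Γ₀.key z.1 < Γ₀.key (labelSwap hR x).1 := lt_of_le_of_ne h3 fun h =>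
        h4 (hφ.inj (y := labelSwap hR x) (h1.trans hv) h)
      have h6 := hφ.step (x := z) (y := labelSwap hR x) (hv.symm.trans h1.symm) h5
      exact ⟨hc.trans h1, h2.trans h6.1, h6.2⟩
    · have h6 := hφ.step (x := z) (y := labelSwap hR z) hv.symm hlt
      exact ⟨hc, h6.1, h6.2⟩

include hR in
-- As the labels do not cross, the other end of `z` lies on the same side of `x`; when it shares a
-- corner with `x`, the distance in the key decides.
theorem between_swap_of {x z : Γ₀.H × Γ₀.H} (hx : x ∈ R) (hz : z ∈ R)
    (hp : Γ₀.pos x.1 < Γ₀.pos x.2) (hzx : z ≠ x) (hzx' : z ≠ x.swap) (h : between x z) :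
    between x z.swap := by
  have hv1 := hR.vert hx
  have hv2 := hR.vert hz
  obtain ⟨h1, h2, h3⟩ := h
  have hn := hR.noncrossing hx hz h1.symm
  refine ⟨hv2.symm.trans h1, ?_⟩
  rw [key_lt] at h2 ⊢
  rw [key_le] at h3 ⊢
  simp only [Prod.fst_swap, Prod.snd_swap] at *
  have hne1 : ¬ (Γ₀.pos z.1 = Γ₀.pos x.1 ∧ Γ₀.pos z.2 = Γ₀.pos x.2) := fun h =>
    hzx (Prod.ext (eq_of_pos h1 h.1) (eq_of_pos (hv2.symm.trans (h1.trans hv1)) h.2))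
  have hne2 : ¬ (Γ₀.pos z.1 = Γ₀.pos x.2 ∧ Γ₀.pos z.2 = Γ₀.pos x.1) := fun h =>
    hzx' (Prod.ext (eq_of_pos (h1.trans hv1) h.1) (eq_of_pos (hv2.symm.trans h1) h.2))
  have ht := hR.two hz
  have d1 := dist_spec hv1
  have d2 := dist_spec hv1.symm
  have d3 := dist_spec hv2
  have d4 := dist_spec hv2.symm
  have d5 := dist_spec h1.symm
  have d6 := dist_spec (h1.symm.trans hv2)
  have d7 := dist_spec (hv1.symm.trans h1.symm)
  have d8 := dist_spec (hv1.symm.trans (h1.symm.trans hv2))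
  rw [← hv1] at d2 d7 d8
  rw [← hv2, h1] at d4
  rw [h1] at d3
  have b1 := Γ₀.pos_lt z.1
  have b2 := Γ₀.pos_lt z.2
  rw [← hv2] at b2
  rw [h1] at b1 b2
  clear hv1 hv2 h1 hzx hzx'
  obtain ⟨-, b3, d1⟩ := d1
  replace d1 := (d1.resolve_right fun h => absurd h.1 hp.not_gt).2
  replace d2 := (d2.2.2.resolve_left fun h => absurd h.1 hp.not_ge).2
  replace d3 := d3.2.2
  replace d4 := d4.2.2
  replace d5 := d5.2.2
  replace d6 := d6.2.2
  replace d7 := d7.2.2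
  replace d8 := d8.2.2
  rcases hn with hn | hn
  · clear d7 d8
    refine ⟨?_, ?_⟩ <;> omega
  · clear d5 d6
    refine ⟨?_, ?_⟩ <;> omega

include hR in
theorem between_swap {x z : Γ₀.H × Γ₀.H} (hx : x ∈ R) (hz : z ∈ R)
    (hp : Γ₀.pos x.1 < Γ₀.pos x.2) (hzx : z ≠ x) (hzx' : z ≠ x.swap) :
    between x z ↔ between x z.swap := by
  refine ⟨between_swap_of hR hx hz hp hzx hzx', fun h => ?_⟩
  have := between_swap_of hR hx (hR.symm hz) hp (fun h' => hzx' (by rw [← h', Prod.swap_swap]))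
    (fun h' => hzx (Prod.swap_injective h')) h
  rwa [Prod.swap_swap] at this

include hφ in
-- With `between_swap` this says that the interval is a union of vertices and is joined to its
-- complement by the edge of `x` only, which is therefore a bridge.
theorem between_rot {x : LabelType R} (hx : x.1 ∈ R) (hp : Γ₀.pos x.1.1 < Γ₀.pos x.1.2)
    (z : LabelType R) : between x.1 z.1 ↔ between x.1 (φ (labelSwap hR z)).1 := by
  have hlt : Γ₀.key x.1 < Γ₀.key x.1.swap := key_lt.2 (Or.inl hp)
  have hxx : labelSwap hR x ≠ x := by
    intro h
    have h' : (labelSwap hR x).1 = x.1 := by rw [h]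
    rw [labelSwap_val] at h'
    rw [h'] at hlt
    exact lt_irrefl _ hlt
  have hss := labelSwap_labelSwap hR
  rw [between_succ hR hφ hp]
  by_cases h1 : z = x
  · subst h1
    have : ¬ between z.1 z.1 := fun h => lt_irrefl _ h.2.1
    tauto
  by_cases h2 : z = labelSwap hR x
  · subst h2
    rw [hss]
    have h3 : between x.1 (labelSwap hR x).1 := ⟨(hR.vert' x).symm, hlt, le_rfl⟩
    simp only [h3, or_true]
  have h3 : labelSwap hR z ≠ labelSwap hR x := fun h => h1 ((labelSwap hR).injective h)
  have h4 : labelSwap hR z ≠ x := fun h => h2 (by rw [← h, hss])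
  have h5 : between x.1 z.1 ↔ between x.1 (labelSwap hR z).1 := by
    rcases z.2 with h | h
    · rw [labelSwap_of_eq hR h]
    · exact between_swap hR hx h hp (fun h => h1 (Subtype.ext h)) (fun h => h2 (Subtype.ext h))
  tauto

include hR in
/-- Every set of labels is the set of labels of a morphism to `Γ₀`. -/
theorem exists_hom_of_labels [Infinite Ω] : ∃ (Γ : RibbonGraph Ω) (f : Hom Γ Γ₀), f.labels = R := by
  obtain ⟨φ, hφ⟩ := exists_label_perm hR
  have hne0 : ∀ {x : Γ₀.H × Γ₀.H}, x ∈ R → x.1 ≠ x.2 := by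
    intro x hx h
    have := hR.two hx
    rw [h, dist_self] at this
    omega
  have : Nonempty (LabelType R) := by
    obtain ⟨h⟩ := Γ₀.nonempty
    exact ⟨⟨(h, h), Or.inl rfl⟩⟩
  obtain ⟨Γ, e, he1, he2⟩ := exists_ribbonGraph (Ω := Ω) ((labelSwap hR).trans φ) (labelFlip hR)
    (labelFlip_labelFlip hR) (fun x h => by
      by_cases hx : x.1.1 = x.1.2
      · rw [labelFlip_of_eq hR hx] at h
        exact Γ₀.flip_ne x.1.1 (congrArg (fun y : LabelType R => y.1.1) h)
      · rw [labelFlip_of_ne hR hx] at h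
        exact hx (congrArg (fun y : LabelType R => y.1.1) h).symm)
    (label_rot_ne hR hφ) (label_connected hR hφ)
  have hr : ∀ y, e (Γ.rot y) = φ (labelSwap hR (e y)) := he1
  let pre : Γ₀.H → Γ.H := fun h => e.symm ⟨(h, h), Or.inl rfl⟩
  have hepre : ∀ h, e (pre h) = ⟨(h, h), Or.inl rfl⟩ := fun h => e.apply_symm_apply _
  have hmem : ∀ y, y ∈ (Set.range pre)ᶜ ↔ (e y).1 ∈ R := by
    intro y
    constructor
    · intro hy
      refine (e y).2.resolve_left fun h => hy ⟨(e y).1.1, ?_⟩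
      exact e.injective ((hepre _).trans (Subtype.ext (Prod.ext rfl h)))
    · rintro h ⟨p, rfl⟩
      rw [hepre] at h
      exact hne0 h rfl
  have hflip : ∀ {y}, (e y).1 ∈ R → e (Γ.flip y) = labelSwap hR (e y) := fun {y} h => by
    rw [he2, labelFlip_of_ne hR (hne0 h)]
  have hclosed : ∀ a ∈ (Set.range pre)ᶜ, Γ.flip a ∈ (Set.range pre)ᶜ := by
    intro a ha
    rw [hmem] at ha ⊢
    rw [hflip ha]
    exact hR.symm ha
  have htau : ∀ y, e (Γ.tau (Set.range pre)ᶜ y) = labelSwap hR (e y) := by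
    intro y
    by_cases hy : y ∈ (Set.range pre)ᶜ
    · rw [tau_of_mem hclosed hy, hflip ((hmem y).1 hy)]
    · rw [tau_of_notMem hy, labelSwap_of_eq]
      exact (e y).2.resolve_right fun h => hy ((hmem y).2 h)
  have hturn : ∀ y, e (Γ.turn (Set.range pre)ᶜ y) = φ (e y) := by
    intro y
    rw [turn_apply, hr, htau]
    rfl
  have hturnp : ∀ n y, e ((Γ.turn (Set.range pre)ᶜ ^ n) y) = (φ ^ n) (e y) := by
    intro n y
    induction n with
    | zero => rfl
    | succ n ih =>
      rw [pow_succ', Equiv.Perm.mul_apply, pow_succ', Equiv.Perm.mul_apply, hturn, ih]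
  have hbr : Γ.Bridges (Set.range pre)ᶜ := by
    -- One direction of the edge suffices; the interval of `a` contains `flip a` but not `a`, and
    -- links that avoid the edge do not leave it.
    have key : ∀ a, a ∈ (Set.range pre)ᶜ → Γ₀.pos (e a).1.1 < Γ₀.pos (e a).1.2 →
        ¬ Γ.Linked (Γ.cut (Set.range pre)ᶜ a) a (Γ.flip a) := by
      intro a ha hp hl
      have haR := (hmem a).1 ha
      have h1 : between (e a).1 (e a).1 ↔ between (e a).1 (e (Γ.flip a)).1 := by
        refine hl.rec_on (p := fun y z => between (e a).1 (e y).1 ↔ between (e a).1 (e z).1)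
          ⟨fun _ => Iff.rfl, Iff.symm, Iff.trans⟩ (fun y => ?_) (fun y hy => ?_)
        · rw [hr]
          exact between_rot hR hφ haR hp (e y)
        · rw [mem_cut, hmem] at hy
          rw [hflip hy.1]
          refine between_swap hR haR hy.1 hp (fun h => hy.2.1 (e.injective (Subtype.ext h)))
            fun h => hy.2.2 (e.injective (Subtype.ext ?_))
          rw [hflip haR]
          exact h
      rw [hflip haR] at h1
      exact lt_irrefl _ (h1.2 ⟨(hR.vert haR).symm, key_lt.2 (Or.inl hp), le_rfl⟩).2.1
    intro a ha hl
    have haR := (hmem a).1 ha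
    rcases lt_trichotomy (Γ₀.pos (e a).1.1) (Γ₀.pos (e a).1.2) with h | h | h
    · exact key a ha h hl
    · exact hne0 haR (eq_of_pos (hR.vert haR) h)
    · refine key (Γ.flip a) (hclosed a ha) ?_ ?_
      · rw [hflip haR]
        exact h
      · rw [cut_flip, Γ.flip_flip]
        exact hl.symm
  let f : Hom Γ Γ₀ :=
    { pre := pre
      pre_injective := fun p q h => by
        have := congrArg e h
        rw [hepre, hepre] at this
        exact congrArg (fun y : LabelType R => y.1.1) this
      pre_flip := fun h => e.injective (by rw [hepre, he2, hepre, labelFlip_of_eq hR rfl])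
      forest := isForest_iff.2 ⟨hclosed, hbr⟩
      pre_rot := fun h => by
        rw [nextLeaf_iff hclosed fun h' => h' ⟨h, rfl⟩]
        refine ⟨fun h' => h' ⟨_, rfl⟩, ?_⟩
        obtain ⟨n, h1, h2⟩ := isCycSucc_rot.first_return hφ
          (fun p => (⟨(p, p), Or.inl rfl⟩ : LabelType R)) (fun _ => rfl) (fun _ => rfl) h
        refine ⟨n, e.injective ?_, ?_⟩
        · rw [hturnp, hepre, hepre, h1]
        · rintro i hi ⟨p, hp⟩
          refine h2 i hi ⟨p, ?_⟩
          have := congrArg e hp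
          rw [hturnp, hepre, hepre] at this
          exact this }
  have hcoll : ∀ y, y ∈ f.coll ↔ (e y).1 ∈ R := hmem
  -- The walk from a forest label keeps the first component and shortens the distance until it
  -- arrives at the leaf `(p, p)`.
  have hcorner : ∀ n y, Γ₀.dist (e y).1.1 (e y).1.2 = n → f.corner y = (e y).1.1 := by
    intro n
    induction n using Nat.strong_induction_on with
    | _ n ih =>
      intro y hy
      by_cases h : y ∈ f.coll
      · have h1 := label_succ_of_ne hR hφ (hne0 ((hcoll y).1 h))
        have h2 : e (Γ.turn f.coll y) = φ (e y) := hturn y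
        rw [← h2] at h1
        rw [← f.corner_turn_of_mem h, ← h1.1]
        exact ih _ (hy ▸ h1.2) _ rfl
      · obtain ⟨p, rfl⟩ := f.notMem_coll.1 h
        rw [f.corner_pre]
        exact (congrArg (fun y : LabelType R => y.1.1) (hepre p)).symm
  have hlabel : ∀ y, f.label y = (e y).1 := by
    intro y
    have h2 : e (Γ.tau f.coll y) = labelSwap hR (e y) := htau y
    rw [Hom.label, hcorner _ _ rfl, hcorner _ _ rfl, h2]
    rfl
  refine ⟨Γ, f, ?_⟩
  ext x
  constructor
  · rintro ⟨y, hy, rfl⟩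
    rw [hlabel]
    exact (hcoll y).1 hy
  · intro hx
    refine ⟨e.symm ⟨x, Or.inr hx⟩, ?_, ?_⟩
    · rw [hcoll, e.apply_symm_apply]
      exact hx
    · rw [hlabel, e.apply_symm_apply]

end model

end RibbonGraph

namespace RibbonGraph

variable {Ω : Type u} {Γ Γ₀ : RibbonGraph Ω}

/-! ### The codimension of the source of a morphism -/

theorem sum_ncard_fiber {X Y : Type*} [Finite X] [Fintype Y] (S : Set X) (q : X → Y) :
    ∑ y, {x | x ∈ S ∧ q x = y}.ncard = S.ncard := by
  have : Fintype X := Fintype.ofFinite X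
  rw [Set.ncard_eq_toFinset_card' S, Finset.card_eq_sum_card_fiberwise (t := Finset.univ) (f := q)
    (fun _ _ => Finset.mem_coe.2 (Finset.mem_univ _))]
  refine Finset.sum_congr rfl fun y _ => ?_
  rw [Set.ncard_eq_toFinset_card']
  congr 1
  ext x
  simp

theorem sum_valence : ∑ w, Γ.valence w = Γ.H.card := by
  have h := sum_ncard_fiber (Set.univ : Set Γ.H) Γ.vert
  simp only [Set.mem_univ, true_and, Set.ncard_univ, Nat.card_eq_fintype_card, Fintype.card_coe] at h
  exact h

theorem three_le_valence_vertex (w : Γ.Vertex) : 3 ≤ Γ.valence w := by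
  rw [← vert_out w]
  exact three_le_valence' _

theorem codim_add_card : Γ.codim + 3 * Nat.card Γ.Vertex = Γ.H.card := by
  rw [← sum_valence, codim, Nat.card_eq_fintype_card, mul_comm, ← smul_eq_mul, ← Finset.card_univ,
    ← Finset.sum_const, ← Finset.sum_add_distrib]
  exact Finset.sum_congr rfl fun w _ => Nat.sub_add_cancel (three_le_valence_vertex w)

theorem ncard_edge_image {S : Set Γ.H} (hS : ∀ a ∈ S, Γ.flip a ∈ S) :
    S.ncard = 2 * (Γ.edge '' S).ncard := by
  rw [Set.ncard_eq_toFinset_card', Finset.card_eq_sum_card_image Γ.edge,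
    Set.ncard_eq_toFinset_card' (Γ.edge '' S), Set.toFinset_image, mul_comm]
  refine Finset.sum_const_nat fun e he => ?_
  obtain ⟨a, ha, rfl⟩ := Finset.mem_image.1 he
  rw [Set.mem_toFinset] at ha
  have : S.toFinset.filter (fun b => Γ.edge b = Γ.edge a) = {a, Γ.flip a} := by
    ext b
    simp only [Finset.mem_filter, Set.mem_toFinset, Finset.mem_insert, Finset.mem_singleton]
    rw [eq_comm (a := Γ.edge b), edge_eq_iff]
    constructor
    · exact And.right
    · rintro (rfl | rfl)
      · exact ⟨ha, Or.inl rfl⟩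
      · exact ⟨hS _ ha, Or.inr rfl⟩
  rw [this, Finset.card_pair (Γ.flip_ne a).symm]

namespace Hom

variable (f : Hom Γ Γ₀)

/-- The map of vertices induced by a morphism. -/
noncomputable def vertexMap (w : Γ.Vertex) : Γ₀.Vertex := Γ₀.vert (f.corner (Quotient.out w))

theorem vertexMap_vert (x : Γ.H) : f.vertexMap (Γ.vert x) = Γ₀.vert (f.corner x) :=
  f.linked_iff.1 (linked_of_vert_eq _ (vert_out _))

theorem ncard_coll_add : f.coll.ncard + Γ₀.H.card = Γ.H.card := by
  have h1 := Set.ncard_add_ncard_compl (Set.range f.pre)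
  rw [← Set.image_univ, Set.ncard_image_of_injective _ f.pre_injective, Set.ncard_univ,
    Set.image_univ] at h1
  simp only [Nat.card_eq_fintype_card, Fintype.card_coe] at h1
  rw [coll]
  omega

/-- Over each vertex of `Γ₀` lies one tree, which has one more vertex than edges. The factor two
arises because `coll` consists of half-edges. -/
theorem card_vertex : 2 * Nat.card Γ.Vertex = f.coll.ncard + 2 * Nat.card Γ₀.Vertex := by
  have h1 := sum_ncard_fiber (Set.univ : Set Γ.Vertex) f.vertexMap
  rw [Set.ncard_univ] at h1
  rw [← h1, ← sum_ncard_fiber f.coll fun a => Γ₀.vert (f.corner a), Nat.card_eq_fintype_card,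
    ← Finset.card_univ, Finset.card_eq_sum_ones, Finset.mul_sum, Finset.mul_sum,
    ← Finset.sum_add_distrib]
  refine Finset.sum_congr rfl fun w _ => ?_
  obtain ⟨h, rfl⟩ : ∃ h, Γ₀.vert (f.corner h) = w :=
    ⟨f.pre (Quotient.out w), by rw [corner_pre, vert_out]⟩
  have h2 := f.forest.2 h
  have h3 : {v | ∃ a, Γ.Linked (Set.range f.pre)ᶜ h a ∧ Γ.vert a = v} =
      {v | v ∈ Set.univ ∧ f.vertexMap v = Γ₀.vert (f.corner h)} := by
    ext v
    constructor
    · rintro ⟨a, ha, rfl⟩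
      exact ⟨trivial, (f.vertexMap_vert a).trans (f.linked_iff.1 ha).symm⟩
    · rintro ⟨-, hv⟩
      refine ⟨Quotient.out v, f.linked_iff.2 hv.symm, vert_out v⟩
  have h4 : {e | ∃ a ∈ (Set.range f.pre)ᶜ, Γ.Linked (Set.range f.pre)ᶜ h a ∧ Γ.edge a = e} =
      Γ.edge '' {a | a ∈ f.coll ∧ Γ₀.vert (f.corner a) = Γ₀.vert (f.corner h)} := by
    ext e
    constructor
    · rintro ⟨a, ha, hl, rfl⟩
      exact ⟨a, ⟨ha, (f.linked_iff.1 hl).symm⟩, rfl⟩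
    · rintro ⟨a, ⟨ha, hl⟩, rfl⟩
      exact ⟨a, ha, f.linked_iff.2 hl.symm, rfl⟩
  rw [h3, h4] at h2
  rw [h2, ncard_edge_image (S := {a | a ∈ f.coll ∧ Γ₀.vert (f.corner a) = Γ₀.vert (f.corner h)})]
  · ring
  · rintro a ⟨ha, hv⟩
    refine ⟨f.closed a ha, ?_⟩
    rw [← hv, ← tau_of_mem f.closed ha, f.vert_corner_tau]

/-- The codimension is the number of half-edges minus three times the number of vertices. Collapsing
an edge removes two half-edges and one vertex, so it adds one. -/
theorem codim_eq : 2 * Γ.codim + f.coll.ncard = 2 * Γ₀.codim := by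
  have h1 := f.ncard_coll_add
  have h2 := f.card_vertex
  have h3 := Γ.codim_add_card
  have h4 := Γ₀.codim_add_card
  omega

theorem ncard_labels : f.labels.ncard = f.coll.ncard :=
  Set.ncard_image_of_injective _ f.label_injective

end Hom

end RibbonGraph

namespace RibbonGraph

open Associahedron

variable {Ω : Type u} {Γ Γ' Γ₀ : RibbonGraph Ω}

/-! ### Labels and diagonals of polygons -/

/-- The half-edges at the vertices `v i` are the sides of polygons, and the pairs of half-edges
given by sets of diagonals of these polygons. -/
def labelSet {r : ℕ} {n : Fin r → ℕ} (v : Fin r → Γ₀.Vertex) (D : ∀ i, Face (n i)) :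
    Set (Γ₀.H × Γ₀.H) :=
  {x | ∃ i, Γ₀.vert x.1 = v i ∧ Γ₀.vert x.2 = v i ∧
    ((D i).Has (Γ₀.pos x.1) (Γ₀.pos x.2) ∨ (D i).Has (Γ₀.pos x.2) (Γ₀.pos x.1))}

variable {r : ℕ} {n : Fin r → ℕ} {v : Fin r → Γ₀.Vertex}

theorem swap_mem_labelSet {D : ∀ i, Face (n i)} {x : Γ₀.H × Γ₀.H} (h : x ∈ labelSet v D) :
    x.swap ∈ labelSet v D := by
  obtain ⟨i, h1, h2, h3⟩ := h
  exact ⟨i, h2, h1, h3.symm⟩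

theorem exists_side (hval : ∀ i, Γ₀.valence (v i) = n i + 3) (i : Fin r) (p : Fin (n i + 3)) :
    ∃ h, Γ₀.vert h = v i ∧ Γ₀.pos h = p :=
  exists_of_pos (by rw [hval]; exact p.2)

theorem labelSet_subset_iff (hv : Function.Injective v) (hval : ∀ i, Γ₀.valence (v i) = n i + 3)
    {D E : ∀ i, Face (n i)} :
    labelSet v D ⊆ labelSet v E ↔ ∀ i, (D i).diagonals ⊆ (E i).diagonals := by
  constructor
  · intro h i a ha
    obtain ⟨p, hp1, hp2⟩ := exists_side hval i a.1.1
    obtain ⟨q, hq1, hq2⟩ := exists_side hval i a.1.2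
    have h1 : (p, q) ∈ labelSet v D := ⟨i, hp1, hq1, Or.inl ⟨a, ha, hp2.symm, hq2.symm⟩⟩
    obtain ⟨j, h2, -, h3⟩ := h h1
    obtain rfl : i = j := hv (hp1.symm.trans h2)
    simp only [hp2, hq2] at h3
    rcases h3 with h3 | h3
    · exact (Face.has_iff a).1 h3
    · have h4 := h3.bounds
      have h5 := a.2
      omega
  · rintro h x ⟨i, h1, h2, h3⟩
    refine ⟨i, h1, h2, h3.imp ?_ ?_⟩
    · rintro ⟨a, ha, h4⟩
      exact ⟨a, h i ha, h4⟩
    · rintro ⟨a, ha, h4⟩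
      exact ⟨a, h i ha, h4⟩

theorem labelSet_injective (hv : Function.Injective v) (hval : ∀ i, Γ₀.valence (v i) = n i + 3) :
    Function.Injective (labelSet v : (∀ i, Face (n i)) → _) := fun D E h => by
  have h1 := (labelSet_subset_iff hv hval).1 h.subset
  have h2 := (labelSet_subset_iff hv hval).1 h.symm.subset
  exact funext fun i => Face.ext' ((h1 i).antisymm (h2 i))

/-- Positions turn cyclic distances into comparisons of numbers: a label with increasing positions
bounds the interval between them from one end and its complement from the other end. -/
theorem isLabelSet_labelSet (hv : Function.Injective v) (hval : ∀ i, Γ₀.valence (v i) = n i + 3)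
    (D : ∀ i, Face (n i)) : Γ₀.IsLabelSet (labelSet v D) := by
  refine ⟨swap_mem_labelSet, ?_, ?_, ?_⟩
  · rintro x ⟨i, h1, h2, -⟩
    exact h1.trans h2.symm
  · rintro x ⟨i, h1, h2, h3⟩
    have h4 := dist_spec (h1.trans h2.symm)
    rw [h1, hval] at h4
    rcases h3 with h3 | h3
    · have := h3.bounds
      omega
    · have := h3.bounds
      omega
  · rintro x y ⟨i, h1, h2, h3⟩ ⟨j, h4, h5, h6⟩ h7
    obtain rfl : i = j := hv (h1.symm.trans (h7.trans h4))
    have key : ∀ {p q : Γ₀.H}, Γ₀.vert p = v i → Γ₀.vert q = v i → (Γ₀.pos p < n i + 3 ∧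
        Γ₀.pos q < n i + 3 ∧ ((Γ₀.pos p ≤ Γ₀.pos q ∧ Γ₀.dist p q = Γ₀.pos q - Γ₀.pos p) ∨
        (Γ₀.pos q < Γ₀.pos p ∧ Γ₀.dist p q = Γ₀.pos q + (n i + 3) - Γ₀.pos p))) := by
      intro p q hp hq
      have := dist_spec (hp.trans hq.symm)
      rwa [hp, hval] at this
    have inside : ∀ {p q s : Γ₀.H}, Γ₀.vert p = v i → Γ₀.vert q = v i → Γ₀.vert s = v i →
        Γ₀.pos p ≤ Γ₀.pos s → Γ₀.pos s ≤ Γ₀.pos q → Γ₀.dist p s ≤ Γ₀.dist p q := by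
      intro p q s hp hq hs _ _
      have d1 := key hp hs
      have d2 := key hp hq
      omega
    have outside : ∀ {p q s : Γ₀.H}, Γ₀.vert p = v i → Γ₀.vert q = v i → Γ₀.vert s = v i →
        Γ₀.pos p < Γ₀.pos q → (Γ₀.pos s ≤ Γ₀.pos p ∨ Γ₀.pos q ≤ Γ₀.pos s) →
        Γ₀.dist q s ≤ Γ₀.dist q p := by
      intro p q s hp hq hs _ _
      have d1 := key hq hs
      have d2 := key hq hp
      omega
    have hc : ∀ {p q s t : ℕ}, (D i).Has p q → (D i).Has s t →
        ¬ (p < s ∧ s < q ∧ q < t) ∧ ¬ (s < p ∧ p < t ∧ t < q) := by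
      rintro _ _ _ _ ⟨a, ha, rfl, rfl⟩ ⟨b, hb, rfl, rfl⟩
      have := (D i).noncrossing a ha b hb
      rw [crosses_iff] at this
      exact not_or.1 this
    have hsep : ∀ {p q : ℕ}, (D i).Has p q →
        (p ≤ Γ₀.pos y.1 ∧ Γ₀.pos y.1 ≤ q ∧ p ≤ Γ₀.pos y.2 ∧ Γ₀.pos y.2 ≤ q) ∨
        ((Γ₀.pos y.1 ≤ p ∨ q ≤ Γ₀.pos y.1) ∧ (Γ₀.pos y.2 ≤ p ∨ q ≤ Γ₀.pos y.2)) := by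
      intro p q h
      rcases h6 with h6 | h6
      · have h7 := hc h h6
        have h8 := h.bounds
        have h9 := h6.bounds
        omega
      · have h7 := hc h h6
        have h8 := h.bounds
        have h9 := h6.bounds
        omega
    rcases h3 with h3 | h3
    · have h8 : Γ₀.pos x.1 < Γ₀.pos x.2 := by have := h3.bounds; omega
      rcases hsep h3 with h | h
      · exact Or.inl ⟨inside h1 h2 h4 h.1 h.2.1, inside h1 h2 h5 h.2.2.1 h.2.2.2⟩
      · exact Or.inr ⟨outside h1 h2 h4 h8 h.1, outside h1 h2 h5 h8 h.2⟩
    · have h8 : Γ₀.pos x.2 < Γ₀.pos x.1 := by have := h3.bounds; omega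
      rcases hsep h3 with h | h
      · exact Or.inr ⟨inside h2 h1 h4 h.1 h.2.1, inside h2 h1 h5 h.2.2.1 h.2.2.2⟩
      · exact Or.inl ⟨outside h2 h1 h4 h8 h.1, outside h2 h1 h5 h8 h.2⟩

/-- The bound on the distance, applied to a label and to its reversal, excludes exactly the sides of
the polygon. -/
theorem exists_labelSet (hval : ∀ i, Γ₀.valence (v i) = n i + 3)
    (htri : ∀ w, w ∉ Set.range v → Γ₀.valence w = 3) {R : Set (Γ₀.H × Γ₀.H)}
    (hR : Γ₀.IsLabelSet R) : ∃ D : ∀ i, Face (n i), labelSet v D = R := by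
  have hnc : ∀ i, ∀ a ∈ Finset.univ.filter (fun a : Diagonal (n i) => ∃ x ∈ R, Γ₀.vert x.1 = v i ∧
      Γ₀.pos x.1 = a.1.1 ∧ Γ₀.pos x.2 = a.1.2), ∀ b ∈ Finset.univ.filter (fun a : Diagonal (n i) =>
      ∃ x ∈ R, Γ₀.vert x.1 = v i ∧ Γ₀.pos x.1 = a.1.1 ∧ Γ₀.pos x.2 = a.1.2), ¬ Crosses a b := by
    intro i a ha b hb hab
    obtain ⟨-, x, hx, h1, h2, h3⟩ := Finset.mem_filter.1 ha
    obtain ⟨-, y, hy, h4, h5, h6⟩ := Finset.mem_filter.1 hb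
    rw [crosses_iff] at hab
    have hn := hR.noncrossing hx hy (h1.trans h4.symm)
    have hxv := hR.vert hx
    have hyv := hR.vert hy
    have d1 := dist_spec hxv
    have d2 := dist_spec hxv.symm
    have d3 := dist_spec (h1.trans h4.symm)
    have d4 := dist_spec ((h1.trans h4.symm).trans hyv)
    have d5 := dist_spec (hxv.symm.trans (h1.trans h4.symm))
    have d6 := dist_spec ((hxv.symm.trans (h1.trans h4.symm)).trans hyv)
    rw [← hxv] at d2 d5 d6
    clear hxv hyv h1 h4 ha hb
    omega
  let D : ∀ i, Face (n i) := fun i => ⟨_, hnc i⟩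
  refine ⟨D, ?_⟩
  · have hmem : ∀ {x : Γ₀.H × Γ₀.H}, x ∈ R → Γ₀.pos x.1 < Γ₀.pos x.2 →
        ∃ i, Γ₀.vert x.1 = v i ∧ ∃ a : Diagonal (n i),
          Γ₀.pos x.1 = a.1.1 ∧ Γ₀.pos x.2 = a.1.2 := by
      intro x hx hlt
      have h1 := hR.two hx
      have h2 := hR.two (hR.symm hx)
      have hxv := hR.vert hx
      have d1 := dist_spec hxv
      have d2 := dist_spec hxv.symm
      simp only [Prod.fst_swap, Prod.snd_swap] at h2
      rw [← hxv] at d2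
      by_cases h : Γ₀.vert x.1 ∈ Set.range v
      · obtain ⟨i, hi⟩ := h
        rw [← hi, hval] at d1 d2
        obtain ⟨a, ha1, ha2⟩ := Diagonal.exists_mk (m := n i) (i := Γ₀.pos x.1) (j := Γ₀.pos x.2)
          (by omega) (by omega) (by omega)
        exact ⟨i, hi.symm, a, ha1.symm, ha2.symm⟩
      -- At a trivalent vertex the two distances add up to three, so they cannot both be at least
      -- two.
      · rw [htri _ h] at d1 d2
        omega
    have hof : ∀ {x : Γ₀.H × Γ₀.H} {i : Fin r}, Γ₀.vert x.1 = v i → Γ₀.vert x.2 = v i →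
        (∃ y ∈ R, Γ₀.vert y.1 = v i ∧ Γ₀.pos y.1 = Γ₀.pos x.1 ∧ Γ₀.pos y.2 = Γ₀.pos x.2) →
        x ∈ R := by
      rintro x i h1 h2 ⟨y, hy, h3, h4, h5⟩
      have h6 : y = x := Prod.ext (eq_of_pos (h3.trans h1.symm) h4)
        (eq_of_pos ((hR.vert hy).symm.trans (h3.trans h2.symm)) h5)
      rwa [← h6]
    ext x
    constructor
    · rintro ⟨i, h1, h2, ⟨a, ha, h3, h4⟩ | ⟨a, ha, h3, h4⟩⟩
      · obtain ⟨-, y, hy, h5, h6, h7⟩ := Finset.mem_filter.1 ha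
        exact hof h1 h2 ⟨y, hy, h5, h6.trans h3, h7.trans h4⟩
      · obtain ⟨-, y, hy, h5, h6, h7⟩ := Finset.mem_filter.1 ha
        exact hR.symm (hof (x := x.swap) h2 h1 ⟨y, hy, h5, h6.trans h3, h7.trans h4⟩)
    · intro hx
      have hto : ∀ {x : Γ₀.H × Γ₀.H}, x ∈ R → Γ₀.pos x.1 < Γ₀.pos x.2 → x ∈ labelSet v D := by
        intro x hx hlt
        obtain ⟨i, h1, a, h2, h3⟩ := hmem hx hlt
        exact ⟨i, h1, (hR.vert hx).symm.trans h1, Or.inl ⟨a, Finset.mem_filter.2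
          ⟨Finset.mem_univ _, x, hx, h1, h2, h3⟩, h2.symm, h3.symm⟩⟩
      rcases lt_trichotomy (Γ₀.pos x.1) (Γ₀.pos x.2) with h | h | h
      · exact hto hx h
      · have h1 := hR.two hx
        rw [eq_of_pos (hR.vert hx) h, dist_self] at h1
        omega
      · exact swap_mem_labelSet (hto (hR.symm hx) h)

theorem ncard_labelSet (hv : Function.Injective v) (hval : ∀ i, Γ₀.valence (v i) = n i + 3)
    (D : ∀ i, Face (n i)) : (labelSet v D).ncard = 2 * ∑ i, (D i).diagonals.card := by
  choose s hs1 hs2 using exists_side hval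
  let A : (Σ i, {a // a ∈ (D i).diagonals}) × Bool → labelSet v D := fun x =>
    if x.2 then ⟨(s x.1.1 x.1.2.1.1.1, s x.1.1 x.1.2.1.1.2), x.1.1, hs1 _ _, hs1 _ _,
      Or.inl ⟨x.1.2.1, x.1.2.2, (hs2 _ _).symm, (hs2 _ _).symm⟩⟩
    else ⟨(s x.1.1 x.1.2.1.1.2, s x.1.1 x.1.2.1.1.1), x.1.1, hs1 _ _, hs1 _ _,
      Or.inr ⟨x.1.2.1, x.1.2.2, (hs2 _ _).symm, (hs2 _ _).symm⟩⟩
  have hA : Function.Bijective A := by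
    constructor
    · rintro ⟨⟨i, a, ha⟩, b⟩ ⟨⟨i', a', ha'⟩, b'⟩ h
      have h0 := congrArg (fun x => Γ₀.vert x.1.1) h
      have h1 := congrArg (fun x => Γ₀.pos x.1.1) h
      have h2 := congrArg (fun x => Γ₀.pos x.1.2) h
      have h3 := a.2
      have h4 := a'.2
      cases b <;> cases b' <;> simp [A, hs1, hs2] at h0 h1 h2 <;> obtain rfl := hv h0
      · obtain rfl := Diagonal.ext' h2 h1
        rfl
      · omega
      · omega
      · obtain rfl := Diagonal.ext' h1 h2
        rfl
    · rintro ⟨x, i, h1, h2, ⟨a, ha, h3, h4⟩ | ⟨a, ha, h3, h4⟩⟩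
      · refine ⟨⟨⟨i, a, ha⟩, true⟩, Subtype.ext (Prod.ext ?_ ?_)⟩
        · exact eq_of_pos ((hs1 _ _).trans h1.symm) ((hs2 _ _).trans h3)
        · exact eq_of_pos ((hs1 _ _).trans h2.symm) ((hs2 _ _).trans h4)
      · refine ⟨⟨⟨i, a, ha⟩, false⟩, Subtype.ext (Prod.ext ?_ ?_)⟩
        · exact eq_of_pos ((hs1 _ _).trans h1.symm) ((hs2 _ _).trans h4)
        · exact eq_of_pos ((hs1 _ _).trans h2.symm) ((hs2 _ _).trans h3)
  rw [← Nat.card_coe_set_eq, ← Nat.card_congr (Equiv.ofBijective A hA), Nat.card_prod,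
    Nat.card_sigma, mul_comm]
  simp

theorem piDim_add (D : ∀ i, Face (n i)) :
    piDim (fun _ => Face.dim) D + ∑ i, (D i).diagonals.card = ∑ i, n i := by
  rw [piDim, ← Finset.sum_add_distrib]
  exact Finset.sum_congr rfl fun i _ => Nat.sub_add_cancel (D i).card_le

theorem piCov_face_iff {D E : ∀ i, Face (n i)} : piCov (fun _ => Face.Cov) D E ↔
    (∀ i, (D i).diagonals ⊆ (E i).diagonals) ∧
      piDim (fun _ => Face.dim) D = piDim (fun _ => Face.dim) E + 1 := by
  have hD := piDim_add D
  have hE := piDim_add E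
  constructor
  · rintro ⟨i, F, ⟨a, ha, hF⟩, rfl⟩
    refine ⟨fun j => ?_, ?_⟩
    · by_cases h : j = i
      · subst h
        rw [Function.update_self, hF]
        exact Finset.subset_insert _ _
      · rw [Function.update_of_ne h]
    · have h1 : ∑ j, (Function.update D i F j).diagonals.card =
          ∑ j, ((D j).diagonals.card + if j = i then 1 else 0) := by
        refine Finset.sum_congr rfl fun j _ => ?_
        by_cases h : j = i
        · subst h
          rw [Function.update_self, hF, Finset.card_insert_of_notMem ha, if_pos rfl]
        · rw [Function.update_of_ne h, if_neg h, add_zero]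
      rw [Finset.sum_add_distrib, Finset.sum_ite_eq' Finset.univ i, if_pos (Finset.mem_univ i)] at h1
      omega
  · rintro ⟨hs, hd⟩
    have hle : ∀ i, (D i).diagonals.card ≤ (E i).diagonals.card := fun i =>
      Finset.card_le_card (hs i)
    have hsum : ∑ i, ((E i).diagonals.card - (D i).diagonals.card) = 1 := by
      rw [Finset.sum_tsub_distrib _ fun i _ => hle i]
      omega
    obtain ⟨i, -, hi⟩ := Finset.exists_ne_zero_of_sum_ne_zero (hsum.trans_ne one_ne_zero)
    rw [← Finset.add_sum_erase _ _ (Finset.mem_univ i)] at hsum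
    have h0 : ∀ j ∈ Finset.univ.erase i, (E j).diagonals.card - (D j).diagonals.card = 0 :=
      Finset.sum_eq_zero_iff.1 (by omega)
    rw [Finset.sum_eq_zero h0] at hsum
    refine ⟨i, E i, ?_, ?_⟩
    · have h1 : ((E i).diagonals \ (D i).diagonals).card = 1 := by
        rw [Finset.card_sdiff_of_subset (hs i)]
        omega
      obtain ⟨a, ha⟩ := Finset.card_eq_one.1 h1
      refine ⟨a, fun h => ?_, ?_⟩
      · have : a ∈ (E i).diagonals \ (D i).diagonals := by rw [ha]; simp
        exact (Finset.mem_sdiff.1 this).2 h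
      · rw [← Finset.sdiff_union_of_subset (hs i), ha, Finset.insert_eq]
    · funext j
      by_cases h : j = i
      · subst h
        rw [Function.update_self]
      · rw [Function.update_of_ne h]
        have := h0 j (by simp [h])
        exact (Face.ext' (Finset.eq_of_subset_of_card_le (hs j) (by omega))).symm

end RibbonGraph

namespace RibbonGraph

open Associahedron

variable {Ω : Type u} {Γ Γ' Γ₀ : RibbonGraph Ω}

/-! ### Classification of the morphisms to a ribbon graph -/

namespace Hom

variable {f : Hom Γ Γ₀} {f' : Hom Γ' Γ₀}

theorem label_of_iso {e : Iso Γ Γ'} (he : ∀ h, e.toEquiv (f.pre h) = f'.pre h) (x : Γ.H) :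
    f'.label (e.toEquiv x) = f.label x := by
  have h := label_of_over (g := (ofLabel (f := f) (f' := f) (j := id) fun _ => rfl).compIso e)
    (f := f') (f' := f) (fun h => by
      change e.toEquiv.symm (f'.pre h) = f.pre h
      rw [← he, e.toEquiv.symm_apply_apply]) (e.toEquiv x)
  rw [← h]
  exact congrArg f.label (e.toEquiv.symm_apply_apply x)

theorem labels_subset_of_over {g : Hom Γ' Γ} (hg : ∀ h, g.pre (f.pre h) = f'.pre h) :
    f.labels ⊆ f'.labels := by
  rintro _ ⟨x, hx, rfl⟩
  exact ⟨g.pre x, (mem_coll_of_over hg x).2 hx, label_of_over hg x⟩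

theorem exists_lift (h : f.labels ⊆ f'.labels) : ∃ j : Γ.H → Γ'.H, ∀ x, f'.label (j x) = f.label x := by
  have h1 : ∀ x, f.label x ∈ Set.range f'.label := fun x => by
    have h2 : f.label x ∈ Set.range f.label := ⟨x, rfl⟩
    rw [range_label] at h2 ⊢
    exact h2.imp id fun h' => h h'
  choose j hj using h1
  exact ⟨j, hj⟩

/-- The leaves have the same labels on both sides, so an inclusion of forest labels is a
label-preserving map of all half-edges, and such a map is a morphism in the opposite direction. -/
theorem exists_over (h : f.labels ⊆ f'.labels) :
    ∃ g : Hom Γ' Γ, ∀ h, g.pre (f.pre h) = f'.pre h := by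
  obtain ⟨j, hj⟩ := exists_lift h
  exact ⟨ofLabel hj, apply_pre_of_label hj⟩

theorem exists_iso (h : f.labels = f'.labels) :
    ∃ e : Iso Γ Γ', ∀ h, e.toEquiv (f.pre h) = f'.pre h := by
  obtain ⟨j, hj⟩ := exists_lift h.subset
  obtain ⟨j', hj'⟩ := exists_lift h.symm.subset
  let e : Γ.H ≃ Γ'.H := ⟨j, j', fun x => f.label_injective (by rw [hj', hj]),
    fun x => f'.label_injective (by rw [hj, hj'])⟩
  exact ⟨isoOfLabel e hj, apply_pre_of_label hj⟩

theorem card_of_codim (f : Hom Γ Γ₀) (f' : Hom Γ' Γ₀) (h : Γ.codim = Γ'.codim + 1) :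
    Γ'.H.card = Γ.H.card + 2 := by
  have h1 := f.codim_eq
  have h2 := f'.codim_eq
  have h3 := f.ncard_coll_add
  have h4 := f'.ncard_coll_add
  omega

end Hom

variable {r : ℕ} {n : Fin r → ℕ} {v : Fin r → Γ₀.Vertex}

theorem codim_eq_sum (hv : Function.Injective v) (hval : ∀ i, Γ₀.valence (v i) = n i + 3)
    (htri : ∀ w, w ∉ Set.range v → Γ₀.valence w = 3) : Γ₀.codim = ∑ i, n i := by
  rw [codim, ← Finset.sum_subset (Finset.subset_univ (Finset.univ.image v)),
    Finset.sum_image fun _ _ _ _ h => hv h]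
  · exact Finset.sum_congr rfl fun i _ => by rw [vertexCodim, hval, Nat.add_sub_cancel]
  · intro w _ hw
    rw [vertexCodim, htri w fun ⟨i, hi⟩ => hw (Finset.mem_image.2 ⟨i, Finset.mem_univ i, hi⟩),
      Nat.sub_self]

variable (hv : Function.Injective v) (hval : ∀ i, Γ₀.valence (v i) = n i + 3)
  (htri : ∀ w, w ∉ Set.range v → Γ₀.valence w = 3)

/-- The sets of diagonals that correspond to a morphism. -/
noncomputable def Hom.code (f : Hom Γ Γ₀) : ∀ i, Face (n i) :=
  (exists_labelSet hval htri f.isLabelSet).choose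

theorem Hom.labelSet_code (f : Hom Γ Γ₀) : labelSet v (f.code hval htri) = f.labels :=
  (exists_labelSet hval htri f.isLabelSet).choose_spec

include hv in
theorem Hom.codim_eq_piDim (f : Hom Γ Γ₀) :
    Γ.codim = piDim (fun _ => Face.dim) (f.code hval htri) := by
  have h1 := f.codim_eq
  have h2 := ncard_labelSet hv hval (f.code hval htri)
  have h3 := piDim_add (f.code hval htri)
  rw [f.labelSet_code, f.ncard_labels] at h2
  rw [codim_eq_sum hv hval htri] at h1
  omega

include hv in
theorem exists_hom_of_code [Infinite Ω] (D : ∀ i, Face (n i)) :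
    ∃ (Γ : RibbonGraph Ω) (f : Hom Γ Γ₀), f.code hval htri = D := by
  obtain ⟨Γ, f, hf⟩ := exists_hom_of_labels (isLabelSet_labelSet hv hval D)
  exact ⟨Γ, f, labelSet_injective hv hval (by rw [f.labelSet_code, hf])⟩

theorem Hom.exists_iso_of_code {f : Hom Γ Γ₀} {f' : Hom Γ' Γ₀}
    (h : f.code hval htri = f'.code hval htri) :
    ∃ e : Iso Γ Γ', ∀ h, e.toEquiv (f.pre h) = f'.pre h :=
  Hom.exists_iso (by rw [← f.labelSet_code hval htri, h, f'.labelSet_code])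

include hv in
theorem Hom.code_eq_of_iso {f : Hom Γ Γ₀} {f' : Hom Γ' Γ₀} {e : Iso Γ Γ'}
    (he : ∀ h, e.toEquiv (f.pre h) = f'.pre h) : f.code hval htri = f'.code hval htri := by
  have h : ∀ h, e.symm.toEquiv (f'.pre h) = f.pre h := fun h => by
    rw [← he]; exact e.toEquiv.symm_apply_apply _
  refine labelSet_injective hv hval ?_
  rw [f.labelSet_code, f'.labelSet_code]
  refine Set.Subset.antisymm ?_ ?_
  · rintro _ ⟨x, hx, rfl⟩
    refine ⟨e.toEquiv x, ?_, label_of_iso he x⟩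
    rw [mem_coll_iff, label_of_iso he]
    exact f.mem_coll_iff.1 hx
  · rintro _ ⟨x, hx, rfl⟩
    refine ⟨e.symm.toEquiv x, ?_, label_of_iso h x⟩
    rw [mem_coll_iff, label_of_iso h]
    exact f'.mem_coll_iff.1 hx

include hv in
theorem Hom.piCov_code {f : Hom Γ Γ₀} {f' : Hom Γ' Γ₀} {g : Hom Γ' Γ}
    (hg : ∀ h, g.pre (f.pre h) = f'.pre h) (hc : Γ.codim = Γ'.codim + 1) :
    piCov (fun _ => Face.Cov) (f.code hval htri) (f'.code hval htri) := by
  rw [piCov_face_iff, ← labelSet_subset_iff hv hval, f.labelSet_code, f'.labelSet_code,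
    ← f.codim_eq_piDim hv hval htri, ← f'.codim_eq_piDim hv hval htri]
  exact ⟨labels_subset_of_over hg, hc⟩

include hv in
-- Covers are inclusions with dimensions differing by one; the labels turn the inclusion into a
-- morphism and the dimension into the codimension.
theorem Hom.exists_over_of_piCov {f : Hom Γ Γ₀} {f' : Hom Γ' Γ₀}
    (h : piCov (fun _ => Face.Cov) (f.code hval htri) (f'.code hval htri)) :
    Γ.codim = Γ'.codim + 1 ∧ ∃ g : Hom Γ' Γ, ∀ h, g.pre (f.pre h) = f'.pre h := by
  rw [piCov_face_iff, ← labelSet_subset_iff hv hval, f.labelSet_code, f'.labelSet_code,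
    ← f.codim_eq_piDim hv hval htri, ← f'.codim_eq_piDim hv hval htri] at h
  exact ⟨h.2, exists_over h.1⟩

end RibbonGraph

namespace RibbonGraph

/-! ### Signs of orderings -/

section orderings

variable {X Y Z : Type u}

theorem orderingOrientation_perm {n : ℕ} (π : Equiv.Perm (Fin n)) (l : Fin n ≃ X) :
    orderingOrientation (π.trans l) = orderingOrientation l ↔ Equiv.Perm.sign π = 1 := by
  have hn : n = Nat.card X := by rw [← Nat.card_congr l, Nat.card_fin]
  rw [orderingOrientation, orderingOrientation, eq_comm, Module.Basis.orientation_eq_iff_det_pos]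
  set b := (Finsupp.basisSingleOne (R := ℝ) (ι := X)).reindex (l.symm.trans (finCongr hn)) with hb
  have h1 : ⇑((Finsupp.basisSingleOne (R := ℝ) (ι := X)).reindex
      ((π.trans l).symm.trans (finCongr hn))) = b ∘ ((finCongr hn).permCongr π) := by
    funext i
    simp [hb, Module.Basis.reindex_apply, Equiv.permCongr_apply]
  rw [h1, AlternatingMap.map_perm, Module.Basis.det_self, Equiv.Perm.sign_permCongr]
  rcases Int.units_eq_one_or (Equiv.Perm.sign π) with h | h <;> rw [h] <;> norm_num

/-- The sign by which an ordering compares with an orientation. -/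
noncomputable def sg {n : ℕ} (l : Fin n ≃ X) (o : Orientation ℝ (X →₀ ℝ) (Fin (Nat.card X))) : ℤˣ :=
  if orderingOrientation l = o then 1 else -1

variable {n : ℕ} {o : Orientation ℝ (X →₀ ℝ) (Fin (Nat.card X))}
  {o' : Orientation ℝ (Y →₀ ℝ) (Fin (Nat.card Y))} {o'' : Orientation ℝ (Z →₀ ℝ) (Fin (Nat.card Z))}

theorem sg_eq_one {l : Fin n ≃ X} : sg l o = 1 ↔ orderingOrientation l = o := by
  rw [sg]
  split_ifs with h
  · simp [h]
  · simp [h]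

theorem sg_neg (l : Fin n ≃ X) : sg l (-o) = -sg l o := by
  rw [sg, sg]
  by_cases h : orderingOrientation l = o
  · rw [if_pos h, if_neg fun h' => (orderingOrientation_eq_neg_iff l o).1 h' h]
  · rw [if_neg h, if_pos ((orderingOrientation_eq_neg_iff l o).2 h), neg_neg]

theorem sg_perm (π : Equiv.Perm (Fin n)) (l : Fin n ≃ X) :
    sg (π.trans l) o = Equiv.Perm.sign π * sg l o := by
  have h1 := orderingOrientation_perm π l
  have h2 := orderingOrientation_eq_neg_iff (π.trans l) (orderingOrientation l)
  rcases Int.units_eq_one_or (Equiv.Perm.sign π) with h | h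
  · rw [h, one_mul, sg, h1.2 h, sg]
  · have h3 : orderingOrientation (π.trans l) = -orderingOrientation l := h2.2 (by
      rw [h1, h]
      decide)
    have h4 : sg (π.trans l) (-o) = sg l o := by
      rw [sg, sg, h3]
      congr 1
      exact propext ⟨fun h => neg_injective (G := Module.Ray ℝ _) h, fun h => by rw [h]⟩
    rw [h, ← h4, sg_neg, neg_one_mul, neg_neg]

theorem sg_conj {α : Type*} [Fintype α] [DecidableEq α] (e : Fin n ≃ α) (ρ : Equiv.Perm α) (Θ : α ≃ X) :
    sg (e.trans (ρ.trans Θ)) o = Equiv.Perm.sign ρ * sg (e.trans Θ) o := by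
  rw [← Equiv.Perm.sign_permCongr e.symm ρ, ← sg_perm]
  congr 1
  ext i
  simp [Equiv.permCongr_apply]

theorem eq_card (l : Fin n ≃ X) : n = Nat.card X := by
  rw [← Nat.card_congr l, Nat.card_fin]

/-- Both sides are the sign of the permutation between the two orderings, which does not depend on
the names of the elements. -/
theorem sg_transport (κ : Y ≃ X) {m : ℕ} (l : Fin n ≃ Y) (l' : Fin m ≃ Y) :
    sg (l.trans κ) o * sg (l'.trans κ) o = sg l o' * sg l' o' := by
  obtain rfl : n = m := (eq_card l).trans (eq_card l').symm
  have : Fintype Y := Fintype.ofEquiv _ l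
  have h : l' = (l'.trans l.symm).trans l := by ext; simp
  have h2 : l'.trans κ = (l'.trans l.symm).trans (l.trans κ) := by ext; simp
  rw [h2, sg_perm, h, sg_perm, ← h, mul_left_comm, Int.units_mul_self, mul_left_comm,
    Int.units_mul_self]

/-- The ordering by three further elements, followed by the elements of an ordering. -/
def extend (Ψ : Fin 3 ⊕ Y ≃ X) (l : Fin n ≃ Y) : Fin (3 + n) ≃ X :=
  finSumFinEquiv.symm.trans ((Equiv.sumCongr (Equiv.refl _) l).trans Ψ)

variable [Finite Y]

/-- The sign by which orientations compare under the extension by three further elements. -/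
noncomputable def chi (Ψ : Fin 3 ⊕ Y ≃ X) (o : Orientation ℝ (X →₀ ℝ) (Fin (Nat.card X)))
    (o' : Orientation ℝ (Y →₀ ℝ) (Fin (Nat.card Y))) : ℤˣ :=
  sg (extend Ψ (Finite.equivFin Y).symm) o * sg (Finite.equivFin Y).symm o'

/-- A permutation of the ordering of `Y` changes both factors by its sign, since it fixes the three
additional elements. -/
theorem chi_eq (Ψ : Fin 3 ⊕ Y ≃ X) (l : Fin n ≃ Y) : chi Ψ o o' = sg (extend Ψ l) o * sg l o' := by
  obtain rfl := eq_card l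
  set m := (Finite.equivFin Y).symm with hm
  have h : m = (m.trans l.symm).trans l := by ext; simp
  have h2 : extend Ψ m = (finSumFinEquiv.symm : Fin (3 + Nat.card Y) ≃ _).trans
      ((Equiv.sumCongr (Equiv.refl _) (m.trans l.symm)).trans
        ((Equiv.sumCongr (Equiv.refl _) l).trans Ψ)) := by
    ext i
    simp only [extend, Equiv.trans_apply]
    rcases finSumFinEquiv.symm i with j | j <;> simp
  have h3 : Equiv.Perm.sign (Equiv.sumCongr (Equiv.refl (Fin 3)) (m.trans l.symm)) =
      Equiv.Perm.sign (m.trans l.symm) := by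
    have := Equiv.Perm.sign_sumCongr (1 : Equiv.Perm (Fin 3)) (m.trans l.symm)
    rw [Equiv.Perm.sign_one, one_mul] at this
    exact this
  have h5 : sg (extend Ψ m) o = Equiv.Perm.sign (m.trans l.symm) * sg (extend Ψ l) o := by
    have h6 : extend Ψ m = ((finSumFinEquiv.permCongr (Equiv.sumCongr (Equiv.refl (Fin 3))
        (m.trans l.symm))).trans (extend Ψ l)) := by
      rw [h2]
      ext i
      simp [extend, Equiv.permCongr_apply]
    rw [h6, sg_perm, Equiv.Perm.sign_permCongr, h3]
  have h4 : sg m o' = Equiv.Perm.sign (m.trans l.symm) * sg l o' := by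
    rw [← sg_perm, ← h]
  rw [chi, ← hm, h5, h4]
  rw [mul_mul_mul_comm, Int.units_mul_self, one_mul]

theorem chi_neg_left (Ψ : Fin 3 ⊕ Y ≃ X) : chi Ψ (-o) o' = -chi Ψ o o' := by
  rw [chi, chi, sg_neg, neg_mul]

theorem chi_neg_right (Ψ : Fin 3 ⊕ Y ≃ X) : chi Ψ o (-o') = -chi Ψ o o' := by
  rw [chi, chi, sg_neg, mul_neg]

theorem chi_perm [Fintype Y] [DecidableEq Y] (ρ : Equiv.Perm (Fin 3 ⊕ Y)) (Ψ : Fin 3 ⊕ Y ≃ X) :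
    chi (ρ.trans Ψ) o o' = Equiv.Perm.sign ρ * chi Ψ o o' := by
  rw [chi, chi, extend, ← Equiv.trans_assoc, sg_conj, mul_assoc]
  rfl

theorem chi_mul_chi [Finite Z] (Ψ : Fin 3 ⊕ Y ≃ X) (Φ : Fin 3 ⊕ Z ≃ Y) (l : Fin n ≃ Z) :
    chi Ψ o o' * chi Φ o' o'' = sg (extend Ψ (extend Φ l)) o * sg l o'' := by
  rw [chi_eq Ψ (extend Φ l), chi_eq Φ l, mul_assoc, ← mul_assoc (sg (extend Φ l) o'),
    Int.units_mul_self, one_mul]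

/-- The exchange of two blocks of three elements. -/
def swapBlocks (Z : Type u) : Equiv.Perm (Fin 3 ⊕ (Fin 3 ⊕ Z)) :=
  (Equiv.sumAssoc _ _ _).permCongr (Equiv.sumCongr (Equiv.sumComm (Fin 3) (Fin 3)) (Equiv.refl Z))

theorem sign_swapBlocks [Fintype Z] : Equiv.Perm.sign (swapBlocks Z) = -1 := by
  rw [swapBlocks, Equiv.Perm.sign_permCongr]
  have := Equiv.Perm.sign_sumCongr (Equiv.sumComm (Fin 3) (Fin 3)) (1 : Equiv.Perm Z)
  rw [Equiv.Perm.sign_one, mul_one] at this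
  refine this.trans ?_
  convert (by decide : Equiv.Perm.sign (Equiv.sumComm (Fin 3) (Fin 3)) = -1)

/-- Each product adds six elements to an ordering of `Z`; they differ by exchanging two blocks of
three, an odd permutation. -/
theorem chi_mul_chi_of_swap {Y' : Type u} [Finite Y'] [Finite Z]
    {o₁ : Orientation ℝ (Y' →₀ ℝ) (Fin (Nat.card Y'))}
    {Ψ : Fin 3 ⊕ Y ≃ X} {Φ : Fin 3 ⊕ Z ≃ Y} {Ψ' : Fin 3 ⊕ Y' ≃ X} {Φ' : Fin 3 ⊕ Z ≃ Y'}
    (h : ∀ z, Ψ' (Sum.map id Φ' z) = Ψ (Sum.map id Φ (swapBlocks Z z))) :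
    chi Ψ' o o₁ * chi Φ' o₁ o'' = -(chi Ψ o o' * chi Φ o' o'') := by
  have : Fintype Z := Fintype.ofFinite Z
  let l := (Finite.equivFin Z).symm
  rw [chi_mul_chi Ψ Φ l, chi_mul_chi Ψ' Φ' l, ← neg_mul]
  congr 1
  have h2 : extend Ψ' (extend Φ' l) = ((finSumFinEquiv.symm.trans (Equiv.sumCongr (Equiv.refl _)
      (finSumFinEquiv.symm.trans (Equiv.sumCongr (Equiv.refl _) l)))).trans
      ((swapBlocks Z).trans ((Equiv.sumCongr (Equiv.refl _) Φ).trans Ψ))) := by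
    ext i
    simp only [extend, Equiv.trans_apply]
    refine Eq.trans ?_ (h _)
    congr 1
    rcases finSumFinEquiv.symm i with j | j <;> simp
  rw [h2, sg_conj, sign_swapBlocks, neg_one_mul]
  congr 2
  ext i
  simp only [extend, Equiv.trans_apply]
  congr 1
  rcases finSumFinEquiv.symm i with j | j <;> simp

end orderings

end RibbonGraph

namespace RibbonGraph

variable {Ω : Type u} {Γ Γ' : RibbonGraph Ω}

/-! ### The collapse of a single edge -/

namespace Hom

/-- The morphism `g` collapses the edge of `a` only. -/
def IsEdge (g : Hom Γ Γ') (a : Γ.H) : Prop := g.coll = {a, Γ.flip a}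

variable {g : Hom Γ Γ'} {a : Γ.H}

theorem isEdge_of_card (h : Γ.H.card = Γ'.H.card + 2) (ha : a ∈ g.coll) : g.IsEdge a := by
  have h1 := g.ncard_coll_add
  refine (Set.eq_of_subset_of_ncard_le ?_ ?_).symm
  · rintro x (rfl | rfl)
    · exact ha
    · exact g.closed _ ha
  · rw [Set.ncard_pair (Γ.flip_ne a).symm]
    omega

theorem exists_isEdge (h : Γ.H.card = Γ'.H.card + 2) : ∃ a, g.IsEdge a := by
  have h1 := g.ncard_coll_add
  obtain ⟨a, ha⟩ := Set.nonempty_of_ncard_ne_zero (s := g.coll) (by omega)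
  exact ⟨a, isEdge_of_card h ha⟩

/-- The effect of a morphism on vertices and half-edges. -/
noncomputable def collapse (g : Hom Γ Γ') : Γ.Cells → Γ'.Cells := Sum.map g.vertexMap g.corner

variable (ha : g.IsEdge a)
include ha

theorem IsEdge.flip : g.IsEdge (Γ.flip a) := by
  rw [IsEdge, Γ.flip_flip, Set.pair_comm]
  exact ha

theorem IsEdge.mem_iff {x : Γ.H} : x ∈ g.coll ↔ x = a ∨ x = Γ.flip a := by
  rw [ha]
  rfl

theorem IsEdge.mem : a ∈ g.coll := ha.mem_iff.2 (Or.inl rfl)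

theorem IsEdge.vert_ne : Γ.vert a ≠ Γ.vert (Γ.flip a) := fun h =>
  g.bridges a ha.mem (linked_of_vert_eq _ h)

theorem IsEdge.vertexMap_eq_iff {x y : Γ.H} : g.vertexMap (Γ.vert x) = g.vertexMap (Γ.vert y) ↔
    Γ.vert x = Γ.vert y ∨ (Γ.vert x = Γ.vert a ∧ Γ.vert (Γ.flip a) = Γ.vert y) ∨
      (Γ.vert x = Γ.vert (Γ.flip a) ∧ Γ.vert a = Γ.vert y) := by
  have h : Γ.cut g.coll a = ∅ := by
    rw [cut, ha, Set.sdiff_self]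
  rw [g.vertexMap_vert, g.vertexMap_vert, ← g.linked_iff, linked_cut ha.mem, h, linked_empty_iff,
    linked_empty_iff, linked_empty_iff, linked_empty_iff, linked_empty_iff]

theorem IsEdge.vertexMap_flip : g.vertexMap (Γ.vert (Γ.flip a)) = g.vertexMap (Γ.vert a) :=
  ha.vertexMap_eq_iff.2 (Or.inr (Or.inr ⟨rfl, rfl⟩))

/-- If a half-edge at the vertex is collapsed, the next one is not: the collapsed edge is no loop
and the valence exceeds one. So every vertex is visible to `Corresponds`. -/
theorem IsEdge.exists_pre (w : Γ.Vertex) : ∃ h, Γ.vert (g.pre h) = w := by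
  revert w
  refine vertex_ind fun x => ?_
  by_cases hx : x ∈ g.coll
  · have h1 : Γ.rot x ∉ g.coll := by
      intro h
      have hv := vert_rot (Γ := Γ) x
      rcases ha.mem_iff.1 hx with h2 | h2 <;> rcases ha.mem_iff.1 h with h3 | h3
      · exact (exists_rot_ne x).1 (h3.trans h2.symm)
      · rw [h3, h2] at hv
        exact ha.vert_ne hv.symm
      · rw [h3, h2] at hv
        exact ha.vert_ne hv
      · exact (exists_rot_ne x).1 (h3.trans h2.symm)
    obtain ⟨h, hh⟩ := g.notMem_coll.1 h1
    exact ⟨h, by rw [hh, vert_rot]⟩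
  · obtain ⟨h, rfl⟩ := g.notMem_coll.1 hx
    exact ⟨h, rfl⟩

theorem IsEdge.corresponds {x : Γ.Cells} (h1 : x ≠ Sum.inr a) (h2 : x ≠ Sum.inr (Γ.flip a)) :
    g.Corresponds x (g.collapse x) := by
  rcases x with w | x
  · obtain ⟨h, rfl⟩ := ha.exists_pre w
    exact ⟨h, by rw [vertexMap_vert, corner_pre], rfl⟩
  · have h3 : x ∉ g.coll := by
      rw [ha.mem_iff]
      rintro (rfl | rfl)
      · exact h1 rfl
      · exact h2 rfl
    obtain ⟨h, rfl⟩ := g.notMem_coll.1 h3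
    exact congrArg g.pre (g.corner_pre h)


theorem eq_collapse {x : Γ.Cells} {y : Γ'.Cells} (h : g.Corresponds x y) : y = g.collapse x := by
  rcases x with w | x <;> rcases y with w' | y
  · obtain ⟨h', rfl, rfl⟩ := h
    rw [collapse, Sum.map_inl, vertexMap_vert, corner_pre]
  · exact h.elim
  · exact h.elim
  · have h' : g.pre y = x := h
    rw [collapse, Sum.map_inr, ← h', corner_pre]


variable (g a) in
/-- The target of `a` and the halves `a` and `flip a`, and the remaining vertices and half-edges. -/
noncomputable def split (x : Γ.Cells) : Fin 3 ⊕ Γ'.Cells :=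
  if x = Sum.inl (Γ.vert (Γ.flip a)) then Sum.inl 0 else if x = Sum.inr a then Sum.inl 1
  else if x = Sum.inr (Γ.flip a) then Sum.inl 2 else Sum.inr (g.collapse x)

theorem IsEdge.split_bijective : Function.Bijective (g.split a) := by
  constructor
  · intro x y h
    rw [split, split] at h
    split_ifs at h with h1 h2 h3 h4 h5 h6 h7 h8 h9 h10 h11 h12 h13 <;> simp_all
    rcases x with w | x <;> rcases y with w' | y
    · refine congrArg Sum.inl ?_
      have h' : g.vertexMap w = g.vertexMap w' := Sum.inl_injective h
      obtain ⟨p, rfl⟩ := ha.exists_pre w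
      obtain ⟨q, rfl⟩ := ha.exists_pre w'
      rcases ha.vertexMap_eq_iff.1 h' with h0 | h0 | h0
      · exact h0
      · exact absurd (congrArg Sum.inl h0.2.symm) (by assumption)
      · exact absurd (congrArg Sum.inl h0.1) (by assumption)
    · cases h
    · cases h
    · have hx : x ∉ g.coll := by
        rw [ha.mem_iff]
        rintro (rfl | rfl) <;> simp_all
      have hy : y ∉ g.coll := by
        rw [ha.mem_iff]
        rintro (rfl | rfl) <;> simp_all
      obtain ⟨p, rfl⟩ := g.notMem_coll.1 hx
      obtain ⟨q, rfl⟩ := g.notMem_coll.1 hy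
      have h' : g.corner (g.pre p) = g.corner (g.pre q) := Sum.inr_injective h
      rw [corner_pre, corner_pre] at h'
      rw [h']
  · rintro (i | w | h)
    · fin_cases i
      · exact ⟨Sum.inl (Γ.vert (Γ.flip a)), by simp [split]⟩
      · exact ⟨Sum.inr a, by simp [split]⟩
      · exact ⟨Sum.inr (Γ.flip a), by simp [split, Γ.flip_ne]⟩
    · by_cases h : Γ.vert (g.pre (Quotient.out w)) = Γ.vert (Γ.flip a)
      · refine ⟨Sum.inl (Γ.vert a), ?_⟩
        have h1 := ha.vertexMap_flip
        rw [← h, vertexMap_vert, corner_pre, vert_out] at h1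
        simp [split, ha.vert_ne, collapse, ← h1]
      · refine ⟨Sum.inl (Γ.vert (g.pre (Quotient.out w))), ?_⟩
        simp [split, h, collapse, vertexMap_vert, corner_pre, vert_out]
    · have h1 := g.pre_notMem h
      rw [ha.mem_iff, not_or] at h1
      exact ⟨Sum.inr (g.pre h), by simp [split, h1.1, h1.2, collapse, corner_pre]⟩

/-- The vertices and half-edges of a ribbon graph and of its quotient by an edge. -/
noncomputable def IsEdge.cells : Fin 3 ⊕ Γ'.Cells ≃ Γ.Cells :=
  (Equiv.ofBijective _ ha.split_bijective).symm

theorem IsEdge.cells_split (x : Γ.Cells) : ha.cells (g.split a x) = x :=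
  Equiv.ofBijective_symm_apply_apply _ _ _

theorem IsEdge.cells_zero : ha.cells (Sum.inl 0) = Sum.inl (Γ.vert (Γ.flip a)) := by
  rw [← ha.cells_split (Sum.inl _)]
  simp [split]

theorem IsEdge.cells_one : ha.cells (Sum.inl 1) = Sum.inr a := by
  rw [← ha.cells_split (Sum.inr a)]
  simp [split]

theorem IsEdge.cells_two : ha.cells (Sum.inl 2) = Sum.inr (Γ.flip a) := by
  rw [← ha.cells_split (Sum.inr (Γ.flip a))]
  simp [split, Γ.flip_ne]

theorem IsEdge.cells_inr {x : Γ.Cells} (h1 : x ≠ Sum.inl (Γ.vert (Γ.flip a)))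
    (h2 : x ≠ Sum.inr a) (h3 : x ≠ Sum.inr (Γ.flip a)) : ha.cells (Sum.inr (g.collapse x)) = x := by
  have := ha.cells_split x
  rwa [split, if_neg h1, if_neg h2, if_neg h3] at this

theorem IsEdge.cells_inr_ne (y : Γ'.Cells) : ha.cells (Sum.inr y) ≠ Sum.inl (Γ.vert (Γ.flip a)) ∧
    ha.cells (Sum.inr y) ≠ Sum.inr a ∧ ha.cells (Sum.inr y) ≠ Sum.inr (Γ.flip a) := by
  rw [← ha.cells_zero, ← ha.cells_one, ← ha.cells_two]
  simp [ha.cells.injective.eq_iff]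

theorem IsEdge.collapse_cells (y : Γ'.Cells) : g.collapse (ha.cells (Sum.inr y)) = y := by
  obtain ⟨h1, h2, h3⟩ := ha.cells_inr_ne y
  exact Sum.inr_injective (ha.cells.injective (ha.cells_inr h1 h2 h3))

theorem IsEdge.cells_pre (h : Γ'.H) : ha.cells (Sum.inr (Sum.inr h)) = Sum.inr (g.pre h) := by
  have h1 := g.pre_notMem h
  rw [ha.mem_iff, not_or] at h1
  have := ha.cells_inr (x := Sum.inr (g.pre h)) (by simp) (by simp [h1.1]) (by simp [h1.2])
  rwa [collapse, Sum.map_inr, corner_pre] at this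

theorem IsEdge.cells_merged :
    ha.cells (Sum.inr (Sum.inl (g.vertexMap (Γ.vert a)))) = Sum.inl (Γ.vert a) :=
  ha.cells_inr (x := Sum.inl (Γ.vert a)) (by simp [ha.vert_ne]) (by simp) (by simp)

/-- Reversing the edge exchanges its two end vertices and its two halves, which are two
transpositions. -/
theorem IsEdge.chi_flip (o : Γ.Ori) (o' : Γ'.Ori) : chi ha.flip.cells o o' = chi ha.cells o o' := by
  have : Fintype Γ'.Cells := Fintype.ofFinite _
  set w := g.vertexMap (Γ.vert a) with hw
  have hm : ha.flip.cells (Sum.inr (Sum.inl w)) = Sum.inl (Γ.vert (Γ.flip a)) := by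
    rw [hw, ← ha.vertexMap_flip]
    exact ha.flip.cells_merged
  have h : ha.flip.cells = ((Equiv.swap (Sum.inl 0) (Sum.inr (Sum.inl w)) : Equiv.Perm _) *
      (Equiv.swap (Sum.inl 1) (Sum.inl 2) : Equiv.Perm (Fin 3 ⊕ Γ'.Cells))).trans ha.cells := by
    ext1 z
    rw [Equiv.trans_apply, Equiv.Perm.mul_apply]
    rcases z with i | y
    · fin_cases i
      · change ha.flip.cells (Sum.inl 0) = _
        rw [ha.flip.cells_zero, Γ.flip_flip]
        change _ = ha.cells (Equiv.swap _ _ (Equiv.swap _ _ (Sum.inl 0)))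
        rw [Equiv.swap_apply_of_ne_of_ne (a := Sum.inl 1) (by simp) (by simp),
          Equiv.swap_apply_left, ha.cells_merged]
      · change ha.flip.cells (Sum.inl 1) = _
        change _ = ha.cells (Equiv.swap _ _ (Equiv.swap _ _ (Sum.inl 1)))
        rw [ha.flip.cells_one, Equiv.swap_apply_left, Equiv.swap_apply_of_ne_of_ne (by simp)
          (by simp), ha.cells_two]
      · change ha.flip.cells (Sum.inl 2) = _
        change _ = ha.cells (Equiv.swap _ _ (Equiv.swap _ _ (Sum.inl 2)))
        rw [ha.flip.cells_two, Γ.flip_flip, Equiv.swap_apply_right,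
          Equiv.swap_apply_of_ne_of_ne (by simp) (by simp), ha.cells_one]
    · rw [Equiv.swap_apply_of_ne_of_ne (a := Sum.inl 1) (by simp) (by simp)]
      by_cases hy : y = Sum.inl w
      · rw [hy, Equiv.swap_apply_right, hm, ha.cells_zero]
      · rw [Equiv.swap_apply_of_ne_of_ne (by simp) (by simpa using hy)]
        obtain ⟨h1, h2, h3⟩ := ha.flip.cells_inr_ne y
        rw [Γ.flip_flip] at h1 h3
        have h4 := ha.flip.collapse_cells y
        have h5 := ha.cells_inr (x := ha.flip.cells (Sum.inr y)) (fun h => hy (by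
          rw [← h4, h, collapse, Sum.map_inl, ha.vertexMap_flip])) h3 h2
        rw [h4] at h5
        exact h5.symm
  rw [h, chi_perm, Equiv.Perm.sign_mul, Equiv.Perm.sign_swap (by simp), Equiv.Perm.sign_swap (by simp)]
  simp

theorem IsEdge.chi_of_mem {b : Γ.H} (hb : g.IsEdge b) (o : Γ.Ori) (o' : Γ'.Ori) :
    chi hb.cells o o' = chi ha.cells o o' := by
  rcases ha.mem_iff.1 hb.mem with rfl | rfl
  · rfl
  · exact ha.chi_flip o o'

end Hom

end RibbonGraph

namespace RibbonGraph

variable {Ω : Type u} {Γ Γ' Γ'' Δ : RibbonGraph Ω}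

/-! ### Induced orientations -/

/-- The cyclic permutation of the first four places that moves the first three to the last three. -/
def rotateFour (n : ℕ) : Fin (3 + (n + 1)) ≃ Fin (n + 4) :=
  (finCongr (by omega)).trans (Fin.cycleRange 3)

theorem fin_two_val {n : ℕ} : ((2 : Fin (n + 4)) : ℕ) = 2 :=
  Nat.mod_eq_of_lt (show 2 < n + 4 by omega)

theorem fin_three_val {n : ℕ} : ((3 : Fin (n + 4)) : ℕ) = 3 :=
  Nat.mod_eq_of_lt (show 3 < n + 4 by omega)

theorem rotateFour_inl {n : ℕ} (j : Fin 3) :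
    (rotateFour n (finSumFinEquiv (Sum.inl j))).val = j + 1 := by
  have h1 : finCongr (by omega : 3 + (n + 1) = n + 4) (finSumFinEquiv (Sum.inl j)) < 3 := by
    rw [Fin.lt_def, fin_three_val]
    simp
  rw [rotateFour, Equiv.trans_apply, Fin.coe_cycleRange_of_lt h1]
  simp

theorem rotateFour_inr_zero {n : ℕ} : rotateFour n (finSumFinEquiv (Sum.inr 0)) = 0 := by
  rw [rotateFour, Equiv.trans_apply, Fin.cycleRange_of_eq]
  refine Fin.ext (Eq.trans ?_ fin_three_val.symm)
  simp

theorem rotateFour_inr_succ {n : ℕ} (i : Fin n) :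
    rotateFour n (finSumFinEquiv (Sum.inr i.succ)) = i.addNat 4 := by
  have h1 : (3 : Fin (n + 4)) < finCongr (by omega : 3 + (n + 1) = n + 4)
      (finSumFinEquiv (Sum.inr i.succ)) := by
    rw [Fin.lt_def, fin_three_val]
    simp
  rw [rotateFour, Equiv.trans_apply, Fin.cycleRange_of_gt h1]
  ext
  simp [add_assoc]

theorem sg_rotateFour {X : Type u} {n : ℕ} (l : Fin (n + 4) ≃ X)
    (o : Orientation ℝ (X →₀ ℝ) (Fin (Nat.card X))) : sg ((rotateFour n).trans l) o = -sg l o := by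
  have h : ∀ {m k : ℕ} (e : m = k) (l : Fin k ≃ X), sg ((finCongr e).trans l) o = sg l o := by
    rintro m _ rfl l
    rfl
  rw [rotateFour, Equiv.trans_assoc, h, sg_perm, Fin.sign_cycleRange, fin_three_val]
  simp [pow_succ]

theorem extend_apply {X Y : Type u} {n : ℕ} (Ψ : Fin 3 ⊕ Y ≃ X) (l : Fin n ≃ Y) (z : Fin 3 ⊕ Fin n) :
    extend Ψ l (finSumFinEquiv z) = Ψ (Sum.map id l z) := by
  simp [extend, Equiv.sumCongr_apply]

theorem sg_mul_eq_one {X Y : Type u} {n m : ℕ} {l : Fin n ≃ X} {l' : Fin m ≃ Y}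
    {o : Orientation ℝ (X →₀ ℝ) (Fin (Nat.card X))} {o' : Orientation ℝ (Y →₀ ℝ) (Fin (Nat.card Y))} :
    sg l o * sg l' o' = 1 ↔ (orderingOrientation l = o ↔ orderingOrientation l' = o') := by
  rw [← sg_eq_one, ← sg_eq_one]
  rcases Int.units_eq_one_or (sg l o) with h | h <;>
    rcases Int.units_eq_one_or (sg l' o') with h' | h' <;> rw [h, h'] <;> decide

namespace Hom

variable {g : Hom Γ Γ'} {a : Γ.H}

theorem IsEdge.chi_eq_neg (ha : g.IsEdge a) {o : Γ.Ori} {o' : Γ'.Ori} {n : ℕ}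
    {l : Fin (n + 4) ≃ Γ.Cells} {l' : Fin (n + 1) ≃ Γ'.Cells}
    (h : extend ha.cells l' = (rotateFour n).trans l) :
    chi ha.cells o o' = -1 ↔ (orderingOrientation l = o ↔ orderingOrientation l' = o') := by
  rw [chi_eq ha.cells l', h, sg_rotateFour, neg_mul, neg_inj, sg_mul_eq_one]

/-- `Induces` begins with the source, whereas `cells` puts it fourth, as the merged vertex of the
quotient. Moving it past the other three elements is odd, hence the value `-1`. -/
theorem induces_iff (hc : Γ.H.card = Γ'.H.card + 2) (ha : g.IsEdge a) {o : Γ.Ori} {o' : Γ'.Ori} :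
    g.Induces o o' ↔ chi ha.cells o o' = -1 := by
  constructor
  · rintro ⟨n, l, l', b, hb, h0, h1, h2, h3, h4, h5, h6⟩
    have hb' : g.IsEdge b := isEdge_of_card hc hb
    rw [← ha.chi_of_mem hb', hb'.chi_eq_neg (l := l) (l' := l') ?_]
    · exact h6
    · have hl : ∀ (i : Fin (n + 4)) (y : Γ'.Cells), 4 ≤ i.val ∨ i.val = 0 → g.Corresponds (l i) y →
          hb'.cells (Sum.inr y) = l i := by
        intro i y hi hy
        rw [eq_collapse hb' hy, hb'.cells_inr]
        · rw [← h1, Ne, l.injective.eq_iff]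
          rintro rfl
          simp at hi
        · rw [← h2, Ne, l.injective.eq_iff]
          rintro rfl
          rw [fin_two_val] at hi
          omega
        · rw [← h3, Ne, l.injective.eq_iff]
          rintro rfl
          rw [fin_three_val] at hi
          omega
      ext1 i
      obtain ⟨z, rfl⟩ := finSumFinEquiv.surjective i
      rw [extend_apply, Equiv.trans_apply]
      rcases z with j | i
      · have hj := rotateFour_inl (n := n) j
        rw [Sum.map_inl, id]
        fin_cases j
        · refine hb'.cells_zero.trans (h1.symm.trans (congrArg l (Fin.ext ?_)))
          rw [hj]
          simp
        · refine hb'.cells_one.trans (h2.symm.trans (congrArg l (Fin.ext ?_)))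
          rw [hj, fin_two_val]
        · refine hb'.cells_two.trans (h3.symm.trans (congrArg l (Fin.ext ?_)))
          rw [hj, fin_three_val]
      · rw [Sum.map_inr]
        refine Fin.cases ?_ (fun i => ?_) i
        · rw [rotateFour_inr_zero]
          exact hl _ _ (Or.inr rfl) h4
        · rw [rotateFour_inr_succ]
          exact hl _ _ (Or.inl (by simp)) (h5 i)
  · intro h
    set w := g.vertexMap (Γ.vert a)
    -- The definition needs an ordering of the quotient that begins with the merged vertex.
    obtain ⟨n, l', hl'⟩ : ∃ (n : ℕ) (l' : Fin (n + 1) ≃ Γ'.Cells), l' 0 = Sum.inl w := by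
      have : Nonempty Γ'.Cells := ⟨Sum.inl w⟩
      obtain ⟨n, hn⟩ := Nat.exists_eq_succ_of_ne_zero (Nat.card_pos (α := Γ'.Cells)).ne'
      let e : Fin (n + 1) ≃ Γ'.Cells := (finCongr hn.symm).trans (Finite.equivFin _).symm
      exact ⟨n, e.trans (Equiv.swap (e 0) (Sum.inl w)), by simp⟩
    let l : Fin (n + 4) ≃ Γ.Cells := (rotateFour n).symm.trans (extend ha.cells l')
    have hl : extend ha.cells l' = (rotateFour n).trans l := by
      ext1 i
      simp [l]
    have hlz : ∀ z, l (rotateFour n (finSumFinEquiv z)) = ha.cells (Sum.map id l' z) := fun z => by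
      rw [← extend_apply, hl]
      rfl
    have hi : ∀ (j : Fin 3) (i : Fin (n + 4)), i.val = j + 1 → l i = ha.cells (Sum.inl j) := by
      intro j i hij
      rw [← rotateFour_inl, ← Fin.ext_iff] at hij
      rw [hij, hlz]
      rfl
    have h0 : l 0 = Sum.inl (Γ.vert a) := by
      rw [← rotateFour_inr_zero, hlz, Sum.map_inr, hl']
      exact ha.cells_merged
    refine ⟨n, l, l', a, ?_, h0, ?_, ?_, ?_, ?_, fun i => ?_, (ha.chi_eq_neg hl).1 h⟩
    · exact ha.mem
    · exact (hi 0 1 (by simp)).trans ha.cells_zero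
    · refine (hi 1 2 fin_two_val).trans ha.cells_one
    · refine (hi 2 3 fin_three_val).trans ha.cells_two
    · rw [hl', h0]
      exact ha.corresponds (by simp) (by simp)
    · rw [← rotateFour_inr_succ, hlz, Sum.map_inr]
      obtain ⟨-, h2, h3⟩ := ha.cells_inr_ne (l' i.succ)
      have := ha.corresponds h2 h3
      rwa [ha.collapse_cells] at this

/-- The sign by which an orientation compares with the one that induces a given orientation. -/
noncomputable def indSign (g : Hom Γ Γ') (o : Γ.Ori) (o' : Γ'.Ori) : ℤˣ :=
  if g.Induces o o' then 1 else -1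

theorem indSign_eq (hc : Γ.H.card = Γ'.H.card + 2) (ha : g.IsEdge a) (o : Γ.Ori) (o' : Γ'.Ori) :
    g.indSign o o' = -chi ha.cells o o' := by
  rw [indSign, induces_iff hc ha]
  rcases Int.units_eq_one_or (chi ha.cells o o') with h | h <;> rw [h] <;> simp

theorem indSign_neg_left (hc : Γ.H.card = Γ'.H.card + 2) (o : Γ.Ori) (o' : Γ'.Ori) :
    g.indSign (-o) o' = -g.indSign o o' := by
  obtain ⟨a, ha⟩ := exists_isEdge hc
  rw [indSign_eq hc ha, indSign_eq hc ha, chi_neg_left]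

theorem indSign_neg_right (hc : Γ.H.card = Γ'.H.card + 2) (o : Γ.Ori) (o' : Γ'.Ori) :
    g.indSign o (-o') = -g.indSign o o' := by
  obtain ⟨a, ha⟩ := exists_isEdge hc
  rw [indSign_eq hc ha, indSign_eq hc ha, chi_neg_right]

/-! ### The two ways to collapse a pair of edges -/

theorem vertexMap_comp {f : Hom Γ' Δ} {f' : Hom Γ Δ} (hg : ∀ h, g.pre (f.pre h) = f'.pre h)
    (w : Γ.Vertex) : f.vertexMap (g.vertexMap w) = f'.vertexMap w := by
  revert w
  refine vertex_ind fun x => ?_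
  rw [vertexMap_vert, vertexMap_vert, vertexMap_vert, ← corner_of_over hg, ← f'.linked_iff]
  refine Linked.mono (coll_subset_of_over hg) (g.linked_iff.2 ?_)
  rw [corner_pre]

theorem isEdge_pair {g₁ : Hom Γ Γ'} {f₁ : Hom Γ' Δ} {g₂ : Hom Γ Γ''} {f₂ : Hom Γ'' Δ}
    (h : ∀ x, g₁.pre (f₁.pre x) = g₂.pre (f₂.pre x)) {p : Γ.H} (hp : g₁.IsEdge p) {q' : Γ''.H}
    (hq' : f₂.IsEdge q') (hpq : p ∉ g₂.coll) : g₂.pre q' = p ∨ g₂.pre q' = Γ.flip p := by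
  obtain ⟨x, hx⟩ := g₂.notMem_coll.1 hpq
  have hx' : x ∈ f₂.coll := by
    intro ⟨y, hy⟩
    refine hp.mem ⟨f₁.pre y, ?_⟩
    rw [h, hy, hx]
  rcases hq'.mem_iff.1 hx' with rfl | rfl
  · exact Or.inl hx
  · right
    rw [← hx, g₂.pre_flip, Γ.flip_flip]

/-- Whichever edge is collapsed first, the cells that disappear are the same two triples, each
consisting of the target and the two halves of one edge; only the order of the triples changes. -/
theorem indSign_mul_indSign {g₁ : Hom Γ Γ'} {f₁ : Hom Γ' Δ} {g₂ : Hom Γ Γ''} {f₂ : Hom Γ'' Δ}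
    {f : Hom Γ Δ} (h₁ : ∀ x, g₁.pre (f₁.pre x) = f.pre x) (h₂ : ∀ x, g₂.pre (f₂.pre x) = f.pre x)
    (hne : g₁.coll ≠ g₂.coll)
    (hg₁ : Γ.H.card = Γ'.H.card + 2) (hg₂ : Γ.H.card = Γ''.H.card + 2)
    (hf₁ : Γ'.H.card = Δ.H.card + 2) (hf₂ : Γ''.H.card = Δ.H.card + 2)
    (o : Γ.Ori) (o₁ : Γ'.Ori) (o₂ : Γ''.Ori) (o' : Δ.Ori) :
    g₂.indSign o o₂ * f₂.indSign o₂ o' = -(g₁.indSign o o₁ * f₁.indSign o₁ o') := by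
  have h : ∀ x, g₁.pre (f₁.pre x) = g₂.pre (f₂.pre x) := fun x => (h₁ x).trans (h₂ x).symm
  obtain ⟨q, hq⟩ := exists_isEdge (g := g₂) hg₂
  -- The directions are chosen with distinct targets, since the targets are the vertices that
  -- disappear.
  obtain ⟨p, hp, hpq⟩ : ∃ p, g₁.IsEdge p ∧ Γ.vert (Γ.flip p) ≠ Γ.vert (Γ.flip q) := by
    obtain ⟨p, hp⟩ := exists_isEdge (g := g₁) hg₁
    by_cases h : Γ.vert (Γ.flip p) = Γ.vert (Γ.flip q)
    · refine ⟨Γ.flip p, hp.flip, ?_⟩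
      rw [Γ.flip_flip, ← h]
      exact hp.vert_ne
    · exact ⟨p, hp, h⟩
  have hp2 : p ∉ g₂.coll := fun h => hne (hp.trans (isEdge_of_card hg₂ h).symm)
  have hq1 : q ∉ g₁.coll := fun h => hne ((isEdge_of_card hg₁ h).trans hq.symm)
  obtain ⟨p', hp', hpp'⟩ : ∃ p', f₂.IsEdge p' ∧ g₂.pre p' = p := by
    obtain ⟨p', hp'⟩ := exists_isEdge (g := f₂) hf₂
    rcases isEdge_pair h hp hp' hp2 with h | h
    · exact ⟨p', hp', h⟩
    · exact ⟨_, hp'.flip, by rw [g₂.pre_flip, h, Γ.flip_flip]⟩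
  obtain ⟨q', hq', hqq'⟩ : ∃ q', f₁.IsEdge q' ∧ g₁.pre q' = q := by
    obtain ⟨q', hq'⟩ := exists_isEdge (g := f₁) hf₁
    rcases isEdge_pair (fun x => (h x).symm) hq hq' hq1 with h | h
    · exact ⟨q', hq', h⟩
    · exact ⟨_, hq'.flip, by rw [g₁.pre_flip, h, Γ.flip_flip]⟩
  have hpf : g₂.pre (Γ''.flip p') = Γ.flip p := by rw [g₂.pre_flip, hpp']
  have hqf : g₁.pre (Γ'.flip q') = Γ.flip q := by rw [g₁.pre_flip, hqq']
  have hv1 : hp.cells (Sum.inr (Sum.inl (Γ'.vert (Γ'.flip q')))) = Sum.inl (Γ.vert (Γ.flip q)) := by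
    have := hp.cells_inr (x := Sum.inl (Γ.vert (Γ.flip q))) (by simp [Ne.symm hpq]) (by simp) (by simp)
    have e : g₁.collapse (Sum.inl (Γ.vert (Γ.flip q))) = Sum.inl (Γ'.vert (Γ'.flip q')) := by
      rw [collapse, Sum.map_inl, vertexMap_vert, ← hqf, corner_pre]
    rwa [e] at this
  have hv2 : hq.cells (Sum.inr (Sum.inl (Γ''.vert (Γ''.flip p')))) = Sum.inl (Γ.vert (Γ.flip p)) := by
    have := hq.cells_inr (x := Sum.inl (Γ.vert (Γ.flip p))) (by simp [hpq]) (by simp) (by simp)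
    have e : g₂.collapse (Sum.inl (Γ.vert (Γ.flip p))) = Sum.inl (Γ''.vert (Γ''.flip p')) := by
      rw [collapse, Sum.map_inl, vertexMap_vert, ← hpf, corner_pre]
    rwa [e] at this
  rw [indSign_eq hg₁ hp, indSign_eq hg₂ hq, indSign_eq hf₁ hq', indSign_eq hf₂ hp', neg_mul_neg,
    neg_mul_neg]
  refine chi_mul_chi_of_swap ?_
  rintro (i | i | z)
  · change hq.cells (Sum.inl i) = hp.cells (Sum.inr (hq'.cells (Sum.inl i)))
    fin_cases i
    · exact hq.cells_zero.trans ((congrArg _ (congrArg _ hq'.cells_zero)).trans hv1).symm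
    · refine hq.cells_one.trans ((congrArg _ (congrArg _ hq'.cells_one)).trans ?_).symm
      rw [hp.cells_pre, hqq']
    · refine hq.cells_two.trans ((congrArg _ (congrArg _ hq'.cells_two)).trans ?_).symm
      rw [hp.cells_pre, hqf]
  · change hq.cells (Sum.inr (hp'.cells (Sum.inl i))) = hp.cells (Sum.inl i)
    fin_cases i
    · exact ((congrArg _ (congrArg _ hp'.cells_zero)).trans hv2).trans hp.cells_zero.symm
    · refine ((congrArg _ (congrArg _ hp'.cells_one)).trans ?_).trans hp.cells_one.symm
      rw [hq.cells_pre, hpp']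
    · refine ((congrArg _ (congrArg _ hp'.cells_two)).trans ?_).trans hp.cells_two.symm
      rw [hq.cells_pre, hpf]
  · change hq.cells (Sum.inr (hp'.cells (Sum.inr z))) = hp.cells (Sum.inr (hq'.cells (Sum.inr z)))
    rcases z with w | y
    -- The surviving vertices are the only nontrivial case: the vertex chosen by one order of
    -- collapse is shown to survive the other and to have the same image.
    · set x := hp.cells (Sum.inr (hq'.cells (Sum.inr (Sum.inl w)))) with hx
      have e1 : g₁.collapse x = hq'.cells (Sum.inr (Sum.inl w)) := hp.collapse_cells _
      have e2 : f₁.collapse (g₁.collapse x) = Sum.inl w := by rw [e1, hq'.collapse_cells]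
      obtain ⟨x0, hx0⟩ : ∃ x0, x = Sum.inl x0 := by
        rcases x with x0 | x0
        · exact ⟨x0, rfl⟩
        · cases e2
      have n1 := hp.cells_inr_ne (hq'.cells (Sum.inr (Sum.inl w)))
      have n2 := hq'.cells_inr_ne (Sum.inl w)
      rw [← hx] at n1
      have n3 : x ≠ Sum.inl (Γ.vert (Γ.flip q)) := fun h => n2.1 (by
        rw [← e1, h, collapse, Sum.map_inl, vertexMap_vert, ← hqf, corner_pre])
      have c1 := hq.cells_inr n3 (by simp [hx0]) (by simp [hx0])
      have c2 : f₂.collapse (g₂.collapse x) = Sum.inl w := by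
        rw [hx0] at e2 ⊢
        rw [← e2]
        refine congrArg Sum.inl ?_
        exact (vertexMap_comp h₂ x0).trans (vertexMap_comp h₁ x0).symm
      have c3 : g₂.collapse x ≠ Sum.inl (Γ''.vert (Γ''.flip p')) := fun h => n1.1 (by
        rw [← c1, h, hv2])
      have c4 := hp'.cells_inr c3 (by simp [hx0, collapse]) (by simp [hx0, collapse])
      rw [c2] at c4
      rw [c4, c1]
    · rw [hp'.cells_pre, hq'.cells_pre, hq.cells_pre, hp.cells_pre, h]

end Hom

end RibbonGraph

namespace RibbonGraph

variable {Ω : Type u} {Γ Γ' Δ : RibbonGraph Ω}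

/-! ### Natural orientations -/

theorem valence_of_codim (h : Γ.codim = 0) (w : Γ.Vertex) : Γ.valence w = 3 := by
  have h1 := Finset.sum_eq_zero_iff.1 h w (Finset.mem_univ w)
  have h2 := three_le_valence_vertex w
  rw [vertexCodim] at h1
  omega

theorem rot_rot_rot (h : Γ.codim = 0) (x : Γ.H) : Γ.rot (Γ.rot (Γ.rot x)) = x := by
  have h1 := Function.iterate_minimalPeriod (f := Γ.rot) (x := x)
  rw [← valence_vert, valence_of_codim h] at h1
  exact h1

theorem eq_or_of_vert_eq (h : Γ.codim = 0) {x y : Γ.H} (hv : Γ.vert x = Γ.vert y) :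
    y = x ∨ y = Γ.rot x ∨ y = Γ.rot (Γ.rot x) := by
  obtain ⟨n, rfl⟩ := (vert_eq_iff.1 hv).exists_nat_pow_eq
  clear hv
  induction n with
  | zero => exact Or.inl rfl
  | succ n ih =>
    rw [pow_succ', Equiv.Perm.mul_apply]
    rcases ih with h1 | h1 | h1 <;> rw [h1]
    · exact Or.inr (Or.inl rfl)
    · exact Or.inr (Or.inr rfl)
    · exact Or.inl (rot_rot_rot h x)

/-- A vertex followed by its three half-edges. -/
def block (Γ : RibbonGraph Ω) (h : Γ.H) : Fin 4 → Γ.Cells :=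
  ![Sum.inl (Γ.vert h), Sum.inr h, Sum.inr (Γ.rot h), Sum.inr (Γ.rot (Γ.rot h))]

/-- An ordering in which each vertex is followed by its three half-edges. -/
def IsNaturalOrder (Γ : RibbonGraph Ω) {n : ℕ} (l : Fin (n * 4) ≃ Γ.Cells) : Prop :=
  ∀ i, ∃ h, ∀ j, l (finProdFinEquiv (i, j)) = Γ.block h j

theorem isNatural_iff {o : Γ.Ori} : Γ.IsNatural o ↔ ∃ (n : ℕ) (l : Fin (n * 4) ≃ Γ.Cells),
    Γ.IsNaturalOrder l ∧ orderingOrientation l = o := by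
  refine exists_congr fun n => exists_congr fun l => and_congr_left fun _ => forall_congr' fun i =>
    exists_congr fun h => ?_
  rw [Fin.forall_fin_succ, Fin.forall_fin_succ, Fin.forall_fin_succ, Fin.forall_fin_succ]
  simp [block]

theorem exists_isNaturalOrder (h : Γ.codim = 0) :
    ∃ (n : ℕ) (l : Fin (n * 4) ≃ Γ.Cells), Γ.IsNaturalOrder l := by
  let N : Γ.Vertex × Fin 4 → Γ.Cells := fun x => Γ.block (Quotient.out x.1) x.2
  have hs : Function.Surjective N := by
    rintro (w | x)
    · exact ⟨(w, 0), congrArg Sum.inl (vert_out w)⟩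
    · rcases eq_or_of_vert_eq h (vert_out (Γ.vert x)) with h1 | h1 | h1
      · exact ⟨(Γ.vert x, 1), congrArg Sum.inr h1.symm⟩
      · exact ⟨(Γ.vert x, 2), congrArg Sum.inr h1.symm⟩
      · exact ⟨(Γ.vert x, 3), congrArg Sum.inr h1.symm⟩
  -- In codimension zero there are three times as many half-edges as vertices, so a surjection
  -- suffices.
  have hb : Function.Bijective N := hs.bijective_of_nat_card_le (by
    have h1 := codim_add_card (Γ := Γ)
    rw [Nat.card_prod, Nat.card_sum, Nat.card_fin, Nat.card_eq_fintype_card (α := Γ.H),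
      Fintype.card_coe]
    omega)
  refine ⟨Nat.card Γ.Vertex, finProdFinEquiv.symm.trans
    ((Equiv.prodCongr (Finite.equivFin _).symm (Equiv.refl _)).trans (Equiv.ofBijective N hb)),
    fun i => ⟨Quotient.out ((Finite.equivFin Γ.Vertex).symm i), fun j => ?_⟩⟩
  rw [Equiv.trans_apply, Equiv.symm_apply_apply]
  rfl

theorem exists_block_perm (h : Γ.codim = 0) {x y : Γ.H} (hv : Γ.vert x = Γ.vert y) :
    ∃ c : Equiv.Perm (Fin 4), Equiv.Perm.sign c = 1 ∧ ∀ j, Γ.block y j = Γ.block x (c j) := by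
  have h3 := rot_rot_rot h x
  have hr := vert_rot (Γ := Γ) x
  have hr' := vert_rot (Γ := Γ) (Γ.rot x)
  rcases eq_or_of_vert_eq h hv with rfl | rfl | rfl
  · exact ⟨1, by simp, fun _ => rfl⟩
  · refine ⟨Equiv.swap 1 2 * Equiv.swap 2 3, by decide, fun j => ?_⟩
    fin_cases j
    · exact congrArg Sum.inl hr
    · rfl
    · rfl
    · exact congrArg Sum.inr h3
  · refine ⟨Equiv.swap 2 3 * Equiv.swap 1 2, by decide, fun j => ?_⟩
    fin_cases j
    · exact congrArg Sum.inl (hr'.trans hr)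
    · rfl
    · exact congrArg Sum.inr h3
    · exact congrArg Sum.inr (congrArg Γ.rot h3)

theorem IsNaturalOrder.vertex_bijective {n : ℕ} {l : Fin (n * 4) ≃ Γ.Cells} {b : Fin n → Γ.H}
    (hb : ∀ i j, l (finProdFinEquiv (i, j)) = Γ.block (b i) j) :
    Function.Bijective fun i => Γ.vert (b i) := by
  constructor
  · intro i i' h
    have h1 : l (finProdFinEquiv (i, 0)) = l (finProdFinEquiv (i', 0)) := by
      rw [hb, hb]
      exact congrArg Sum.inl h
    exact congrArg Prod.fst (finProdFinEquiv.injective (l.injective h1))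
  · intro w
    obtain ⟨⟨i, j⟩, hij⟩ := (finProdFinEquiv.trans l).surjective (Sum.inl w)
    rw [Equiv.trans_apply, hb] at hij
    refine ⟨i, ?_⟩
    fin_cases j
    · exact Sum.inl_injective hij
    · cases hij
    · cases hij
    · cases hij

/-- Two natural orderings differ by rotations of the three half-edges at each vertex, which are
even, and a permutation of the blocks, which is even because the blocks have the even length four.
-/
theorem IsNaturalOrder.sg_eq (h : Γ.codim = 0) {n m : ℕ} {l : Fin (n * 4) ≃ Γ.Cells}
    {l' : Fin (m * 4) ≃ Γ.Cells} (hl : Γ.IsNaturalOrder l) (hl' : Γ.IsNaturalOrder l') (o : Γ.Ori) :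
    sg l' o = sg l o := by
  obtain rfl : n = m := by
    have := (eq_card l).trans (eq_card l').symm
    omega
  choose b hb using hl
  choose b' hb' using hl'
  let e := Equiv.ofBijective _ (vertex_bijective hb)
  let τ : Equiv.Perm (Fin n) := (Equiv.ofBijective _ (vertex_bijective hb')).trans e.symm
  have hτ : ∀ i, Γ.vert (b (τ i)) = Γ.vert (b' i) := fun i => e.apply_symm_apply _
  choose c hc1 hc2 using fun i => exists_block_perm h (hτ i)
  have h1 : l' = finProdFinEquiv.symm.trans ((Equiv.prodCongrRight c).trans
      ((Equiv.prodCongrLeft fun _ => τ).trans (finProdFinEquiv.trans l))) := by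
    ext1 x
    obtain ⟨⟨i, j⟩, rfl⟩ := finProdFinEquiv.surjective x
    simp [hb, hb', hc2]
  rw [h1, sg_conj, sg_conj, Equiv.Perm.sign_prodCongrRight, Equiv.Perm.sign_prodCongrLeft,
    Finset.prod_eq_one fun i _ => hc1 i, one_mul, Finset.prod_const, Finset.card_fin,
    (by decide : ∀ u : ℤˣ, u ^ 4 = 1), one_mul]
  congr 1
  ext1 x
  rw [Equiv.trans_apply, Equiv.trans_apply, Equiv.apply_symm_apply]

theorem orientationSign_eq_sg (h : Γ.codim = 0) {n : ℕ} {l : Fin (n * 4) ≃ Γ.Cells}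
    (hl : Γ.IsNaturalOrder l) (o : Γ.Ori) : Γ.orientationSign o = (sg l o : ℤ) := by
  have h1 : ∀ o, Γ.IsNatural o ↔ sg l o = 1 := by
    intro o
    rw [isNatural_iff]
    constructor
    · rintro ⟨m, l', hl', ho⟩
      rw [← hl.sg_eq h hl', sg_eq_one, ho]
    · exact fun h => ⟨n, l, hl, sg_eq_one.1 h⟩
  rw [orientationSign]
  simp only [h1, sg_neg]
  rcases Int.units_eq_one_or (sg l o) with h | h <;> rw [h] <;> simp

/-! ### The two ways to expand a vertex of valence four -/

theorem exists_four_cycle {X : Type*} [Fintype X] [DecidableEq X] {w x y z : X} (h1 : w ≠ x)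
    (h2 : w ≠ y) (h3 : w ≠ z) (h4 : x ≠ y) (h5 : x ≠ z) (h6 : y ≠ z) : ∃ c : Equiv.Perm X,
    Equiv.Perm.sign c = -1 ∧ c w = z ∧ c x = w ∧ c y = x ∧ c z = y ∧
      ∀ t, t ≠ w → t ≠ x → t ≠ y → t ≠ z → c t = t := by
  refine ⟨Equiv.swap z y * Equiv.swap y x * Equiv.swap x w, ?_, ?_, ?_, ?_, ?_, ?_⟩
  · rw [Equiv.Perm.sign_mul, Equiv.Perm.sign_mul, Equiv.Perm.sign_swap h6.symm,
      Equiv.Perm.sign_swap h4.symm, Equiv.Perm.sign_swap h1.symm]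
    rfl
  · simp
  · simp [Equiv.swap_apply_of_ne_of_ne, *]
  · simp [Equiv.swap_apply_of_ne_of_ne, *, Ne.symm, Ne.symm h4]
  · simp [Equiv.swap_apply_of_ne_of_ne, Ne.symm h3, Ne.symm h5, Ne.symm h6]
  · intro t t1 t2 t3 t4
    simp [Equiv.swap_apply_of_ne_of_ne, *]

namespace Hom

variable {g : Hom Γ Δ} {a : Γ.H}

theorem pre_corner {x : Γ.H} (hx : x ∉ g.coll) : g.pre (g.corner x) = x := by
  obtain ⟨h, rfl⟩ := g.notMem_coll.1 hx
  rw [corner_pre]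

theorem corner_rot_of_notMem {x : Γ.H} (hx : x ∉ g.coll) :
    g.corner (Γ.rot x) = Δ.rot (g.corner x) := by
  rw [← g.corner_turn_of_notMem hx, turn_of_notMem hx]

theorem IsEdge.rot_notMem (ha : g.IsEdge a) {x : Γ.H} (hx : Γ.vert x = Γ.vert a) (hxa : x ≠ a) :
    x ∉ g.coll := by
  rw [ha.mem_iff]
  rintro (rfl | rfl)
  · exact hxa rfl
  · exact ha.vert_ne hx.symm

/-- At a trivalent vertex, `a` is followed by two leaves, which are consecutive in the quotient. The
corner of `flip a` is the first of them, and the corner of `a` is the one after both. -/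
theorem IsEdge.rot_edge (hΓ : Γ.codim = 0) (ha : g.IsEdge a) :
    Γ.rot a = g.pre (g.corner (Γ.flip a)) ∧
    Γ.rot (g.pre (g.corner (Γ.flip a))) = g.pre (Δ.rot (g.corner (Γ.flip a))) ∧
    Γ.rot (g.pre (Δ.rot (g.corner (Γ.flip a)))) = a ∧
    g.corner a = Δ.rot (Δ.rot (g.corner (Γ.flip a))) ∧
    Δ.vert (g.corner (Γ.flip a)) = g.vertexMap (Γ.vert a) := by
  have hr := exists_rot_ne a
  have h1 := ha.rot_notMem (vert_rot a) hr.1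
  have h2 := ha.rot_notMem ((vert_rot _).trans (vert_rot a)) hr.2
  have h3 : g.corner (Γ.flip a) = g.corner (Γ.rot a) := by
    rw [← g.corner_turn_of_mem (g.closed _ ha.mem), turn_of_mem g.closed (g.closed _ ha.mem),
      Γ.flip_flip]
  have e1 : Γ.rot a = g.pre (g.corner (Γ.flip a)) := by rw [h3, pre_corner h1]
  have e2 : Γ.rot (Γ.rot a) = g.pre (Δ.rot (g.corner (Γ.flip a))) := by
    rw [h3, ← corner_rot_of_notMem h1, pre_corner h2]
  refine ⟨e1, by rw [← e1, e2], by rw [← e2, rot_rot_rot hΓ], ?_, ?_⟩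
  · rw [h3, ← corner_rot_of_notMem h1, ← corner_rot_of_notMem h2, rot_rot_rot hΓ]
  · rw [h3, ← vertexMap_vert, vert_rot]

theorem IsEdge.rot_pre (ha : g.IsEdge a) {h : Δ.H} (hv : Δ.vert h ≠ g.vertexMap (Γ.vert a)) :
    Γ.rot (g.pre h) = g.pre (Δ.rot h) := by
  have h1 : Γ.rot (g.pre h) ∉ g.coll := by
    intro h1
    have h2 : g.vertexMap (Γ.vert (Γ.rot (g.pre h))) = Δ.vert h := by
      rw [vert_rot, vertexMap_vert, corner_pre]
    rcases ha.mem_iff.1 h1 with h3 | h3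
    · exact hv (by rw [← h2, h3])
    · exact hv (by rw [← h2, h3, ha.vertexMap_flip])
  rw [← pre_corner h1, corner_rot_of_notMem (g.pre_notMem h), corner_pre]

theorem IsEdge.labels_eq (ha : g.IsEdge a) : g.labels =
    {(g.corner a, g.corner (Γ.flip a)), (g.corner (Γ.flip a), g.corner a)} := by
  rw [labels, ha, Set.image_pair, label, label, tau_of_mem g.closed ha.mem,
    tau_of_mem g.closed (g.closed _ ha.mem), Γ.flip_flip]

/-- At every other vertex the quotient is still trivalent, so the third power of `rot` is already
trivial there. -/
theorem IsEdge.eq_vertex (hΓ : Γ.codim = 0) (ha : g.IsEdge a) {h : Δ.H}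
    (h4 : Δ.rot (Δ.rot (Δ.rot (Δ.rot h))) = h) : Δ.vert h = g.vertexMap (Γ.vert a) := by
  by_contra hv
  have hr := ha.rot_pre hv
  have hr1 := ha.rot_pre (h := Δ.rot h) (by rwa [vert_rot])
  have hr2 := ha.rot_pre (h := Δ.rot (Δ.rot h)) (by rwa [vert_rot, vert_rot])
  have h3 := rot_rot_rot hΓ (g.pre h)
  rw [hr, hr1, hr2] at h3
  have h3' := g.pre_injective h3
  rw [h3'] at h4
  exact (exists_rot_ne h).1 h4

/-- The two splittings of a four-valent vertex differ by a quarter turn. The bijection of cells that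
takes `a'` to `a` and moves the four leaves at the merged vertex one step back respects `rot`,
although not `flip`, so it preserves natural orderings. Over the quotient it is a four-cycle, which
is odd. -/
theorem exists_natural_pair {g' : Hom Γ' Δ} {a' : Γ'.H} (hΓ : Γ.codim = 0) (hΓ' : Γ'.codim = 0)
    (ha : g.IsEdge a) (ha' : g'.IsEdge a') (h : g'.corner (Γ'.flip a') = Δ.rot (g.corner (Γ.flip a)))
    (o : Γ.Ori) (o' : Γ'.Ori) (o₀ : Δ.Ori) : (chi ha.cells o o₀ : ℤ) * Γ.orientationSign o =
      -(chi ha'.cells o' o₀ * Γ'.orientationSign o') := by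
  obtain ⟨n, l', hl'⟩ := exists_isNaturalOrder hΓ'
  obtain ⟨a1, a2, a3, a4, a5⟩ := ha.rot_edge hΓ
  obtain ⟨b1, b2, b3, b4, -⟩ := ha.flip.rot_edge hΓ
  obtain ⟨c1, c2, c3, c4, c5⟩ := ha'.rot_edge hΓ'
  obtain ⟨d1, d2, d3, -, -⟩ := ha'.flip.rot_edge hΓ'
  rw [Γ.flip_flip] at b1 b2 b3 b4
  rw [Γ'.flip_flip] at d1 d2 d3
  rw [c4, h] at d1 d2 d3
  rw [h] at c1 c2 c3 c5
  rw [a4] at b1 b2 b3 b4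
  set p := g.corner (Γ.flip a)
  have hr := exists_rot_ne p
  have h3 : Δ.rot (Δ.rot (Δ.rot p)) ≠ p := fun h => hr.1 (by rw [← h, ← b4, h])
  obtain ⟨c, hc, cp, cp1, cp2, cp3, hct⟩ := exists_four_cycle (w := p) (x := Δ.rot p)
    (y := Δ.rot (Δ.rot p)) (z := Δ.rot (Δ.rot (Δ.rot p))) hr.1.symm hr.2.symm h3.symm
    (fun h => hr.1 (Δ.rot.injective h).symm) (fun h => hr.2 (Δ.rot.injective h).symm)
    (fun h => hr.1 (Δ.rot.injective (Δ.rot.injective h)).symm)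
  have hw : g'.vertexMap (Γ'.vert a') = g.vertexMap (Γ.vert a) := by rw [← c5, ← a5, vert_rot]
  have hp : ∀ x, Δ.vert x = g.vertexMap (Γ.vert a) → x = p ∨ x = Δ.rot p ∨ x = Δ.rot (Δ.rot p) ∨
      x = Δ.rot (Δ.rot (Δ.rot p)) := by
    intro x hx
    obtain ⟨n, rfl⟩ := (vert_eq_iff.1 (a5.trans hx.symm)).exists_nat_pow_eq
    clear hx
    induction n with
    | zero => exact Or.inl rfl
    | succ n ih =>
      rw [pow_succ', Equiv.Perm.mul_apply]
      rcases ih with h1 | h1 | h1 | h1 <;> rw [h1]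
      · exact Or.inr (Or.inl rfl)
      · exact Or.inr (Or.inr (Or.inl rfl))
      · exact Or.inr (Or.inr (Or.inr rfl))
      · exact Or.inl b4.symm
  have hct' : ∀ x, Δ.vert x ≠ g.vertexMap (Γ.vert a) → c x = x := by
    intro x hx
    refine hct x ?_ ?_ ?_ ?_ <;> rintro rfl <;> exact hx (by simp only [vert_rot, a5])
  let ρ : Equiv.Perm (Fin 3 ⊕ Δ.Cells) := Equiv.sumCongr (Equiv.refl _)
    (Equiv.sumCongr (Equiv.refl _) c)
  have hρ : Equiv.Perm.sign ρ = -1 := by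
    have e1 := Equiv.Perm.sign_sumCongr (1 : Equiv.Perm Δ.Vertex) c
    have e2 := Equiv.Perm.sign_sumCongr (1 : Equiv.Perm (Fin 3)) (Equiv.Perm.sumCongr (1 : Equiv.Perm Δ.Vertex) c)
    rw [e1, Equiv.Perm.sign_one, Equiv.Perm.sign_one, one_mul, one_mul, hc] at e2
    exact e2
  let κ : Γ'.Cells ≃ Γ.Cells := ha'.cells.symm.trans (ρ.trans ha.cells)
  have hκ : ∀ z, κ (ha'.cells z) = ha.cells (ρ z) := fun z => by simp [κ]
  have ka : κ (Sum.inr a') = Sum.inr a := by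
    rw [← ha'.cells_one, hκ]
    exact ha.cells_one
  have kb : κ (Sum.inr (Γ'.flip a')) = Sum.inr (Γ.flip a) := by
    rw [← ha'.cells_two, hκ]
    exact ha.cells_two
  have kpre : ∀ x, κ (Sum.inr (g'.pre x)) = Sum.inr (g.pre (c x)) := by
    intro x
    rw [← ha'.cells_pre, hκ]
    exact ha.cells_pre _
  have hex : ∀ x, ∃ y, κ (Sum.inr x) = Sum.inr y := by
    intro x
    by_cases hx : x ∈ g'.coll
    · rcases ha'.mem_iff.1 hx with rfl | rfl
      · exact ⟨_, ka⟩
      · exact ⟨_, kb⟩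
    · obtain ⟨y, rfl⟩ := g'.notMem_coll.1 hx
      exact ⟨_, kpre y⟩
  choose k hk using hex
  replace ka : k a' = a := Sum.inr_injective ((hk _).symm.trans ka)
  replace kb : k (Γ'.flip a') = Γ.flip a := Sum.inr_injective ((hk _).symm.trans kb)
  replace kpre : ∀ x, k (g'.pre x) = g.pre (c x) := fun x =>
    Sum.inr_injective ((hk _).symm.trans (kpre x))
  have krot : ∀ x, k (Γ'.rot x) = Γ.rot (k x) := by
    intro x
    by_cases hx : x ∈ g'.coll
    · rcases ha'.mem_iff.1 hx with rfl | rfl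
      · rw [c1, kpre, cp1, ka, a1]
      · rw [d1, kpre, cp3, kb, b1]
    · obtain ⟨y, rfl⟩ := g'.notMem_coll.1 hx
      by_cases hy : Δ.vert y = g.vertexMap (Γ.vert a)
      · rcases hp y hy with rfl | rfl | rfl | rfl
        · rw [← b4] at d3
          rw [d3, kb, kpre, cp, b3]
        · rw [c2, kpre, kpre, cp2, cp1, a2]
        · rw [c3, ka, kpre, cp2, a3]
        · rw [d2, kpre, kpre, ← b4, cp, cp3, b2]
      · rw [ha'.rot_pre (by rwa [hw]), kpre, kpre, hct' _ hy, hct' _ (by rwa [vert_rot]),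
          ha.rot_pre hy]
  have kflip : κ (Sum.inl (Γ'.vert (Γ'.flip a'))) = Sum.inl (Γ.vert (Γ.flip a)) := by
    rw [← ha'.cells_zero, hκ]
    exact ha.cells_zero
  have kvert' : κ (Sum.inl (Γ'.vert a')) = Sum.inl (Γ.vert a) := by
    rw [← ha'.cells_merged, hκ, hw]
    exact ha.cells_merged
  have kcyc : ∀ {x y : Γ'.H}, κ (Sum.inl (Γ'.vert x)) = Sum.inl (Γ.vert (k x)) →
      Γ'.vert x = Γ'.vert y → κ (Sum.inl (Γ'.vert y)) = Sum.inl (Γ.vert (k y)) := by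
    intro x y h1 h2
    rw [← h2, h1]
    rcases eq_or_of_vert_eq hΓ' h2 with rfl | rfl | rfl
    · rfl
    · rw [krot, vert_rot]
    · rw [krot, krot, vert_rot, vert_rot]
  -- The bijection is also compatible with the vertices; those away from the two edges are
  -- unchanged.
  have kvert : ∀ x, κ (Sum.inl (Γ'.vert x)) = Sum.inl (Γ.vert (k x)) := by
    intro x
    by_cases h1 : Γ'.vert a' = Γ'.vert x
    · exact kcyc (by rw [kvert', ka]) h1
    by_cases h2 : Γ'.vert (Γ'.flip a') = Γ'.vert x
    · exact kcyc (by rw [kflip, kb]) h2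
    have hx : x ∉ g'.coll := by
      rw [ha'.mem_iff]
      rintro (rfl | rfl)
      · exact h1 rfl
      · exact h2 rfl
    obtain ⟨y, rfl⟩ := g'.notMem_coll.1 hx
    have hy : Δ.vert y ≠ g.vertexMap (Γ.vert a) := by
      intro hy
      rw [← hw, ← g'.corner_pre y, ← vertexMap_vert, eq_comm, ha'.vertexMap_eq_iff] at hy
      tauto
    have hy' : Γ.vert (g.pre y) ≠ Γ.vert (Γ.flip a) := by
      intro h
      refine hy ?_
      rw [← ha.vertexMap_flip, ← h, vertexMap_vert, corner_pre]
    have e1 := ha'.cells_inr (x := Sum.inl (Γ'.vert (g'.pre y))) (by simpa using Ne.symm h2)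
      (by simp) (by simp)
    have e2 := ha.cells_inr (x := Sum.inl (Γ.vert (g.pre y))) (by simpa using hy') (by simp) (by simp)
    rw [collapse, Sum.map_inl, vertexMap_vert, corner_pre] at e1 e2
    rw [kpre, hct' _ hy, ← e1, hκ, ← e2]
    rfl
  have hl : Γ.IsNaturalOrder (l'.trans κ) := by
    intro i
    obtain ⟨x, hx⟩ := hl' i
    refine ⟨k x, fun j => ?_⟩
    rw [Equiv.trans_apply, hx]
    fin_cases j
    · exact kvert x
    · exact hk x
    · exact (hk _).trans (congrArg Sum.inr (krot x))
    · exact (hk _).trans (congrArg Sum.inr ((krot _).trans (congrArg Γ.rot (krot x))))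
  rw [orientationSign_eq_sg hΓ hl, orientationSign_eq_sg hΓ' hl']
  let m := (Finite.equivFin Δ.Cells).symm
  have e1 := sg_transport (o := o) (o' := o') κ (extend ha'.cells m) l'
  have e2 : (extend ha'.cells m).trans κ = (finSumFinEquiv.symm.trans
      (Equiv.sumCongr (Equiv.refl (Fin 3)) m)).trans (ρ.trans ha.cells) := by
    ext1 i
    simp only [extend, Equiv.trans_apply, hκ]
  have e3 : sg ((finSumFinEquiv.symm.trans (Equiv.sumCongr (Equiv.refl (Fin 3)) m)).trans ha.cells) o =
      sg (extend ha.cells m) o := rfl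
  rw [e2, sg_conj, hρ, e3] at e1
  rw [chi_eq ha.cells m, chi_eq ha'.cells m, ← Units.val_mul, ← Units.val_mul, ← Units.val_neg]
  congr 1
  rw [mul_right_comm, mul_right_comm _ _ (sg l' o'), ← e1]
  simp

/-- At a vertex of valence four there are only two splittings, so edges with different labels are
related by a quarter turn, after reversing one of them if necessary. -/
theorem indSign_mul_orientationSign {g' : Hom Γ' Δ} (hg : Γ.H.card = Δ.H.card + 2)
    (hg' : Γ'.H.card = Δ.H.card + 2) (hΓ : Γ.codim = 0) (hΓ' : Γ'.codim = 0)
    (hne : g.labels ≠ g'.labels) (o : Γ.Ori) (o' : Γ'.Ori) (o₀ : Δ.Ori) :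
    (g.indSign o o₀ : ℤ) * Γ.orientationSign o = -(g'.indSign o' o₀ * Γ'.orientationSign o') := by
  obtain ⟨a, ha⟩ := exists_isEdge (g := g) hg
  obtain ⟨a', ha'⟩ := exists_isEdge (g := g') hg'
  obtain ⟨-, -, -, a4, a5⟩ := ha.rot_edge hΓ
  obtain ⟨-, -, -, b4, b5⟩ := ha.flip.rot_edge hΓ
  obtain ⟨-, -, -, c4, c5⟩ := ha'.rot_edge hΓ'
  obtain ⟨-, -, -, d4, -⟩ := ha'.flip.rot_edge hΓ'
  rw [Γ.flip_flip] at b4 b5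
  rw [Γ'.flip_flip] at d4
  have hfin : ∀ {b : Γ'.H}, g'.IsEdge b → g'.corner (Γ'.flip b) = Δ.rot (g.corner (Γ.flip a)) →
      (g.indSign o o₀ : ℤ) * Γ.orientationSign o =
        -(g'.indSign o' o₀ * Γ'.orientationSign o') := by
    intro b hb h
    rw [indSign_eq hg ha, indSign_eq hg' hb]
    simp only [Units.val_neg, neg_mul, exists_natural_pair hΓ hΓ' ha hb h o o' o₀]
  rw [ha.labels_eq, ha'.labels_eq] at hne
  have hv : Δ.vert (g.corner (Γ.flip a)) = Δ.vert (g'.corner (Γ'.flip a')) := by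
    rw [a5, ha.eq_vertex hΓ]
    rw [← c4, ← d4]
  obtain ⟨i, hi⟩ := (vert_eq_iff.1 hv).exists_nat_pow_eq
  -- The four half-edges in cyclic order; an even number of steps leads to the same pair of labels,
  -- an odd number to `a'` or its reversal in the position of `exists_natural_pair`.
  have key : ∀ i : ℕ, (Δ.rot ^ i) (g.corner (Γ.flip a)) = g.corner (Γ.flip a) ∨
      (Δ.rot ^ i) (g.corner (Γ.flip a)) = Δ.rot (g.corner (Γ.flip a)) ∨
      (Δ.rot ^ i) (g.corner (Γ.flip a)) = g.corner a ∨
      (Δ.rot ^ i) (g.corner (Γ.flip a)) = Δ.rot (g.corner a) := by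
    intro i
    induction i with
    | zero => exact Or.inl rfl
    | succ i ih =>
      rw [pow_succ', Equiv.Perm.mul_apply]
      rcases ih with h | h | h | h <;> rw [h]
      · exact Or.inr (Or.inl rfl)
      · exact Or.inr (Or.inr (Or.inl a4.symm))
      · exact Or.inr (Or.inr (Or.inr rfl))
      · exact Or.inl b4.symm
  have hk := key i
  rw [hi] at hk
  rcases hk with h | h | h | h
  · refine absurd ?_ hne
    rw [c4, h, ← a4]
  · exact hfin ha' h
  · refine absurd ?_ hne
    rw [c4, h, ← b4, Set.pair_comm]
  · refine hfin ha'.flip ?_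
    rw [Γ'.flip_flip, c4, h, ← b4]

end Hom

end RibbonGraph

namespace RibbonGraph

open Associahedron OrientedOver

variable {Ω : Type u} {Γ Γ' Δ Γ₀ : RibbonGraph Ω}

/-! ### Orientations of isomorphic objects -/

theorem Iso.preserves_or (e : Iso Γ Γ') (o : Γ.Ori) (o' : Γ'.Ori) :
    e.Preserves o o' ∨ e.Preserves (-o) o' := by
  have key : ∀ o₁ : Γ.Ori, sg (Finite.equivFin Γ.Cells).symm o₁ =
      sg ((Finite.equivFin Γ.Cells).symm.trans e.cellsEquiv) o' → e.Preserves o₁ o' := by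
    intro o₁ h n l
    have h1 := sg_transport (o := o') (o' := o₁) e.cellsEquiv l (Finite.equivFin Γ.Cells).symm
    rw [h, mul_left_inj] at h1
    rw [← sg_eq_one, ← sg_eq_one, h1]
  by_cases h : sg (Finite.equivFin Γ.Cells).symm o =
      sg ((Finite.equivFin Γ.Cells).symm.trans e.cellsEquiv) o'
  · exact Or.inl (key o h)
  · refine Or.inr (key (-o) ?_)
    rw [sg_neg]
    rcases Int.units_eq_one_or (sg (Finite.equivFin Γ.Cells).symm o) with h1 | h1 <;>
      rcases Int.units_eq_one_or (sg ((Finite.equivFin Γ.Cells).symm.trans e.cellsEquiv) o')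
        with h2 | h2 <;> simp_all

theorem Iso.Preserves.not_neg {e : Iso Γ Γ'} {o : Γ.Ori} {o' : Γ'.Ori} (h : e.Preserves o o') :
    ¬ e.Preserves (-o) o' := fun h' => by
  have h1 := h _ (Finite.equivFin Γ.Cells).symm
  rw [← h' _ (Finite.equivFin Γ.Cells).symm, orderingOrientation_eq_neg_iff] at h1
  exact iff_not_self h1

theorem Iso.Preserves.trans {Γ'' : RibbonGraph Ω} {e : Iso Γ Γ'} {e' : Iso Γ' Γ''} {e'' : Iso Γ Γ''}
    {o : Γ.Ori} {o' : Γ'.Ori} {o'' : Γ''.Ori} (h : e.Preserves o o') (h' : e'.Preserves o' o'')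
    (he : ∀ x, e''.toEquiv x = e'.toEquiv (e.toEquiv x)) : e''.Preserves o o'' := by
  intro n l
  rw [h n l, h' n]
  have : (l.trans e.cellsEquiv).trans e'.cellsEquiv = l.trans e''.cellsEquiv := by
    ext1 i
    rw [Equiv.trans_apply, Equiv.trans_apply, Equiv.trans_apply]
    generalize l i = c
    rcases c with c | x
    · obtain ⟨x, rfl⟩ : ∃ x, Γ.vert x = c := Quotient.exists_rep c
      exact congrArg (fun y => Sum.inl (Γ''.vert y)) (he x).symm
    · exact congrArg Sum.inr (he x).symm
  rw [this]

/-- Induced orientations do not change under isomorphisms of the source. -/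
theorem Hom.Induces.of_iso {g : Hom Γ Δ} {g' : Hom Γ' Δ} {e : Iso Γ Γ'} {o : Γ.Ori} {o₁ : Γ'.Ori}
    {o' : Δ.Ori} (h : g.Induces o o') (he : ∀ x, e.toEquiv (g.pre x) = g'.pre x)
    (hp : e.Preserves o o₁) : g'.Induces o₁ o' := by
  have hC : ∀ {x y}, g.Corresponds x y → g'.Corresponds (e.cellsEquiv x) y := by
    rintro (x | x) (y | y) hx
    · obtain ⟨c, h1, h2⟩ := hx
      refine ⟨c, h1, ?_⟩
      rw [← he, ← h2]
      rfl
    · exact hx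
    · exact hx
    · change g'.pre y = e.toEquiv x
      rw [← he, show g.pre y = x from hx]
  obtain ⟨n, l, l', a, h0, h1, h2, h3, h4, h5, h6, h7⟩ := h
  refine ⟨n, l.trans e.cellsEquiv, l', e.toEquiv a, ?_, ?_, ?_, ?_, ?_, hC h5, fun i => hC (h6 i), ?_⟩
  · rintro ⟨c, hc⟩
    exact h0 ⟨c, e.toEquiv.injective ((he c).trans hc)⟩
  · rw [Equiv.trans_apply, h1]; rfl
  · rw [Equiv.trans_apply, h2, ← e.map_flip]; rfl
  · rw [Equiv.trans_apply, h3]; rfl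
  · rw [Equiv.trans_apply, h4, ← e.map_flip]; rfl
  · rw [← h7, ← hp _ l]

theorem Hom.Induces.indSign_eq {g : Hom Γ Δ} {o : Γ.Ori} {o' : Δ.Ori} (h : g.Induces o o') :
    g.indSign o o' = 1 := if_pos h

theorem Hom.induces_or {g : Hom Γ Δ} (hc : Γ.H.card = Δ.H.card + 2) (o : Γ.Ori) (o' : Δ.Ori) :
    g.Induces o o' ∨ g.Induces (-o) o' := by
  by_contra! h
  have h1 := g.indSign_neg_left hc o o'
  rw [indSign, indSign, if_neg h.1, if_neg h.2] at h1
  exact absurd h1 (by decide)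

theorem Hom.Induces.not_neg {g : Hom Γ Δ} (hc : Γ.H.card = Δ.H.card + 2) {o : Γ.Ori} {o' : Δ.Ori}
    (h : g.Induces o o') : ¬ g.Induces o (-o') := fun h' => by
  have h1 := g.indSign_neg_right hc o o'
  rw [h.indSign_eq, h'.indSign_eq] at h1
  exact absurd h1 (by decide)

/-! ### Objects over a ribbon graph -/

/-- Morphisms over `Γ₀` preserve labels, and labels are injective. -/
theorem Hom.pre_eq_of_over {f : Hom Γ Γ₀} {f' : Hom Γ' Γ₀} {g g' : Hom Γ' Γ}
    (hg : ∀ h, g.pre (f.pre h) = f'.pre h) (hg' : ∀ h, g'.pre (f.pre h) = f'.pre h) : g = g' := by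
  have : g.pre = g'.pre := funext fun x =>
    f'.label_injective (by rw [label_of_over hg, label_of_over hg'])
  cases g
  cases g'
  cases this
  rfl

variable {k : ℕ}

theorem OrientedOver.OverIso.apply_eq {x y : OrientedOver Γ₀ k} {e e' : Iso x.Γ y.Γ}
    (he : ∀ h, e.toEquiv (x.f.pre h) = y.f.pre h) (he' : ∀ h, e'.toEquiv (x.f.pre h) = y.f.pre h)
    (z : x.Γ.H) : e.toEquiv z = e'.toEquiv z :=
  y.f.label_injective (by rw [Hom.label_of_iso he, Hom.label_of_iso he'])

/-- Isomorphisms over `Γ₀` are unique, so none can be orientation reversing when another preserves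
the orientation. This keeps the generators from being identified with their negatives. -/
theorem OrientedOver.not_overIso_reverse {x y : OrientedOver Γ₀ k} (a : OverIso x y)
    (b : OverIso x.reverse y) : False := by
  have h : b.g = a.g := by
    have h1 := OverIso.apply_eq (x := x) b.over_eq a.over_eq
    rcases hb : b.g with ⟨e⟩
    rcases ha : a.g with ⟨e'⟩
    rw [hb, ha] at h1
    cases Equiv.ext h1
    rfl
  have := b.preserves
  rw [h] at this
  exact a.preserves.not_neg this

theorem OrientedOver.Expansion.apply_pre {x : OrientedOver Γ₀ (k + 1)} {e : Expansion x} {Γ' : RibbonGraph Ω}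
    {f' : Hom Γ' Γ₀} {g' : Hom Γ' x.Γ} (hg' : ∀ h, g'.pre (x.f.pre h) = f'.pre h)
    {a : Iso e.src.Γ Γ'} (ha : ∀ h, a.toEquiv (e.src.f.pre h) = f'.pre h) (h : x.Γ.H) :
    a.toEquiv (e.g.pre h) = g'.pre h :=
  f'.label_injective (by
    rw [Hom.label_of_iso ha, Hom.label_of_over hg', Hom.label_of_over e.over_eq])

/-! ### The incidence numbers of the forest complex -/

section

variable {r : ℕ} {n : Fin r → ℕ} {v : Fin r → Γ₀.Vertex} (hv : Function.Injective v)
  (hval : ∀ i, Γ₀.valence (v i) = n i + 3) (htri : ∀ w, w ∉ Set.range v → Γ₀.valence w = 3)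

theorem OrientedOver.overIso_or {x y : OrientedOver Γ₀ k}
    (h : x.f.code hval htri = y.f.code hval htri) :
    Nonempty (OverIso x y) ∨ Nonempty (OverIso x.reverse y) := by
  obtain ⟨e, he⟩ := Hom.exists_iso_of_code hval htri h
  exact (e.preserves_or x.o y.o).imp (fun hp => ⟨⟨e, he, hp⟩⟩) fun hp => ⟨⟨e, he, hp⟩⟩

variable {R : (∀ i, Face (n i)) → RibbonGraph Ω} {f : ∀ D, Hom (R D) Γ₀}
  (hf : ∀ D, (f D).code hval htri = D) (o : ∀ D, (R D).Ori)

include hv hf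

theorem labels_injective : Function.Injective fun D => (f D).labels := fun D E h => by
  refine labelSet_injective hv hval ?_
  rw [← hf D, ← hf E, Hom.labelSet_code, Hom.labelSet_code]
  exact h

theorem codim_repr (D : ∀ i, Face (n i)) : (R D).codim = piDim (fun _ => Face.dim) D := by
  rw [(f D).codim_eq_piDim hv hval htri, hf]

theorem exists_over_repr {D E : ∀ i, Face (n i)} (h : piCov (fun _ => Face.Cov) D E) :
    (R E).H.card = (R D).H.card + 2 ∧ ∃ g : Hom (R E) (R D), ∀ h, g.pre ((f D).pre h) = (f E).pre h := by
  rw [← hf D, ← hf E] at h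
  have h' := Hom.exists_over_of_piCov hv hval htri h
  exact ⟨(f D).card_of_codim (f E) h'.1, h'.2⟩

omit hv hf in
variable (f) in
/-- The incidence numbers of the forest complex. -/
noncomputable def incidence (D E : ∀ i, Face (n i)) : ℤ :=
  if piCov (fun _ => Face.Cov) D E then
    if ∃ g : Hom (R E) (R D), (∀ h, g.pre ((f D).pre h) = (f E).pre h) ∧ g.Induces (o E) (o D)
    then 1 else -1
  else 0

omit hv hf in
theorem incidence_eq {D E : ∀ i, Face (n i)} (h : piCov (fun _ => Face.Cov) D E)
    {g : Hom (R E) (R D)} (hg : ∀ h, g.pre ((f D).pre h) = (f E).pre h) :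
    incidence f o D E = g.indSign (o E) (o D) := by
  rw [incidence, if_pos h, Hom.indSign]
  by_cases hi : g.Induces (o E) (o D)
  · rw [if_pos hi, if_pos ⟨g, hg, hi⟩, Units.val_one]
  · rw [if_neg hi, if_neg, Units.val_neg, Units.val_one]
    rintro ⟨g', hg', hi'⟩
    exact hi (Hom.pre_eq_of_over hg' hg ▸ hi')

/-- Thinness leaves two terms in each sum: the two orders of collapsing a pair of edges for `sq`,
and the two splittings of a vertex of valence four for `aug`. -/
theorem isIncidence : IsIncidence (piDim fun _ => Face.dim) (piCov fun _ => Face.Cov)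
    (incidence f o) fun D => (R D).orientationSign (o D) := by
  have hT := isThin_pi r (fun i => Face (n i)) (fun _ => Face.dim) (fun _ => Face.Cov)
    (fun _ => Face.isThin)
  have hinj := labels_injective hv hval htri hf
  refine ⟨fun {D E} h => ?_, fun h => if_neg h, fun D G => ?_, fun D hD => ?_, fun D hD => ?_⟩
  · rw [incidence, if_pos h]
    split_ifs <;> simp
  · by_cases h : ∃ E, piCov (fun _ => Face.Cov) D E ∧ piCov (fun _ => Face.Cov) E G
    · obtain ⟨E, h1, h2⟩ := h
      obtain ⟨E', hne, h1', h2', hE⟩ := hT.diamond h1 h2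
      rw [Finset.sum_eq_add_of_mem E E' (Finset.mem_univ _) (Finset.mem_univ _) hne.symm]
      · obtain ⟨hf₁, f₁, k₁⟩ := exists_over_repr hv hval htri hf h1
        obtain ⟨hg₁, g₁, l₁⟩ := exists_over_repr hv hval htri hf h2
        obtain ⟨hf₂, f₂, k₂⟩ := exists_over_repr hv hval htri hf h1'
        obtain ⟨hg₂, g₂, l₂⟩ := exists_over_repr hv hval htri hf h2'
        obtain ⟨q, hq⟩ := Hom.exists_over
          ((Hom.labels_subset_of_over k₁).trans (Hom.labels_subset_of_over l₁))
        -- The labels of the intermediate object are those of `G` that the morphism does not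
        -- collapse, so equal collapsed edges would mean equal faces.
        have hcoll : g₁.coll ≠ g₂.coll := fun h => hne.symm <| hinj <| by
          have key : ∀ {A} {g : Hom (R G) (R A)}, (∀ h, g.pre ((f A).pre h) = (f G).pre h) →
              (f A).labels = (f G).label '' ((f G).coll \ g.coll) := by
            intro A g hg
            ext p
            constructor
            · rintro ⟨x, hx, rfl⟩
              exact ⟨g.pre x, ⟨(Hom.mem_coll_of_over hg x).2 hx, fun h' => h' ⟨x, rfl⟩⟩,
                Hom.label_of_over hg x⟩
            · rintro ⟨y, ⟨hy, hy'⟩, rfl⟩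
              obtain ⟨x, rfl⟩ := not_not.1 hy'
              exact ⟨x, (Hom.mem_coll_of_over hg x).1 hy, (Hom.label_of_over hg x).symm⟩
          change (f E).labels = (f E').labels
          rw [key l₁, key l₂, h]
        have hp : ∀ {A} {g : Hom (R G) (R A)} {j : Hom (R A) (R D)},
            (∀ h, g.pre ((f A).pre h) = (f G).pre h) → (∀ h, j.pre ((f D).pre h) = (f A).pre h) →
            ∀ x, g.pre (j.pre x) = q.pre x := fun hg hj x => (f G).label_injective (by
          rw [Hom.label_of_over hg, Hom.label_of_over hj, Hom.label_of_over hq])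
        have := congrArg (Units.val (α := ℤ)) (Hom.indSign_mul_indSign (hp l₁ k₁) (hp l₂ k₂) hcoll
          hg₁ hg₂ hf₁ hf₂ (o G) (o E) (o E') (o D))
        rw [incidence_eq o h1 k₁, incidence_eq o h2 l₁, incidence_eq o h1' k₂, incidence_eq o h2' l₂]
        push_cast at this
        linear_combination this
      · intro A _ hA
        by_contra h0
        have h3 : ∀ {A B}, incidence f o A B ≠ 0 → piCov (fun _ => Face.Cov) A B := fun h => by
          by_contra h'
          exact h (if_neg h')
        rcases hE A (h3 (left_ne_zero_of_mul h0)) (h3 (right_ne_zero_of_mul h0)) with h | h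
        · exact hA.1 h
        · exact hA.2 h
    · refine Finset.sum_eq_zero fun E _ => ?_
      rw [incidence, incidence]
      split_ifs with h1 h2
      all_goals first | exact (h ⟨E, h1, by assumption⟩).elim | simp
  · obtain ⟨E, E', hne, h, h', hE⟩ := hT.edge hD
    rw [Finset.sum_eq_add_of_mem E E' (Finset.mem_univ _) (Finset.mem_univ _) hne]
    · obtain ⟨hc, g, hg⟩ := exists_over_repr hv hval htri hf h
      obtain ⟨hc', g', hg'⟩ := exists_over_repr hv hval htri hf h'
      rw [incidence_eq o h hg, incidence_eq o h' hg']
      have hcodim : ∀ {A}, piCov (fun _ => Face.Cov) D A → (R A).codim = 0 := fun hA => by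
        have := hT.dim_eq hA
        rw [codim_repr hv hval htri hf]
        omega
      have hlab : g.labels ≠ g'.labels := fun hl => hne <| by
        obtain ⟨e, he⟩ := Hom.exists_iso hl
        rw [← hf E, ← hf E']
        exact Hom.code_eq_of_iso hv hval htri (e := e) fun x => by rw [← hg, ← hg', he]
      rw [Hom.indSign_mul_orientationSign hc hc' (hcodim h) (hcodim h') hlab (o E) (o E') (o D)]
      ring
    · intro A _ hA
      rw [incidence, if_neg, zero_mul]
      intro h0
      rcases hE A h0 with h | h
      · exact hA.1 h
      · exact hA.2 h
  · have h0 : (R D).codim = 0 := by rw [codim_repr hv hval htri hf, hD]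
    obtain ⟨m, l, hl⟩ := exists_isNaturalOrder h0
    rw [orientationSign_eq_sg h0 hl]
    rcases Int.units_eq_one_or (sg l (o D)) with h | h <;> simp [h]

end

end RibbonGraph

/-! ### The basis and the boundary of the forest complex -/

namespace RibbonGraph

open Associahedron OrientedOver

variable {Ω : Type u} {Γ₀ : RibbonGraph Ω} {k : ℕ}

theorem forestLift_cls {M : Type v} [AddCommGroup M] {φ : OrientedOver Γ₀ k → M}
    (h₁ : ∀ x y, OverIso x y → φ x = φ y) (h₂ : ∀ x, φ x.reverse = -φ x) (x : OrientedOver Γ₀ k) :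
    forestLift φ h₁ h₂ (cls x) = φ x := FreeAbelianGroup.lift_apply_of ..

theorem forestChain_hom_ext {M : Type v} [AddCommGroup M] {φ ψ : ForestChain Γ₀ k →+ M}
    (h : ∀ x, φ (cls x) = ψ (cls x)) : φ = ψ :=
  QuotientAddGroup.addMonoidHom_ext _ (FreeAbelianGroup.lift_ext _ _ fun x => h x)

variable {r : ℕ} {n : Fin r → ℕ} {v : Fin r → Γ₀.Vertex} (hv : Function.Injective v)
  (hval : ∀ i, Γ₀.valence (v i) = n i + 3) (htri : ∀ w, w ∉ Set.range v → Γ₀.valence w = 3)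
  {R : (∀ i, Face (n i)) → RibbonGraph Ω} {f : ∀ D, Hom (R D) Γ₀}
  (hf : ∀ D, (f D).code hval htri = D) (o : ∀ D, (R D).Ori)

/-- The face of a product of associahedra that corresponds to an object over `Γ₀`. -/
noncomputable def face (x : OrientedOver Γ₀ k) : {D : ∀ i, Face (n i) // piDim (fun _ => Face.dim) D = k} :=
  ⟨x.f.code hval htri, by rw [← x.f.codim_eq_piDim hv hval htri, x.codim_eq]⟩

/-- The object over `Γ₀` that has been chosen for a face. -/
noncomputable def repr (D : {D : ∀ i, Face (n i) // piDim (fun _ => Face.dim) D = k}) :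
    OrientedOver Γ₀ k :=
  ⟨R D.1, by rw [codim_repr hv hval htri hf, D.2], f D.1, o D.1⟩

theorem face_repr (D : {D : ∀ i, Face (n i) // piDim (fun _ => Face.dim) D = k}) :
    face hv hval htri (repr hv hval htri hf o D) = D := Subtype.ext (hf D.1)

theorem overIso_repr_or (x : OrientedOver Γ₀ k) :
    Nonempty (OverIso x (repr hv hval htri hf o (face hv hval htri x))) ∨
      Nonempty (OverIso x.reverse (repr hv hval htri hf o (face hv hval htri x))) :=
  overIso_or hval htri (hf (x.f.code hval htri)).symm

theorem face_eq_of_iso {x y : OrientedOver Γ₀ k} (a : OverIso x y) :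
    face hv hval htri x = face hv hval htri y :=
  Subtype.ext (Hom.code_eq_of_iso hv hval htri a.over_eq)

/-- The coordinates of a generator. -/
noncomputable def coord (x : OrientedOver Γ₀ k) :
    {D : ∀ i, Face (n i) // piDim (fun _ => Face.dim) D = k} →₀ ℤ :=
  Finsupp.single (face hv hval htri x)
    (if Nonempty (OverIso x (repr hv hval htri hf o (face hv hval htri x))) then 1 else -1)

theorem nonempty_overIso_iff {x y z : OrientedOver Γ₀ k} (a : OverIso x y) :
    Nonempty (OverIso x z) ↔ Nonempty (OverIso y z) := by
  have key : ∀ {x y z : OrientedOver Γ₀ k}, OverIso x y → OverIso y z → OverIso x z := fun a b =>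
    { g := ⟨a.g.toEquiv.trans b.g.toEquiv, fun h => by simp [a.g.map_flip, b.g.map_flip],
        fun h => by simp [a.g.map_rot, b.g.map_rot]⟩
      over_eq := fun h => by rw [Equiv.trans_apply, a.over_eq, b.over_eq]
      preserves := a.preserves.trans b.preserves fun _ => rfl }
  exact ⟨fun ⟨b⟩ => ⟨key a.symm b⟩, fun ⟨b⟩ => ⟨key a b⟩⟩

theorem coord_eq_of_iso (x y : OrientedOver Γ₀ k) (a : OverIso x y) :
    coord hv hval htri hf o x = coord hv hval htri hf o y := by
  rw [coord, coord, face_eq_of_iso hv hval htri a, nonempty_overIso_iff a]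

theorem coord_reverse (x : OrientedOver Γ₀ k) :
    coord hv hval htri hf o x.reverse = -coord hv hval htri hf o x := by
  rw [coord, coord, ← Finsupp.single_neg]
  refine congrArg (Finsupp.single (face hv hval htri x)) ?_
  have h1 := overIso_repr_or hv hval htri hf o x
  have h2 : face hv hval htri x.reverse = face hv hval htri x := rfl
  rw [h2]
  by_cases h : Nonempty (OverIso x (repr hv hval htri hf o (face hv hval htri x)))
  · rw [if_pos h, if_neg fun ⟨b⟩ => not_overIso_reverse h.some b]
  · rw [if_neg h, if_pos (h1.resolve_left h), neg_neg]

theorem coord_repr (D : {D : ∀ i, Face (n i) // piDim (fun _ => Face.dim) D = k}) :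
    coord hv hval htri hf o (repr hv hval htri hf o D) = Finsupp.single D 1 := by
  have h : Nonempty (OverIso (repr hv hval htri hf o D) (repr hv hval htri hf o D)) :=
    ⟨⟨⟨Equiv.refl _, fun _ => rfl, fun _ => rfl⟩, fun _ => rfl, fun m l => by
      have : l.trans (Iso.cellsEquiv ⟨Equiv.refl (R D.1).H, fun _ => rfl, fun _ => rfl⟩) = l := by
        ext1 i
        rw [Equiv.trans_apply]
        generalize l i = c
        rcases c with c | x
        · obtain ⟨x, rfl⟩ : ∃ x, (R D.1).vert x = c := Quotient.exists_rep c
          rfl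
        · rfl
      exact iff_of_eq (congrArg (fun z => orderingOrientation z = o D.1) this.symm)⟩⟩
  rw [coord, face_repr, if_pos h]

/-- The coordinates of the chains with respect to the chosen objects. -/
noncomputable def coordEquiv : ForestChain Γ₀ k ≃+
    ({D : ∀ i, Face (n i) // piDim (fun _ => Face.dim) D = k} →₀ ℤ) :=
  AddMonoidHom.toAddEquiv
    (forestLift (coord hv hval htri hf o) (coord_eq_of_iso hv hval htri hf o)
      (coord_reverse hv hval htri hf o))
    (Finsupp.liftAddHom fun D => zmultiplesHom _ (cls (repr hv hval htri hf o D)))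
    (forestChain_hom_ext fun x => by
      rw [AddMonoidHom.comp_apply, forestLift_cls, coord, Finsupp.liftAddHom_apply_single,
        zmultiplesHom_apply, AddMonoidHom.id_apply]
      split_ifs with h
      · rw [one_smul, cls_eq h.some]
      · rw [neg_smul, one_smul, neg_eq_iff_eq_neg, ← cls_reverse,
          cls_eq ((overIso_repr_or hv hval htri hf o x).resolve_left h).some])
    (Finsupp.addHom_ext' fun D => AddMonoidHom.ext_int (by
      simp only [AddMonoidHom.comp_apply, Finsupp.singleAddHom_apply,
        Finsupp.liftAddHom_apply_single, zmultiplesHom_apply, one_smul, forestLift_cls,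
        coord_repr, AddMonoidHom.id_apply]))

/-- The basis of the group of chains that consists of the chosen objects. -/
noncomputable def reprBasis (k : ℕ) :
    Module.Basis {D : ∀ i, Face (n i) // piDim (fun _ => Face.dim) D = k} ℤ (ForestChain Γ₀ k) :=
  Module.Basis.ofRepr (coordEquiv hv hval htri hf o).toIntLinearEquiv

theorem reprBasis_apply (D : {D : ∀ i, Face (n i) // piDim (fun _ => Face.dim) D = k}) :
    reprBasis hv hval htri hf o k D = cls (repr hv hval htri hf o D) := by
  change (coordEquiv hv hval htri hf o).symm (Finsupp.single D 1) = _
  rw [AddEquiv.symm_apply_eq]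
  exact ((forestLift_cls (coord_eq_of_iso hv hval htri hf o)
    (coord_reverse hv hval htri hf o) _).trans (coord_repr hv hval htri hf o D)).symm

/-- Up to orientation the source is the chosen object of its face. Induced orientations are carried
along by isomorphisms, so the discrepancy is the sign recorded in `incidence`. -/
theorem cls_expansion (D : {D : ∀ i, Face (n i) // piDim (fun _ => Face.dim) D = k + 1})
    (e : Expansion (repr hv hval htri hf o D)) :
    cls e.src = incidence f o D.1 (face hv hval htri e.src).1 •
      cls (repr hv hval htri hf o (face hv hval htri e.src)) := by
  have hcov : piCov (fun _ => Face.Cov) D.1 (face hv hval htri e.src).1 := by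
    have := Hom.piCov_code hv hval htri (f := f D.1) e.over_eq
      (by rw [codim_repr hv hval htri hf, D.2, e.src.codim_eq])
    rwa [hf] at this
  obtain ⟨hc, g, hg⟩ := exists_over_repr hv hval htri hf hcov
  rw [incidence_eq o hcov hg]
  rcases overIso_repr_or hv hval htri hf o e.src with ⟨⟨a⟩⟩ | ⟨⟨a⟩⟩
  · have : g.Induces (o (face hv hval htri e.src).1) (o D.1) :=
      e.induces.of_iso (Expansion.apply_pre hg a.over_eq) a.preserves
    rw [Hom.Induces.indSign_eq this, Units.val_one, one_smul, cls_eq a]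
  · have : g.Induces (o (face hv hval htri e.src).1) (-o D.1) :=
      e.induces.neg.of_iso (Expansion.apply_pre hg a.over_eq) a.preserves
    have h1 := Hom.indSign_neg_right hc (g := g) (o (face hv hval htri e.src).1) (o D.1)
    rw [Hom.Induces.indSign_eq this] at h1
    rw [← neg_eq_iff_eq_neg.2 h1, Units.val_neg, Units.val_one, neg_smul, one_smul, ← cls_eq a,
      cls_reverse, neg_neg]

/-- Right equivalence classes of expansions correspond bijectively to the facets, so the finite sum
over classes becomes a sum over faces. -/
theorem boundary_repr (D : {D : ∀ i, Face (n i) // piDim (fun _ => Face.dim) D = k + 1}) :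
    boundary (repr hv hval htri hf o D) =
      ∑ E : {E : ∀ i, Face (n i) // piDim (fun _ => Face.dim) E = k},
        incidence f o D.1 E.1 • cls (repr hv hval htri hf o E) := by
  set x := repr hv hval htri hf o D with hx
  set F : {E : ∀ i, Face (n i) // piDim (fun _ => Face.dim) E = k} → ForestChain Γ₀ k :=
    fun E => incidence f o D.1 E.1 • cls (repr hv hval htri hf o E) with hF
  let T : Quot (Expansion.Rel (x := x)) → {E : ∀ i, Face (n i) // piDim (fun _ => Face.dim) E = k} :=
    Quot.lift (fun e => face hv hval htri e.src) fun _ _ ⟨a, _⟩ => face_eq_of_iso hv hval htri a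
  -- The orientation of the source is forced by the induced one, so sources over the same face
  -- cannot differ by a reversal.
  have hT : Function.Injective T := by
    rintro ⟨e⟩ ⟨e'⟩ h
    have h' : face hv hval htri e.src = face hv hval htri e'.src := h
    rcases overIso_or hval htri (x := e.src) (y := e'.src) (congrArg Subtype.val h') with ⟨⟨a⟩⟩ | ⟨⟨a⟩⟩
    · exact Quot.sound ⟨a, Expansion.apply_pre e'.over_eq a.over_eq⟩
    · exact (e'.induces.not_neg e'.one_edge (e.induces.neg.of_iso
        (Expansion.apply_pre e'.over_eq a.over_eq) a.preserves)).elim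
  have hsupp : Function.support F ⊆ Set.range T := by
    intro E hE
    have hcov : piCov (fun _ => Face.Cov) D.1 E.1 := by
      by_contra h
      exact hE (by rw [hF]; simp only [incidence, if_neg h, zero_smul])
    obtain ⟨hc, g, hg⟩ := exists_over_repr hv hval htri hf hcov
    -- Every facet occurs, with whichever of the two orientations of the chosen object induces the
    -- given one.
    have key : ∀ o' : (R E.1).Ori, g.Induces o' (o D.1) → E ∈ Set.range T := fun o' ho' =>
      ⟨Quot.mk _ ⟨⟨R E.1, (repr hv hval htri hf o E).codim_eq, f E.1, o'⟩, g, hc, hg, ho'⟩,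
        Subtype.ext (hf E.1)⟩
    exact (Hom.induces_or hc (o E.1) (o D.1)).elim (key _) (key _)
  rw [← finsum_eq_sum_of_fintype, boundary]
  trans ∑ᶠ c, F (T c)
  · refine finsum_congr ?_
    rintro ⟨e⟩
    exact cls_expansion hv hval htri hf o D e
  · rw [← finsum_mem_range hT, finsum_mem_def, Set.indicator_eq_self.2 hsupp]

include hv hval htri hf in
theorem forestComplex_models : Γ₀.forestComplex.Models (piDim fun _ => Face.dim) (incidence f o)
    fun D => (R D).orientationSign (o D) := by
  have hb : ∀ {k} D, reprBasis hv hval htri hf o k D = cls (repr hv hval htri hf o D) :=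
    reprBasis_apply hv hval htri hf o
  have h1 : ∀ k D, forestLift boundary boundary_eq_of_iso boundary_reverse
      (reprBasis hv hval htri hf o (k + 1) D) =
      ∑ E : {E : ∀ i, Face (n i) // piDim (fun _ => Face.dim) E = k},
        incidence f o D.1 E.1 • reprBasis hv hval htri hf o k E := fun k D => by
    simp only [hb, forestLift_cls, boundary_repr hv hval htri hf o D]
  have h2 : ∀ D, forestLift (fun x : OrientedOver Γ₀ 0 => x.Γ.orientationSign x.o)
      (fun _ _ a => a.preserves.orientationSign_eq) (fun x => x.Γ.orientationSign_neg x.o)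
      (reprBasis hv hval htri hf o 0 D) = (R D.1).orientationSign (o D.1) := fun D => by
    rw [hb]
    exact forestLift_cls ..
  have h3 : ∀ k, Set.range (cls (Γ₀ := Γ₀) (k := k)) = {x | ∃ D, x = reprBasis hv hval htri hf o k D ∨
      x = -reprBasis hv hval htri hf o k D} := fun k => by
    simp only [hb]
    refine Set.Subset.antisymm ?_ ?_
    · rintro _ ⟨x, rfl⟩
      refine ⟨face hv hval htri x, ?_⟩
      rcases overIso_repr_or hv hval htri hf o x with ⟨⟨a⟩⟩ | ⟨⟨a⟩⟩
      · exact Or.inl (cls_eq a)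
      · exact Or.inr (by rw [← cls_eq a, cls_reverse, neg_neg])
    · rintro _ ⟨D, rfl | rfl⟩
      · exact ⟨_, rfl⟩
      · exact ⟨_, cls_reverse _⟩
  exact ⟨fun k => reprBasis hv hval htri hf o k, h1, h2, h3⟩

end RibbonGraph

theorem mainTheorem9 {Ω : Type*} [Infinite Ω] (Γ₀ : RibbonGraph Ω)
    (r : ℕ) (v : Fin r → Γ₀.Vertex) (hv : Function.Injective v) (n : Fin r → ℕ)
    (hn : ∀ i, Γ₀.vertexCodim (v i) = n i)
    (htri : ∀ w, w ∉ Set.range v → Γ₀.valence w = 3) :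
    Γ₀.forestComplex.IsBased ∧
    Γ₀.forestComplex.BasedIso (BasedSeq.tensorFin r fun i => Associahedron.complex (n i)) ∧
    Γ₀.forestComplex.IsAcyclic := by
  have hval : ∀ i, Γ₀.valence (v i) = n i + 3 := fun i => by
    have := Γ₀.three_le_valence_vertex (v i)
    rw [← hn, RibbonGraph.vertexCodim, Nat.sub_add_cancel this]
  choose R f hf using RibbonGraph.exists_hom_of_code hv hval htri
  -- Any choice of orientations will do; a different choice changes the signs of basis elements.
  have o : ∀ D, (R D).Ori := fun D =>
    RibbonGraph.orderingOrientation (Finite.equivFin (R D).Cells).symm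
  exact (RibbonGraph.forestComplex_models hv hval htri hf o).associahedra
    (RibbonGraph.isIncidence hv hval htri hf o)
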